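/- Let $m_1,m_2\in\mathbb N$, $m=m_1+m_2$, $0<l<\infty$, $M>0$, $j=\mathrm{diag}(I_{m_1},-I_{m_2})$, and let $v$ be a measurable $m_1\times m_2$ matrix function on $(0,l)$ with $\|v(x)\|\le M$ for $0<x<l$. Put $V=\begin{bmatrix}0&v\\ v^*&0\end{bmatrix}$ and let $u(x,z)$ be the ($m\times m$, absolutely continuous in $x$) fundamental solution of the skew-self-adjoint Dirac system $$u'(x,z)=(\mathrm i zj+jV(x))u(x,z)\quad(0\le x\le l),\qquad u(0,z)=I_m .$$ Let $\mathbb C_M=\{z:\Im z>M\}$. An $m\times m_1$ matrix function $\mathcal P$, meromorphic in the open upper half-plane, has property-$j$ if $\mathcal P(z)^*\mathcal P(z)>0$ and $\mathcal P(z)^*j\mathcal P(z)\ge 0$ for $z\in\mathbb C_M$ outside a discrete set. Let $\mathcal N(l,z)$ be the set of values at $z$ of the matrix functions $$\begin{bmatrix}0&I_{m_2}\end{bmatrix}u(l,z)^{-1}\mathcal P(z)\Big(\begin{bmatrix}I_{m_1}&0\end{bmatrix}u(l,z)^{-1}\mathcal P(z)\Big)^{-1},\qquad \mathcal P \text{ with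 property-}j$$ (continued through removable singularities). A Weyl function of the system on $[0,l]$ is an $m_2\times m_1$ matrix function $\varphi$, analytic in $\mathbb C_M$, with $\varphi(z)\in\mathcal N(l,z)$ for all $z\in\mathbb C_M$. Put $\beta(x)=\begin{bmatrix}I_{m_1}&0\end{bmatrix}u(x,0)$ and $\gamma(x)=\begin{bmatrix}0&I_{m_2}\end{bmatrix}u(x,0)=\begin{bmatrix}\gamma_1&\gamma_2\end{bmatrix}$, where $\gamma_k$ is $m_2\times m_k$. A matrix function on $[0,l]$ is called boundedly differentiable if it is absolutely continuous with bounded derivative. On $L^2_{m_2}(0,l)$ let $Af=-\mathrm i\int_0^x f(t)\,dt$ and $Kf=-\mathrm i\,\gamma(x)\int_0^x\gamma(t)^*f(t)\,dt$. **Theorem.** Let $\varphi$ be a Weyl function of the system on $[0,l]$. Then $v$ is uniquely determined by $\varphi$ (almost everywhere on $(0,l)$): if $\varphi$ is also a Weyl function on $[0,l]$ (in $\mathbb C_{M'}$) of the Dirac system with a measurable potential $v'$, $\|v'(x)\|\le M'$, $M'>0$, then $v'=v$ a.e. on $(0,l)$. Moreover $v$ is recovered from $\varphi$ as follows. 1.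 There are an operator $E=I+\int_0^xE(x,t)\,\cdot\,dt$ with bounded kernel such that $K=EAE^{-1}$ and $E^{-1}\gamma_2\equiv I_{m_2}$, and a boundedly differentiable $\Phi_1=E^{-1}\gamma_1$ with $\Phi_1(0)=0$. This $\Phi_1$ is recovered from $\varphi$: for every $\eta>M$, $$\Phi_1\Big(\frac x2\Big)=\frac1\pi\,\mathrm e^{x\eta}\ \mathrm{l.i.m.}_{a\to\infty}\int_{-a}^{a}\mathrm e^{-\mathrm i x\xi}\,\frac{\varphi(\xi+\mathrm i\eta)}{2\mathrm i(\xi+\mathrm i\eta)}\,d\xi ,$$ where l.i.m. is the entrywise limit in $L^2(0,2l)$; for any one such $\eta$ this determines the continuous function $\Phi_1$ on $[0,l]$. 2. Let $S=I+\int_0^l s(x,t)\,\cdot\,dt$ on $L^2_{m_2}(0,l)$, $s(x,t)=\int_0^{\min(x,t)}\Phi_1'(x-\zeta)\Phi_1'(t-\zeta)^*\,d\zeta$, and for $0<r\le l$ let $S_r=P_rSP_r^*$, where $P_r$ is the restriction from $L^2_{m_2}(0,l)$ to $L^2_{m_2}(0,r)$. Then $S_r$ is invertible for $0<r\le l$ and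 $$\beta(r)=\begin{bmatrix}I_{m_1}&0\end{bmatrix}-\int_0^r\big(S_r^{-1}\Phi_1'\big)(t)^*\begin{bmatrix}\Phi_1(t)&I_{m_2}\end{bmatrix}dt .$$ 3. There is a boundedly differentiable $m_2\times m$ matrix function $\widetilde\gamma$ on $[0,l]$ with $\beta\widetilde\gamma^*\equiv0$, $\widetilde\gamma\widetilde\gamma^*>0$ on $[0,l]$ and $\widetilde\gamma(0)=\begin{bmatrix}0&I_{m_2}\end{bmatrix}$. For every such $\widetilde\gamma$, the problem $\widetilde\varkappa'=-\widetilde\varkappa\,\widetilde\gamma'\widetilde\gamma^*(\widetilde\gamma\widetilde\gamma^*)^{-1}$ a.e., $\widetilde\varkappa(0)=I_{m_2}$, has a unique absolutely continuous solution $\widetilde\varkappa$ on $[0,l]$, and $\gamma=\widetilde\varkappa\widetilde\gamma$ on $[0,l]$. 4. $v(x)=\beta'(x)\gamma(x)^*$ for almost all $x\in(0,l)$. -/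

import Mathlib

open MeasureTheory Filter Topology Set Matrix
open scoped Matrix.Norms.L2Operator ComplexOrder

/-!
Skew-self-adjoint Dirac systems `y' = (i z j + j V) y` on `[0, l]` with a bounded
`m₁ × m₂` potential `v`.  All matrices carry the operator norm induced by the `ℓ²` norms.
-/

namespace SkewDirac

/-- Lebesgue measure on `(0, l)`. -/
noncomputable abbrev vol (l : ℝ) : Measure ℝ := volume.restrict (Ioo 0 l)

/-- The open half-plane `ℂ_M = {z : Im z > M}`. -/
def halfPlane (M : ℝ) : Set ℂ := {z | M < z.im}

/-- The class `B¹[0, l]` of boundedly differentiable matrix functions: absolutely continuous with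
(almost everywhere defined) bounded derivative. -/
def BddDiff {a b : Type*} [Fintype a] [Fintype b] [DecidableEq b]
    (l : ℝ) (f : ℝ → Matrix a b ℂ) : Prop :=
  AbsolutelyContinuousOnInterval f 0 l ∧ ∃ C : ℝ, ∀ᵐ x ∂(vol l), ‖deriv f x‖ ≤ C

section Dirac

variable {m₁ m₂ : ℕ}

/-- `j = diag (I_{m₁}, -I_{m₂})`. -/
def jMat (m₁ m₂ : ℕ) : Matrix (Fin m₁ ⊕ Fin m₂) (Fin m₁ ⊕ Fin m₂) ℂ :=
  fromBlocks 1 0 0 (-1)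

/-- `V = [[0, v], [v*, 0]]`. -/
def potMat (v : Matrix (Fin m₁) (Fin m₂) ℂ) : Matrix (Fin m₁ ⊕ Fin m₂) (Fin m₁ ⊕ Fin m₂) ℂ :=
  fromBlocks 0 v vᴴ 0

/-- The row `[I_{m₁} 0]`. -/
def upperRow (m₁ m₂ : ℕ) : Matrix (Fin m₁) (Fin m₁ ⊕ Fin m₂) ℂ := fromCols 1 0

/-- The row `[0 I_{m₂}]`. -/
def lowerRow (m₁ m₂ : ℕ) : Matrix (Fin m₂) (Fin m₁ ⊕ Fin m₂) ℂ := fromCols 0 1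

/-- `v` is measurable on `(0, l)` and `‖v(x)‖ ≤ M` for `0 < x < l`. -/
def IsBddPotential (l M : ℝ) (v : ℝ → Matrix (Fin m₁) (Fin m₂) ℂ) : Prop :=
  AEStronglyMeasurable v (vol l) ∧ ∀ x ∈ Ioo 0 l, ‖v x‖ ≤ M

/-- `u(x, z)` is the fundamental solution on `[0, l]` of `u' = (i z j + j V) u`, `u(0, z) = I`:
for each `z` it is absolutely continuous in `x` and satisfies the equation almost everywhere. -/
def IsFundamentalSolution (l : ℝ) (v : ℝ → Matrix (Fin m₁) (Fin m₂) ℂ)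
    (u : ℝ → ℂ → Matrix (Fin m₁ ⊕ Fin m₂) (Fin m₁ ⊕ Fin m₂) ℂ) : Prop :=
  ∀ z : ℂ, u 0 z = 1 ∧ AbsolutelyContinuousOnInterval (fun x => u x z) 0 l ∧
    ∀ᵐ x ∂(vol l), HasDerivAt (fun s => u s z)
      (((Complex.I * z) • jMat m₁ m₂ + jMat m₁ m₂ * potMat (v x)) * u x z) x

/-- The class of nonsingular `m × m₁` matrix functions with property-`j`: meromorphic in the open
upper half-plane and, off a discrete set, `P* P > 0` and `P* j P ≥ 0` in `ℂ_M`. -/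
def PropertyJ (M : ℝ) (P : ℂ → Matrix (Fin m₁ ⊕ Fin m₂) (Fin m₁) ℂ) : Prop :=
  MeromorphicOn P {z | 0 < z.im} ∧
    ∀ᶠ z in codiscreteWithin (halfPlane M),
      ((P z)ᴴ * P z).PosDef ∧ ((P z)ᴴ * jMat m₁ m₂ * P z).PosSemidef

/-- `[0 I] U⁻¹ P ([I 0] U⁻¹ P)⁻¹`. -/
noncomputable def moebius (U : Matrix (Fin m₁ ⊕ Fin m₂) (Fin m₁ ⊕ Fin m₂) ℂ)
    (P : Matrix (Fin m₁ ⊕ Fin m₂) (Fin m₁) ℂ) : Matrix (Fin m₂) (Fin m₁) ℂ :=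
  (lowerRow m₁ m₂ * U⁻¹ * P) * (upperRow m₁ m₂ * U⁻¹ * P)⁻¹

/-- The set `𝒩(x, z)` of the values at `z` of the functions `φ(x, ·, P)`, `P` with property-`j`.
The value at `z` of this meromorphic function is its limit at `z`, so that an exceptional
point of `P` that is a removable singularity of `φ(x, ·, P)` is allowed. -/
def weylBall (M : ℝ) (u : ℝ → ℂ → Matrix (Fin m₁ ⊕ Fin m₂) (Fin m₁ ⊕ Fin m₂) ℂ)
    (x : ℝ) (z : ℂ) : Set (Matrix (Fin m₂) (Fin m₁) ℂ) :=
  {w | ∃ P : ℂ → Matrix (Fin m₁ ⊕ Fin m₂) (Fin m₁) ℂ, PropertyJ M P ∧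
    Tendsto (fun ζ => moebius (u x ζ) (P ζ)) (𝓝[≠] z) (𝓝 w)}

/-- Weyl functions on `[0, l]` of the Dirac system with fundamental solution `u`: the analytic
functions `φ` on `ℂ_M` with `φ(z) ∈ 𝒩(l, z)` for all `z ∈ ℂ_M`. -/
def IsWeylFunction (l M : ℝ) (u : ℝ → ℂ → Matrix (Fin m₁ ⊕ Fin m₂) (Fin m₁ ⊕ Fin m₂) ℂ)
    (φ : ℂ → Matrix (Fin m₂) (Fin m₁) ℂ) : Prop :=
  DifferentiableOn ℂ φ (halfPlane M) ∧ ∀ z ∈ halfPlane M, φ z ∈ weylBall M u l z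

/-- `β(x) = [I 0] u(x, 0)`. -/
def betaFun (u : ℝ → ℂ → Matrix (Fin m₁ ⊕ Fin m₂) (Fin m₁ ⊕ Fin m₂) ℂ) (x : ℝ) :
    Matrix (Fin m₁) (Fin m₁ ⊕ Fin m₂) ℂ := upperRow m₁ m₂ * u x 0

/-- `γ(x) = [0 I] u(x, 0)`. -/
def gammaFun (u : ℝ → ℂ → Matrix (Fin m₁ ⊕ Fin m₂) (Fin m₁ ⊕ Fin m₂) ℂ) (x : ℝ) :
    Matrix (Fin m₂) (Fin m₁ ⊕ Fin m₂) ℂ := lowerRow m₁ m₂ * u x 0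

end Dirac

section Operators

/-! Operators on `L²_{m₂}(0, l)` act on `m₂ × p` matrix functions columnwise (`p = 1` gives the
vector functions); they are given on square-integrable functions by their integral formulas. -/

variable {m₁ m₂ p : ℕ}

/-- `(A f)(x) = -i ∫₀ˣ f(t) dt`. -/
noncomputable def opA (f : ℝ → Matrix (Fin m₂) (Fin p) ℂ) (x : ℝ) : Matrix (Fin m₂) (Fin p) ℂ :=
  (-Complex.I) • ∫ t in (0 : ℝ)..x, f t

/-- `(K f)(x) = ∫₀ˣ F(x) G(t) f(t) dt` with `F = γ`, `G = -i γ*`. -/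
noncomputable def opK (γ : ℝ → Matrix (Fin m₂) (Fin m₁ ⊕ Fin m₂) ℂ)
    (f : ℝ → Matrix (Fin m₂) (Fin p) ℂ) (x : ℝ) : Matrix (Fin m₂) (Fin p) ℂ :=
  ∫ t in (0 : ℝ)..x, γ x * ((-Complex.I) • (γ t)ᴴ) * f t

/-- `(E f)(x) = f(x) + ∫₀ˣ E(x, t) f(t) dt`. -/
noncomputable def opE (𝓔 : ℝ → ℝ → Matrix (Fin m₂) (Fin m₂) ℂ)
    (f : ℝ → Matrix (Fin m₂) (Fin p) ℂ) (x : ℝ) : Matrix (Fin m₂) (Fin p) ℂ :=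
  f x + ∫ t in (0 : ℝ)..x, 𝓔 x t * f t

/-- `𝓔` is the (bounded, measurable) kernel on `0 < t < x < l` of the normalized similarity
operator `E`: `E A = K E` on `L²(0, l)`, that is `K = E A E⁻¹`, and `E I_{m₂} = γ₂`, that is
`E⁻¹ γ₂ = I_{m₂}`.  (A Volterra operator `E` of this form is always boundedly invertible.) -/
structure IsSimilarityKernel (l : ℝ) (γ : ℝ → Matrix (Fin m₂) (Fin m₁ ⊕ Fin m₂) ℂ)
    (𝓔 : ℝ → ℝ → Matrix (Fin m₂) (Fin m₂) ℂ) : Prop where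
  measurable : AEStronglyMeasurable (Function.uncurry 𝓔)
    ((volume : Measure (ℝ × ℝ)).restrict {q | 0 < q.2 ∧ q.2 < q.1 ∧ q.1 < l})
  bounded : ∃ C : ℝ, ∀ x t : ℝ, 0 < t → t < x → x < l → ‖𝓔 x t‖ ≤ C
  intertwines : ∀ (p : ℕ) (f : ℝ → Matrix (Fin m₂) (Fin p) ℂ), MemLp f 2 (vol l) →
    ∀ᵐ x ∂(vol l), opE 𝓔 (opA f) x = opK γ (opE 𝓔 f) x
  normalized : ∀ᵐ x ∂(vol l), opE 𝓔 (fun _ => (1 : Matrix (Fin m₂) (Fin m₂) ℂ)) x = (γ x).toCols₂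

/-- `Φ₁ = E⁻¹ γ₁`, where `E` is the normalized similarity operator of `γ = [γ₁ γ₂]`. -/
def IsNodeFunction (l : ℝ) (γ : ℝ → Matrix (Fin m₂) (Fin m₁ ⊕ Fin m₂) ℂ)
    (Φ₁ : ℝ → Matrix (Fin m₂) (Fin m₁) ℂ) : Prop :=
  ∃ 𝓔 : ℝ → ℝ → Matrix (Fin m₂) (Fin m₂) ℂ, IsSimilarityKernel l γ 𝓔 ∧
    ∀ᵐ x ∂(vol l), opE 𝓔 Φ₁ x = (γ x).toCols₁

/-- `Φ₁(x/2) = π⁻¹ e^{xη} l.i.m._{a → ∞} ∫_{-a}^a e^{-ixξ} φ(ξ+iη) / (2i(ξ+iη)) dξ`, where l.i.m. is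
the entrywise limit in `L²(0, 2l)`. -/
def IsInverseFourier (l η : ℝ) (φ : ℂ → Matrix (Fin m₂) (Fin m₁) ℂ)
    (Φ₁ : ℝ → Matrix (Fin m₂) (Fin m₁) ℂ) : Prop :=
  ∀ (i : Fin m₂) (k : Fin m₁), Tendsto (fun a : ℝ => eLpNorm (fun x : ℝ => Φ₁ (x / 2) i k -
      ((1 / Real.pi * Real.exp (x * η) : ℝ) : ℂ) *
        ∫ ξ in (-a)..a, Complex.exp (-(Complex.I * x * ξ)) *
          (φ (ξ + Complex.I * η) i k / (2 * Complex.I * (ξ + Complex.I * η))))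
      2 (vol (2 * l))) atTop (𝓝 0)

/-- `s(x, t) = ∫₀^{min(x,t)} Φ₁'(x-ζ) Φ₁'(t-ζ)* dζ`. -/
noncomputable def sKernel (Φ₁ : ℝ → Matrix (Fin m₂) (Fin m₁) ℂ) (x t : ℝ) :
    Matrix (Fin m₂) (Fin m₂) ℂ :=
  ∫ ζ in (0 : ℝ)..(min x t), deriv Φ₁ (x - ζ) * (deriv Φ₁ (t - ζ))ᴴ

/-- `S = I + ∫₀ˡ s(x, t) · dt`. -/
noncomputable def opS (l : ℝ) (Φ₁ : ℝ → Matrix (Fin m₂) (Fin m₁) ℂ)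
    (f : ℝ → Matrix (Fin m₂) (Fin p) ℂ) (x : ℝ) : Matrix (Fin m₂) (Fin p) ℂ :=
  f x + ∫ t in (0 : ℝ)..l, sKernel Φ₁ x t * f t

/-- `S_r f = g` in `L²(0, r)`, where `S_r = P_r S P_r*`: extend `f` by zero from `(0, r)`,
apply `S`, and restrict to `(0, r)`. -/
def CompressedEq (l r : ℝ) (Φ₁ : ℝ → Matrix (Fin m₂) (Fin m₁) ℂ)
    (f g : ℝ → Matrix (Fin m₂) (Fin p) ℂ) : Prop :=
  MemLp f 2 (vol r) ∧ ∀ᵐ x ∂(vol r), opS l Φ₁ ((Ioo 0 r).indicator f) x = g x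

/-- `S_r` is a bijection of `L²(0, r)`. -/
def CompressedInvertible (l r : ℝ) (Φ₁ : ℝ → Matrix (Fin m₂) (Fin m₁) ℂ) : Prop :=
  ∀ (p : ℕ) (g : ℝ → Matrix (Fin m₂) (Fin p) ℂ), MemLp g 2 (vol r) →
    (∃ f, CompressedEq l r Φ₁ f g) ∧
      ∀ f f', CompressedEq l r Φ₁ f g → CompressedEq l r Φ₁ f' g → f =ᵐ[vol r] f'

/-- Boundedly differentiable `γ̃` with `β γ̃* = 0`, `γ̃ γ̃* > 0` on `[0, l]` and
`γ̃(0) = [0 I_{m₂}]`, the value at `0` of `γ`. -/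
def IsComplement (l : ℝ) (β : ℝ → Matrix (Fin m₁) (Fin m₁ ⊕ Fin m₂) ℂ)
    (γt : ℝ → Matrix (Fin m₂) (Fin m₁ ⊕ Fin m₂) ℂ) : Prop :=
  BddDiff l γt ∧ (∀ x ∈ Icc 0 l, β x * (γt x)ᴴ = 0 ∧ (γt x * (γt x)ᴴ).PosDef) ∧
    γt 0 = lowerRow m₁ m₂

/-- `κ̃' = -κ̃ γ̃' γ̃* (γ̃ γ̃*)⁻¹` almost everywhere on `[0, l]`, `κ̃(0) = I_{m₂}`. -/
def SolvesKappa (l : ℝ) (γt : ℝ → Matrix (Fin m₂) (Fin m₁ ⊕ Fin m₂) ℂ)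
    (κ : ℝ → Matrix (Fin m₂) (Fin m₂) ℂ) : Prop :=
  AbsolutelyContinuousOnInterval κ 0 l ∧ κ 0 = 1 ∧
    ∀ᵐ x ∂(vol l), HasDerivAt κ (-(κ x * deriv γt x * (γt x)ᴴ * (γt x * (γt x)ᴴ)⁻¹)) x

end Operators

end SkewDirac

/-!
The proof rests on a transmutation operator. Two bounded Volterra kernels `E`, `N`, solving the
Goursat problem `∂ₓ N = v E`, `(∂ₓ + ∂ₜ) E = -v* N`, `N(t, t) = v(t)`, `E(x, 0) = 0`
(`exists_transmutation`), give operators with `(N f)' = v E f` and `(E F)' = E F' - v* N F`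
(`isPrim_opN`, `isPrim_opE`). If `k` solves the Volterra equation `E k = -v*`, they carry the
solutions of the explicitly solvable equation `F' = -2 i z F + k A` to solutions of the Dirac
system: `u(x, z) [A; F(0)] = e^{izx} [A + N F; E F]` (`IsTransmutation.fundamental_mul`). At `z = 0`
this yields `E I = γ₂`, `E Φ₁ = γ₁` for `Φ₁ = ∫₀ˣ k`, and `β = [I + N Φ₁, N I]`. Since `γ β* = 0` and
`γ γ* = I`, the same two relations yield `E A = K E` (`IsTransmutation.isSimilarityKernel`).

The Weyl function enters through energy inequalities. For `Im z > M` the indefinite energy of a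
solution decreases; hence, for `w` in the Weyl ball, the solution with initial value `[I; w]` has its
lower block dominated by the upper one on the whole interval, and decays
(`IsFundamentalSolution.vnorm_le_of_mem_weylBall`, `IsDiracSol.norm_upper_le_exp`). Volterra operators
being bounded from below, the representation of this solution turns the decay into
`‖φ(z) + ∫₀ˣ e^{2izt} k(t) dt‖ ≤ D e^{-2x Im z}` (`IsTransmutation.norm_add_lap_le`). For `x = l`
the error term, divided by `2iz`, contributes nothing to the truncated inverse Fourier integral in the
limit, as a shift of the contour upwards shows; the Laplace transform of `k` reduces to integrals of
`e^{isz} / (iz)`, which converge to a step function. This is the formula for `Φ₁`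
(`isInverseFourier_nodePrim`).

To express `β` by `Φ₁` it remains to recognize the row `N(r, ·)`. The solution with initial value
`[-w*; I]` at the conjugate parameter is orthogonal to the Weyl solution, hence it too decays, now with
the upper block dominated by the lower one. Inserted into the representation, this says that the
Laplace transform of `N(r, ·) + k* + (N(r, ·) ⋆ k) * k*` — correlation, then convolution, on `(0, r)` —
is `O(e^{2r Im ω})` for `Im ω < -M` (`IsTransmutation.norm_laplace_residual_le`). A function on `(0, r)`
with such a transform vanishes, by Liouville's theorem (`ae_eq_zero_of_laplace_le`). The result reads
`S_r N(r, ·)* = -k`. As `S_r = I + B B*`, with `B` the convolution with `k`, the operator is invertible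
(`compressedInvertible`), and the formula for `β` follows (`IsTransmutation.betaFun_eq`).

The rest is algebra in the unitary matrix `u(x, 0)`. Any `γ̃` with `β γ̃* = 0` equals `a γ` with
`a = γ̃ γ*` invertible, and `γ' γ* = -v* β γ* = 0` identifies `a⁻¹` as the solution of the equation for
`κ̃` (`IsComplement.gammaFun_eq`); and `β' = v γ` gives `v = β' γ*`. Each of `Φ₁`, `β`, `γ`, `v` is
thus determined by the preceding one and the first by `φ`, which gives the uniqueness of the potential
(`ae_eq_of_isWeylFunction`).
-/

set_option linter.unusedSectionVars false

namespace SkewDirac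

/-! ### Matrix-valued measurable functions and integrals -/

section MatrixCalculus

variable {a b c : Type*} [Fintype a] [Fintype b] [Fintype c]
  [DecidableEq a] [DecidableEq b] [DecidableEq c]

/-- Multiplication of rectangular matrices as a bounded real bilinear map. -/
noncomputable def mulL (a b c : Type*) [Fintype a] [Fintype b] [Fintype c]
    [DecidableEq a] [DecidableEq b] [DecidableEq c] :
    Matrix a b ℂ →L[ℝ] Matrix b c ℂ →L[ℝ] Matrix a c ℂ :=
  LinearMap.mkContinuous₂ (LinearMap.mk₂ ℝ (fun A B => A * B) Matrix.add_mul
    (fun r A B => Matrix.smul_mul r A B) Matrix.mul_add (fun r A B => Matrix.mul_smul A r B)) 1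
    (fun A B => by simpa using Matrix.l2_opNorm_mul A B)

/-- Conjugate transposition as a bounded real linear map. -/
noncomputable def adjL (a b : Type*) [Fintype a] [Fintype b] [DecidableEq a] [DecidableEq b] :
    Matrix a b ℂ →L[ℝ] Matrix b a ℂ :=
  LinearMap.mkContinuous
    { toFun := fun A => Aᴴ
      map_add' := Matrix.conjTranspose_add
      map_smul' := fun r A => by ext; simp } 1
    (fun A => by simpa using (Matrix.l2_opNorm_conjTranspose A).le)

lemma norm_mul_le_of_le {A : Matrix a b ℂ} {B : Matrix b c ℂ} {p q : ℝ} (hA : ‖A‖ ≤ p)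
    (hB : ‖B‖ ≤ q) : ‖A * B‖ ≤ p * q :=
  (Matrix.l2_opNorm_mul A B).trans
    (mul_le_mul hA hB (norm_nonneg _) ((norm_nonneg _).trans hA))

lemma stronglyMeasurable_mul {α : Type*} [MeasurableSpace α] {f : α → Matrix a b ℂ}
    {g : α → Matrix b c ℂ} (hf : StronglyMeasurable f) (hg : StronglyMeasurable g) :
    StronglyMeasurable (fun x => f x * g x) :=
  (continuous_fst.matrix_mul continuous_snd).comp_stronglyMeasurable (hf.prodMk hg)

lemma aestronglyMeasurable_mul {α : Type*} [MeasurableSpace α] {μ : Measure α}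
    {f : α → Matrix a b ℂ} {g : α → Matrix b c ℂ} (hf : AEStronglyMeasurable f μ)
    (hg : AEStronglyMeasurable g μ) : AEStronglyMeasurable (fun x => f x * g x) μ :=
  (continuous_fst.matrix_mul continuous_snd).comp_aestronglyMeasurable (hf.prodMk hg)

lemma stronglyMeasurable_adj {α : Type*} [MeasurableSpace α] {f : α → Matrix a b ℂ}
    (hf : StronglyMeasurable f) : StronglyMeasurable (fun x => (f x)ᴴ) :=
  (adjL a b).continuous.comp_stronglyMeasurable hf

lemma integral_const_matrix_mul {s t : ℝ} (A : Matrix a b ℂ) {f : ℝ → Matrix b c ℂ}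
    (hf : IntervalIntegrable f volume s t) : ∫ x in s..t, A * f x = A * ∫ x in s..t, f x :=
  (mulL a b c A).intervalIntegral_comp_comm hf

lemma integral_matrix_mul_const {s t : ℝ} {f : ℝ → Matrix a b ℂ} (B : Matrix b c ℂ)
    (hf : IntervalIntegrable f volume s t) : ∫ x in s..t, f x * B = (∫ x in s..t, f x) * B :=
  ((mulL a b c).flip B).intervalIntegral_comp_comm hf

lemma integral_adj {s t : ℝ} {f : ℝ → Matrix a b ℂ} (hf : IntervalIntegrable f volume s t) :
    ∫ x in s..t, (f x)ᴴ = (∫ x in s..t, f x)ᴴ :=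
  (adjL a b).intervalIntegral_comp_comm hf

lemma intervalIntegrable_adj {s t : ℝ} {f : ℝ → Matrix a b ℂ}
    (hf : IntervalIntegrable f volume s t) : IntervalIntegrable (fun x => (f x)ᴴ) volume s t :=
  ⟨(adjL a b).integrable_comp hf.1, (adjL a b).integrable_comp hf.2⟩

/-- A bounded measurable kernel times an integrable function is integrable on the square. -/
lemma integrable_kernel_mul {s t C : ℝ} (hst : s ≤ t) {G : ℝ → ℝ → Matrix a b ℂ}
    {f : ℝ → Matrix b c ℂ} (hG : StronglyMeasurable (Function.uncurry G))
    (hC : ∀ x ∈ Ioc s t, ∀ y ∈ Ioc s t, ‖G x y‖ ≤ C) (hf : IntervalIntegrable f volume s t) :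
    Integrable (Function.uncurry fun x y => G x y * f y)
      ((volume.restrict (Ioc s t)).prod (volume.restrict (Ioc s t))) := by
  have hf' : Integrable f (volume.restrict (Ioc s t)) :=
    (intervalIntegrable_iff_integrableOn_Ioc_of_le hst).1 hf
  have h1 : Integrable (fun q : ℝ × ℝ => C * ‖f q.2‖)
      ((volume.restrict (Ioc s t)).prod (volume.restrict (Ioc s t))) :=
    (hf'.norm.comp_snd _).const_mul C
  refine h1.mono' (aestronglyMeasurable_mul hG.aestronglyMeasurable
    hf'.aestronglyMeasurable.comp_snd) ?_
  rw [Measure.prod_restrict]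
  filter_upwards [ae_restrict_mem (measurableSet_Ioc.prod measurableSet_Ioc)] with q hq
  exact norm_mul_le_of_le (hC _ hq.1 _ hq.2) le_rfl

lemma intervalIntegrable_bdd_mul {s t C : ℝ} {g : ℝ → Matrix a b ℂ}
    {f : ℝ → Matrix b c ℂ} (hg : AEStronglyMeasurable g (volume.restrict (uIoc s t)))
    (hC : ∀ᵐ x ∂volume.restrict (uIoc s t), ‖g x‖ ≤ C) (hf : IntervalIntegrable f volume s t) :
    IntervalIntegrable (fun x => g x * f x) volume s t := by
  rw [intervalIntegrable_iff] at hf ⊢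
  refine (hf.norm.const_mul C).mono' (aestronglyMeasurable_mul hg hf.aestronglyMeasurable) ?_
  filter_upwards [hC] with x hx
  exact norm_mul_le_of_le hx le_rfl

end MatrixCalculus

section Scalar

variable {V : Type*} [NormedAddCommGroup V] [NormedSpace ℝ V]

/-- Fubini's theorem on the triangle `s < y < x < t`. -/
lemma integral_triangle_swap {s t : ℝ} (hst : s ≤ t) {F : ℝ → ℝ → V}
    (hF : Integrable (Function.uncurry F)
      ((volume.restrict (Ioc s t)).prod (volume.restrict (Ioc s t)))) :
    ∫ x in s..t, ∫ y in s..x, F x y = ∫ y in s..t, ∫ x in y..t, F x y := by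
  have h1 : ∀ x ∈ Ioc s t, ∫ y in s..x, F x y =
      ∫ y in Ioc s t, {q : ℝ × ℝ | q.2 ≤ q.1}.indicator (Function.uncurry F) (x, y) := by
    intro x hx
    rw [intervalIntegral.integral_of_le hx.1.le]
    have : (fun y => {q : ℝ × ℝ | q.2 ≤ q.1}.indicator (Function.uncurry F) (x, y)) =
        (Iic x).indicator (F x) := by
      ext y; simp [indicator]
    rw [this, setIntegral_indicator measurableSet_Iic]
    congr 2
    ext y; simp only [mem_Ioc, mem_inter_iff, mem_Iic]
    constructor
    · rintro ⟨h, h'⟩; exact ⟨⟨h, h'.trans hx.2⟩, h'⟩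
    · rintro ⟨⟨h, _⟩, h'⟩; exact ⟨h, h'⟩
  have h2 : ∀ y ∈ Ioc s t, ∫ x in y..t, F x y =
      ∫ x in Ioc s t, {q : ℝ × ℝ | q.2 ≤ q.1}.indicator (Function.uncurry F) (x, y) := by
    intro y hy
    rw [intervalIntegral.integral_of_le hy.2, ← integral_Icc_eq_integral_Ioc]
    have : (fun x => {q : ℝ × ℝ | q.2 ≤ q.1}.indicator (Function.uncurry F) (x, y)) =
        (Ici y).indicator (fun x => F x y) := by
      ext y; simp [indicator]
    rw [this, setIntegral_indicator measurableSet_Ici]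
    congr 2
    ext x; simp only [mem_Ioc, mem_Icc, mem_inter_iff, mem_Ici]
    constructor
    · rintro ⟨h, h'⟩; exact ⟨⟨hy.1.trans_le h, h'⟩, h⟩
    · rintro ⟨⟨_, h⟩, h'⟩; exact ⟨h', h⟩
  rw [intervalIntegral.integral_of_le hst, intervalIntegral.integral_of_le hst,
    setIntegral_congr_fun measurableSet_Ioc h1, setIntegral_congr_fun measurableSet_Ioc h2]
  exact integral_integral_swap
    (hF.indicator (measurableSet_le measurable_snd measurable_fst))

/-- Gronwall's inequality in integral form. -/
lemma le_exp_of_le_integral {l A C : ℝ} (hC : 0 ≤ C) {g : ℝ → ℝ}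
    (hg : IntervalIntegrable g volume 0 l)
    (h : ∀ x ∈ Icc 0 l, g x ≤ A + C * ∫ t in (0 : ℝ)..x, g t) :
    ∀ x ∈ Icc 0 l, g x ≤ A * Real.exp (C * x) := by
  rcases lt_or_ge l 0 with hl | hl
  · intro x hx; exact absurd (hx.1.trans hx.2) (not_le.2 hl)
  -- the right-hand side `G` of the hypothesis is continuous, and satisfies the same inequality
  set G : ℝ → ℝ := fun x => A + C * ∫ t in (0 : ℝ)..x, g t with hG
  have hGc : ContinuousOn G (Icc 0 l) := by
    have := intervalIntegral.continuousOn_primitive_interval' hg left_mem_uIcc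
    rw [uIcc_of_le hl] at this
    exact continuousOn_const.add (continuousOn_const.mul this)
  have hGi : IntervalIntegrable G volume 0 l := by
    apply ContinuousOn.intervalIntegrable; rwa [uIcc_of_le hl]
  have sub : ∀ x ∈ Icc 0 l, uIcc 0 x ⊆ uIcc 0 l := fun x hx => by
    rw [uIcc_of_le hx.1, uIcc_of_le hl]; exact Icc_subset_Icc_right hx.2
  have hGle : ∀ x ∈ Icc 0 l, G x ≤ A + C * ∫ t in (0 : ℝ)..x, G t := by
    intro x hx
    have : ∫ t in (0 : ℝ)..x, g t ≤ ∫ t in (0 : ℝ)..x, G t :=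
      intervalIntegral.integral_mono_on hx.1 (hg.mono_set (sub x hx)) (hGi.mono_set (sub x hx))
        (fun t ht => h t ⟨ht.1, ht.2.trans hx.2⟩)
    have := mul_le_mul_of_nonneg_left this hC
    simp only [hG] at this ⊢; linarith
  set H : ℝ → ℝ := fun x => A + C * ∫ t in (0 : ℝ)..x, G t with hH
  have hHc : ContinuousOn H (Icc 0 l) := by
    have := intervalIntegral.continuousOn_primitive_interval' hGi left_mem_uIcc
    rw [uIcc_of_le hl] at this
    exact continuousOn_const.add (continuousOn_const.mul this)
  have hHd : ∀ x ∈ Ico 0 l, HasDerivWithinAt H (C * G x) (Ici x) x := by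
    intro x hx
    have hx' : x ∈ Icc 0 l := ⟨hx.1, hx.2.le⟩
    refine HasDerivWithinAt.const_add _ (HasDerivWithinAt.const_mul _ ?_)
    have hnb : Icc 0 l ∈ 𝓝[Ici x] x := mem_of_superset (Icc_mem_nhdsGE hx.2)
      (Icc_subset_Icc_left hx.1)
    refine intervalIntegral.integral_hasDerivWithinAt_right (hGi.mono_set (sub x hx')) ?_
      (t := Ioi x) ?_
    · refine ⟨Icc 0 l, mem_of_superset (Ioc_mem_nhdsGT hx.2) (fun y hy => ⟨hx.1.trans hy.1.le, hy.2⟩),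
        hGc.aestronglyMeasurable measurableSet_Icc⟩
    · exact (hGc x hx').mono_of_mem_nhdsWithin
        (mem_of_superset (Ioc_mem_nhdsGT hx.2) (fun y hy => ⟨hx.1.trans hy.1.le, hy.2⟩))
  intro x hx
  have key := le_gronwallBound_of_liminf_deriv_right_le (f := H) (f' := fun x => C * G x)
    (δ := A) (K := C) (ε := 0) (a := 0) (b := l) hHc
    (fun x hx r hr => (hHd x hx).liminf_right_slope_le hr) (by simp [hH])
    (fun x hx => by
      simpa using mul_le_mul_of_nonneg_left (hGle x ⟨hx.1, hx.2.le⟩) hC) x hx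
  rw [gronwallBound_ε0, sub_zero] at key
  exact (h x hx).trans ((hGle x hx).trans key)

/-- A bounded function that is strongly measurable on the interval is integrable there. -/
lemma intervalIntegrable_of_bdd {s t C : ℝ} {f : ℝ → V}
    (hf : AEStronglyMeasurable f (volume.restrict (uIoc s t)))
    (hC : ∀ x ∈ uIoc s t, ‖f x‖ ≤ C) : IntervalIntegrable f volume s t := by
  rw [intervalIntegrable_iff]
  have : IntegrableOn (fun _ : ℝ => C) (uIoc s t) volume := by
    rw [uIoc]; exact integrableOn_const measure_Ioc_lt_top.ne
  exact Integrable.mono' this hf ((ae_restrict_mem measurableSet_uIoc).mono fun x hx => hC x hx)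

end Scalar

/-! ### Functions with integrable derivative -/

section Prim

variable {V W Z : Type*} [NormedAddCommGroup V] [NormedSpace ℝ V] [NormedAddCommGroup W]
  [NormedSpace ℝ W] [NormedAddCommGroup Z] [NormedSpace ℝ Z]

/-- `F` is a primitive on `[0, l]` of the integrable function `f`. -/
structure IsPrim (l : ℝ) (F f : ℝ → V) : Prop where
  nonneg : 0 ≤ l
  integrable : IntervalIntegrable f volume 0 l
  eq : ∀ x ∈ Icc 0 l, F x = F 0 + ∫ t in (0 : ℝ)..x, f t

lemma ae_Ioc_of_vol {l : ℝ} {p : ℝ → Prop} (h : ∀ᵐ x ∂(vol l), p x) : ∀ᵐ x, x ∈ Ioc 0 l → p x := by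
  rw [vol, restrict_Ioo_eq_restrict_Ioc] at h
  exact (ae_restrict_iff' measurableSet_Ioc).1 h

lemma vol_of_ae_Icc {l : ℝ} {p : ℝ → Prop} (h : ∀ᵐ x, x ∈ Icc 0 l → p x) : ∀ᵐ x ∂(vol l), p x :=
  (ae_restrict_iff' measurableSet_Ioo).2 (h.mono fun _ hx h' => hx ⟨h'.1.le, h'.2.le⟩)

lemma uIcc_sub {l x : ℝ} (hx : x ∈ Icc 0 l) : uIcc 0 x ⊆ uIcc 0 l := by
  rw [uIcc_of_le hx.1, uIcc_of_le (hx.1.trans hx.2)]; exact Icc_subset_Icc_right hx.2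

lemma intervalIntegrable_of_mem {l x : ℝ} {f : ℝ → V} (h : IntervalIntegrable f volume 0 l)
    (hx : x ∈ Icc 0 l) : IntervalIntegrable f volume 0 x :=
  h.mono_set (uIcc_sub hx)

/-- The primitive of an integrable function, as a continuous function. -/
lemma isPrim_integral {l : ℝ} (hl : 0 ≤ l) {f : ℝ → V} (hf : IntervalIntegrable f volume 0 l)
    (A : V) : IsPrim l (fun x => A + ∫ t in (0 : ℝ)..x, f t) f :=
  ⟨hl, hf, fun x _ => by simp⟩

namespace IsPrim

variable {l : ℝ} {F f : ℝ → V} {G g : ℝ → W}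

lemma integrable_of_mem (h : IsPrim l F f) {x : ℝ} (hx : x ∈ Icc 0 l) :
    IntervalIntegrable f volume 0 x :=
  intervalIntegrable_of_mem h.integrable hx

lemma continuousOn (h : IsPrim l F f) : ContinuousOn F (Icc 0 l) := by
  have := intervalIntegral.continuousOn_primitive_interval' h.integrable left_mem_uIcc
  rw [uIcc_of_le h.nonneg] at this
  exact (continuousOn_const.add this).congr h.eq

lemma congr_ae {f' : ℝ → V} (h : IsPrim l F f) (hff' : ∀ᵐ x ∂(vol l), f x = f' x) :
    IsPrim l F f' := by
  have key := ae_Ioc_of_vol hff'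
  refine ⟨h.nonneg, h.integrable.congr_ae ?_, fun x hx => ?_⟩
  · rw [uIoc_of_le h.nonneg]
    exact (ae_restrict_iff' measurableSet_Ioc).2 key
  · rw [h.eq x hx]
    congr 1
    refine intervalIntegral.integral_congr_ae (key.mono fun t ht htx => ht ?_)
    rw [uIoc_of_le hx.1] at htx
    exact ⟨htx.1, htx.2.trans hx.2⟩

lemma congr {F' : ℝ → V} (h : IsPrim l F f) (hF : ∀ x ∈ Icc 0 l, F' x = F x) :
    IsPrim l F' f :=
  ⟨h.nonneg, h.integrable, fun x hx => by
    rw [hF x hx, hF 0 ⟨le_rfl, h.nonneg⟩, h.eq x hx]⟩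

lemma add {G g : ℝ → V} (hF : IsPrim l F f) (hG : IsPrim l G g) :
    IsPrim l (fun x => F x + G x) (fun x => f x + g x) :=
  ⟨hF.nonneg, hF.integrable.add hG.integrable, fun x hx => by
    rw [intervalIntegral.integral_add (hF.integrable_of_mem hx) (hG.integrable_of_mem hx),
      hF.eq x hx, hG.eq x hx]; abel⟩

lemma const (hl : 0 ≤ l) (A : V) : IsPrim l (fun _ => A) (fun _ => (0 : V)) :=
  ⟨hl, IntervalIntegrable.zero, fun x _ => by simp⟩

lemma eq_of_zero (hF : IsPrim l F (fun _ => 0)) {x : ℝ} (hx : x ∈ Icc 0 l) : F x = F 0 := by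
  simpa using hF.eq x hx

section Complete

variable [CompleteSpace V] [CompleteSpace W] [CompleteSpace Z]

lemma clm (hF : IsPrim l F f) (T : V →L[ℝ] W) : IsPrim l (fun x => T (F x)) (fun x => T (f x)) :=
  ⟨hF.nonneg, ⟨T.integrable_comp hF.integrable.1, T.integrable_comp hF.integrable.2⟩, fun x hx => by
    rw [T.intervalIntegral_comp_comm (hF.integrable_of_mem hx), hF.eq x hx, map_add]⟩

lemma neg (hF : IsPrim l F f) : IsPrim l (fun x => -F x) (fun x => -f x) := by
  simpa using hF.clm (-ContinuousLinearMap.id ℝ V)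

lemma sub {G g : ℝ → V} (hF : IsPrim l F f) (hG : IsPrim l G g) :
    IsPrim l (fun x => F x - G x) (fun x => f x - g x) := by
  simpa [sub_eq_add_neg] using hF.add hG.neg

lemma integrable_bilin (B : V →L[ℝ] W →L[ℝ] Z) (hf : IntervalIntegrable f volume 0 l)
    (hG : ContinuousOn G (Icc 0 l)) (hl : 0 ≤ l) :
    IntervalIntegrable (fun x => B (f x) (G x)) volume 0 l := by
  obtain ⟨C, hC⟩ := isCompact_Icc.exists_bound_of_continuousOn hG
  rw [intervalIntegrable_iff_integrableOn_Ioc_of_le hl] at hf ⊢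
  have hGm : AEStronglyMeasurable G (volume.restrict (Ioc 0 l)) :=
    (hG.mono Ioc_subset_Icc_self).aestronglyMeasurable measurableSet_Ioc
  refine (hf.norm.const_mul (‖B‖ * C)).mono' (B.continuous₂.comp_aestronglyMeasurable
    (AEStronglyMeasurable.prodMk hf.aestronglyMeasurable hGm)) ?_
  filter_upwards [ae_restrict_mem measurableSet_Ioc] with x hx
  have h1 := B.le_opNorm₂ (f x) (G x)
  have h2 := hC x (Ioc_subset_Icc_self hx)
  calc _ ≤ ‖B‖ * ‖f x‖ * ‖G x‖ := h1
    _ ≤ ‖B‖ * ‖f x‖ * C := by gcongr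
    _ = _ := by ring

/-- The product rule, by Fubini's theorem on the triangle. -/
lemma bilin (B : V →L[ℝ] W →L[ℝ] Z) (hF : IsPrim l F f) (hG : IsPrim l G g) :
    IsPrim l (fun x => B (F x) (G x)) (fun x => B (f x) (G x) + B (F x) (g x)) := by
  have i1 := integrable_bilin B hF.integrable hG.continuousOn hF.nonneg
  have i2 : IntervalIntegrable (fun x => B (F x) (g x)) volume 0 l :=
    integrable_bilin B.flip hG.integrable hF.continuousOn hF.nonneg
  refine ⟨hF.nonneg, i1.add i2, fun x hx => ?_⟩
  have hf := hF.integrable_of_mem hx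
  have hg := hG.integrable_of_mem hx
  have hsub : ∀ {s}, s ∈ Icc 0 x → s ∈ Icc 0 l := fun hs => ⟨hs.1, hs.2.trans hx.2⟩
  have i1' := intervalIntegrable_of_mem i1 hx
  have i2' := intervalIntegrable_of_mem i2 hx
  rw [intervalIntegral.integral_add i1' i2']
  have hint : Integrable (Function.uncurry fun s t => B (f t) (g s))
      ((volume.restrict (Ioc 0 x)).prod (volume.restrict (Ioc 0 x))) := by
    have hf' := (intervalIntegrable_iff_integrableOn_Ioc_of_le hx.1).1 hf
    have hg' := (intervalIntegrable_iff_integrableOn_Ioc_of_le hx.1).1 hg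
    refine ((hg'.norm.mul_prod hf'.norm).const_mul ‖B‖).mono'
      (B.continuous₂.comp_aestronglyMeasurable
        (AEStronglyMeasurable.prodMk hf'.aestronglyMeasurable.comp_snd
          hg'.aestronglyMeasurable.comp_fst)) (Eventually.of_forall fun q => ?_)
    have := B.le_opNorm₂ (f q.2) (g q.1)
    simp only [Function.uncurry]
    linarith
  have key := integral_triangle_swap hx.1 hint
  have e1 : ∫ s in (0 : ℝ)..x, ∫ t in (0 : ℝ)..s, B (f t) (g s) =
      (∫ s in (0 : ℝ)..x, B (F s) (g s)) - B (F 0) (∫ s in (0 : ℝ)..x, g s) := by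
    rw [← (B (F 0)).intervalIntegral_comp_comm hg,
      ← intervalIntegral.integral_sub i2' ⟨(B (F 0)).integrable_comp hg.1,
        (B (F 0)).integrable_comp hg.2⟩]
    refine intervalIntegral.integral_congr fun s hs => ?_
    rw [uIcc_of_le hx.1] at hs
    have h1 := (B.flip (g s)).intervalIntegral_comp_comm (hF.integrable_of_mem (hsub hs))
    simp only [ContinuousLinearMap.flip_apply] at h1
    simp only [h1, hF.eq s (hsub hs), map_add, _root_.add_apply]
    abel
  have e2 : ∫ t in (0 : ℝ)..x, ∫ s in t..x, B (f t) (g s) =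
      B (∫ t in (0 : ℝ)..x, f t) (G x) - ∫ t in (0 : ℝ)..x, B (f t) (G t) := by
    have h0 := (B.flip (G x)).intervalIntegral_comp_comm hf
    simp only [ContinuousLinearMap.flip_apply] at h0
    have h0i : IntervalIntegrable (fun s => B (f s) (G x)) volume 0 x :=
      ⟨(B.flip (G x)).integrable_comp hf.1, (B.flip (G x)).integrable_comp hf.2⟩
    rw [← h0, ← intervalIntegral.integral_sub h0i i1']
    refine intervalIntegral.integral_congr fun t ht => ?_
    rw [uIcc_of_le hx.1] at ht
    have hgt := hG.integrable_of_mem (hsub ht)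
    have h1 := (B (f t)).intervalIntegral_comp_comm (hgt.symm.trans hg)
    simp only [h1]
    rw [← intervalIntegral.integral_interval_sub_left hg hgt, hG.eq t (hsub ht), hG.eq x hx]
    simp only [map_add, map_sub]
    abel
  rw [e1, e2] at key
  have hFx : ∫ t in (0 : ℝ)..x, f t = F x - F 0 := by rw [hF.eq x hx]; abel
  have hGx : ∫ t in (0 : ℝ)..x, g t = G x - G 0 := by rw [hG.eq x hx]; abel
  rw [hFx, hGx] at key
  simp only [map_sub, _root_.sub_apply] at key
  rw [sub_eq_iff_eq_add] at key
  rw [key]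
  abel

lemma const_of_deriv {E : Type*} [NormedAddCommGroup E] [NormedSpace ℝ E] [CompleteSpace E]
    (hl : 0 ≤ l) {F f : ℝ → E} (h : ∀ x, HasDerivAt F (f x) x) (hf : Continuous f) :
    IsPrim l F f :=
  ⟨hl, hf.intervalIntegrable _ _, fun x _ => by
    rw [intervalIntegral.integral_eq_sub_of_hasDerivAt (fun x _ => h x)
      (hf.intervalIntegrable _ _)]; abel⟩

/-- The absolutely continuous functions with a bounded derivative are the primitives of
bounded functions. -/
lemma absolutelyContinuous (hF : IsPrim l F f) {C : ℝ} (hC : ∀ᵐ x ∂(vol l), ‖f x‖ ≤ C) :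
    AbsolutelyContinuousOnInterval F 0 l := by
  have hlip : LipschitzOnWith C.toNNReal F (uIcc 0 l) := by
    rw [uIcc_of_le hF.nonneg]
    refine LipschitzOnWith.of_dist_le_mul fun x hx y hy => ?_
    rw [dist_eq_norm, dist_eq_norm, hF.eq x hx, hF.eq y hy, add_sub_add_left_eq_sub,
      intervalIntegral.integral_interval_sub_left (hF.integrable_of_mem hx)
        (hF.integrable_of_mem hy), Real.norm_eq_abs]
    have hC' := ae_Ioc_of_vol hC
    refine (intervalIntegral.norm_integral_le_of_norm_le_const_ae (C := C.toNNReal) ?_).trans le_rfl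
    filter_upwards [hC'] with t ht htm
    refine (ht ?_).trans (Real.le_coe_toNNReal C)
    rcases le_total x y with h | h
    · rw [uIoc_of_ge h] at htm; exact ⟨hx.1.trans_lt htm.1, htm.2.trans hy.2⟩
    · rw [uIoc_of_le h] at htm; exact ⟨hy.1.trans_lt htm.1, htm.2.trans hx.2⟩
  exact hlip.absolutelyContinuousOnInterval

lemma ae_hasDerivAt (hF : IsPrim l F f) : ∀ᵐ x ∂(vol l), HasDerivAt F (f x) x := by
  rw [ae_restrict_iff' measurableSet_Ioo]
  filter_upwards [hF.integrable.ae_hasDerivAt_integral] with x hx hxm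
  have h1 := hx (by rw [uIcc_of_le hF.nonneg]; exact ⟨hxm.1.le, hxm.2.le⟩) 0 left_mem_uIcc
  refine (h1.const_add (F 0)).congr_of_eventuallyEq ?_
  filter_upwards [Icc_mem_nhds hxm.1 hxm.2] with y hy
  exact hF.eq y hy

lemma of_absolutelyContinuous (hl : 0 ≤ l) (hF : AbsolutelyContinuousOnInterval F 0 l)
    (hd : ∀ᵐ x ∂(vol l), HasDerivAt F (f x) x) (hf : IntervalIntegrable f volume 0 l)
    {C : ℝ} (hC : ∀ᵐ x ∂(vol l), ‖f x‖ ≤ C) : IsPrim l F f := by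
  have h0 := isPrim_integral hl hf 0
  have hac := hF.sub (h0.absolutelyContinuous hC)
  have hz : ∀ᵐ x, x ∈ uIcc 0 l → HasDerivAt (F - fun x => 0 + ∫ t in (0 : ℝ)..x, f t) 0 x := by
    have h1 := (ae_restrict_iff' measurableSet_Ioo).1 (hd.and h0.ae_hasDerivAt)
    have n1 : ∀ᵐ x : ℝ, x ≠ 0 := by simp [ae_iff, measure_singleton]
    have n2 : ∀ᵐ x : ℝ, x ≠ l := by simp [ae_iff, measure_singleton]
    filter_upwards [h1, n1, n2] with x hx hx0 hxl hxm
    rw [uIcc_of_le hl] at hxm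
    have := hx ⟨lt_of_le_of_ne hxm.1 hx0.symm, lt_of_le_of_ne hxm.2 hxl⟩
    simpa using this.1.sub this.2
  obtain ⟨D, hD⟩ := hac.const_of_ae_hasDerivAt_zero hz
  rw [uIcc_of_le hl] at hD
  refine ⟨hl, hf, fun x hx => ?_⟩
  have e1 := hD x hx
  have e2 := hD 0 ⟨le_rfl, hl⟩
  simp only [Pi.sub_apply, intervalIntegral.integral_same, zero_add, sub_zero] at e1 e2
  rw [e2, ← e1]; abel

end Complete

section MatrixPrim

variable {a b c : Type*} [Fintype a] [Fintype b] [Fintype c]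
  [DecidableEq a] [DecidableEq b] [DecidableEq c]

lemma mul {F f : ℝ → Matrix a b ℂ} {G g : ℝ → Matrix b c ℂ} (hF : IsPrim l F f)
    (hG : IsPrim l G g) : IsPrim l (fun x => F x * G x) (fun x => f x * G x + F x * g x) :=
  hF.bilin (mulL a b c) hG

lemma adj {F f : ℝ → Matrix a b ℂ} (hF : IsPrim l F f) :
    IsPrim l (fun x => (F x)ᴴ) (fun x => (f x)ᴴ) :=
  hF.clm (adjL a b)

lemma const_mul {F f : ℝ → Matrix b c ℂ} (hF : IsPrim l F f) (A : Matrix a b ℂ) :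
    IsPrim l (fun x => A * F x) (fun x => A * f x) :=
  hF.clm (mulL a b c A)

lemma mul_const {F f : ℝ → Matrix a b ℂ} (hF : IsPrim l F f) (B : Matrix b c ℂ) :
    IsPrim l (fun x => F x * B) (fun x => f x * B) :=
  hF.clm ((mulL a b c).flip B)

end MatrixPrim

/-- Multiplication by the exponential `e^{ω x}`. -/
lemma exp_smul {a b : Type*} [Fintype a] [Fintype b] [DecidableEq b]
    {F f : ℝ → Matrix a b ℂ} (hF : IsPrim l F f) (ω : ℂ) :
    IsPrim l (fun x => Complex.exp (ω * x) • F x)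
      (fun x => Complex.exp (ω * x) • (ω • F x + f x)) := by
  have h : IsPrim l (fun x : ℝ => Complex.exp (ω * x)) (fun x : ℝ => Complex.exp (ω * x) * ω) :=
    const_of_deriv hF.nonneg (fun x => by
      have h1 : HasDerivAt (fun x : ℝ => ω * (x : ℂ)) ω x := by
        simpa using (Complex.ofRealCLM.hasDerivAt (x := x)).const_mul ω
      exact h1.cexp) (by fun_prop)
  have := h.bilin (ContinuousLinearMap.lsmul ℝ ℂ) hF
  refine this.congr_ae (Eventually.of_forall fun x => ?_)
  simp [smul_add, smul_smul]

end IsPrim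

end Prim

/-! ### Successive approximations -/

section Picard

lemma stronglyMeasurable_intervalIntegral {α V : Type*} [MeasurableSpace α]
    [NormedAddCommGroup V] [NormedSpace ℝ V] {h : α → ℝ → V}
    (hh : StronglyMeasurable (Function.uncurry h)) {e : α → ℝ} (he : Measurable e) :
    StronglyMeasurable fun p => ∫ ρ in (0 : ℝ)..e p, h p ρ := by
  have aux : ∀ S : Set (α × ℝ), MeasurableSet S →
      StronglyMeasurable fun p => ∫ ρ, S.indicator (Function.uncurry h) (p, ρ) := fun S hS =>
    StronglyMeasurable.integral_prod_right (f := fun p ρ => S.indicator (Function.uncurry h) (p, ρ))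
      (hh.indicator hS)
  have m1 : MeasurableSet {q : α × ℝ | 0 < q.2 ∧ q.2 ≤ e q.1} :=
    (measurableSet_lt measurable_const measurable_snd).inter
      (measurableSet_le measurable_snd (he.comp measurable_fst))
  have m2 : MeasurableSet {q : α × ℝ | e q.1 < q.2 ∧ q.2 ≤ 0} :=
    (measurableSet_lt (he.comp measurable_fst) measurable_snd).inter
      (measurableSet_le measurable_snd measurable_const)
  convert (aux _ m1).sub (aux _ m2) using 2 with p
  simp only [intervalIntegral, Pi.sub_apply]
  rw [← integral_indicator measurableSet_Ioc, ← integral_indicator measurableSet_Ioc]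
  congr 1

lemma integrable_square_of_bdd {V : Type*} [NormedAddCommGroup V] {s t C : ℝ} {F : ℝ × ℝ → V}
    (hF : StronglyMeasurable F) (hC : ∀ x ∈ Ioc s t, ∀ y ∈ Ioc s t, ‖F (x, y)‖ ≤ C) :
    Integrable F ((volume.restrict (Ioc s t)).prod (volume.restrict (Ioc s t))) := by
  refine Integrable.mono' (g := fun _ => C) (integrable_const _) hF.aestronglyMeasurable ?_
  rw [Measure.prod_restrict]
  filter_upwards [ae_restrict_mem (measurableSet_Ioc.prod measurableSet_Ioc)] with q hq
  exact hC _ hq.1 _ hq.2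

lemma norm_integral_le_pow {V : Type*} [NormedAddCommGroup V] [NormedSpace ℝ V] {f : ℝ → V}
    {τ K : ℝ} {n : ℕ} (hτ : 0 ≤ τ)
    (hf : ∀ σ ∈ Ioc 0 τ, ‖f σ‖ ≤ K * σ ^ n / n.factorial) :
    ‖∫ σ in (0 : ℝ)..τ, f σ‖ ≤ K * τ ^ (n + 1) / (n + 1).factorial := by
  have h1 : ‖∫ σ in (0 : ℝ)..τ, f σ‖ ≤ ∫ σ in (0 : ℝ)..τ, K * σ ^ n / n.factorial :=
    intervalIntegral.norm_integral_le_of_norm_le hτ (Eventually.of_forall hf)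
      (by apply Continuous.intervalIntegrable; fun_prop)
  refine h1.trans (le_of_eq ?_)
  rw [intervalIntegral.integral_div, intervalIntegral.integral_const_mul, integral_pow]
  rw [Nat.factorial_succ]
  have := Nat.factorial_ne_zero n
  push_cast
  field_simp
  simp

/-- Volterra equations `f = g + T f` are solved by successive approximations: the `n`-th iterate
of `T` gains a factor `wⁿ / n!`. -/
lemma exists_volterra_solution {α V : Type*} [MeasurableSpace α] [NormedAddCommGroup V]
    [CompleteSpace V] {s : Set α} (hs : MeasurableSet s)
    {T : (α → V) → α → V} {w : α → ℝ} {W : ℝ} (hw : ∀ p ∈ s, 0 ≤ w p ∧ w p ≤ W)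
    (hT : ∀ f, StronglyMeasurable f → StronglyMeasurable (T f))
    (hsub : ∀ f g, StronglyMeasurable f → StronglyMeasurable g → (∃ C, ∀ p ∈ s, ‖f p‖ ≤ C) →
      (∃ C, ∀ p ∈ s, ‖g p‖ ≤ C) → ∀ p ∈ s, T f p - T g p = T (f - g) p)
    {c : ℝ} (hc : 0 ≤ c)
    (hb : ∀ (n : ℕ) (f : α → V) (B : ℝ), StronglyMeasurable f → 0 ≤ B →
      (∀ p ∈ s, ‖f p‖ ≤ B * w p ^ n / n.factorial) →
      ∀ p ∈ s, ‖T f p‖ ≤ c * B * w p ^ (n + 1) / (n + 1).factorial)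
    {g : α → V} (hg : StronglyMeasurable g) {B : ℝ} (hB : 0 ≤ B) (hgB : ∀ p ∈ s, ‖g p‖ ≤ B) :
    ∃ f, StronglyMeasurable f ∧ (∃ C, ∀ p ∈ s, ‖f p‖ ≤ C) ∧ ∀ p ∈ s, f p = g p + T f p := by
  let F : ℕ → α → V := fun n => Nat.rec g (fun _ f => g + T f) n
  have F0 : F 0 = g := rfl
  have FS : ∀ n, F (n + 1) = g + T (F n) := fun _ => rfl
  have hFm : ∀ n, StronglyMeasurable (F n) := by
    intro n
    induction n with
    | zero => exact hg
    | succ n ih => rw [FS]; exact hg.add (hT _ ih)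
  have hTb : ∀ f : α → V, StronglyMeasurable f → ∀ C : ℝ, 0 ≤ C → (∀ p ∈ s, ‖f p‖ ≤ C) →
      ∀ p ∈ s, ‖T f p‖ ≤ c * C * W := by
    intro f hf C hC0 hC p hp
    have := hb 0 f C hf hC0 (fun p hp => by simpa using hC p hp) p hp
    simp only [zero_add, pow_one, Nat.factorial_one, Nat.cast_one, div_one] at this
    exact this.trans (mul_le_mul_of_nonneg_left (hw p hp).2 (mul_nonneg hc hC0))
  have hFb : ∀ n, ∃ C, 0 ≤ C ∧ ∀ p ∈ s, ‖F n p‖ ≤ C := by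
    intro n
    induction n with
    | zero => exact ⟨B, hB, hgB⟩
    | succ n ih =>
      obtain ⟨C, hC0, hC⟩ := ih
      refine ⟨B + |c * C * W|, by positivity, fun p hp => ?_⟩
      rw [FS]
      exact (norm_add_le _ _).trans (add_le_add (hgB p hp)
        ((hTb _ (hFm n) C hC0 hC p hp).trans (le_abs_self _)))
  have hFb' : ∀ n, ∃ C, ∀ p ∈ s, ‖F n p‖ ≤ C := fun n => let ⟨C, _, h⟩ := hFb n; ⟨C, h⟩
  have hd : ∀ n, ∀ p ∈ s, ‖F (n + 1) p - F n p‖ ≤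
      (c ^ (n + 1) * B) * w p ^ (n + 1) / (n + 1).factorial := by
    intro n
    induction n with
    | zero =>
      intro p hp
      have := hb 0 g B hg hB (fun p hp => by simpa using hgB p hp) p hp
      simpa [FS, F0] using this
    | succ n ih =>
      intro p hp
      have e : F (n + 1 + 1) p - F (n + 1) p = T (F (n + 1) - F n) p := by
        rw [FS (n + 1), ← hsub (F (n + 1)) (F n) (hFm (n + 1)) (hFm n) (hFb' (n + 1)) (hFb' n) p hp]
        nth_rewrite 2 [FS n]
        simp
      rw [e]
      refine (hb (n + 1) (F (n + 1) - F n) _ ((hFm (n + 1)).sub (hFm n)) (by positivity)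
        (fun q hq => ih q hq) p hp).trans (le_of_eq ?_)
      ring
  let A : ℕ → ℝ := fun n => B * (c * |W|) ^ (n + 1) / (n + 1).factorial
  have hA : Summable A := by
    have := (summable_nat_add_iff 1).2 (Real.summable_pow_div_factorial (c * |W|))
    refine (this.mul_left B).congr fun n => ?_
    simp only [A]; ring
  have hdA : ∀ n, ∀ p ∈ s, ‖F (n + 1) p - F n p‖ ≤ A n := by
    intro n p hp
    refine (hd n p hp).trans ?_
    have h1 : w p ^ (n + 1) ≤ |W| ^ (n + 1) :=
      pow_le_pow_left₀ (hw p hp).1 ((hw p hp).2.trans (le_abs_self W)) _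
    simp only [A, mul_pow]
    rw [mul_comm (c ^ (n + 1)) B, mul_assoc]
    gcongr
  have hlim : ∀ p, ∃ y, Tendsto (fun n => s.indicator (F n) p) atTop (𝓝 y) := by
    intro p
    by_cases hp : p ∈ s
    · simp only [indicator_of_mem hp]
      refine cauchySeq_tendsto_of_complete (cauchySeq_of_summable_dist ?_)
      refine Summable.of_nonneg_of_le (fun _ => dist_nonneg) (fun n => ?_) hA
      rw [dist_comm, dist_eq_norm]
      exact hdA n p hp
    · exact ⟨0, by simp [indicator_of_notMem hp]⟩
  choose f hf using hlim
  have hfm : StronglyMeasurable f :=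
    stronglyMeasurable_of_tendsto atTop (fun n => (hFm n).indicator hs) (tendsto_pi_nhds.2 hf)
  have hf' : ∀ p ∈ s, Tendsto (fun n => F n p) atTop (𝓝 (f p)) := fun p hp => by
    simpa [indicator_of_mem hp] using hf p
  have htail : ∀ n, ∀ p ∈ s, ‖F n p - f p‖ ≤ ∑' k, A (n + k) := by
    intro n p hp
    rw [← dist_eq_norm]
    exact dist_le_tsum_of_dist_le_of_tendsto A (fun n => by
      rw [dist_comm, dist_eq_norm]; exact hdA n p hp) hA (hf' p hp) n
  have htail0 : Tendsto (fun n => ∑' k, A (n + k)) atTop (𝓝 0) := by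
    simpa [add_comm] using tendsto_sum_nat_add A
  have hfb : ∃ C, ∀ p ∈ s, ‖f p‖ ≤ C := by
    refine ⟨B + ∑' k, A (0 + k), fun p hp => ?_⟩
    have h1 := htail 0 p hp
    have h2 := hgB p hp
    rw [F0] at h1
    calc ‖f p‖ = ‖g p - (g p - f p)‖ := by congr 1; abel
      _ ≤ _ := (norm_sub_le _ _).trans (add_le_add h2 h1)
  refine ⟨f, hfm, hfb, fun p hp => ?_⟩
  have h1 : Tendsto (fun n => F (n + 1) p) atTop (𝓝 (f p)) := (hf' p hp).comp (tendsto_add_atTop_nat 1)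
  have h2 : Tendsto (fun n => T (F n) p) atTop (𝓝 (T f p)) := by
    rw [tendsto_iff_norm_sub_tendsto_zero]
    refine squeeze_zero (fun _ => norm_nonneg _) (fun n => ?_)
      (by simpa using (htail0.const_mul c).mul_const W)
    rw [hsub _ _ (hFm n) hfm (hFb' n) hfb p hp]
    exact hTb _ ((hFm n).sub hfm) _ ((norm_nonneg _).trans (htail n p hp))
      (fun q hq => htail n q hq) p hp
  exact tendsto_nhds_unique h1 (by simpa [FS] using h2.const_add (g p))

end Picard

/-! ### Transmutation kernels -/

section Kernels

variable {m₁ m₂ : ℕ}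

/-- Bounded measurable solutions of the Goursat problem
`∂ₓ N = v E`, `(∂ₓ + ∂ₜ) E = -v* N`, `N(t, t) = v(t)`, `E(x, 0) = 0` on the triangle
`0 < t < x < l`, in integrated form. -/
structure IsTransmutation (l : ℝ) (v : ℝ → Matrix (Fin m₁) (Fin m₂) ℂ)
    (E : ℝ → ℝ → Matrix (Fin m₂) (Fin m₂) ℂ) (N : ℝ → ℝ → Matrix (Fin m₁) (Fin m₂) ℂ) :
    Prop where
  measE : StronglyMeasurable (Function.uncurry E)
  measN : StronglyMeasurable (Function.uncurry N)
  bound : ∃ C, 0 ≤ C ∧ ∀ x ∈ Icc 0 l, ∀ t ∈ Icc 0 l, ‖E x t‖ ≤ C ∧ ‖N x t‖ ≤ C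
  zero : ∀ x, E x 0 = 0
  eqN : ∀ x ∈ Icc 0 l, ∀ t ∈ Icc 0 x, N x t = v t + ∫ s in t..x, v s * E s t
  eqE : ∀ x ∈ Icc 0 l, ∀ s ∈ Icc 0 x, ∫ t in s..x, E x t =
    (∫ y in s..x, E y s) - ∫ y in s..x, (v y)ᴴ * ∫ t in s..y, N y t

variable {l M : ℝ} {v : ℝ → Matrix (Fin m₁) (Fin m₂) ℂ}

/-- In the characteristic coordinates `τ = x - t`, `t`, the Goursat problem is a Volterra
equation. -/
lemma exists_characteristic_kernel (hv : StronglyMeasurable v) (hM : 0 ≤ M) (hvM : ∀ x, ‖v x‖ ≤ M)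
    (hl : 0 ≤ l) :
    ∃ f : ℝ × ℝ → Matrix (Fin m₁) (Fin m₂) ℂ, StronglyMeasurable f ∧
      (∃ C, ∀ p ∈ Icc 0 l ×ˢ Icc 0 l, ‖f p‖ ≤ C) ∧
      ∀ p ∈ Icc 0 l ×ˢ Icc 0 l, f p = v p.2 + ∫ σ in (0 : ℝ)..p.1, v (p.2 + σ) *
        (-∫ ρ in (0 : ℝ)..p.2, (v (σ + ρ))ᴴ * f (σ, ρ)) := by
  set s : Set (ℝ × ℝ) := Icc 0 l ×ˢ Icc 0 l with hs
  let I : (ℝ × ℝ → Matrix (Fin m₁) (Fin m₂) ℂ) → ℝ × ℝ → Matrix (Fin m₂) (Fin m₂) ℂ :=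
    fun f q => ∫ ρ in (0 : ℝ)..q.2, (v (q.1 + ρ))ᴴ * f (q.1, ρ)
  have m0 : ∀ f : ℝ × ℝ → Matrix (Fin m₁) (Fin m₂) ℂ, StronglyMeasurable f →
      StronglyMeasurable (Function.uncurry fun (q : ℝ × ℝ) (ρ : ℝ) => (v (q.1 + ρ))ᴴ * f (q.1, ρ)) :=
    fun f hf => stronglyMeasurable_mul
      (stronglyMeasurable_adj (hv.comp_measurable (by fun_prop)))
      (hf.comp_measurable (by fun_prop))
  have mI : ∀ f, StronglyMeasurable f → StronglyMeasurable (I f) := fun f hf =>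
    stronglyMeasurable_intervalIntegral (m0 f hf) measurable_snd
  have m1 : ∀ f : ℝ × ℝ → Matrix (Fin m₁) (Fin m₂) ℂ, StronglyMeasurable f → StronglyMeasurable
      (Function.uncurry fun (q : ℝ × ℝ) (σ : ℝ) => v (q.2 + σ) * -I f (σ, q.2)) :=
    fun f hf => stronglyMeasurable_mul (hv.comp_measurable (by fun_prop))
      ((mI f hf).comp_measurable (by fun_prop)).neg
  have bI : ∀ f : ℝ × ℝ → Matrix (Fin m₁) (Fin m₂) ℂ, ∀ q ∈ s, ∀ K : ℝ,
      (∀ ρ ∈ Icc 0 l, ‖f (q.1, ρ)‖ ≤ K) → ‖I f q‖ ≤ M * K * l := by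
    intro f q hq K hK
    have hK0 : 0 ≤ K := (norm_nonneg _).trans (hK 0 ⟨le_rfl, hl⟩)
    refine (intervalIntegral.norm_integral_le_of_norm_le_const (C := M * K) fun ρ hρ => ?_).trans ?_
    · rw [uIoc_of_le hq.2.1] at hρ
      exact norm_mul_le_of_le ((Matrix.l2_opNorm_conjTranspose _).le.trans (hvM _))
        (hK ρ ⟨hρ.1.le, hρ.2.trans hq.2.2⟩)
    · rw [sub_zero, abs_of_nonneg hq.2.1]
      exact mul_le_mul_of_nonneg_left hq.2.2 (by positivity)
  have iI : ∀ f : ℝ × ℝ → Matrix (Fin m₁) (Fin m₂) ℂ, StronglyMeasurable f →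
      (∃ C, ∀ p ∈ s, ‖f p‖ ≤ C) → ∀ q ∈ s,
      IntervalIntegrable (fun ρ => (v (q.1 + ρ))ᴴ * f (q.1, ρ)) volume 0 q.2 := by
    rintro f hf ⟨C, hC⟩ q hq
    refine intervalIntegrable_of_bdd (C := M * C)
      ((m0 f hf).comp_measurable measurable_prodMk_left).aestronglyMeasurable fun ρ hρ => ?_
    rw [uIoc_of_le hq.2.1] at hρ
    exact norm_mul_le_of_le ((Matrix.l2_opNorm_conjTranspose _).le.trans (hvM _))
      (hC (q.1, ρ) ⟨hq.1, hρ.1.le, hρ.2.trans hq.2.2⟩)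
  have iO : ∀ f : ℝ × ℝ → Matrix (Fin m₁) (Fin m₂) ℂ, StronglyMeasurable f →
      (∃ C, ∀ p ∈ s, ‖f p‖ ≤ C) → ∀ q ∈ s,
      IntervalIntegrable (fun σ => v (q.2 + σ) * -I f (σ, q.2)) volume 0 q.1 := by
    rintro f hf ⟨C, hC⟩ q hq
    refine intervalIntegrable_of_bdd (C := M * (M * C * l))
      ((m1 f hf).comp_measurable measurable_prodMk_left).aestronglyMeasurable fun σ hσ => ?_
    rw [uIoc_of_le hq.1.1] at hσ
    have hσ' : (σ, q.2) ∈ s := ⟨⟨hσ.1.le, hσ.2.trans hq.1.2⟩, hq.2⟩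
    refine norm_mul_le_of_le (hvM _) ?_
    rw [norm_neg]
    exact bI f _ hσ' C fun ρ hρ => hC _ ⟨hσ'.1, hρ⟩
  refine exists_volterra_solution (c := M * M * l) (w := fun q => q.1) (W := l)
    (T := fun f p => ∫ σ in (0 : ℝ)..p.1, v (p.2 + σ) * -I f (σ, p.2))
    (measurableSet_Icc.prod measurableSet_Icc) (fun p hp => hp.1)
    (fun f hf => stronglyMeasurable_intervalIntegral (m1 f hf) measurable_fst)
    (fun f g hf hg hfb hgb p hp => ?_) (by positivity) (fun n f B hf hB hfb p hp => ?_)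
    (hv.comp_measurable measurable_snd) hM (fun p _ => hvM _)
  · rw [← intervalIntegral.integral_sub (iO f hf hfb p hp) (iO g hg hgb p hp)]
    refine intervalIntegral.integral_congr fun σ hσ => ?_
    rw [uIcc_of_le hp.1.1] at hσ
    have hσ' : (σ, p.2) ∈ s := ⟨⟨hσ.1, hσ.2.trans hp.1.2⟩, hp.2⟩
    have : I (f - g) (σ, p.2) = I f (σ, p.2) - I g (σ, p.2) := by
      simp only [I]
      rw [← intervalIntegral.integral_sub (iI f hf hfb _ hσ') (iI g hg hgb _ hσ')]
      simp [Matrix.mul_sub]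
    simp only [this]
    rw [← Matrix.mul_sub]; congr 1; abel
  · refine (norm_integral_le_pow (K := M * M * l * B) hp.1.1 fun σ hσ => ?_)
    have hσ' : (σ, p.2) ∈ s := ⟨⟨hσ.1.le, hσ.2.trans hp.1.2⟩, hp.2⟩
    have h1 := bI f _ hσ' (B * σ ^ n / n.factorial) fun ρ hρ => hfb (σ, ρ) ⟨hσ'.1, hρ⟩
    rw [← norm_neg] at h1
    refine (norm_mul_le_of_le (hvM _) h1).trans (le_of_eq ?_)
    ring

lemma exists_transmutation (hv : StronglyMeasurable v) (hM : 0 ≤ M) (hvM : ∀ x, ‖v x‖ ≤ M)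
    (hl : 0 ≤ l) : ∃ E N, IsTransmutation l v E N := by
  obtain ⟨f, hf, ⟨C, hC⟩, hfe⟩ := exists_characteristic_kernel hv hM hvM hl
  have hC0 : 0 ≤ C := (norm_nonneg _).trans (hC (0, 0) ⟨⟨le_rfl, hl⟩, ⟨le_rfl, hl⟩⟩)
  have m0 : StronglyMeasurable (Function.uncurry fun (q : ℝ × ℝ) (ρ : ℝ) =>
      (v (q.1 + ρ))ᴴ * f (q.1, ρ)) :=
    stronglyMeasurable_mul (stronglyMeasurable_adj (hv.comp_measurable (by fun_prop)))
      (hf.comp_measurable (by fun_prop))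
  let e : ℝ × ℝ → Matrix (Fin m₂) (Fin m₂) ℂ :=
    fun q => -∫ ρ in (0 : ℝ)..q.2, (v (q.1 + ρ))ᴴ * f (q.1, ρ)
  have he : StronglyMeasurable e := (stronglyMeasurable_intervalIntegral m0 measurable_snd).neg
  have hgb : ∀ τ ∈ Icc 0 l, ∀ ρ ∈ Icc 0 l, ‖(v (τ + ρ))ᴴ * f (τ, ρ)‖ ≤ M * C := fun τ hτ ρ hρ =>
    norm_mul_le_of_le ((Matrix.l2_opNorm_conjTranspose _).le.trans (hvM _)) (hC _ ⟨hτ, hρ⟩)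
  have hgi : ∀ τ ∈ Icc 0 l, ∀ r ∈ Icc 0 l, ∀ t ∈ Icc 0 l,
      IntervalIntegrable (fun ρ => (v (τ + ρ))ᴴ * f (τ, ρ)) volume r t := by
    intro τ hτ r hr t ht
    refine intervalIntegrable_of_bdd (C := M * C)
      (m0.comp_measurable (measurable_prodMk_left (x := (τ, (0 : ℝ))))).aestronglyMeasurable
      fun ρ hρ => hgb τ hτ ρ ?_
    have := uIoc_subset_uIcc hρ
    exact ⟨(le_inf hr.1 ht.1).trans this.1, this.2.trans (sup_le hr.2 ht.2)⟩
  have heb : ∀ q ∈ Icc 0 l ×ˢ Icc 0 l, ‖e q‖ ≤ M * C * l := by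
    intro q hq
    simp only [e, norm_neg]
    refine (intervalIntegral.norm_integral_le_of_norm_le_const (C := M * C) fun ρ hρ => ?_).trans ?_
    · rw [uIoc_of_le hq.2.1] at hρ
      exact hgb _ hq.1 _ ⟨hρ.1.le, hρ.2.trans hq.2.2⟩
    · rw [sub_zero, abs_of_nonneg hq.2.1]
      exact mul_le_mul_of_nonneg_left hq.2.2 (by positivity)
  -- the kernels are cut off above the diagonal, where they play no role
  let D : Set (ℝ × ℝ) := {q | q.2 ≤ q.1}
  have hD : MeasurableSet D := measurableSet_le measurable_snd measurable_fst
  let E : ℝ → ℝ → Matrix (Fin m₂) (Fin m₂) ℂ := fun x t =>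
    D.indicator (fun q => e (q.1 - q.2, q.2)) (x, t)
  let N : ℝ → ℝ → Matrix (Fin m₁) (Fin m₂) ℂ := fun x t =>
    D.indicator (fun q => f (q.1 - q.2, q.2)) (x, t)
  have hE : ∀ {x t}, t ≤ x → E x t = e (x - t, t) := fun h => indicator_of_mem (s := D) h _
  have hN : ∀ {x t}, t ≤ x → N x t = f (x - t, t) := fun h => indicator_of_mem (s := D) h _
  have mN : StronglyMeasurable (Function.uncurry N) := by
    have h : StronglyMeasurable (fun q : ℝ × ℝ => f (q.1 - q.2, q.2)) :=
      hf.comp_measurable (by fun_prop)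
    exact h.indicator hD
  have mE : StronglyMeasurable (Function.uncurry E) := by
    have h : StronglyMeasurable (fun q : ℝ × ℝ => e (q.1 - q.2, q.2)) :=
      he.comp_measurable (by fun_prop)
    exact h.indicator hD
  have hsq : ∀ {x t}, x ∈ Icc 0 l → t ∈ Icc 0 l → t ≤ x →
      (x - t, t) ∈ Icc 0 l ×ˢ Icc 0 l := fun hx ht h =>
    ⟨⟨sub_nonneg.2 h, (sub_le_self _ ht.1).trans hx.2⟩, ht⟩
  have bN : ∀ x ∈ Icc 0 l, ∀ t ∈ Icc 0 l, ‖N x t‖ ≤ C := by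
    intro x hx t ht
    by_cases h : t ≤ x
    · rw [hN h]; exact hC _ (hsq hx ht h)
    · rw [show N x t = 0 from indicator_of_notMem (s := D) h _, norm_zero]; exact hC0
  have bE : ∀ x ∈ Icc 0 l, ∀ t ∈ Icc 0 l, ‖E x t‖ ≤ M * C * l := by
    intro x hx t ht
    by_cases h : t ≤ x
    · rw [hE h]; exact heb _ (hsq hx ht h)
    · rw [show E x t = 0 from indicator_of_notMem (s := D) h _, norm_zero]; positivity
  refine ⟨E, N, mE, mN, ⟨max C (M * C * l), le_max_of_le_left hC0, fun x hx t ht =>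
    ⟨(bE x hx t ht).trans (le_max_right _ _), (bN x hx t ht).trans (le_max_left _ _)⟩⟩,
    fun x => ?_, fun x hx t ht => ?_, fun x hx s hs => ?_⟩
  · simp only [E, indicator]
    split_ifs <;> simp [e]
  · have ht' : t ∈ Icc 0 l := ⟨ht.1, ht.2.trans hx.2⟩
    rw [hN ht.2, hfe _ (hsq hx ht' ht.2)]
    congr 1
    have := intervalIntegral.integral_comp_add_left
      (fun s => v s * E s t) t (a := 0) (b := x - t)
    rw [add_zero, add_sub_cancel] at this
    rw [← this]
    refine intervalIntegral.integral_congr fun σ hσ => ?_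
    rw [uIcc_of_le (sub_nonneg.2 ht.2)] at hσ
    simp only
    rw [hE (le_add_of_nonneg_right hσ.1), add_sub_cancel_left]
  · have hs' : s ∈ Icc 0 l := ⟨hs.1, hs.2.trans hx.2⟩
    have hmem : ∀ {t}, t ∈ Icc s x → t ∈ Icc 0 l := fun h => ⟨hs.1.trans h.1, h.2.trans hx.2⟩
    have hmem' : ∀ {t}, t ∈ Icc s x → x - t ∈ Icc 0 l := fun h =>
      ⟨sub_nonneg.2 h.2, (sub_le_self _ (hs.1.trans h.1)).trans hx.2⟩
    have i1 : IntervalIntegrable (fun t => e (x - t, s)) volume s x := by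
      refine intervalIntegrable_of_bdd (C := M * C * l)
        (he.comp_measurable (g := fun t : ℝ => (x - t, s)) (by fun_prop)).aestronglyMeasurable
        fun t ht => ?_
      rw [uIoc_of_le hs.2] at ht
      exact heb _ ⟨hmem' ⟨ht.1.le, ht.2⟩, hs'⟩
    have i2 : IntervalIntegrable (fun t => E x t) volume s x := by
      refine intervalIntegrable_of_bdd (C := M * C * l)
        (mE.comp_measurable measurable_prodMk_left).aestronglyMeasurable fun t ht => ?_
      rw [uIoc_of_le hs.2] at ht
      exact bE x hx _ (hmem ⟨ht.1.le, ht.2⟩)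
    have e1 : ∫ y in s..x, E y s = ∫ t in s..x, e (x - t, s) := by
      have := intervalIntegral.integral_comp_sub_left (fun y => E y s) (x + s) (a := s) (b := x)
      rw [add_sub_cancel_left, add_sub_cancel_right] at this
      rw [← this]
      refine intervalIntegral.integral_congr fun t ht => ?_
      rw [uIcc_of_le hs.2] at ht
      rw [hE (by linarith [ht.2])]
      congr 2; ring
    have split : ∀ t ∈ Icc s x, e (x - t, s) - E x t =
        ∫ ρ in s..t, (v (x - t + ρ))ᴴ * f (x - t, ρ) := by
      intro t ht
      rw [hE ht.2]
      simp only [e]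
      have z0 : (0 : ℝ) ∈ Icc 0 l := ⟨le_rfl, hl⟩
      rw [← intervalIntegral.integral_interval_sub_left
        (hgi (x - t) (hmem' ht) 0 z0 t (hmem ht)) (hgi (x - t) (hmem' ht) 0 z0 s hs')]
      abel
    rw [e1, eq_comm, sub_eq_iff_eq_add, ← sub_eq_iff_eq_add',
      ← intervalIntegral.integral_sub i1 i2]
    rw [intervalIntegral.integral_congr (fun t ht => split t (by rwa [uIcc_of_le hs.2] at ht))]
    -- exchange the order, move along the characteristics, exchange the order again
    have sw1 := integral_triangle_swap hs.2
      (F := fun t ρ => (v (x - t + ρ))ᴴ * f (x - t, ρ))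
      (integrable_square_of_bdd (C := M * C) (stronglyMeasurable_mul
          (stronglyMeasurable_adj (hv.comp_measurable (by fun_prop)))
          (hf.comp_measurable (by fun_prop)))
        fun t ht ρ hρ => hgb _ (hmem' ⟨ht.1.le, ht.2⟩) _ (hmem ⟨hρ.1.le, hρ.2⟩))
    have sw2 := integral_triangle_swap hs.2
      (F := fun y ρ => (v y)ᴴ * N y ρ)
      (integrable_square_of_bdd (C := M * C)
        (stronglyMeasurable_mul (stronglyMeasurable_adj (hv.comp_measurable measurable_fst)) mN)
        fun y hy ρ hρ => norm_mul_le_of_le ((Matrix.l2_opNorm_conjTranspose _).le.trans (hvM _))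
            (bN _ (hmem ⟨hy.1.le, hy.2⟩) _ (hmem ⟨hρ.1.le, hρ.2⟩)))
    rw [sw1]
    have sw3 : ∀ ρ ∈ uIcc s x, ∫ t in ρ..x, (v (x - t + ρ))ᴴ * f (x - t, ρ) =
        ∫ y in ρ..x, (v y)ᴴ * N y ρ := by
      intro ρ hρ
      rw [uIcc_of_le hs.2] at hρ
      have := intervalIntegral.integral_comp_sub_left (fun y => (v y)ᴴ * N y ρ) (x + ρ)
        (a := ρ) (b := x)
      rw [add_sub_cancel_left, add_sub_cancel_right] at this
      rw [← this]
      refine intervalIntegral.integral_congr fun t ht => ?_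
      rw [uIcc_of_le hρ.2] at ht
      rw [hN (by linarith [ht.2]), show x - t + ρ = x + ρ - t by ring,
        show x + ρ - t - ρ = x - t by ring]
    rw [intervalIntegral.integral_congr sw3, ← sw2]
    refine intervalIntegral.integral_congr fun y hy => ?_
    rw [uIcc_of_le hs.2] at hy
    refine integral_const_matrix_mul _ (intervalIntegrable_of_bdd (C := C)
        (mN.comp_measurable measurable_prodMk_left).aestronglyMeasurable fun t ht => ?_)
    rw [uIoc_of_le hy.1] at ht
    exact bN y (hmem hy) _ (hmem ⟨ht.1.le, ht.2.trans hy.2⟩)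

end Kernels

/-! ### Volterra operators with bounded kernels -/

section Volterra

variable {a b c : Type*} [Fintype a] [Fintype b] [Fintype c]
  [DecidableEq a] [DecidableEq b] [DecidableEq c] {l C : ℝ}

lemma intervalIntegrable_kernel_mul {G : ℝ → ℝ → Matrix a b ℂ}
    (hG : StronglyMeasurable (Function.uncurry G))
    (hC : ∀ x ∈ Icc 0 l, ∀ t ∈ Icc 0 l, ‖G x t‖ ≤ C) {f : ℝ → Matrix b c ℂ}
    (hf : IntervalIntegrable f volume 0 l) {x y : ℝ} (hx : x ∈ Icc 0 l) (hy : y ∈ Icc 0 l) :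
    IntervalIntegrable (fun t => G x t * f t) volume 0 y := by
  refine intervalIntegrable_bdd_mul (C := C)
    (hG.comp_measurable measurable_prodMk_left).aestronglyMeasurable ?_
    (intervalIntegrable_of_mem hf hy)
  rw [uIoc_of_le hy.1]
  filter_upwards [ae_restrict_mem measurableSet_Ioc] with t ht
  exact hC x hx t ⟨ht.1.le, ht.2.trans hy.2⟩

/-- A Volterra operator with bounded kernel maps integrable functions to bounded ones. -/
lemma norm_volterra_le {G : ℝ → ℝ → Matrix a b ℂ}
    (hC : ∀ x ∈ Icc 0 l, ∀ t ∈ Icc 0 l, ‖G x t‖ ≤ C) {f : ℝ → Matrix b c ℂ}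
    (hf : IntervalIntegrable f volume 0 l) {x : ℝ} (hx : x ∈ Icc 0 l) :
    ‖∫ t in (0 : ℝ)..x, G x t * f t‖ ≤ C * ∫ t in (0 : ℝ)..x, ‖f t‖ := by
  rw [← intervalIntegral.integral_const_mul]
  refine intervalIntegral.norm_integral_le_of_norm_le hx.1 (Eventually.of_forall fun t ht => ?_)
    ((intervalIntegrable_of_mem hf hx).norm.const_mul C)
  exact norm_mul_le_of_le (hC x hx t ⟨ht.1.le, ht.2.trans hx.2⟩) le_rfl

lemma intervalIntegrable_volterra {G : ℝ → ℝ → Matrix a b ℂ}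
    (hG : StronglyMeasurable (Function.uncurry G))
    (hC : ∀ x ∈ Icc 0 l, ∀ t ∈ Icc 0 l, ‖G x t‖ ≤ C) {f : ℝ → Matrix b c ℂ}
    (hf : IntervalIntegrable f volume 0 l) (hl : 0 ≤ l) :
    IntervalIntegrable (fun x => ∫ t in (0 : ℝ)..x, G x t * f t) volume 0 l := by
  have hC0 : 0 ≤ C := (norm_nonneg _).trans (hC 0 ⟨le_rfl, hl⟩ 0 ⟨le_rfl, hl⟩)
  have hfi := (intervalIntegrable_iff_integrableOn_Ioc_of_le hl).1 hf
  obtain ⟨g, hg, hfg⟩ := hfi.aestronglyMeasurable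
  have hfg' := (ae_restrict_iff' measurableSet_Ioc).1 hfg
  have hm : StronglyMeasurable fun x => ∫ t in (0 : ℝ)..x, G x t * g t :=
    stronglyMeasurable_intervalIntegral (h := fun x t => G x t * g t)
      (stronglyMeasurable_mul hG (hg.comp_measurable measurable_snd)) measurable_id
  refine intervalIntegrable_of_bdd (C := C * ∫ t in (0 : ℝ)..l, ‖f t‖)
    (hm.aestronglyMeasurable.congr ?_) fun x hx => ?_
  · rw [uIoc_of_le hl]
    filter_upwards [ae_restrict_mem measurableSet_Ioc] with x hx
    refine intervalIntegral.integral_congr_ae (hfg'.mono fun t ht htx => ?_)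
    rw [uIoc_of_le hx.1.le] at htx
    rw [ht ⟨htx.1, htx.2.trans hx.2⟩]
  · rw [uIoc_of_le hl] at hx
    refine (norm_volterra_le hC hf ⟨hx.1.le, hx.2⟩).trans (mul_le_mul_of_nonneg_left ?_ hC0)
    exact intervalIntegral.integral_mono_interval le_rfl hx.1.le hx.2
      (Eventually.of_forall fun t => norm_nonneg _) hf.norm

/-- Fubini's theorem for a Volterra operator: integrating the kernel first gives the integral of
the image. -/
lemma integral_tail_mul {G : ℝ → ℝ → Matrix a b ℂ}
    (hG : StronglyMeasurable (Function.uncurry G))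
    (hC : ∀ x ∈ Icc 0 l, ∀ t ∈ Icc 0 l, ‖G x t‖ ≤ C) {f : ℝ → Matrix b c ℂ}
    (hf : IntervalIntegrable f volume 0 l) {x : ℝ} (hx : x ∈ Icc 0 l) :
    ∫ s in (0 : ℝ)..x, (∫ y in s..x, G y s) * f s =
      ∫ y in (0 : ℝ)..x, ∫ s in (0 : ℝ)..y, G y s * f s := by
  have hsub : ∀ {t}, t ∈ Icc 0 x → t ∈ Icc 0 l := fun h => ⟨h.1, h.2.trans hx.2⟩
  rw [integral_triangle_swap hx.1 (F := fun y s => G y s * f s)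
    (integrable_kernel_mul (C := C) hx.1 hG (fun y hy s hs => hC _ (hsub ⟨hy.1.le, hy.2⟩) _
      (hsub ⟨hs.1.le, hs.2⟩)) (intervalIntegrable_of_mem hf hx))]
  refine intervalIntegral.integral_congr fun s hs => ?_
  rw [uIcc_of_le hx.1] at hs
  refine (integral_matrix_mul_const (f s) (intervalIntegrable_of_bdd (C := C)
    (hG.comp_measurable measurable_prodMk_right).aestronglyMeasurable fun y hy => ?_)).symm
  rw [uIoc_of_le hs.2] at hy
  exact hC y (hsub ⟨hs.1.trans hy.1.le, hy.2⟩) s (hsub hs)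

/-- Integration by parts against the tail integral of `g`. -/
lemma integral_mul_primitive {g : ℝ → Matrix a b ℂ} (hg : StronglyMeasurable g)
    (hC : ∀ t ∈ Icc 0 l, ‖g t‖ ≤ C) {F f : ℝ → Matrix b c ℂ} (hF : IsPrim l F f) {x : ℝ}
    (hx : x ∈ Icc 0 l) :
    ∫ t in (0 : ℝ)..x, g t * F t =
      (∫ t in (0 : ℝ)..x, g t) * F 0 + ∫ s in (0 : ℝ)..x, (∫ t in s..x, g t) * f s := by
  have hsub : ∀ {t}, t ∈ Icc 0 x → t ∈ Icc 0 l := fun h => ⟨h.1, h.2.trans hx.2⟩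
  have gi : IntervalIntegrable g volume 0 l :=
    intervalIntegrable_of_bdd (C := C) hg.aestronglyMeasurable fun t ht => by
      rw [uIoc_of_le hF.nonneg] at ht; exact hC t ⟨ht.1.le, ht.2⟩
  rw [integral_tail_mul (G := fun y _ => g y) (hg.comp_measurable measurable_fst)
    (fun x hx _ _ => hC x hx) hF.integrable hx,
    ← integral_matrix_mul_const _ (intervalIntegrable_of_mem gi hx),
    ← intervalIntegral.integral_add]
  · refine intervalIntegral.integral_congr fun t ht => ?_
    rw [uIcc_of_le hx.1] at ht
    have := integral_const_matrix_mul (g t) (hF.integrable_of_mem (hsub ht))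
    simp only [this]
    rw [← Matrix.mul_add, ← hF.eq t (hsub ht)]
  · exact intervalIntegrable_of_mem ((IsPrim.integrable_bilin (mulL a b c) gi
      continuousOn_const hF.nonneg)) hx
  · exact intervalIntegrable_of_mem (intervalIntegrable_volterra (G := fun y _ => g y)
      (hg.comp_measurable measurable_fst) (fun x hx _ _ => hC x hx) hF.integrable hF.nonneg) hx

end Volterra

section Transmutation

variable {m₁ m₂ p : ℕ} {l M : ℝ} {v : ℝ → Matrix (Fin m₁) (Fin m₂) ℂ}
  {E : ℝ → ℝ → Matrix (Fin m₂) (Fin m₂) ℂ} {N : ℝ → ℝ → Matrix (Fin m₁) (Fin m₂) ℂ}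

/-- The Volterra operator `(N f)(x) = ∫₀ˣ N(x, t) f(t) dt`. -/
noncomputable def opN (N : ℝ → ℝ → Matrix (Fin m₁) (Fin m₂) ℂ)
    (f : ℝ → Matrix (Fin m₂) (Fin p) ℂ) (x : ℝ) : Matrix (Fin m₁) (Fin p) ℂ :=
  ∫ t in (0 : ℝ)..x, N x t * f t

namespace IsTransmutation

lemma intervalIntegrable_opE (h : IsTransmutation l v E N) (hl : 0 ≤ l)
    {f : ℝ → Matrix (Fin m₂) (Fin p) ℂ} (hf : IntervalIntegrable f volume 0 l) :
    IntervalIntegrable (opE E f) volume 0 l := by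
  obtain ⟨C, _, hC⟩ := h.bound
  exact hf.add (intervalIntegrable_volterra h.measE (fun x hx t ht => (hC x hx t ht).1) hf hl)

/-- The first of the two relations that carry the argument: `(N f)' = v E f`. -/
lemma isPrim_opN (h : IsTransmutation l v E N) (hv : StronglyMeasurable v)
    (hvM : ∀ x, ‖v x‖ ≤ M) (hl : 0 ≤ l)
    {f : ℝ → Matrix (Fin m₂) (Fin p) ℂ} (hf : IntervalIntegrable f volume 0 l) :
    IsPrim l (opN N f) (fun x => v x * opE E f x) := by
  obtain ⟨C, hC0, hC⟩ := h.bound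
  have hM : 0 ≤ M := (norm_nonneg _).trans (hvM 0)
  have hEi := h.intervalIntegrable_opE hl hf
  refine ⟨hl, intervalIntegrable_bdd_mul hv.aestronglyMeasurable
    (Eventually.of_forall hvM) hEi, fun x hx => ?_⟩
  have hsub : ∀ {t}, t ∈ Icc 0 x → t ∈ Icc 0 l := fun h => ⟨h.1, h.2.trans hx.2⟩
  have hvf : IntervalIntegrable (fun t => v t * f t) volume 0 l :=
    intervalIntegrable_bdd_mul hv.aestronglyMeasurable (Eventually.of_forall hvM) hf
  have hG : StronglyMeasurable (Function.uncurry fun s t => v s * E s t) :=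
    stronglyMeasurable_mul (hv.comp_measurable measurable_fst) h.measE
  have hGC : ∀ x ∈ Icc 0 l, ∀ t ∈ Icc 0 l, ‖v x * E x t‖ ≤ M * C := fun x hx t ht =>
    norm_mul_le_of_le (hvM x) (hC x hx t ht).1
  have key := integral_tail_mul hG hGC hf hx
  have hNi := intervalIntegrable_kernel_mul h.measN (fun x hx t ht => (hC x hx t ht).2) hf hx hx
  have hvfx := intervalIntegrable_of_mem hvf hx
  have e0 : opN N f 0 = 0 := by simp [opN]
  rw [e0, zero_add]
  have e1 : ∀ t ∈ uIcc 0 x, (∫ s in t..x, v s * E s t) * f t = N x t * f t - v t * f t := by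
    intro t ht
    rw [uIcc_of_le hx.1] at ht
    rw [h.eqN x hx t ht, Matrix.add_mul]; abel
  rw [intervalIntegral.integral_congr e1, intervalIntegral.integral_sub hNi hvfx,
    sub_eq_iff_eq_add] at key
  rw [opN, key, ← intervalIntegral.integral_add _ hvfx]
  · refine intervalIntegral.integral_congr fun s hs => ?_
    rw [uIcc_of_le hx.1] at hs
    have := integral_const_matrix_mul (v s) (intervalIntegrable_kernel_mul h.measE
      (fun x hx t ht => (hC x hx t ht).1) hf (hsub hs) (hsub hs))
    simp only [opE, Matrix.mul_add, ← this, Matrix.mul_assoc]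
    abel
  · exact intervalIntegrable_of_mem (intervalIntegrable_volterra hG hGC hf hl) hx

/-- The second relation, the commutation of `E` with integration:
`(E F)' = E F' - v* N F`. Together with `(N f)' = v E f` it gives both the intertwining relation
`E A = K E` and the representation of the solutions of the Dirac system. -/
lemma isPrim_opE (h : IsTransmutation l v E N) (hv : StronglyMeasurable v)
    (hvM : ∀ x, ‖v x‖ ≤ M) {F f : ℝ → Matrix (Fin m₂) (Fin p) ℂ} (hF : IsPrim l F f) :
    IsPrim l (opE E F) (fun x => opE E f x - (v x)ᴴ * opN N F x) := by
  obtain ⟨C, hC0, hC⟩ := h.bound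
  have hl := hF.nonneg
  have hM : 0 ≤ M := (norm_nonneg _).trans (hvM 0)
  have hf := hF.integrable
  have hFi : IntervalIntegrable F volume 0 l := by
    apply ContinuousOn.intervalIntegrable; rw [uIcc_of_le hl]; exact hF.continuousOn
  have hEi := h.intervalIntegrable_opE hl hf
  have hvm : StronglyMeasurable fun x => (v x)ᴴ := stronglyMeasurable_adj hv
  have hvb : ∀ x, ‖(v x)ᴴ‖ ≤ M := fun x => (Matrix.l2_opNorm_conjTranspose _).le.trans (hvM x)
  have hNi : IntervalIntegrable (opN N F) volume 0 l :=
    intervalIntegrable_volterra h.measN (fun x hx t ht => (hC x hx t ht).2) hFi hl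
  have hvN : IntervalIntegrable (fun x => (v x)ᴴ * opN N F x) volume 0 l :=
    intervalIntegrable_bdd_mul hvm.aestronglyMeasurable (Eventually.of_forall hvb) hNi
  refine ⟨hl, hEi.sub hvN, fun x hx => ?_⟩
  have hsub : ∀ {t}, t ∈ Icc 0 x → t ∈ Icc 0 l := fun h => ⟨h.1, h.2.trans hx.2⟩
  have h0 : (0 : ℝ) ∈ Icc 0 x := ⟨le_rfl, hx.1⟩
  have hfx := intervalIntegrable_of_mem hf hx
  -- the kernel `n(y, s) = ∫ₛʸ N(y, t) dt`
  let n : ℝ → ℝ → Matrix (Fin m₁) (Fin m₂) ℂ := fun y s =>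
    (∫ t in (0 : ℝ)..y, N y t) - ∫ t in (0 : ℝ)..s, N y t
  have Ni : ∀ {y t}, y ∈ Icc 0 l → t ∈ Icc 0 l →
      IntervalIntegrable (fun t => N y t) volume 0 t := fun {y t} hy ht =>
    intervalIntegrable_of_bdd (C := C)
      (h.measN.comp_measurable measurable_prodMk_left).aestronglyMeasurable fun r hr => by
        rw [uIoc_of_le ht.1] at hr; exact (hC y hy r ⟨hr.1.le, hr.2.trans ht.2⟩).2
  have hn : ∀ {y s}, y ∈ Icc 0 l → s ∈ Icc 0 l → n y s = ∫ t in s..y, N y t := fun hy hs =>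
    intervalIntegral.integral_interval_sub_left (Ni hy hy) (Ni hy hs)
  have nm : StronglyMeasurable (Function.uncurry n) := by
    have m1 := stronglyMeasurable_intervalIntegral h.measN measurable_id
    have m2 : StronglyMeasurable fun q : ℝ × ℝ => ∫ t in (0 : ℝ)..q.2, N q.1 t :=
      stronglyMeasurable_intervalIntegral (h := fun (q : ℝ × ℝ) t => N q.1 t)
        (h.measN.comp_measurable (g := fun r : (ℝ × ℝ) × ℝ => (r.1.1, r.2)) (by fun_prop))
        measurable_snd
    exact (m1.comp_measurable measurable_fst).sub m2
  have nb : ∀ y ∈ Icc 0 l, ∀ s ∈ Icc 0 l, ‖n y s‖ ≤ C * l := by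
    intro y hy s hs
    rw [hn hy hs]
    refine (intervalIntegral.norm_integral_le_of_norm_le_const (C := C) fun t ht => ?_).trans ?_
    · have := uIoc_subset_uIcc ht
      exact (hC y hy t ⟨(le_inf hs.1 hy.1).trans this.1, this.2.trans (sup_le hs.2 hy.2)⟩).2
    · refine mul_le_mul_of_nonneg_left ?_ hC0
      rw [abs_le]; constructor <;> linarith [hy.1, hy.2, hs.1, hs.2]
  have vnm : StronglyMeasurable (Function.uncurry fun y s => (v y)ᴴ * n y s) :=
    stronglyMeasurable_mul (hvm.comp_measurable measurable_fst) nm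
  have vnb : ∀ y ∈ Icc 0 l, ∀ s ∈ Icc 0 l, ‖(v y)ᴴ * n y s‖ ≤ M * (C * l) := fun y hy s hs =>
    norm_mul_le_of_le (hvb y) (nb y hy s hs)
  have vnF : ∀ y ∈ Icc 0 x, ∫ s in (0 : ℝ)..y, ((v y)ᴴ * n y s) * f s =
      (v y)ᴴ * opN N F y - ((v y)ᴴ * ∫ t in (0 : ℝ)..y, N y t) * F 0 := by
    intro y hy
    have hy' := hsub hy
    have e := integral_mul_primitive (g := fun t => N y t) (C := C)
      (h.measN.comp_measurable (measurable_prodMk_left (x := y)))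
      (fun t ht => (hC y hy' t ht).2) hF hy'
    have ii := intervalIntegrable_kernel_mul nm nb hf hy' hy'
    simp only [Matrix.mul_assoc]
    rw [integral_const_matrix_mul _ ii, ← Matrix.mul_sub,
      show opN N F y - _ = _ from sub_eq_of_eq_add' e]
    congr 1
    refine intervalIntegral.integral_congr fun s hs => ?_
    rw [uIcc_of_le hy.1] at hs
    rw [hn hy' ⟨hs.1, hs.2.trans hy'.2⟩]
  have Em : ∀ s ∈ Icc 0 x, IntervalIntegrable (fun y => E y s) volume s x := fun s hs =>
    intervalIntegrable_of_bdd (C := C)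
      (h.measE.comp_measurable measurable_prodMk_right).aestronglyMeasurable fun y hy => by
        rw [uIoc_of_le hs.2] at hy
        exact (hC y (hsub ⟨hs.1.trans hy.1.le, hy.2⟩) s (hsub hs)).1
  -- the equation of the kernel, integrated against `f`
  have eqE : ∀ s ∈ Icc 0 x, ∫ t in s..x, E x t =
      (∫ y in s..x, E y s) - ∫ y in s..x, (v y)ᴴ * n y s := by
    intro s hs
    rw [h.eqE x hx s hs]
    congr 1
    refine intervalIntegral.integral_congr fun y hy => ?_
    rw [uIcc_of_le hs.2] at hy
    rw [hn (hsub ⟨hs.1.trans hy.1, hy.2⟩) (hsub hs)]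
  have k1 := integral_mul_primitive (g := fun t => E x t) (C := C)
    (h.measE.comp_measurable (measurable_prodMk_left (x := x)))
    (fun t ht => (hC x hx t ht).1) hF hx
  have k2 := integral_tail_mul h.measE (fun x hx t ht => (hC x hx t ht).1) hf hx
  have k3 := integral_tail_mul vnm vnb hf hx
  have tail_int : ∀ {G : ℝ → ℝ → Matrix (Fin m₂) (Fin m₂) ℂ} {D : ℝ},
      StronglyMeasurable (Function.uncurry G) →
      (∀ x ∈ Icc 0 l, ∀ t ∈ Icc 0 l, ‖G x t‖ ≤ D) →
      IntervalIntegrable (fun s => (∫ y in s..x, G y s) * f s) volume 0 x := by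
    intro G D hG hD
    have m1 : StronglyMeasurable fun s => (∫ y in (0 : ℝ)..x, G y s) - ∫ y in (0 : ℝ)..s, G y s := by
      have hG' : StronglyMeasurable (Function.uncurry fun s y => G y s) :=
        hG.comp_measurable measurable_swap
      exact (stronglyMeasurable_intervalIntegral hG' measurable_const).sub
        (stronglyMeasurable_intervalIntegral hG' measurable_id)
    have gi : ∀ {s t}, s ∈ Icc 0 x → t ∈ Icc 0 x →
        IntervalIntegrable (fun y => G y s) volume 0 t := fun {s t} hs ht =>
      intervalIntegrable_of_bdd (C := D)
        (hG.comp_measurable measurable_prodMk_right).aestronglyMeasurable fun r hr => by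
          rw [uIoc_of_le ht.1] at hr; exact hD r (hsub ⟨hr.1.le, hr.2.trans ht.2⟩) s (hsub hs)
    have hx0 : x ∈ Icc 0 x := ⟨hx.1, le_rfl⟩
    refine intervalIntegrable_bdd_mul (C := D * |l|) (m1.aestronglyMeasurable.congr ?_) ?_ hfx
    · rw [uIoc_of_le hx.1]
      filter_upwards [ae_restrict_mem measurableSet_Ioc] with s hs
      exact intervalIntegral.integral_interval_sub_left (gi ⟨hs.1.le, hs.2⟩ hx0)
        (gi ⟨hs.1.le, hs.2⟩ ⟨hs.1.le, hs.2⟩)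
    · rw [uIoc_of_le hx.1]
      filter_upwards [ae_restrict_mem measurableSet_Ioc] with s hs
      refine (intervalIntegral.norm_integral_le_of_norm_le_const (C := D) fun t ht => ?_).trans ?_
      · rw [uIoc_of_le hs.2] at ht
        exact hD t (hsub ⟨hs.1.le.trans ht.1.le, ht.2⟩) s (hsub ⟨hs.1.le, hs.2⟩)
      · have : 0 ≤ D := (norm_nonneg _).trans (hD 0 (hsub h0) 0 (hsub h0))
        refine mul_le_mul_of_nonneg_left ?_ this
        rw [abs_of_nonneg (by linarith [hs.2]), abs_of_nonneg hl]; linarith [hs.1, hx.2]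
  have e1 : ∀ s ∈ uIcc 0 x, (∫ t in s..x, E x t) * f s =
      (∫ y in s..x, E y s) * f s - (∫ y in s..x, (v y)ᴴ * n y s) * f s := by
    intro s hs
    rw [uIcc_of_le hx.1] at hs
    rw [eqE s hs, Matrix.sub_mul]
  rw [intervalIntegral.integral_congr e1, intervalIntegral.integral_sub
    (tail_int h.measE (fun x hx t ht => (hC x hx t ht).1)) (tail_int vnm vnb), k2, k3,
    intervalIntegral.integral_congr (fun y hy => vnF y (by rwa [uIcc_of_le hx.1] at hy))] at k1
  have hN0 : IntervalIntegrable (fun y => (v y)ᴴ * n y 0) volume 0 x := by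
    refine intervalIntegrable_of_bdd (C := M * (C * l))
      (vnm.comp_measurable measurable_prodMk_right).aestronglyMeasurable fun y hy => ?_
    rw [uIoc_of_le hx.1] at hy
    exact vnb y (hsub ⟨hy.1.le, hy.2⟩) 0 (hsub h0)
  have z1 := eqE 0 h0
  simp only [h.zero, intervalIntegral.integral_zero, zero_sub] at z1
  have z2 : ∀ y, n y 0 = ∫ t in (0 : ℝ)..y, N y t := fun y => by simp [n]
  have z3 : IntervalIntegrable (fun y => ((v y)ᴴ * ∫ t in (0 : ℝ)..y, N y t) * F 0) volume 0 x := by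
    simp only [← z2]
    exact ⟨((mulL (Fin m₂) (Fin m₂) (Fin p)).flip (F 0)).integrable_comp hN0.1,
      ((mulL (Fin m₂) (Fin m₂) (Fin p)).flip (F 0)).integrable_comp hN0.2⟩
  rw [intervalIntegral.integral_sub (intervalIntegrable_of_mem hvN hx) z3] at k1
  simp only [← z2] at k1
  rw [integral_matrix_mul_const _ hN0, z1] at k1
  have hEx := intervalIntegrable_of_mem (intervalIntegrable_volterra h.measE
    (fun x hx t ht => (hC x hx t ht).1) hf hl) hx
  rw [intervalIntegral.integral_sub (intervalIntegrable_of_mem hEi hx)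
    (intervalIntegrable_of_mem hvN hx)]
  have z4 : opE E F 0 = F 0 := by simp [opE]
  have z5 : ∫ y in (0 : ℝ)..x, opE E f y = (∫ y in (0 : ℝ)..x, f y) +
      ∫ y in (0 : ℝ)..x, ∫ t in (0 : ℝ)..y, E y t * f t :=
    intervalIntegral.integral_add hfx hEx
  rw [z4, z5, opE, k1, hF.eq x hx]
  simp only [Matrix.neg_mul]
  abel

end IsTransmutation

end Transmutation

/-! ### Solutions of the Dirac system -/

section DiracSolutions

variable {m₁ m₂ : ℕ} {p : Type*} [Fintype p] [DecidableEq p]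

lemma upperRow_mul_fromRows (A : Matrix (Fin m₁) p ℂ) (B : Matrix (Fin m₂) p ℂ) :
    upperRow m₁ m₂ * fromRows A B = A := by
  simp [upperRow, fromCols_mul_fromRows]

lemma lowerRow_mul_fromRows (A : Matrix (Fin m₁) p ℂ) (B : Matrix (Fin m₂) p ℂ) :
    lowerRow m₁ m₂ * fromRows A B = B := by
  simp [lowerRow, fromCols_mul_fromRows]

lemma fromRows_upperRow_lowerRow (A : Matrix (Fin m₁ ⊕ Fin m₂) p ℂ) :
    fromRows (upperRow m₁ m₂ * A) (lowerRow m₁ m₂ * A) = A := by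
  rw [← fromRows_toRows A, upperRow_mul_fromRows, lowerRow_mul_fromRows]

lemma upperRow_mul_coeff (z : ℂ) (w : Matrix (Fin m₁) (Fin m₂) ℂ) :
    upperRow m₁ m₂ * ((Complex.I * z) • jMat m₁ m₂ + jMat m₁ m₂ * potMat w) =
      (Complex.I * z) • upperRow m₁ m₂ + w * lowerRow m₁ m₂ := by
  simp [upperRow, lowerRow, jMat, potMat, fromBlocks_multiply, fromBlocks_smul, fromBlocks_add,
    fromCols_mul_fromBlocks, mul_fromCols]
  ext i (k | k) <;> simp

lemma lowerRow_mul_coeff (z : ℂ) (w : Matrix (Fin m₁) (Fin m₂) ℂ) :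
    lowerRow m₁ m₂ * ((Complex.I * z) • jMat m₁ m₂ + jMat m₁ m₂ * potMat w) =
      -((Complex.I * z) • lowerRow m₁ m₂) - wᴴ * upperRow m₁ m₂ := by
  simp [upperRow, lowerRow, jMat, potMat, fromBlocks_multiply, fromBlocks_smul, fromBlocks_add,
    fromCols_mul_fromBlocks, mul_fromCols]
  ext i (k | k) <;> simp

lemma conjTranspose_mul_eq_rows {q : Type*} [Fintype q] [DecidableEq q]
    (A : Matrix (Fin m₁ ⊕ Fin m₂) p ℂ)
    (B : Matrix (Fin m₁ ⊕ Fin m₂) q ℂ) :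
    Aᴴ * B = (upperRow m₁ m₂ * A)ᴴ * (upperRow m₁ m₂ * B) +
      (lowerRow m₁ m₂ * A)ᴴ * (lowerRow m₁ m₂ * B) := by
  conv_lhs => rw [← fromRows_upperRow_lowerRow A, ← fromRows_upperRow_lowerRow B]
  rw [conjTranspose_fromRows_eq_fromCols_conjTranspose, fromCols_mul_fromRows]

lemma conjTranspose_mul_jMat_mul (A : Matrix (Fin m₁ ⊕ Fin m₂) p ℂ) :
    Aᴴ * jMat m₁ m₂ * A = (upperRow m₁ m₂ * A)ᴴ * (upperRow m₁ m₂ * A) -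
      (lowerRow m₁ m₂ * A)ᴴ * (lowerRow m₁ m₂ * A) := by
  conv_lhs => rw [← fromRows_upperRow_lowerRow A]
  rw [conjTranspose_fromRows_eq_fromCols_conjTranspose, jMat, fromCols_mul_fromBlocks,
    fromCols_mul_fromRows]
  simp [sub_eq_add_neg]

lemma upperRow_mul_conjTranspose : upperRow m₁ m₂ * (upperRow m₁ m₂)ᴴ = 1 := by
  simp [upperRow, conjTranspose_fromCols_eq_fromRows_conjTranspose, fromCols_mul_fromRows]

lemma lowerRow_mul_conjTranspose : lowerRow m₁ m₂ * (lowerRow m₁ m₂)ᴴ = 1 := by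
  simp [lowerRow, conjTranspose_fromCols_eq_fromRows_conjTranspose, fromCols_mul_fromRows]

lemma upperRow_mul_lowerRow_conjTranspose : upperRow m₁ m₂ * (lowerRow m₁ m₂)ᴴ = 0 := by
  simp [upperRow, lowerRow, conjTranspose_fromCols_eq_fromRows_conjTranspose,
    fromCols_mul_fromRows]

lemma lowerRow_mul_upperRow_conjTranspose : lowerRow m₁ m₂ * (upperRow m₁ m₂)ᴴ = 0 := by
  simp [upperRow, lowerRow, conjTranspose_fromCols_eq_fromRows_conjTranspose,
    fromCols_mul_fromRows]

/-- The pair `(b, g)` of the upper and the lower block of a matrix solution on `[0, l]` of the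
Dirac system with spectral parameter `z`. -/
structure IsDiracSol (l : ℝ) (v : ℝ → Matrix (Fin m₁) (Fin m₂) ℂ) (z : ℂ)
    (b : ℝ → Matrix (Fin m₁) p ℂ) (g : ℝ → Matrix (Fin m₂) p ℂ) : Prop where
  upper : IsPrim l b (fun x => (Complex.I * z) • b x + v x * g x)
  lower : IsPrim l g (fun x => -((Complex.I * z) • g x) - (v x)ᴴ * b x)

variable {l M : ℝ} {v : ℝ → Matrix (Fin m₁) (Fin m₂) ℂ}

/-- The Lagrange identity for a pair of solutions with conjugate spectral parameters. -/
lemma IsDiracSol.wronskian {q : Type*} [Fintype q] [DecidableEq q] {z : ℂ}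
    {b : ℝ → Matrix (Fin m₁) p ℂ} {g : ℝ → Matrix (Fin m₂) p ℂ}
    {b' : ℝ → Matrix (Fin m₁) q ℂ} {g' : ℝ → Matrix (Fin m₂) q ℂ}
    (h : IsDiracSol l v z b g) (h' : IsDiracSol l v (starRingEnd ℂ z) b' g') {x : ℝ}
    (hx : x ∈ Icc 0 l) :
    (b' x)ᴴ * b x + (g' x)ᴴ * g x = (b' 0)ᴴ * b 0 + (g' 0)ᴴ * g 0 := by
  have key := (h'.upper.adj.mul h.upper).add (h'.lower.adj.mul h.lower)
  refine (key.congr_ae (f' := fun _ => 0) (Eventually.of_forall fun x => ?_)).eq_of_zero hx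
  simp only [conjTranspose_add, conjTranspose_sub, conjTranspose_neg, conjTranspose_smul,
    conjTranspose_mul, conjTranspose_conjTranspose, Matrix.add_mul, Matrix.mul_add, Matrix.sub_mul,
    Matrix.mul_sub, Matrix.smul_mul, Matrix.mul_smul, Matrix.neg_mul, Matrix.mul_neg,
    Matrix.mul_assoc, star_mul', RCLike.star_def, Complex.conj_conj, Complex.conj_I, neg_smul,
    neg_mul]
  abel

lemma IsDiracSol.mul_const {q : Type*} [Fintype q] [DecidableEq q] {z : ℂ}
    {b : ℝ → Matrix (Fin m₁) p ℂ} {g : ℝ → Matrix (Fin m₂) p ℂ}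
    (h : IsDiracSol l v z b g) (A : Matrix p q ℂ) :
    IsDiracSol l v z (fun x => b x * A) (fun x => g x * A) :=
  ⟨by simpa [Matrix.add_mul, Matrix.mul_assoc] using h.upper.mul_const A,
    by simpa [Matrix.sub_mul, Matrix.mul_assoc] using h.lower.mul_const A⟩

end DiracSolutions

section Fundamental

variable {m₁ m₂ : ℕ} {l M : ℝ} {v : ℝ → Matrix (Fin m₁) (Fin m₂) ℂ}
  {u : ℝ → ℂ → Matrix (Fin m₁ ⊕ Fin m₂) (Fin m₁ ⊕ Fin m₂) ℂ}

lemma IsBddPotential.exists_measurable (hM : 0 ≤ M) (hv : IsBddPotential l M v) :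
    ∃ v₀ : ℝ → Matrix (Fin m₁) (Fin m₂) ℂ, StronglyMeasurable v₀ ∧ (∀ x, ‖v₀ x‖ ≤ M) ∧
      v =ᵐ[vol l] v₀ := by
  obtain ⟨w, hw, hvw⟩ := hv.1
  refine ⟨{x | ‖w x‖ ≤ M}.indicator w, hw.indicator ?_, fun x => ?_, ?_⟩
  · exact measurableSet_le hw.norm.measurable measurable_const
  · by_cases h : ‖w x‖ ≤ M
    · rwa [indicator_of_mem (by exact h)]
    · rw [indicator_of_notMem (by exact h)]; simpa using hM
  · filter_upwards [hvw, ae_restrict_mem measurableSet_Ioo] with x hx hxm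
    rw [indicator_of_mem, hx]
    have := hv.2 x hxm
    rwa [hx] at this

lemma IsFundamentalSolution.congr {v₀ : ℝ → Matrix (Fin m₁) (Fin m₂) ℂ} (h : v =ᵐ[vol l] v₀)
    (hu : IsFundamentalSolution l v u) : IsFundamentalSolution l v₀ u := fun z =>
  ⟨(hu z).1, (hu z).2.1, by filter_upwards [(hu z).2.2, h] with x hx hv; rwa [← hv]⟩

lemma IsFundamentalSolution.isPrim (hu : IsFundamentalSolution l v u)
    (hv : StronglyMeasurable v) (hvM : ∀ x, ‖v x‖ ≤ M) (hl : 0 ≤ l) (z : ℂ) :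
    IsPrim l (fun x => u x z) (fun x =>
      ((Complex.I * z) • jMat m₁ m₂ + jMat m₁ m₂ * potMat (v x)) * u x z) := by
  obtain ⟨-, hac, hd⟩ := hu z
  have hc : ContinuousOn (fun x => u x z) (Icc 0 l) := by
    have := hac.continuousOn; rwa [uIcc_of_le hl] at this
  obtain ⟨C, hC⟩ := isCompact_Icc.exists_bound_of_continuousOn hc
  let T : Matrix (Fin m₁) (Fin m₂) ℂ → Matrix (Fin m₁ ⊕ Fin m₂) (Fin m₁ ⊕ Fin m₂) ℂ :=
    fun w => (Complex.I * z) • jMat m₁ m₂ + jMat m₁ m₂ * potMat w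
  have hT : Continuous T := by
    refine continuous_const.add (continuous_const.matrix_mul ?_)
    exact Continuous.matrix_fromBlocks continuous_const continuous_id
      continuous_id.matrix_conjTranspose continuous_const
  have hTm : StronglyMeasurable fun x => T (v x) := hT.comp_stronglyMeasurable hv
  obtain ⟨D, hD⟩ := (isCompact_closedBall (0 : Matrix (Fin m₁) (Fin m₂) ℂ)
    M).exists_bound_of_continuousOn hT.continuousOn
  have hTD : ∀ x, ‖T (v x)‖ ≤ D := fun x => hD _ (by simpa using hvM x)
  have hb : ∀ x ∈ Icc 0 l, ‖T (v x) * u x z‖ ≤ D * C := fun x hx =>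
    norm_mul_le_of_le (hTD x) (hC x hx)
  refine IsPrim.of_absolutelyContinuous (C := D * C) hl hac hd
    (intervalIntegrable_of_bdd (C := D * C) ?_ fun x hx => ?_) ?_
  · refine aestronglyMeasurable_mul hTm.aestronglyMeasurable ?_
    rw [uIoc_of_le hl]
    exact (hc.mono Ioc_subset_Icc_self).aestronglyMeasurable measurableSet_Ioc
  · rw [uIoc_of_le hl] at hx; exact hb x (Ioc_subset_Icc_self hx)
  · filter_upwards [ae_restrict_mem measurableSet_Ioo] with x hx
    exact hb x (Ioo_subset_Icc_self hx)

lemma IsFundamentalSolution.isDiracSol (hu : IsFundamentalSolution l v u)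
    (hv : StronglyMeasurable v) (hvM : ∀ x, ‖v x‖ ≤ M) (hl : 0 ≤ l) (z : ℂ) :
    IsDiracSol l v z (fun x => upperRow m₁ m₂ * u x z) (fun x => lowerRow m₁ m₂ * u x z) := by
  have h := hu.isPrim hv hvM hl z
  constructor
  · refine (h.const_mul (upperRow m₁ m₂)).congr_ae (Eventually.of_forall fun x => ?_)
    rw [← Matrix.mul_assoc, upperRow_mul_coeff, Matrix.add_mul, Matrix.smul_mul, Matrix.mul_assoc]
  · refine (h.const_mul (lowerRow m₁ m₂)).congr_ae (Eventually.of_forall fun x => ?_)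
    rw [← Matrix.mul_assoc, lowerRow_mul_coeff, Matrix.sub_mul, Matrix.neg_mul, Matrix.smul_mul,
      Matrix.mul_assoc]

lemma IsFundamentalSolution.conjTranspose_mul (hu : IsFundamentalSolution l v u)
    (hv : StronglyMeasurable v) (hvM : ∀ x, ‖v x‖ ≤ M) (hl : 0 ≤ l) (z : ℂ) {x : ℝ}
    (hx : x ∈ Icc 0 l) : (u x (starRingEnd ℂ z))ᴴ * u x z = 1 := by
  have := (hu.isDiracSol hv hvM hl z).wronskian (hu.isDiracSol hv hvM hl _) hx
  rw [← conjTranspose_mul_eq_rows, ← conjTranspose_mul_eq_rows, (hu z).1, (hu _).1] at this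
  simpa using this

lemma IsFundamentalSolution.mul_conjTranspose (hu : IsFundamentalSolution l v u)
    (hv : StronglyMeasurable v) (hvM : ∀ x, ‖v x‖ ≤ M) (hl : 0 ≤ l) (z : ℂ) {x : ℝ}
    (hx : x ∈ Icc 0 l) : u x z * (u x (starRingEnd ℂ z))ᴴ = 1 :=
  mul_eq_one_comm.1 (hu.conjTranspose_mul hv hvM hl z hx)

/-- A solution is determined by its initial value. -/
lemma IsFundamentalSolution.eq_mul (hu : IsFundamentalSolution l v u)
    (hv : StronglyMeasurable v) (hvM : ∀ x, ‖v x‖ ≤ M) (hl : 0 ≤ l) {z : ℂ} {p : Type*}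
    [Fintype p] [DecidableEq p] {b : ℝ → Matrix (Fin m₁) p ℂ} {g : ℝ → Matrix (Fin m₂) p ℂ}
    (h : IsDiracSol l v z b g) {x : ℝ} (hx : x ∈ Icc 0 l) :
    fromRows (b x) (g x) = u x z * fromRows (b 0) (g 0) := by
  have h1 := h.wronskian (hu.isDiracSol hv hvM hl (starRingEnd ℂ z)) hx
  have e : ∀ y, (upperRow m₁ m₂ * u y (starRingEnd ℂ z))ᴴ * b y +
      (lowerRow m₁ m₂ * u y (starRingEnd ℂ z))ᴴ * g y =
      (u y (starRingEnd ℂ z))ᴴ * fromRows (b y) (g y) := fun y => by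
    rw [conjTranspose_mul_eq_rows, upperRow_mul_fromRows, lowerRow_mul_fromRows]
  rw [e, e, (hu _).1, conjTranspose_one, Matrix.one_mul] at h1
  rw [← h1, ← Matrix.mul_assoc, hu.mul_conjTranspose hv hvM hl z hx, Matrix.one_mul]

end Fundamental

/-! ### Energy inequalities and the Weyl ball -/

section Energy

variable {m₁ m₂ : ℕ} {p : Type*} [Fintype p] [DecidableEq p]

/-- The Euclidean norm of `A c`. -/
noncomputable def vnorm {a : Type*} [Fintype a] (A : Matrix a p ℂ) (c : p → ℂ) : ℝ :=
  ‖(WithLp.toLp 2 (A *ᵥ c) : EuclideanSpace ℂ a)‖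

lemma vnorm_nonneg {a : Type*} [Fintype a] (A : Matrix a p ℂ) (c : p → ℂ) : 0 ≤ vnorm A c :=
  norm_nonneg _

lemma vnorm_le {a : Type*} [Fintype a] (A : Matrix a p ℂ) (c : p → ℂ) :
    vnorm A c ≤ ‖A‖ * ‖(WithLp.toLp 2 c : EuclideanSpace ℂ p)‖ :=
  Matrix.l2_opNorm_mulVec A (WithLp.toLp 2 c)

lemma vnorm_mul {a q : Type*} [Fintype a] [Fintype q] [DecidableEq q] (A : Matrix a p ℂ)
    (B : Matrix p q ℂ) (c : q → ℂ) : vnorm (A * B) c = vnorm A (B *ᵥ c) := by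
  simp [vnorm, Matrix.mulVec_mulVec]

lemma norm_le_of_vnorm_le {a b : Type*} [Fintype a] [Fintype b] {A : Matrix a p ℂ}
    {B : Matrix b p ℂ} (h : ∀ c, vnorm A c ≤ vnorm B c) : ‖A‖ ≤ ‖B‖ := by
  rw [Matrix.l2_opNorm_def A]
  refine ContinuousLinearMap.opNorm_le_bound _ (norm_nonneg _) fun x => ?_
  exact (h x.ofLp).trans (vnorm_le B x.ofLp)

lemma re_inner_eq {a : Type*} [Fintype a] (A B : Matrix a p ℂ) (c : p → ℂ) :
    (star c ⬝ᵥ ((Aᴴ * B) *ᵥ c)) =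
      inner ℂ (WithLp.toLp 2 (A *ᵥ c) : EuclideanSpace ℂ a) (WithLp.toLp 2 (B *ᵥ c)) := by
  rw [EuclideanSpace.inner_toLp_toLp, ← Matrix.mulVec_mulVec, Matrix.dotProduct_mulVec,
    Matrix.vecMul_conjTranspose, star_star, dotProduct_comm]

lemma vnorm_sq {a : Type*} [Fintype a] (A : Matrix a p ℂ) (c : p → ℂ) :
    vnorm A c ^ 2 = (star c ⬝ᵥ ((Aᴴ * A) *ᵥ c)).re := by
  rw [re_inner_eq, vnorm, ← inner_self_eq_norm_sq (𝕜 := ℂ)]; rfl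

lemma abs_re_form_le {a : Type*} [Fintype a] (A B : Matrix a p ℂ) (c : p → ℂ) :
    |(star c ⬝ᵥ ((Aᴴ * B) *ᵥ c)).re| ≤ vnorm A c * vnorm B c := by
  rw [re_inner_eq]
  exact (Complex.abs_re_le_norm _).trans (norm_inner_le_norm _ _)

/-- The quadratic form of a matrix as a real linear map. -/
noncomputable def formL (c : p → ℂ) : Matrix p p ℂ →L[ℝ] ℝ :=
  LinearMap.toContinuousLinearMap
    { toFun := fun A => (star c ⬝ᵥ (A *ᵥ c)).re
      map_add' := fun A B => by simp [Matrix.add_mulVec]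
      map_smul' := fun r A => by simp [Matrix.smul_mulVec, dotProduct_smul] }

lemma formL_apply (c : p → ℂ) (A : Matrix p p ℂ) : formL c A = (star c ⬝ᵥ (A *ᵥ c)).re := rfl

variable {l M : ℝ} {v : ℝ → Matrix (Fin m₁) (Fin m₂) ℂ} {z : ℂ}
  {b : ℝ → Matrix (Fin m₁) p ℂ} {g : ℝ → Matrix (Fin m₂) p ℂ}

/-- The rate of change of the indefinite energy `‖b c‖² - ‖g c‖²` of a solution. -/
lemma IsDiracSol.energy (h : IsDiracSol l v z b g) (c : p → ℂ) :
    IsPrim l (fun x => vnorm (b x) c ^ 2 - vnorm (g x) c ^ 2) (fun x =>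
      -(2 * z.im * (vnorm (b x) c ^ 2 + vnorm (g x) c ^ 2)) +
        4 * formL c ((b x)ᴴ * (v x * g x))) := by
  have key := ((h.upper.adj.mul h.upper).sub (h.lower.adj.mul h.lower)).clm (formL c)
  refine (key.congr fun x _ => ?_).congr_ae (Eventually.of_forall fun x => ?_)
  · rw [map_sub, vnorm_sq, vnorm_sq, formL_apply, formL_apply]
  · have hsymm : formL c ((g x)ᴴ * ((v x)ᴴ * b x)) = formL c ((b x)ᴴ * (v x * g x)) := by
      rw [formL_apply, formL_apply, ← Matrix.mul_assoc, ← conjTranspose_mul, re_inner_eq,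
        re_inner_eq, ← inner_conj_symm, Complex.conj_re]
    have e1 : (Complex.I * z) + star (Complex.I * z) = ((-(2 * z.im) : ℝ) : ℂ) := by
      apply Complex.ext <;> simp; ring
    have e2 : ∀ {a : Type} [Fintype a] (A : Matrix a p ℂ),
        formL c (star (Complex.I * z) • (Aᴴ * A)) + formL c ((Complex.I * z) • (Aᴴ * A)) =
          -(2 * z.im) * vnorm A c ^ 2 := by
      intro a _ A
      rw [← map_add, ← add_smul, add_comm (star _), e1, vnorm_sq, ← formL_apply, Complex.coe_smul,
        map_smul, smul_eq_mul]
    have e3 := e2 (b x)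
    have e4 := e2 (g x)
    simp only [conjTranspose_add, conjTranspose_sub, conjTranspose_neg, conjTranspose_smul,
      conjTranspose_mul, conjTranspose_conjTranspose, Matrix.add_mul, Matrix.mul_add,
      Matrix.sub_mul, Matrix.mul_sub, Matrix.smul_mul, Matrix.mul_smul, Matrix.neg_mul,
      Matrix.mul_neg, map_add, map_sub, map_neg, Matrix.mul_assoc, hsymm]
    linarith

lemma vnorm_v_mul_le {w : Matrix (Fin m₁) (Fin m₂) ℂ} (hw : ‖w‖ ≤ M) (B : Matrix (Fin m₁) p ℂ)
    (G : Matrix (Fin m₂) p ℂ) (c : p → ℂ) :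
    |formL c (Bᴴ * (w * G))| ≤ M * (vnorm B c * vnorm G c) := by
  have h1 := abs_re_form_le B (w * G) c
  have h2 : vnorm (w * G) c ≤ M * vnorm G c := by
    rw [vnorm_mul]
    refine (vnorm_le _ _).trans ?_
    exact mul_le_mul_of_nonneg_right hw (norm_nonneg _)
  rw [formL_apply]
  refine h1.trans ?_
  have := mul_le_mul_of_nonneg_left h2 (vnorm_nonneg B c)
  linarith

/-- In `ℂ_M` the indefinite energy decreases. -/
lemma IsDiracSol.energy_le (h : IsDiracSol l v z b g) (hvM : ∀ x, ‖v x‖ ≤ M) (hz : M ≤ z.im)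
    (c : p → ℂ) {x y : ℝ} (hx : x ∈ Icc 0 l) (hy : y ∈ Icc 0 l) (hxy : x ≤ y) :
    vnorm (b y) c ^ 2 - vnorm (g y) c ^ 2 ≤ vnorm (b x) c ^ 2 - vnorm (g x) c ^ 2 := by
  have he := h.energy c
  rw [he.eq x hx, he.eq y hy, add_le_add_iff_left,
    ← intervalIntegral.integral_add_adjacent_intervals (he.integrable_of_mem hx)
      ((he.integrable_of_mem hx).symm.trans (he.integrable_of_mem hy))]
  refine add_le_of_nonpos_right ?_
  rw [← neg_nonneg, ← intervalIntegral.integral_neg]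
  refine intervalIntegral.integral_nonneg hxy fun t _ => ?_
  have h1 := (abs_le.1 (vnorm_v_mul_le (hvM t) (b t) (g t) c)).2
  have hM : 0 ≤ M := (norm_nonneg _).trans (hvM 0)
  nlinarith [sq_nonneg (vnorm (b t) c - vnorm (g t) c), sq_nonneg (vnorm (b t) c),
    sq_nonneg (vnorm (g t) c), vnorm_nonneg (b t) c, vnorm_nonneg (g t) c,
    mul_nonneg hM (sq_nonneg (vnorm (b t) c - vnorm (g t) c)),
    mul_nonneg (sub_nonneg.2 hz) (add_nonneg (sq_nonneg (vnorm (b t) c))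
      (sq_nonneg (vnorm (g t) c)))]

/-- In the conjugate of `ℂ_M` the indefinite energy increases. -/
lemma IsDiracSol.le_energy (h : IsDiracSol l v z b g) (hvM : ∀ x, ‖v x‖ ≤ M) (hz : z.im ≤ -M)
    (c : p → ℂ) {x y : ℝ} (hx : x ∈ Icc 0 l) (hy : y ∈ Icc 0 l) (hxy : x ≤ y) :
    vnorm (b x) c ^ 2 - vnorm (g x) c ^ 2 ≤ vnorm (b y) c ^ 2 - vnorm (g y) c ^ 2 := by
  have he := h.energy c
  rw [he.eq x hx, he.eq y hy, add_le_add_iff_left,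
    ← intervalIntegral.integral_add_adjacent_intervals (he.integrable_of_mem hx)
      ((he.integrable_of_mem hx).symm.trans (he.integrable_of_mem hy))]
  refine le_add_of_nonneg_right (intervalIntegral.integral_nonneg hxy fun t _ => ?_)
  have h1 := (abs_le.1 (vnorm_v_mul_le (hvM t) (b t) (g t) c)).1
  have hM : 0 ≤ M := (norm_nonneg _).trans (hvM 0)
  nlinarith [mul_nonneg hM (sq_nonneg (vnorm (b t) c - vnorm (g t) c)),
    mul_nonneg (sub_nonneg.2 hz) (add_nonneg (sq_nonneg (vnorm (b t) c))
      (sq_nonneg (vnorm (g t) c)))]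

end Energy

section Weyl

variable {m₁ m₂ : ℕ} {l M : ℝ} {v : ℝ → Matrix (Fin m₁) (Fin m₂) ℂ}
  {u : ℝ → ℂ → Matrix (Fin m₁ ⊕ Fin m₂) (Fin m₁ ⊕ Fin m₂) ℂ}

/-- Growth of the solutions of the Dirac system. -/
lemma IsDiracSol.norm_le {p : Type*} [Fintype p] [DecidableEq p] {z : ℂ}
    {b : ℝ → Matrix (Fin m₁) p ℂ} {g : ℝ → Matrix (Fin m₂) p ℂ}
    (h : IsDiracSol l v z b g) (hvM : ∀ x, ‖v x‖ ≤ M) {x : ℝ} (hx : x ∈ Icc 0 l) :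
    ‖b x‖ + ‖g x‖ ≤ (‖b 0‖ + ‖g 0‖) * Real.exp ((‖z‖ + M) * x) := by
  have hl := h.upper.nonneg
  have hM : 0 ≤ M := (norm_nonneg _).trans (hvM 0)
  have hc : ContinuousOn (fun x => ‖b x‖ + ‖g x‖) (Icc 0 l) :=
    h.upper.continuousOn.norm.add h.lower.continuousOn.norm
  have hi : IntervalIntegrable (fun x => ‖b x‖ + ‖g x‖) volume 0 l := by
    apply ContinuousOn.intervalIntegrable; rwa [uIcc_of_le hl]
  refine le_exp_of_le_integral (C := ‖z‖ + M) (by positivity) hi (fun x hx => ?_) x hx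
  have hib : IntervalIntegrable (fun x => ‖b x‖) volume 0 x := by
    apply ContinuousOn.intervalIntegrable; rw [uIcc_of_le hx.1]
    exact h.upper.continuousOn.norm.mono (Icc_subset_Icc_right hx.2)
  have hig : IntervalIntegrable (fun x => ‖g x‖) volume 0 x := by
    apply ContinuousOn.intervalIntegrable; rw [uIcc_of_le hx.1]
    exact h.lower.continuousOn.norm.mono (Icc_subset_Icc_right hx.2)
  have hI : ‖Complex.I * z‖ = ‖z‖ := by simp
  have h1 : ‖b x‖ ≤ ‖b 0‖ + ∫ t in (0 : ℝ)..x, (‖z‖ * ‖b t‖ + M * ‖g t‖) := by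
    rw [h.upper.eq x hx]
    refine (norm_add_le _ _).trans (add_le_add_right ?_ _)
    refine intervalIntegral.norm_integral_le_of_norm_le hx.1 (Eventually.of_forall fun t _ => ?_)
      ((hib.const_mul _).add (hig.const_mul _))
    refine (norm_add_le _ _).trans (add_le_add ?_ (norm_mul_le_of_le (hvM t) le_rfl))
    rw [norm_smul, hI]
  have h2 : ‖g x‖ ≤ ‖g 0‖ + ∫ t in (0 : ℝ)..x, (‖z‖ * ‖g t‖ + M * ‖b t‖) := by
    rw [h.lower.eq x hx]
    refine (norm_add_le _ _).trans (add_le_add_right ?_ _)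
    refine intervalIntegral.norm_integral_le_of_norm_le hx.1 (Eventually.of_forall fun t _ => ?_)
      ((hig.const_mul _).add (hib.const_mul _))
    refine (norm_sub_le _ _).trans (add_le_add ?_ (norm_mul_le_of_le
      ((Matrix.l2_opNorm_conjTranspose _).le.trans (hvM t)) le_rfl))
    rw [norm_neg, norm_smul, hI]
  have h3 := intervalIntegral.integral_add ((hib.const_mul ‖z‖).add (hig.const_mul M))
    ((hig.const_mul ‖z‖).add (hib.const_mul M))
  rw [← intervalIntegral.integral_const_mul]
  have h4 : ∫ t in (0 : ℝ)..x, (‖z‖ + M) * (‖b t‖ + ‖g t‖) = _ :=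
    Eq.trans (intervalIntegral.integral_congr fun t _ => by ring) h3
  rw [h4]
  linarith

/-- The fundamental solution depends continuously on the spectral parameter. -/
lemma IsFundamentalSolution.continuous (hu : IsFundamentalSolution l v u)
    (hv : StronglyMeasurable v) (hvM : ∀ x, ‖v x‖ ≤ M) (hl : 0 ≤ l) :
    Continuous fun z => u l z := by
  have hM : 0 ≤ M := (norm_nonneg _).trans (hvM 0)
  have hll : l ∈ Icc 0 l := ⟨hl, le_rfl⟩
  rw [continuous_iff_continuousAt]
  intro z
  have h0 := hu.isDiracSol hv hvM hl (starRingEnd ℂ z)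
  let β := upperRow m₁ m₂
  let γ := lowerRow m₁ m₂
  -- the quotient of two fundamental solutions is the identity up to `O(ζ - z)`
  have hprim : ∀ ζ, IsPrim l (fun x => (u x (starRingEnd ℂ z))ᴴ * u x ζ) (fun x =>
      (Complex.I * (ζ - z)) • ((β * u x (starRingEnd ℂ z))ᴴ * (β * u x ζ) -
        (γ * u x (starRingEnd ℂ z))ᴴ * (γ * u x ζ))) := by
    intro ζ
    have h1 := hu.isDiracSol hv hvM hl ζ
    refine (((h0.upper.adj.mul h1.upper).add (h0.lower.adj.mul h1.lower)).congr
      fun x _ => conjTranspose_mul_eq_rows _ _).congr_ae (Eventually.of_forall fun x => ?_)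
    simp only [conjTranspose_add, conjTranspose_sub, conjTranspose_neg, conjTranspose_smul,
      Matrix.conjTranspose_mul, conjTranspose_conjTranspose, Matrix.add_mul, Matrix.mul_add,
      Matrix.sub_mul, Matrix.mul_sub, Matrix.smul_mul, Matrix.mul_smul, Matrix.neg_mul,
      Matrix.mul_neg, Matrix.mul_assoc, star_mul', RCLike.star_def, Complex.conj_conj,
      Complex.conj_I, neg_smul, neg_mul, mul_sub, sub_smul, smul_sub, β, γ]
    generalize u x ((starRingEnd ℂ) z) = U
    abel
  let D := ‖β * (1 : Matrix (Fin m₁ ⊕ Fin m₂) (Fin m₁ ⊕ Fin m₂) ℂ)‖ +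
    ‖γ * (1 : Matrix (Fin m₁ ⊕ Fin m₂) (Fin m₁ ⊕ Fin m₂) ℂ)‖
  let B := D * Real.exp ((‖z‖ + 1 + M) * l)
  have hB : ∀ ζ, ‖ζ‖ ≤ ‖z‖ + 1 → ∀ x ∈ Icc 0 l, ‖β * u x ζ‖ + ‖γ * u x ζ‖ ≤ B := by
    intro ζ hζ x hx
    have := (hu.isDiracSol hv hvM hl ζ).norm_le hvM hx
    simp only [(hu ζ).1] at this
    refine this.trans (mul_le_mul_of_nonneg_left ?_ (by positivity))
    rw [Real.exp_le_exp]
    exact mul_le_mul (by linarith) hx.2 hx.1 (by positivity)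
  have hB0 : 0 ≤ B := by positivity
  have hest : ∀ ζ, ‖ζ‖ ≤ ‖z‖ + 1 →
      ‖(u l (starRingEnd ℂ z))ᴴ * u l ζ - 1‖ ≤ ‖ζ - z‖ * (B * B + B * B) * l := by
    intro ζ hζ
    rw [(hprim ζ).eq l hll, (hu _).1, (hu _).1]
    simp only [conjTranspose_one, Matrix.mul_one, add_sub_cancel_left]
    refine (intervalIntegral.norm_integral_le_of_norm_le_const (C := ‖ζ - z‖ * (B * B + B * B))
      fun x hx => ?_).trans (by rw [sub_zero, abs_of_nonneg hl])
    rw [uIoc_of_le hl] at hx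
    have hx' := Ioc_subset_Icc_self hx
    have b1 := hB ζ hζ x hx'
    have b2 := hB (starRingEnd ℂ z) (by simp) x hx'
    rw [norm_smul]
    refine mul_le_mul (by simp) ((norm_sub_le _ _).trans (add_le_add ?_ ?_)) (norm_nonneg _)
      (norm_nonneg _)
    · refine norm_mul_le_of_le ((Matrix.l2_opNorm_conjTranspose _).le.trans ?_) ?_
      · linarith [norm_nonneg (γ * u x (starRingEnd ℂ z))]
      · linarith [norm_nonneg (γ * u x ζ)]
    · refine norm_mul_le_of_le ((Matrix.l2_opNorm_conjTranspose _).le.trans ?_) ?_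
      · linarith [norm_nonneg (β * u x (starRingEnd ℂ z))]
      · linarith [norm_nonneg (β * u x ζ)]
  have hev : ∀ᶠ ζ in 𝓝 z, ‖ζ‖ ≤ ‖z‖ + 1 := by
    filter_upwards [Metric.ball_mem_nhds z one_pos] with ζ hζ
    have := norm_sub_norm_le ζ z
    rw [mem_ball_iff_norm] at hζ
    linarith
  have hlim : Tendsto (fun ζ => (u l (starRingEnd ℂ z))ᴴ * u l ζ) (𝓝 z) (𝓝 1) := by
    rw [tendsto_iff_norm_sub_tendsto_zero]
    refine squeeze_zero' (Eventually.of_forall fun _ => norm_nonneg _) (hev.mono fun ζ hζ =>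
      hest ζ hζ) ?_
    have : Continuous fun ζ : ℂ => ‖ζ - z‖ * (B * B + B * B) * l := by fun_prop
    simpa using this.tendsto z
  have h2 : Tendsto (fun ζ => u l z * ((u l (starRingEnd ℂ z))ᴴ * u l ζ)) (𝓝 z)
      (𝓝 (u l z * 1)) := by
    have hcm : Continuous fun A : Matrix (Fin m₁ ⊕ Fin m₂) (Fin m₁ ⊕ Fin m₂) ℂ => u l z * A := by
      fun_prop
    exact (hcm.tendsto _).comp hlim
  have e : ∀ ζ, u l z * ((u l (starRingEnd ℂ z))ᴴ * u l ζ) = u l ζ := fun ζ => by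
    rw [← Matrix.mul_assoc, hu.mul_conjTranspose hv hvM hl z hll, Matrix.one_mul]
  simp only [e, Matrix.mul_one] at h2
  exact h2

end Weyl

section WeylBall

variable {m₁ m₂ : ℕ} {l M : ℝ} {v : ℝ → Matrix (Fin m₁) (Fin m₂) ℂ}
  {u : ℝ → ℂ → Matrix (Fin m₁ ⊕ Fin m₂) (Fin m₁ ⊕ Fin m₂) ℂ}
  {p : Type*} [Fintype p] [DecidableEq p]

/-- The block column `[I; w]`, the initial value of the Weyl solution. -/
noncomputable def graphCol (w : Matrix (Fin m₂) (Fin m₁) ℂ) :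
    Matrix (Fin m₁ ⊕ Fin m₂) (Fin m₁) ℂ := fromRows 1 w

/-- The block column `[-w*; I]`, orthogonal to `[I; w]`. -/
noncomputable def dualCol (w : Matrix (Fin m₂) (Fin m₁) ℂ) :
    Matrix (Fin m₁ ⊕ Fin m₂) (Fin m₂) ℂ := fromRows (-wᴴ) 1

lemma vnorm_sub_vnorm_sq (A : Matrix (Fin m₁ ⊕ Fin m₂) p ℂ) (c : p → ℂ) :
    vnorm (upperRow m₁ m₂ * A) c ^ 2 - vnorm (lowerRow m₁ m₂ * A) c ^ 2 =
      (star c ⬝ᵥ ((Aᴴ * jMat m₁ m₂ * A) *ᵥ c)).re := by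
  rw [conjTranspose_mul_jMat_mul, vnorm_sq, vnorm_sq, Matrix.sub_mulVec, dotProduct_sub,
    Complex.sub_re]

lemma continuous_vnorm_mul {a q : Type*} [Fintype a] [DecidableEq a] [Fintype q]
    (B : Matrix a q ℂ) (c : p → ℂ) : Continuous fun A : Matrix q p ℂ => vnorm (B * A) c := by
  unfold vnorm
  have : Continuous fun A : Matrix q p ℂ => (B * A) *ᵥ c := by fun_prop
  exact ((PiLp.continuous_toLp 2 _).comp this).norm

lemma eq_zero_of_vnorm {a : Type*} [Fintype a] {A : Matrix a p ℂ} {c : p → ℂ}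
    (h : vnorm A c = 0) : A *ᵥ c = 0 := by
  have := norm_eq_zero.1 h
  simpa using this

lemma norm_one_matrix_le : ‖(1 : Matrix p p ℂ)‖ ≤ 1 := by
  have h := Matrix.l2_opNorm_conjTranspose_mul_self (1 : Matrix p p ℂ)
  rw [conjTranspose_one, Matrix.one_mul] at h
  by_contra! h1
  nlinarith

lemma isUnit_det_of_injective {A : Matrix p p ℂ} (h : ∀ c, A *ᵥ c = 0 → c = 0) :
    IsUnit A.det := by
  rw [← Matrix.isUnit_iff_isUnit_det, ← Matrix.mulVec_injective_iff_isUnit]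
  intro c d hcd
  refine sub_eq_zero.1 (h _ ?_)
  rw [Matrix.mulVec_sub, sub_eq_zero]
  exact hcd

lemma IsFundamentalSolution.isDiracSol_mul (hu : IsFundamentalSolution l v u)
    (hv : StronglyMeasurable v) (hvM : ∀ x, ‖v x‖ ≤ M) (hl : 0 ≤ l) (z : ℂ)
    (A : Matrix (Fin m₁ ⊕ Fin m₂) p ℂ) :
    IsDiracSol l v z (fun x => upperRow m₁ m₂ * (u x z * A))
      (fun x => lowerRow m₁ m₂ * (u x z * A)) := by
  simpa only [Matrix.mul_assoc] using (hu.isDiracSol hv hvM hl z).mul_const A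

lemma tendsto_matrix_mul {α a b c : Type*} [Fintype a] [Fintype b] [Fintype c] [DecidableEq a]
    [DecidableEq b] [DecidableEq c] {F : Filter α}
    {f : α → Matrix a b ℂ} {g : α → Matrix b c ℂ} {A : Matrix a b ℂ} {B : Matrix b c ℂ}
    (hf : Tendsto f F (𝓝 A)) (hg : Tendsto g F (𝓝 B)) :
    Tendsto (fun x => f x * g x) F (𝓝 (A * B)) :=
  (((mulL a b c).isBoundedBilinearMap.continuous.tendsto (A, B)).comp (hf.prodMk_nhds hg) : _)

/-- If `P = U Q` is nonsingular with `P* j P ≥ 0` and the indefinite energy of `Q` is not smaller,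
then the upper block of `Q` is invertible. -/
lemma isUnit_upperRow_mul {U : Matrix (Fin m₁ ⊕ Fin m₂) (Fin m₁ ⊕ Fin m₂) ℂ}
    {Q : Matrix (Fin m₁ ⊕ Fin m₂) (Fin m₁) ℂ} (hP : ((U * Q)ᴴ * (U * Q)).PosDef)
    (hpos : ∀ c, vnorm (lowerRow m₁ m₂ * Q) c ^ 2 ≤ vnorm (upperRow m₁ m₂ * Q) c ^ 2) :
    IsUnit (upperRow m₁ m₂ * Q).det := by
  refine isUnit_det_of_injective fun c hc => ?_
  have h2 : vnorm (upperRow m₁ m₂ * Q) c = 0 := by simp [vnorm, hc]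
  have h4 : vnorm (lowerRow m₁ m₂ * Q) c = 0 := by
    have h3 := hpos c
    rw [h2] at h3
    nlinarith [vnorm_nonneg (lowerRow m₁ m₂ * Q) c]
  have h5 : Q *ᵥ c = 0 := by
    rw [← fromRows_upperRow_lowerRow Q, Matrix.fromRows_mulVec, hc, eq_zero_of_vnorm h4]
    ext (i | i) <;> rfl
  have h6 : (U * Q) *ᵥ c = 0 := by rw [← Matrix.mulVec_mulVec, h5, Matrix.mulVec_zero]
  by_contra hne
  have h7 := hP.dotProduct_mulVec_pos hne
  rw [← Matrix.mulVec_mulVec, h6, Matrix.mulVec_zero, dotProduct_zero] at h7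
  exact lt_irrefl _ h7

lemma vnorm_mul_le_vnorm_mul {a b q : Type*} [Fintype a] [Fintype b] [Fintype q] [DecidableEq q]
    {A : Matrix a p ℂ} {B : Matrix b p ℂ} (h : ∀ c, vnorm A c ≤ vnorm B c) (D : Matrix p q ℂ)
    (c : q → ℂ) : vnorm (A * D) c ≤ vnorm (B * D) c := by
  rw [vnorm_mul, vnorm_mul]
  exact h _

lemma mul_graphCol_moebius {U : Matrix (Fin m₁ ⊕ Fin m₂) (Fin m₁ ⊕ Fin m₂) ℂ}
    {P Q : Matrix (Fin m₁ ⊕ Fin m₂) (Fin m₁) ℂ} (hQ : U⁻¹ * P = Q) (hUQ : U * Q = P)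
    (hunit : IsUnit (upperRow m₁ m₂ * Q).det) :
    U * graphCol (moebius U P) = P * (upperRow m₁ m₂ * Q)⁻¹ := by
  have hinv := Matrix.mul_nonsing_inv _ hunit
  have h : graphCol (moebius U P) = Q * (upperRow m₁ m₂ * Q)⁻¹ := by
    rw [← fromRows_upperRow_lowerRow (Q * _), ← Matrix.mul_assoc, hinv, graphCol, moebius,
      Matrix.mul_assoc _ U⁻¹, Matrix.mul_assoc _ U⁻¹, hQ, Matrix.mul_assoc]
  rw [h, ← Matrix.mul_assoc, hUQ]

/-- Where `P` is nonsingular with `P* j P ≥ 0`, the linear-fractional transformation is well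
defined and the corresponding solution is nonnegative with respect to `j` at `l`. -/
lemma IsFundamentalSolution.vnorm_moebius_le (hu : IsFundamentalSolution l v u)
    (hv : StronglyMeasurable v) (hvM : ∀ x, ‖v x‖ ≤ M) (hl : 0 ≤ l) {z : ℂ} (hz : M ≤ z.im)
    {P : Matrix (Fin m₁ ⊕ Fin m₂) (Fin m₁) ℂ} (hP : (Pᴴ * P).PosDef)
    (hPj : (Pᴴ * jMat m₁ m₂ * P).PosSemidef) (c : Fin m₁ → ℂ) :
    vnorm (lowerRow m₁ m₂ * (u l z * graphCol (moebius (u l z) P))) c ≤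
      vnorm (upperRow m₁ m₂ * (u l z * graphCol (moebius (u l z) P))) c := by
  have hll : l ∈ Icc 0 l := ⟨hl, le_rfl⟩
  obtain ⟨Q, hQ⟩ : ∃ Q, (u l z)⁻¹ * P = Q := ⟨_, rfl⟩
  have hUQ : u l z * Q = P := by
    rw [← hQ, ← Matrix.mul_assoc, Matrix.inv_eq_right_inv (hu.mul_conjTranspose hv hvM hl z hll),
      hu.mul_conjTranspose hv hvM hl z hll, Matrix.one_mul]
  have hpos : ∀ c, vnorm (lowerRow m₁ m₂ * P) c ^ 2 ≤ vnorm (upperRow m₁ m₂ * P) c ^ 2 := by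
    intro c
    have h := (Complex.le_def.1 (hPj.dotProduct_mulVec_nonneg c)).1
    rw [← vnorm_sub_vnorm_sq, Complex.zero_re] at h
    linarith
  have hunit : IsUnit (upperRow m₁ m₂ * Q).det := by
    refine isUnit_upperRow_mul (U := u l z) (by rwa [hUQ]) fun c => ?_
    have h1 := (hu.isDiracSol_mul hv hvM hl z Q).energy_le hvM hz c ⟨le_rfl, hl⟩ hll hl
    simp only [(hu z).1, Matrix.one_mul, hUQ] at h1
    linarith [hpos c]
  have hpos' := fun c => (sq_le_sq₀ (vnorm_nonneg _ c) (vnorm_nonneg _ c)).1 (hpos c)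
  have h := vnorm_mul_le_vnorm_mul hpos' (upperRow m₁ m₂ * Q)⁻¹ c
  rwa [Matrix.mul_assoc, Matrix.mul_assoc, ← mul_graphCol_moebius hQ hUQ hunit] at h

/-- For a value `w` in the Weyl ball the solution with initial value `[I; w]` is nonnegative
with respect to `j` at the right end. -/
lemma IsFundamentalSolution.vnorm_le_of_mem_weylBall (hu : IsFundamentalSolution l v u)
    (hv : StronglyMeasurable v) (hvM : ∀ x, ‖v x‖ ≤ M) (hl : 0 ≤ l) {z : ℂ} (hz : M < z.im)
    {w : Matrix (Fin m₂) (Fin m₁) ℂ} (hw : w ∈ weylBall M u l z) (c : Fin m₁ → ℂ) :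
    vnorm (lowerRow m₁ m₂ * (u l z * graphCol w)) c ≤
      vnorm (upperRow m₁ m₂ * (u l z * graphCol w)) c := by
  obtain ⟨P, ⟨-, hP⟩, hlim⟩ := hw
  have hcont := hu.continuous hv hvM hl
  have hut : Tendsto (fun ζ => u l ζ) (𝓝[≠] z) (𝓝 (u l z)) := (hcont.tendsto z).mono_left
    nhdsWithin_le_nhds
  have hY : Tendsto (fun ζ => u l ζ * graphCol (moebius (u l ζ) (P ζ))) (𝓝[≠] z)
      (𝓝 (u l z * graphCol w)) := by
    have hfr : Continuous fun w : Matrix (Fin m₂) (Fin m₁) ℂ =>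
        graphCol w := by
      refine continuous_matrix fun i j => ?_
      rcases i with i | i
      · exact continuous_const
      · exact continuous_id.matrix_elem i j
    exact tendsto_matrix_mul hut ((hfr.tendsto w).comp hlim)
  refine le_of_tendsto_of_tendsto (((continuous_vnorm_mul (lowerRow m₁ m₂) c).tendsto _).comp hY)
    (((continuous_vnorm_mul (upperRow m₁ m₂) c).tendsto _).comp hY) ?_
  have h2 := mem_codiscreteWithin_iff_forall_mem_nhdsNE.1 hP z hz
  have h3 : halfPlane M ∈ 𝓝 z := by
    have : IsOpen (halfPlane M) := isOpen_lt continuous_const Complex.continuous_im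
    exact this.mem_nhds hz
  filter_upwards [h2, nhdsWithin_le_nhds h3] with ζ hζ hζM
  rcases hζ with hζ | hζ
  · exact hu.vnorm_moebius_le hv hvM hl (le_of_lt hζM) hζ.1 hζ.2 c
  · exact absurd hζM hζ

variable {z : ℂ} {b : ℝ → Matrix (Fin m₁) p ℂ} {g : ℝ → Matrix (Fin m₂) p ℂ}

lemma norm_cexp_smul_ofReal {V : Type*} [NormedAddCommGroup V] [NormedSpace ℂ V] (ω : ℂ) (x : ℝ)
    (y : V) : ‖Complex.exp (ω * x) • y‖ = Real.exp (ω.re * x) * ‖y‖ := by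
  rw [norm_smul, Complex.norm_exp, Complex.re_mul_ofReal]

lemma IsDiracSol.vnorm_lower_le (h : IsDiracSol l v z b g) (hvM : ∀ x, ‖v x‖ ≤ M)
    (hz : M ≤ z.im) (hend : ∀ c, vnorm (g l) c ≤ vnorm (b l) c) {x : ℝ} (hx : x ∈ Icc 0 l)
    (c : p → ℂ) : vnorm (g x) c ≤ vnorm (b x) c := by
  have h1 := h.energy_le hvM hz c hx ⟨hx.1.trans hx.2, le_rfl⟩ hx.2
  have h2 := (sq_le_sq₀ (vnorm_nonneg _ _) (vnorm_nonneg _ _)).2 (hend c)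
  exact (sq_le_sq₀ (vnorm_nonneg _ _) (vnorm_nonneg _ _)).1 (by linarith)

lemma IsDiracSol.vnorm_upper_le (h : IsDiracSol l v z b g) (hvM : ∀ x, ‖v x‖ ≤ M)
    (hz : z.im ≤ -M) (hend : ∀ c, vnorm (b l) c ≤ vnorm (g l) c) {x : ℝ} (hx : x ∈ Icc 0 l)
    (c : p → ℂ) : vnorm (b x) c ≤ vnorm (g x) c := by
  have h1 := h.le_energy hvM hz c hx ⟨hx.1.trans hx.2, le_rfl⟩ hx.2
  have h2 := (sq_le_sq₀ (vnorm_nonneg _ _) (vnorm_nonneg _ _)).2 (hend c)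
  exact (sq_le_sq₀ (vnorm_nonneg _ _) (vnorm_nonneg _ _)).1 (by linarith)

/-- Growth bound for a function whose derivative is dominated by the function itself. -/
lemma IsPrim.norm_le_exp {V : Type*} [NormedAddCommGroup V] [NormedSpace ℝ V] {F f : ℝ → V}
    (h : IsPrim l F f) (hM : 0 ≤ M) (hf : ∀ x ∈ Icc 0 l, ‖f x‖ ≤ M * ‖F x‖) {x : ℝ}
    (hx : x ∈ Icc 0 l) : ‖F x‖ ≤ ‖F 0‖ * Real.exp (M * x) := by
  have hi : IntervalIntegrable (fun x => ‖F x‖) volume 0 l := by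
    apply ContinuousOn.intervalIntegrable; rw [uIcc_of_le h.nonneg]; exact h.continuousOn.norm
  refine le_exp_of_le_integral hM hi (fun x hx => ?_) x hx
  rw [h.eq x hx, ← intervalIntegral.integral_const_mul]
  refine (norm_add_le _ _).trans (add_le_add_right ?_ _)
  refine intervalIntegral.norm_integral_le_of_norm_le hx.1 (Eventually.of_forall fun t ht => ?_)
    ((intervalIntegrable_of_mem hi hx).const_mul M)
  exact hf t ⟨ht.1.le, ht.2.trans hx.2⟩

/-- Solutions that are nonnegative with respect to `j` decay exponentially in `ℂ_M`. -/
lemma IsDiracSol.norm_upper_le_exp (h : IsDiracSol l v z b g) (hvM : ∀ x, ‖v x‖ ≤ M)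
    (hz : M ≤ z.im) (hend : ∀ c, vnorm (g l) c ≤ vnorm (b l) c) {x : ℝ} (hx : x ∈ Icc 0 l) :
    ‖b x‖ ≤ ‖b 0‖ * Real.exp (-(z.im - M) * x) := by
  have hM : 0 ≤ M := (norm_nonneg _).trans (hvM 0)
  have h1 := (h.upper.exp_smul (-(Complex.I * z))).norm_le_exp hM (fun t ht => ?_) hx
  · simp only [norm_cexp_smul_ofReal, mul_zero, Complex.ofReal_zero, Complex.exp_zero,
      one_smul] at h1
    have e : (-(Complex.I * z)).re = z.im := by simp
    rw [e] at h1
    have e2 : -(z.im - M) * x = M * x - z.im * x := by ring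
    rw [e2, Real.exp_sub, ← mul_div_assoc, le_div_iff₀ (Real.exp_pos _)]
    linarith
  · rw [neg_smul, neg_add_cancel_left, norm_cexp_smul_ofReal, norm_cexp_smul_ofReal, mul_left_comm]
    refine mul_le_mul_of_nonneg_left (norm_mul_le_of_le (hvM t) ?_) (Real.exp_pos _).le
    exact norm_le_of_vnorm_le fun c => h.vnorm_lower_le hvM hz hend ht c

/-- Solutions that are nonpositive with respect to `j` decay exponentially in the conjugate of
`ℂ_M`. -/
lemma IsDiracSol.norm_lower_le_exp (h : IsDiracSol l v z b g) (hvM : ∀ x, ‖v x‖ ≤ M)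
    (hz : z.im ≤ -M) (hend : ∀ c, vnorm (b l) c ≤ vnorm (g l) c) {x : ℝ} (hx : x ∈ Icc 0 l) :
    ‖g x‖ ≤ ‖g 0‖ * Real.exp ((z.im + M) * x) := by
  have hM : 0 ≤ M := (norm_nonneg _).trans (hvM 0)
  have h1 := (h.lower.exp_smul (Complex.I * z)).norm_le_exp hM (fun t ht => ?_) hx
  · simp only [norm_cexp_smul_ofReal, mul_zero, Complex.ofReal_zero, Complex.exp_zero,
      one_smul] at h1
    have e : (Complex.I * z).re = -z.im := by simp
    rw [e] at h1
    have e2 : (z.im + M) * x = M * x - (-z.im) * x := by ring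
    rw [e2, Real.exp_sub, ← mul_div_assoc, le_div_iff₀ (Real.exp_pos _)]
    linarith
  · have e : (Complex.I * z) • g t + (-((Complex.I * z) • g t) - (v t)ᴴ * b t) =
        -((v t)ᴴ * b t) := by abel
    rw [e, norm_cexp_smul_ofReal, norm_cexp_smul_ofReal, mul_left_comm, norm_neg]
    refine mul_le_mul_of_nonneg_left (norm_mul_le_of_le ((Matrix.l2_opNorm_conjTranspose _).le.trans
      (hvM t)) ?_) (Real.exp_pos _).le
    exact norm_le_of_vnorm_le fun c => h.vnorm_upper_le hvM hz hend ht c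

/-- If `[Y₁; Y₂]` is the graph of a contraction, its orthogonal complement is one as well. -/
lemma vnorm_le_of_orthogonal {q : Type*} [Fintype q] [DecidableEq q] {Y1 : Matrix p p ℂ}
    {Y2 : Matrix q p ℂ} {X1 : Matrix p q ℂ} {X2 : Matrix q q ℂ} (hunit : IsUnit Y1.det)
    (horth : X1ᴴ * Y1 + X2ᴴ * Y2 = 0) (hend : ∀ c, vnorm Y2 c ≤ vnorm Y1 c) (c : q → ℂ) :
    vnorm X1 c ≤ vnorm X2 c := by
  have hinv := Matrix.mul_nonsing_inv _ hunit
  have hΘ : ‖Y2 * Y1⁻¹‖ ≤ 1 := by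
    refine (norm_le_of_vnorm_le (B := Y1 * Y1⁻¹) fun c => ?_).trans (hinv ▸ norm_one_matrix_le)
    rw [vnorm_mul, vnorm_mul]
    exact hend _
  have hX : X1 = -((Y2 * Y1⁻¹)ᴴ * X2) := by
    have h1 : X1ᴴ * (Y1 * Y1⁻¹) + X2ᴴ * (Y2 * Y1⁻¹) = 0 := by
      rw [← Matrix.mul_assoc, ← Matrix.mul_assoc, ← Matrix.add_mul, horth, Matrix.zero_mul]
    rw [hinv, Matrix.mul_one] at h1
    have h2 := congrArg conjTranspose (eq_neg_of_add_eq_zero_left h1)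
    rw [conjTranspose_conjTranspose, conjTranspose_neg, Matrix.conjTranspose_mul,
      conjTranspose_conjTranspose] at h2
    exact h2
  have h3 : vnorm X1 c = vnorm ((Y2 * Y1⁻¹)ᴴ * X2) c := by
    rw [hX]; simp [vnorm, Matrix.neg_mulVec]
  rw [h3, vnorm_mul]
  refine (vnorm_le _ _).trans ?_
  refine (mul_le_mul_of_nonneg_right ((Matrix.l2_opNorm_conjTranspose _).le.trans hΘ)
    (norm_nonneg _)).trans ?_
  rw [one_mul]; rfl

/-- The solution orthogonal to the one with initial value `[I; w]` is nonpositive with respect to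
`j` at the right end. -/
lemma IsFundamentalSolution.vnorm_dual_le (hu : IsFundamentalSolution l v u)
    (hv : StronglyMeasurable v) (hvM : ∀ x, ‖v x‖ ≤ M) (hl : 0 ≤ l) {z : ℂ}
    {w : Matrix (Fin m₂) (Fin m₁) ℂ}
    (hend : ∀ c, vnorm (lowerRow m₁ m₂ * (u l z * graphCol w)) c ≤
      vnorm (upperRow m₁ m₂ * (u l z * graphCol w)) c) (c : Fin m₂ → ℂ) :
    vnorm (upperRow m₁ m₂ * (u l (starRingEnd ℂ z) * dualCol w)) c ≤
      vnorm (lowerRow m₁ m₂ * (u l (starRingEnd ℂ z) * dualCol w)) c := by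
  have hll : l ∈ Icc 0 l := ⟨hl, le_rfl⟩
  have horth : (u l (starRingEnd ℂ z) * dualCol w)ᴴ * (u l z * graphCol w) =
      (0 : Matrix (Fin m₂) (Fin m₁) ℂ) := by
    rw [Matrix.conjTranspose_mul, Matrix.mul_assoc, ← Matrix.mul_assoc (u l _)ᴴ,
      hu.conjTranspose_mul hv hvM hl z hll, Matrix.one_mul, dualCol, graphCol,
      conjTranspose_fromRows_eq_fromCols_conjTranspose, fromCols_mul_fromRows]
    simp
  rw [conjTranspose_mul_eq_rows] at horth
  set Y1 := upperRow m₁ m₂ * (u l z * graphCol w) with hY1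
  set Y2 := lowerRow m₁ m₂ * (u l z * graphCol w) with hY2
  set X1 := upperRow m₁ m₂ * (u l (starRingEnd ℂ z) * dualCol w)
  set X2 := lowerRow m₁ m₂ * (u l (starRingEnd ℂ z) * dualCol w)
  have hunit : IsUnit Y1.det := by
    refine isUnit_det_of_injective fun c hc => ?_
    have h2 : vnorm Y1 c = 0 := by simp [vnorm, hc]
    have h3 : Y2 *ᵥ c = 0 := eq_zero_of_vnorm (le_antisymm (h2 ▸ hend c) (vnorm_nonneg _ _))
    have h4 : (u l z * graphCol w) *ᵥ c = 0 := by
      rw [← fromRows_upperRow_lowerRow (u l z * graphCol w), Matrix.fromRows_mulVec, hc, h3]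
      ext (i | i) <;> rfl
    have h5 : graphCol w *ᵥ c = 0 := by
      have := congrArg (fun d => (u l (starRingEnd ℂ z))ᴴ *ᵥ d) h4
      simpa only [Matrix.mulVec_mulVec, ← Matrix.mul_assoc, hu.conjTranspose_mul hv hvM hl z hll,
        Matrix.one_mul, Matrix.mulVec_zero] using this
    rw [graphCol, Matrix.fromRows_mulVec, Matrix.one_mulVec] at h5
    ext i
    exact congrFun h5 (Sum.inl i)
  exact vnorm_le_of_orthogonal hunit horth hend c

end WeylBall

/-! ### The similarity operator and the representation of the solutions -/

section Node

variable {m₁ m₂ p q : ℕ} {l M : ℝ} {v : ℝ → Matrix (Fin m₁) (Fin m₂) ℂ}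
  {u : ℝ → ℂ → Matrix (Fin m₁ ⊕ Fin m₂) (Fin m₁ ⊕ Fin m₂) ℂ}
  {E : ℝ → ℝ → Matrix (Fin m₂) (Fin m₂) ℂ} {N : ℝ → ℝ → Matrix (Fin m₁) (Fin m₂) ℂ}
  {k : ℝ → Matrix (Fin m₂) (Fin m₁) ℂ}

/-- `k` is the (bounded, measurable) solution of `E k = -v*`; it is the derivative of `E⁻¹ γ₁`. -/
structure IsNodeDensity (l : ℝ) (v : ℝ → Matrix (Fin m₁) (Fin m₂) ℂ)
    (E : ℝ → ℝ → Matrix (Fin m₂) (Fin m₂) ℂ) (k : ℝ → Matrix (Fin m₂) (Fin m₁) ℂ) : Prop where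
  measurable : StronglyMeasurable k
  bound : ∃ K, 0 ≤ K ∧ ∀ x, ‖k x‖ ≤ K
  zero : ∀ x, x ∉ Icc 0 l → k x = 0
  eq : ∀ x ∈ Icc 0 l, opE E k x = -(v x)ᴴ

/-- Volterra equations of the second kind are solvable; the bound of `k` is needed on the whole
line, so that the solution is cut off outside `[0, l]`. -/
lemma IsTransmutation.exists_density (h : IsTransmutation l v E N) (hv : StronglyMeasurable v)
    (hvM : ∀ x, ‖v x‖ ≤ M) : ∃ k, IsNodeDensity l v E k := by
  obtain ⟨C, hC0, hC⟩ := h.bound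
  have hM : 0 ≤ M := (norm_nonneg _).trans (hvM 0)
  have hsub : ∀ {x}, x ∈ Icc 0 l → ∀ {t}, t ∈ Ioc 0 x → t ∈ Icc 0 l := fun hx _ ht =>
    ⟨ht.1.le, ht.2.trans hx.2⟩
  have hint : ∀ f : ℝ → Matrix (Fin m₂) (Fin m₁) ℂ, StronglyMeasurable f →
      (∃ C, ∀ p ∈ Icc 0 l, ‖f p‖ ≤ C) → ∀ x ∈ Icc 0 l,
      IntervalIntegrable (fun t => E x t * f t) volume 0 x := by
    rintro f hf ⟨B, hB⟩ x hx
    refine intervalIntegrable_of_bdd (C := C * B) (stronglyMeasurable_mul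
      (h.measE.comp_measurable measurable_prodMk_left) hf).aestronglyMeasurable fun t ht => ?_
    rw [uIoc_of_le hx.1] at ht
    exact norm_mul_le_of_le (hC x hx t (hsub hx ht)).1 (hB t (hsub hx ht))
  obtain ⟨f, hf, ⟨B, hB⟩, hfe⟩ := exists_volterra_solution (s := Icc 0 l) measurableSet_Icc
    (T := fun (f : ℝ → Matrix (Fin m₂) (Fin m₁) ℂ) x => -∫ t in (0 : ℝ)..x, E x t * f t)
    (w := id) (W := l) (fun p hp => hp)
    (fun f hf => (stronglyMeasurable_intervalIntegral (h := fun x t => E x t * f t)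
      (stronglyMeasurable_mul h.measE (hf.comp_measurable measurable_snd)) measurable_id).neg)
    (fun f g hf hg hfb hgb x hx => by
      rw [neg_sub_neg, ← neg_sub, neg_inj, ← intervalIntegral.integral_sub (hint f hf hfb x hx)
        (hint g hg hgb x hx)]
      exact intervalIntegral.integral_congr fun t _ => by simp [Matrix.mul_sub])
    hC0
    (fun n f B hf hB hfB x hx => by
      rw [norm_neg]
      refine norm_integral_le_pow hx.1 fun t ht => ?_
      refine (norm_mul_le_of_le (hC x hx t (hsub hx ht)).1 (hfB t (hsub hx ht))).trans (le_of_eq ?_)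
      simp only [id]; ring)
    (g := fun x => -(v x)ᴴ) (stronglyMeasurable_adj hv).neg hM
    (fun x _ => by rw [norm_neg, Matrix.l2_opNorm_conjTranspose]; exact hvM x)
  refine ⟨(Icc 0 l).indicator f, hf.indicator measurableSet_Icc, ⟨max B 0, le_max_right _ _,
    fun x => ?_⟩, fun x hx => indicator_of_notMem hx _, fun x hx => ?_⟩
  · by_cases hx : x ∈ Icc 0 l
    · rw [indicator_of_mem hx]; exact (hB x hx).trans (le_max_left _ _)
    · rw [indicator_of_notMem hx, norm_zero]; exact le_max_right _ _
  · have e : ∫ t in (0 : ℝ)..x, E x t * (Icc 0 l).indicator f t = ∫ t in (0 : ℝ)..x, E x t * f t :=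
      intervalIntegral.integral_congr fun t ht => by
        rw [uIcc_of_le hx.1] at ht
        rw [indicator_of_mem (show t ∈ Icc 0 l from ⟨ht.1, ht.2.trans hx.2⟩)]
    rw [opE, e, indicator_of_mem hx, hfe x hx]
    abel

lemma IsNodeDensity.intervalIntegrable (hk : IsNodeDensity l v E k) (s t : ℝ) :
    IntervalIntegrable k volume s t := by
  obtain ⟨K, -, hK⟩ := hk.bound
  exact intervalIntegrable_of_bdd (C := K) hk.measurable.aestronglyMeasurable fun x _ => hK x

lemma intervalIntegrable_mul_const {f : ℝ → Matrix (Fin m₂) (Fin q) ℂ} {s t : ℝ}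
    (hf : IntervalIntegrable f volume s t) (A : Matrix (Fin q) (Fin p) ℂ) :
    IntervalIntegrable (fun x => f x * A) volume s t :=
  ⟨((mulL (Fin m₂) (Fin q) (Fin p)).flip A).integrable_comp hf.1,
    ((mulL (Fin m₂) (Fin q) (Fin p)).flip A).integrable_comp hf.2⟩

lemma IsTransmutation.intervalIntegrable_mul (h : IsTransmutation l v E N)
    {f : ℝ → Matrix (Fin m₂) (Fin p) ℂ} (hf : IntervalIntegrable f volume 0 l) {x : ℝ}
    (hx : x ∈ Icc 0 l) : IntervalIntegrable (fun t => E x t * f t) volume 0 x := by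
  obtain ⟨C, _, hC⟩ := h.bound
  exact intervalIntegrable_kernel_mul h.measE (fun x hx t ht => (hC x hx t ht).1) hf hx hx

lemma IsTransmutation.opE_smul_add_mul (h : IsTransmutation l v E N)
    {F : ℝ → Matrix (Fin m₂) (Fin p) ℂ} {f : ℝ → Matrix (Fin m₂) (Fin q) ℂ}
    (hF : IntervalIntegrable F volume 0 l) (hf : IntervalIntegrable f volume 0 l) (ω : ℂ)
    (A : Matrix (Fin q) (Fin p) ℂ) {x : ℝ} (hx : x ∈ Icc 0 l) :
    opE E (fun t => ω • F t + f t * A) x = ω • opE E F x + opE E f x * A := by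
  simp only [opE, Matrix.mul_add, Matrix.mul_smul, Matrix.add_mul, ← Matrix.mul_assoc]
  rw [intervalIntegral.integral_add (f := fun t => ω • (E x t * F t))
    ((h.intervalIntegrable_mul hF hx).smul ω)
    (intervalIntegrable_mul_const (h.intervalIntegrable_mul hf hx) A),
    intervalIntegral.integral_smul,
    integral_matrix_mul_const A (h.intervalIntegrable_mul hf hx), smul_add]
  abel

/-- The transmutation carries the solutions of the free first order equation
`F' = -2 i z F + k A` to the solutions of the Dirac system. -/
lemma IsTransmutation.isDiracSol (h : IsTransmutation l v E N) (hv : StronglyMeasurable v)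
    (hvM : ∀ x, ‖v x‖ ≤ M) (hk : IsNodeDensity l v E k) {z : ℂ}
    {F : ℝ → Matrix (Fin m₂) (Fin p) ℂ} {A : Matrix (Fin m₁) (Fin p) ℂ}
    (hF : IsPrim l F (fun x => (-(2 * (Complex.I * z))) • F x + k x * A)) :
    IsDiracSol l v z (fun x => Complex.exp (Complex.I * z * x) • (A + opN N F x))
      (fun x => Complex.exp (Complex.I * z * x) • opE E F x) := by
  have hl := hF.nonneg
  have hFi : IntervalIntegrable F volume 0 l := by
    apply ContinuousOn.intervalIntegrable; rw [uIcc_of_le hl]; exact hF.continuousOn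
  have h1 := ((IsPrim.const hl A).add (h.isPrim_opN hv hvM hl hFi)).exp_smul (Complex.I * z)
  have h2 := (h.isPrim_opE hv hvM hF).exp_smul (Complex.I * z)
  constructor
  · refine h1.congr_ae (Eventually.of_forall fun x => ?_)
    rw [zero_add, smul_add, smul_comm, Matrix.mul_smul]
  · refine h2.congr_ae (ae_restrict_of_forall_mem measurableSet_Ioo fun x hx => ?_)
    have hx' : x ∈ Icc 0 l := Ioo_subset_Icc_self hx
    rw [h.opE_smul_add_mul hFi (hk.intervalIntegrable 0 l) _ A hx', hk.eq x hx', smul_comm (_ * z),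
      ← smul_neg, Matrix.mul_smul, ← smul_sub]
    congr 1
    rw [neg_smul, two_mul, add_smul, Matrix.neg_mul, Matrix.mul_add]
    abel

lemma opN_zero (f : ℝ → Matrix (Fin m₂) (Fin p) ℂ) : opN N f 0 = 0 := by simp [opN]

lemma opE_zero (f : ℝ → Matrix (Fin m₂) (Fin p) ℂ) : opE E f 0 = f 0 := by simp [opE]

/-- The representation of the solutions: `u(x, z) [A; F(0)] = e^{izx} [A + N F; E F]` whenever
`F' = -2 i z F + k A`. -/
lemma IsTransmutation.fundamental_mul (h : IsTransmutation l v E N)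
    (hu : IsFundamentalSolution l v u) (hv : StronglyMeasurable v)
    (hvM : ∀ x, ‖v x‖ ≤ M) (hk : IsNodeDensity l v E k) {z : ℂ}
    {F : ℝ → Matrix (Fin m₂) (Fin p) ℂ} {A : Matrix (Fin m₁) (Fin p) ℂ}
    (hF : IsPrim l F (fun x => (-(2 * (Complex.I * z))) • F x + k x * A)) {x : ℝ}
    (hx : x ∈ Icc 0 l) :
    fromRows (Complex.exp (Complex.I * z * x) • (A + opN N F x))
      (Complex.exp (Complex.I * z * x) • opE E F x) = u x z * fromRows A (F 0) := by
  have := hu.eq_mul hv hvM hF.nonneg (h.isDiracSol hv hvM hk hF) hx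
  simpa [opN_zero, opE_zero] using this

/-! ### The normalized similarity operator -/

lemma lowerRow_mul_toCols₁ (U : Matrix (Fin m₁ ⊕ Fin m₂) (Fin m₁ ⊕ Fin m₂) ℂ) :
    (lowerRow m₁ m₂ * U).toCols₁ =
      lowerRow m₁ m₂ * (U * (fromRows 1 0 : Matrix (Fin m₁ ⊕ Fin m₂) (Fin m₁) ℂ)) := by
  rw [← Matrix.mul_assoc]
  conv_rhs => rw [← fromCols_toCols (lowerRow m₁ m₂ * U), fromCols_mul_fromRows]
  simp

lemma lowerRow_mul_toCols₂ (U : Matrix (Fin m₁ ⊕ Fin m₂) (Fin m₁ ⊕ Fin m₂) ℂ) :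
    (lowerRow m₁ m₂ * U).toCols₂ =
      lowerRow m₁ m₂ * (U * (fromRows 0 1 : Matrix (Fin m₁ ⊕ Fin m₂) (Fin m₂) ℂ)) := by
  rw [← Matrix.mul_assoc]
  conv_rhs => rw [← fromCols_toCols (lowerRow m₁ m₂ * U), fromCols_mul_fromRows]
  simp

/-- The representation at `z = 0` with `F = I`, `A = 0`: `E I = γ₂`. -/
lemma IsTransmutation.opE_one (h : IsTransmutation l v E N)
    (hu : IsFundamentalSolution l v u) (hv : StronglyMeasurable v)
    (hvM : ∀ x, ‖v x‖ ≤ M) (hk : IsNodeDensity l v E k) {x : ℝ} (hx : x ∈ Icc 0 l) :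
    opE E (fun _ => (1 : Matrix (Fin m₂) (Fin m₂) ℂ)) x = (gammaFun u x).toCols₂ := by
  have hF : IsPrim l (fun _ : ℝ => (1 : Matrix (Fin m₂) (Fin m₂) ℂ))
      (fun x => (-(2 * (Complex.I * 0))) • (1 : Matrix (Fin m₂) (Fin m₂) ℂ) +
        k x * (0 : Matrix (Fin m₁) (Fin m₂) ℂ)) := by
    simpa using IsPrim.const (hx.1.trans hx.2) (1 : Matrix (Fin m₂) (Fin m₂) ℂ)
  have h1 := h.fundamental_mul hu hv hvM hk hF hx
  rw [gammaFun, lowerRow_mul_toCols₂, ← h1, lowerRow_mul_fromRows]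
  simp

/-- The primitive of the density, which is `E⁻¹ γ₁`. -/
noncomputable def nodePrim (k : ℝ → Matrix (Fin m₂) (Fin m₁) ℂ) (x : ℝ) :
    Matrix (Fin m₂) (Fin m₁) ℂ := ∫ t in (0 : ℝ)..x, k t

lemma IsNodeDensity.isPrim (hk : IsNodeDensity l v E k) (hl : 0 ≤ l) : IsPrim l (nodePrim k) k :=
  (isPrim_integral hl (hk.intervalIntegrable 0 l) 0).congr fun x _ => by simp [nodePrim]

/-- The representation at `z = 0` with `F = Φ₁`, `A = I`: `E Φ₁ = γ₁`. -/
lemma IsTransmutation.opE_nodePrim (h : IsTransmutation l v E N)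
    (hu : IsFundamentalSolution l v u) (hv : StronglyMeasurable v)
    (hvM : ∀ x, ‖v x‖ ≤ M) (hk : IsNodeDensity l v E k) {x : ℝ} (hx : x ∈ Icc 0 l) :
    opE E (nodePrim k) x = (gammaFun u x).toCols₁ := by
  have hF : IsPrim l (nodePrim k) (fun x => (-(2 * (Complex.I * 0))) • nodePrim k x +
        k x * (1 : Matrix (Fin m₁) (Fin m₁) ℂ)) := by
    simpa using hk.isPrim (hx.1.trans hx.2)
  have h1 := h.fundamental_mul hu hv hvM hk hF hx
  have h0 : nodePrim k 0 = 0 := by simp [nodePrim]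
  rw [h0] at h1
  rw [gammaFun, lowerRow_mul_toCols₁, ← h1, lowerRow_mul_fromRows]
  simp

section Gamma

variable (hu : IsFundamentalSolution l v u) (hv : StronglyMeasurable v)
  (hvM : ∀ x, ‖v x‖ ≤ M) (hl : 0 ≤ l)
include hu hv hvM hl

lemma betaFun_isPrim : IsPrim l (betaFun u) (fun x => v x * gammaFun u x) :=
  (hu.isDiracSol hv hvM hl 0).upper.congr_ae (Eventually.of_forall fun x => by simp [gammaFun])

lemma gammaFun_isPrim : IsPrim l (gammaFun u) (fun x => -((v x)ᴴ * betaFun u x)) :=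
  (hu.isDiracSol hv hvM hl 0).lower.congr_ae (Eventually.of_forall fun x => by simp [betaFun])

lemma fundamental_mul_conjTranspose {x : ℝ} (hx : x ∈ Icc 0 l) : u x 0 * (u x 0)ᴴ = 1 := by
  simpa using hu.mul_conjTranspose hv hvM hl 0 hx

lemma betaFun_mul_conjTranspose {x : ℝ} (hx : x ∈ Icc 0 l) :
    betaFun u x * (betaFun u x)ᴴ = 1 := by
  rw [betaFun, Matrix.conjTranspose_mul, Matrix.mul_assoc, ← Matrix.mul_assoc (u x 0),
    fundamental_mul_conjTranspose hu hv hvM hl hx, Matrix.one_mul, upperRow_mul_conjTranspose]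

lemma gammaFun_mul_conjTranspose {x : ℝ} (hx : x ∈ Icc 0 l) :
    gammaFun u x * (gammaFun u x)ᴴ = 1 := by
  rw [gammaFun, Matrix.conjTranspose_mul, Matrix.mul_assoc, ← Matrix.mul_assoc (u x 0),
    fundamental_mul_conjTranspose hu hv hvM hl hx, Matrix.one_mul, lowerRow_mul_conjTranspose]

lemma betaFun_mul_gammaFun {x : ℝ} (hx : x ∈ Icc 0 l) :
    betaFun u x * (gammaFun u x)ᴴ = 0 := by
  rw [betaFun, gammaFun, Matrix.conjTranspose_mul, Matrix.mul_assoc, ← Matrix.mul_assoc (u x 0),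
    fundamental_mul_conjTranspose hu hv hvM hl hx, Matrix.one_mul,
    upperRow_mul_lowerRow_conjTranspose]

lemma gammaFun_mul_betaFun {x : ℝ} (hx : x ∈ Icc 0 l) :
    gammaFun u x * (betaFun u x)ᴴ = 0 := by
  rw [betaFun, gammaFun, Matrix.conjTranspose_mul, Matrix.mul_assoc, ← Matrix.mul_assoc (u x 0),
    fundamental_mul_conjTranspose hu hv hvM hl hx, Matrix.one_mul,
    lowerRow_mul_upperRow_conjTranspose]

lemma conjTranspose_mul_betaFun_add {x : ℝ} (hx : x ∈ Icc 0 l) :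
    (betaFun u x)ᴴ * betaFun u x + (gammaFun u x)ᴴ * gammaFun u x = 1 := by
  rw [betaFun, gammaFun, ← conjTranspose_mul_eq_rows]
  simpa using hu.conjTranspose_mul hv hvM hl 0 hx

/-- The intertwining relation `E A = K E` up to the factor `-i`: for the primitive `F` of `f`, the
function `β* (N F) + γ* (E F)` has the derivative `γ* (E f)`, and multiplication by `γ` from the
left isolates `E F`, because `γ β* = 0` and `γ γ* = I`. -/
lemma IsTransmutation.opE_primitive (h : IsTransmutation l v E N)
    {f : ℝ → Matrix (Fin m₂) (Fin p) ℂ} (hf : IntervalIntegrable f volume 0 l) {x : ℝ}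
    (hx : x ∈ Icc 0 l) :
    opE E (fun x => ∫ t in (0 : ℝ)..x, f t) x =
      gammaFun u x * ∫ t in (0 : ℝ)..x, (gammaFun u t)ᴴ * opE E f t := by
  have hF : IsPrim l (fun x => ∫ t in (0 : ℝ)..x, f t) f := by
    simpa using isPrim_integral hl hf 0
  have hFi : IntervalIntegrable (fun x => ∫ t in (0 : ℝ)..x, f t) volume 0 l := by
    apply ContinuousOn.intervalIntegrable; rw [uIcc_of_le hl]; exact hF.continuousOn
  have hb := betaFun_isPrim hu hv hvM hl
  have hg := gammaFun_isPrim hu hv hvM hl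
  have key := (hb.adj.mul (h.isPrim_opN hv hvM hl hFi)).add
    (hg.adj.mul (h.isPrim_opE hv hvM hF))
  have key2 := (key.congr_ae (f' := fun x => (gammaFun u x)ᴴ * opE E f x)
    (Eventually.of_forall fun x => ?_)).eq x hx
  · rw [opN_zero, opE_zero] at key2
    simp only [intervalIntegral.integral_same, Matrix.mul_zero, add_zero, zero_add] at key2
    rw [← key2, Matrix.mul_add, ← Matrix.mul_assoc, ← Matrix.mul_assoc,
      gammaFun_mul_betaFun hu hv hvM hl hx, gammaFun_mul_conjTranspose hu hv hvM hl hx,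
      Matrix.zero_mul, Matrix.one_mul, zero_add]
  · simp only [Matrix.conjTranspose_mul, conjTranspose_neg, conjTranspose_conjTranspose,
      Matrix.mul_assoc, Matrix.mul_sub, Matrix.neg_mul]
    abel

lemma IsTransmutation.isSimilarityKernel (h : IsTransmutation l v E N)
    (hk : IsNodeDensity l v E k) : IsSimilarityKernel l (gammaFun u) E := by
  obtain ⟨C, _, hC⟩ := h.bound
  refine ⟨h.measE.aestronglyMeasurable, ⟨C, fun x t h0 htx hxl => (hC x ⟨(h0.trans htx).le, hxl.le⟩
    t ⟨h0.le, (htx.trans hxl).le⟩).1⟩, fun p f hf => ?_, ?_⟩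
  · have hfi : IntervalIntegrable f volume 0 l := by
      rw [intervalIntegrable_iff_integrableOn_Ioo_of_le hl]
      exact hf.integrable one_le_two
    refine ae_restrict_of_forall_mem measurableSet_Ioo fun x hx => ?_
    have hx' : x ∈ Icc 0 l := Ioo_subset_Icc_self hx
    have h1 := h.opE_primitive hu hv hvM hl hfi hx'
    have h2 : opE E (opA f) x = (-Complex.I) • opE E (fun x => ∫ t in (0 : ℝ)..x, f t) x := by
      simp only [opE, opA, smul_add, Matrix.mul_smul]
      rw [intervalIntegral.integral_smul]
    have hgE : IntervalIntegrable (fun t => (gammaFun u t)ᴴ * opE E f t) volume 0 l :=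
      (IsPrim.integrable_bilin (mulL _ _ _).flip (h.intervalIntegrable_opE hl hfi)
        (gammaFun_isPrim hu hv hvM hl).adj.continuousOn hl :)
    rw [h2, h1, opK, ← integral_const_matrix_mul _ (intervalIntegrable_of_mem hgE hx'),
      ← intervalIntegral.integral_smul]
    refine intervalIntegral.integral_congr fun t _ => ?_
    simp only [Matrix.mul_smul, Matrix.smul_mul, Matrix.mul_assoc]
  · exact ae_restrict_of_forall_mem measurableSet_Ioo fun x hx =>
      h.opE_one hu hv hvM hk (Ioo_subset_Icc_self hx)

end Gamma

/-! ### Exponential type estimates for the Weyl function -/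

/-- The truncated Laplace transform `∫₀ˣ e^{2izt} k(t) dt`. -/
noncomputable def lap (k : ℝ → Matrix (Fin m₂) (Fin m₁) ℂ) (z : ℂ) (x : ℝ) :
    Matrix (Fin m₂) (Fin m₁) ℂ := ∫ t in (0 : ℝ)..x, Complex.exp (2 * (Complex.I * z) * t) • k t

lemma IsNodeDensity.isPrim_lap (hk : IsNodeDensity l v E k) (hl : 0 ≤ l) (z : ℂ) :
    IsPrim l (lap k z) (fun t => Complex.exp (2 * (Complex.I * z) * t) • k t) := by
  refine (isPrim_integral hl ?_ 0).congr fun x _ => by simp [lap]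
  have hc : Continuous fun t : ℝ => Complex.exp (2 * (Complex.I * z) * t) := by fun_prop
  exact (hk.intervalIntegrable 0 l).continuousOn_smul hc.continuousOn

/-- The solution of `F' = -2izF + k` with `F(0) = w`. -/
noncomputable def freeSol (k : ℝ → Matrix (Fin m₂) (Fin m₁) ℂ) (z : ℂ)
    (w : Matrix (Fin m₂) (Fin m₁) ℂ) (x : ℝ) : Matrix (Fin m₂) (Fin m₁) ℂ :=
  Complex.exp (-(2 * (Complex.I * z)) * x) • (w + lap k z x)

lemma IsNodeDensity.isPrim_freeSol (hk : IsNodeDensity l v E k) (hl : 0 ≤ l) (z : ℂ)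
    (w : Matrix (Fin m₂) (Fin m₁) ℂ) :
    IsPrim l (freeSol k z w) (fun x => (-(2 * (Complex.I * z))) • freeSol k z w x +
      k x * (1 : Matrix (Fin m₁) (Fin m₁) ℂ)) := by
  have h := ((IsPrim.const hl w).add (hk.isPrim_lap hl z)).exp_smul (-(2 * (Complex.I * z)))
  refine h.congr_ae (Eventually.of_forall fun x => ?_)
  rw [smul_add, zero_add, smul_smul (Complex.exp _) (Complex.exp _), ← Complex.exp_add,
    neg_mul, neg_add_cancel, Complex.exp_zero, one_smul, Matrix.mul_one, freeSol, neg_mul,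
    smul_comm]

lemma freeSol_zero (z : ℂ) (w : Matrix (Fin m₂) (Fin m₁) ℂ) : freeSol k z w 0 = w := by
  simp [freeSol, lap]

/-- The representation of the solution with initial value `[I; w]`. -/
lemma IsTransmutation.fundamental_mul_graphCol (h : IsTransmutation l v E N)
    (hu : IsFundamentalSolution l v u) (hv : StronglyMeasurable v)
    (hvM : ∀ x, ‖v x‖ ≤ M) (hk : IsNodeDensity l v E k) (z : ℂ)
    (w : Matrix (Fin m₂) (Fin m₁) ℂ) {x : ℝ} (hx : x ∈ Icc 0 l) :
    fromRows (Complex.exp (Complex.I * z * x) • (1 + opN N (freeSol k z w) x))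
      (Complex.exp (Complex.I * z * x) • opE E (freeSol k z w) x) = u x z * graphCol w := by
  have := h.fundamental_mul hu hv hvM hk (hk.isPrim_freeSol (hx.1.trans hx.2) z w) hx
  rwa [freeSol_zero] at this

/-- A Volterra operator with bounded kernel is bounded from below in the uniform norm. -/
lemma IsTransmutation.norm_le_of_opE_le (h : IsTransmutation l v E N) :
    ∃ D, 0 ≤ D ∧ ∀ (p : ℕ) (F : ℝ → Matrix (Fin m₂) (Fin p) ℂ) (B : ℝ), ContinuousOn F (Icc 0 l) →
      (∀ x ∈ Icc 0 l, ‖opE E F x‖ ≤ B) → ∀ x ∈ Icc 0 l, ‖F x‖ ≤ B * D := by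
  obtain ⟨C, hC0, hC⟩ := h.bound
  refine ⟨Real.exp (C * l), (Real.exp_pos _).le, fun p F B hF hB x hx => ?_⟩
  have hFi : IntervalIntegrable F volume 0 l := by
    apply ContinuousOn.intervalIntegrable; rw [uIcc_of_le (hx.1.trans hx.2)]; exact hF
  have hB0 : 0 ≤ B := (norm_nonneg _).trans (hB x hx)
  refine (le_exp_of_le_integral hC0 hFi.norm (A := B) (fun x hx => ?_) x hx).trans
    (mul_le_mul_of_nonneg_left (Real.exp_le_exp.2 (mul_le_mul_of_nonneg_left hx.2 hC0)) hB0)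
  have e : F x = opE E F x - ∫ t in (0 : ℝ)..x, E x t * F t := by rw [opE]; abel
  calc ‖F x‖ ≤ ‖opE E F x‖ + ‖∫ t in (0 : ℝ)..x, E x t * F t‖ := by
        conv_lhs => rw [e]
        exact norm_sub_le _ _
    _ ≤ _ := add_le_add (hB x hx) (norm_volterra_le (fun x hx t ht => (hC x hx t ht).1) hFi hx)

/-- The Weyl function is the Laplace transform of `-k` up to an exponentially small error. For
`w` in the Weyl ball the solution with initial value `[I; w]` decays, its lower block is
`e^{izx} E F` with `F = e^{-2izx} (w + ∫₀ˣ e^{2izt} k(t) dt)`, and `E` is bounded from below. -/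
lemma IsTransmutation.norm_add_lap_le (h : IsTransmutation l v E N)
    (hu : IsFundamentalSolution l v u) (hv : StronglyMeasurable v)
    (hvM : ∀ x, ‖v x‖ ≤ M) (hk : IsNodeDensity l v E k) (hl : 0 ≤ l) :
    ∃ D, 0 ≤ D ∧ ∀ z ∈ halfPlane M, ∀ w ∈ weylBall M u l z, ∀ x ∈ Icc 0 l,
      ‖w + lap k z x‖ ≤ D * Real.exp (-(2 * z.im * x)) := by
  obtain ⟨D, hD0, hD⟩ := h.norm_le_of_opE_le
  have hM : 0 ≤ M := (norm_nonneg _).trans (hvM 0)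
  refine ⟨Real.exp (M * l) * D, mul_nonneg (Real.exp_pos _).le hD0, fun z hz w hw x hx => ?_⟩
  have hz' : M ≤ z.im := le_of_lt hz
  have hs := hu.isDiracSol_mul hv hvM hl z (graphCol w)
  have hend := hu.vnorm_le_of_mem_weylBall hv hvM hl hz hw
  have hE : ∀ t ∈ Icc 0 l, ‖opE E (freeSol k z w) t‖ ≤ Real.exp (M * l) := by
    intro t ht
    have h1 := hs.norm_upper_le_exp hvM hz' hend ht
    have h2 := norm_le_of_vnorm_le fun c => hs.vnorm_lower_le hvM hz' hend ht c
    have h0 : upperRow m₁ m₂ * (u 0 z * graphCol w) = 1 := by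
      rw [(hu z).1, Matrix.one_mul, graphCol, upperRow_mul_fromRows]
    rw [h0] at h1
    replace h2 := h2.trans h1
    rw [← h.fundamental_mul_graphCol hu hv hvM hk z w ht, lowerRow_mul_fromRows,
      norm_cexp_smul_ofReal] at h2
    have h3 := mul_le_mul_of_nonneg_right (norm_one_matrix_le (p := Fin m₁))
      (Real.exp_pos (-(z.im - M) * t)).le
    have h4 : Real.exp ((Complex.I * z).re * t) * ‖opE E (freeSol k z w) t‖ ≤
        Real.exp (-(z.im - M) * t) := by
      linarith
    have e1 : (Complex.I * z).re * t = -(z.im * t) := by simp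
    have e2 : -(z.im - M) * t = -(z.im * t) + M * t := by ring
    rw [e1, e2, Real.exp_add] at h4
    have h5 := le_of_mul_le_mul_left h4 (Real.exp_pos _)
    exact h5.trans (Real.exp_le_exp.2 (mul_le_mul_of_nonneg_left ht.2 hM))
  have hF := hD m₁ (freeSol k z w) _ (hk.isPrim_freeSol hl z w).continuousOn hE x hx
  rw [freeSol, norm_cexp_smul_ofReal] at hF
  have e1 : (-(2 * (Complex.I * z))).re * x = 2 * z.im * x := by simp
  rw [e1] at hF
  rw [Real.exp_neg, ← div_eq_mul_inv, le_div_iff₀ (Real.exp_pos _), mul_comm]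
  exact hF

end Node

/-! ### Contour estimates for truncated inverse Fourier integrals -/

section Contour

/-- The vertical sides of the contour contribute `O(1 / δ)`, uniformly in the height. -/
lemma norm_integral_exp_le {f : ℝ → ℂ} {η H δ B : ℝ} (hη : 0 < η) (hH : η ≤ H) (hδ : 0 < δ)
    (hB : 0 ≤ B) (hf : ∀ y ∈ Icc η H, ‖f y‖ ≤ B * Real.exp (-δ * y)) :
    ‖∫ y in η..H, f y‖ ≤ B / δ := by
  have h1 : ‖∫ y in η..H, f y‖ ≤ ∫ y in η..H, B * Real.exp (-δ * y) :=
    intervalIntegral.norm_integral_le_of_norm_le hH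
      (Eventually.of_forall fun y hy => hf y (Ioc_subset_Icc_self hy))
      (by apply Continuous.intervalIntegrable; fun_prop)
  refine h1.trans ?_
  rw [intervalIntegral.integral_const_mul, div_eq_mul_inv]
  refine mul_le_mul_of_nonneg_left ?_ hB
  have h2 : ∫ y in η..H, Real.exp (-δ * y) = (Real.exp (-δ * η) - Real.exp (-δ * H)) / δ := by
    have hd : ∀ y ∈ uIcc η H, HasDerivAt (fun y => -(Real.exp (-δ * y) / δ))
        (Real.exp (-δ * y)) y := fun y _ => by
      refine (((hasDerivAt_id' y).const_mul (-δ)).exp.div_const δ).neg.congr_deriv ?_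
      field_simp
    rw [intervalIntegral.integral_eq_sub_of_hasDerivAt hd
      (by apply Continuous.intervalIntegrable; fun_prop)]
    ring
  rw [h2, inv_eq_one_div]
  refine div_le_div_of_nonneg_right ?_ hδ.le
  have : Real.exp (-δ * η) ≤ 1 := Real.exp_le_one_iff.2 (by nlinarith)
  linarith [Real.exp_pos (-δ * H)]

/-- Shifting the contour upwards: only the vertical sides contribute. -/
lemma norm_lineIntegral_le {f : ℂ → ℂ} {M η δ D a : ℝ} (hf : DifferentiableOn ℂ f (halfPlane M))
    (hη : 0 < η) (hMη : M < η) (hδ : 0 < δ) (hD : 0 ≤ D) (ha : 0 < a)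
    (hb : ∀ z : ℂ, η ≤ z.im → ‖f z‖ ≤ D * Real.exp (-δ * z.im) / ‖z‖) :
    ‖∫ ξ in (-a)..a, f (ξ + Complex.I * η)‖ ≤ 2 * D / (a * δ) := by
  have key : ∀ H, η < H → ‖∫ ξ in (-a)..a, f (ξ + Complex.I * η)‖ ≤
      2 * D / (a * δ) + D * Real.exp (-δ * H) / η * (2 * a) := by
    intro H hH
    have hrect := Complex.integral_boundary_rect_eq_zero_of_differentiableOn f
      (⟨-a, η⟩ : ℂ) ⟨a, H⟩ (hf.mono fun z hz => by
        have := hz.2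
        simp only [mem_preimage, uIcc_of_le hH.le] at this
        exact hMη.trans_le this.1)
    simp only at hrect
    have hside : ∀ c : ℝ, |c| = a → ‖∫ y in η..H, f (c + y * Complex.I)‖ ≤ D / a / δ := by
      intro c hc
      refine norm_integral_exp_le hη hH.le hδ (by positivity) fun y hy => ?_
      have e : ((c : ℂ) + y * Complex.I).im = y := by simp
      refine (hb _ (by rw [e]; exact hy.1)).trans ?_
      rw [e, div_mul_eq_mul_div]
      refine div_le_div_of_nonneg_left (by positivity) ha ?_
      have := Complex.abs_re_le_norm ((c : ℂ) + y * Complex.I)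
      simpa [hc] using this
    have htop : ‖∫ x in (-a)..a, f (x + H * Complex.I)‖ ≤ D * Real.exp (-δ * H) / η * (2 * a) := by
      refine (intervalIntegral.norm_integral_le_of_norm_le_const
        (C := D * Real.exp (-δ * H) / η) fun x _ => ?_).trans (le_of_eq ?_)
      · have e : ((x : ℂ) + H * Complex.I).im = H := by simp
        refine (hb _ (by rw [e]; exact hH.le)).trans ?_
        rw [e]
        refine div_le_div_of_nonneg_left (by positivity) hη ?_
        have := Complex.abs_im_le_norm ((x : ℂ) + H * Complex.I)
        rw [e] at this
        exact hH.le.trans ((le_abs_self H).trans this)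
      · rw [abs_of_pos (by linarith)]; ring
    have h1 := hside a (abs_of_pos ha)
    have h2 := hside (-a) (by rw [abs_neg, abs_of_pos ha])
    have e : ∫ ξ in (-a)..a, f (ξ + Complex.I * η) = (∫ x in (-a)..a, f (x + H * Complex.I)) -
        Complex.I • (∫ y in η..H, f (a + y * Complex.I)) +
        Complex.I • (∫ y in η..H, f (((-a : ℝ) : ℂ) + y * Complex.I)) := by
      have : ∫ ξ in (-a)..a, f (ξ + Complex.I * η) = ∫ x in (-a)..a, f (x + η * Complex.I) := by
        simp only [mul_comm Complex.I]
      rw [this]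
      linear_combination hrect
    rw [e]
    have e2 : 2 * D / (a * δ) = D / a / δ + D / a / δ := by field_simp; ring
    have n1 : ‖Complex.I • ∫ y in η..H, f (a + y * Complex.I)‖ ≤ D / a / δ := by
      rw [norm_smul, Complex.norm_I, one_mul]; exact h1
    have n2 : ‖Complex.I • ∫ y in η..H, f (((-a : ℝ) : ℂ) + y * Complex.I)‖ ≤ D / a / δ := by
      rw [norm_smul, Complex.norm_I, one_mul]; exact h2
    refine (norm_add_le _ _).trans ?_
    have := norm_sub_le (∫ x in (-a)..a, f (x + H * Complex.I))
      (Complex.I • (∫ y in η..H, f (a + y * Complex.I)))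
    linarith
  have hlim : Tendsto (fun H => 2 * D / (a * δ) + D * Real.exp (-δ * H) / η * (2 * a)) atTop
      (𝓝 (2 * D / (a * δ) + D * 0 / η * (2 * a))) := by
    have h0 : Tendsto (fun H => Real.exp (-δ * H)) atTop (𝓝 0) := by
      simp only [neg_mul]
      exact Real.tendsto_exp_neg_atTop_nhds_zero.comp (tendsto_id.const_mul_atTop hδ)
    exact (((h0.const_mul D).div_const η).mul_const _).const_add _
  rw [mul_zero, zero_div, zero_mul, add_zero] at hlim
  exact ge_of_tendsto hlim ((eventually_gt_atTop η).mono key)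

/-- The truncated integral `∫ e^{isz} / (iz) dξ` along `Im z = η`. -/
noncomputable def jInt (η a s : ℝ) : ℂ :=
  ∫ ξ in (-a)..a, Complex.exp (Complex.I * s * (ξ + Complex.I * η)) /
    (Complex.I * (ξ + Complex.I * η))

lemma norm_exp_sub_one_le_mul_exp (w : ℂ) : ‖Complex.exp w - 1‖ ≤ ‖w‖ * Real.exp ‖w‖ := by
  simpa using Complex.norm_exp_sub_sum_le_norm_mul_exp w 1

lemma norm_line_ge (η ξ : ℝ) : η ≤ ‖(ξ : ℂ) + Complex.I * η‖ := by
  have := Complex.abs_im_le_norm ((ξ : ℂ) + Complex.I * η)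
  simp only [Complex.add_im, Complex.ofReal_im, Complex.mul_im, Complex.I_re, Complex.I_im,
    Complex.ofReal_re, zero_mul, one_mul, zero_add] at this
  exact (le_abs_self η).trans this

lemma line_ne_zero {η : ℝ} (hη : 0 < η) (ξ : ℝ) : (ξ : ℂ) + Complex.I * η ≠ 0 :=
  norm_pos_iff.1 (hη.trans_le (norm_line_ge η ξ))

lemma norm_jInt_le_of_pos {η a s : ℝ} (hη : 0 < η) (ha : 0 < a) (hs : 0 < s) :
    ‖jInt η a s‖ ≤ 2 / (a * s) := by
  have h := norm_lineIntegral_le (f := fun z => Complex.exp (Complex.I * s * z) / (Complex.I * z))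
    (M := 0) (D := 1) ?_ hη hη hs zero_le_one ha ?_
  · simpa [jInt] using h
  · intro z hz
    have hz0 : z ≠ 0 := by
      rintro rfl
      simp [halfPlane] at hz
    refine DifferentiableAt.differentiableWithinAt ?_
    refine DifferentiableAt.div (by fun_prop) (by fun_prop) (mul_ne_zero Complex.I_ne_zero hz0)
  · intro z _
    rw [norm_div, norm_mul, Complex.norm_I, one_mul, Complex.norm_exp, one_mul]
    have : (Complex.I * s * z).re = -s * z.im := by simp
    rw [this]

lemma jInt_zero {η a : ℝ} (hη : 0 < η) : jInt η a 0 = ((-(2 * Real.arctan (a / η)) : ℝ) : ℂ) := by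
  have hd : ∀ ξ ∈ uIcc (-a) a, HasDerivAt (fun ξ : ℝ =>
      -(Complex.I * (((1 / 2 * Real.log (ξ ^ 2 + η ^ 2) : ℝ)) : ℂ)) - ((Real.arctan (ξ / η) : ℝ) : ℂ))
      (1 / (Complex.I * (ξ + Complex.I * η))) ξ := by
    intro ξ _
    have hp : 0 < ξ ^ 2 + η ^ 2 := by positivity
    have h1 : HasDerivAt (fun ξ : ℝ => 1 / 2 * Real.log (ξ ^ 2 + η ^ 2)) (ξ / (ξ ^ 2 + η ^ 2)) ξ := by
      refine ((((hasDerivAt_id' ξ).pow 2).add_const (η ^ 2)).log hp.ne').const_mul (1 / 2)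
        |>.congr_deriv ?_
      simp
      field_simp
    have h2 : HasDerivAt (fun ξ : ℝ => Real.arctan (ξ / η)) (η / (ξ ^ 2 + η ^ 2)) ξ := by
      refine ((hasDerivAt_id' ξ).div_const η).arctan.congr_deriv ?_
      field_simp
      rw [add_comm]
    refine (((h1.ofReal_comp.const_mul Complex.I).neg).sub h2.ofReal_comp).congr_deriv ?_
    have hz := line_ne_zero hη ξ
    have hp' : (ξ : ℂ) ^ 2 + (η : ℂ) ^ 2 ≠ 0 := by exact_mod_cast hp.ne'
    push_cast
    rw [eq_div_iff (mul_ne_zero Complex.I_ne_zero hz)]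
    field_simp
    linear_combination (-(ξ : ℂ) ^ 2 - η ^ 2 - ξ * η * Complex.I) * Complex.I_sq
  have hc : Continuous fun ξ : ℝ => 1 / (Complex.I * ((ξ : ℂ) + Complex.I * η)) :=
    continuous_const.div (by fun_prop) fun ξ => mul_ne_zero Complex.I_ne_zero (line_ne_zero hη ξ)
  rw [jInt]
  simp only [Complex.ofReal_zero, mul_zero, zero_mul, Complex.exp_zero]
  rw [intervalIntegral.integral_eq_sub_of_hasDerivAt hd (hc.intervalIntegrable _ _), neg_sq,
    neg_div, Real.arctan_neg]
  push_cast
  ring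

lemma norm_jInt_zero_add_le {η a : ℝ} (hη : 0 < η) (ha : 0 < a) :
    ‖2 * jInt η a 0 + 2 * Real.pi‖ ≤ 4 * η / a := by
  have h := Real.arctan_inv_of_pos (show 0 < a / η by positivity)
  rw [inv_div] at h
  have e : 2 * jInt η a 0 + 2 * Real.pi = ((4 * Real.arctan (η / a) : ℝ) : ℂ) := by
    rw [jInt_zero hη, h]; push_cast; ring
  have h0 : 0 ≤ Real.arctan (η / a) := Real.arctan_nonneg.2 (by positivity)
  rw [e, Complex.norm_real, Real.norm_of_nonneg (by positivity), mul_div_assoc]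
  have h1 : Real.arctan (η / a) ≤ η / a := by
    have := Real.le_tan h0 (Real.arctan_lt_pi_div_two _)
    rwa [Real.tan_arctan] at this
  linarith

lemma norm_jInt_zero_le {η a : ℝ} (hη : 0 < η) : ‖jInt η a 0‖ ≤ Real.pi := by
  rw [jInt_zero hη, Complex.norm_real, Real.norm_eq_abs, abs_neg, abs_mul, abs_two]
  have h1 := Real.arctan_lt_pi_div_two (a / η)
  have h2 := Real.neg_pi_div_two_lt_arctan (a / η)
  have := abs_le.2 ⟨h2.le, h1.le⟩
  linarith

/-- Bound for small `s`. -/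
lemma norm_jInt_le_of_small {η a s L : ℝ} (hη : 0 < η) (ha : 0 < a) (hs : |s| ≤ L)
    (has : a * |s| ≤ 1) : ‖jInt η a s‖ ≤ 2 * Real.exp (1 + L * η) + Real.pi := by
  have hc : ∀ s : ℝ, Continuous fun ξ : ℝ => Complex.exp (Complex.I * s * (ξ + Complex.I * η)) /
      (Complex.I * (ξ + Complex.I * η)) := fun s =>
    Continuous.div (by fun_prop) (by fun_prop) fun ξ =>
      mul_ne_zero Complex.I_ne_zero (line_ne_zero hη ξ)
  have e : jInt η a s = (jInt η a s - jInt η a 0) + jInt η a 0 := by ring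
  rw [e]
  refine (norm_add_le _ _).trans (add_le_add ?_ (norm_jInt_zero_le hη))
  rw [jInt, jInt, ← intervalIntegral.integral_sub ((hc s).intervalIntegrable _ _)
    ((hc 0).intervalIntegrable _ _)]
  refine (intervalIntegral.norm_integral_le_of_norm_le_const
    (C := |s| * Real.exp (1 + L * η)) fun ξ hξ => ?_).trans ?_
  · have hz := line_ne_zero hη ξ
    have hzn : ‖(ξ : ℂ) + Complex.I * η‖ ≤ a + η := by
      refine (norm_add_le _ _).trans (add_le_add ?_ ?_)
      · rw [uIoc_of_le (by linarith)] at hξ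
        rw [Complex.norm_real, Real.norm_eq_abs]
        exact abs_le.2 ⟨hξ.1.le, hξ.2⟩
      · simp [abs_of_pos hη]
    rw [← sub_div, Complex.ofReal_zero, mul_zero, zero_mul, Complex.exp_zero, norm_div, norm_mul,
      Complex.norm_I, one_mul, div_le_iff₀ (norm_pos_iff.2 hz)]
    refine (norm_exp_sub_one_le_mul_exp _).trans ?_
    have e2 : ‖Complex.I * s * ((ξ : ℂ) + Complex.I * η)‖ = |s| * ‖(ξ : ℂ) + Complex.I * η‖ := by
      simp
    rw [e2]
    have e3 : |s| * ‖(ξ : ℂ) + Complex.I * η‖ ≤ 1 + L * η := by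
      have := mul_le_mul_of_nonneg_left hzn (abs_nonneg s)
      nlinarith
    have := mul_le_mul_of_nonneg_left (Real.exp_le_exp.2 e3)
      (show 0 ≤ |s| * ‖(ξ : ℂ) + Complex.I * η‖ by positivity)
    linarith
  · rw [abs_of_pos (by linarith : (0 : ℝ) < a - -a)]
    nlinarith [Real.exp_pos (1 + L * η)]

/-- The reflection identity: only the pole at the origin separates the lines `Im z = ± η`. -/
lemma norm_jInt_add_jInt_neg_le {η a s L : ℝ} (hη : 0 < η) (ha : 0 < a) (hs : |s| ≤ L) :
    ‖jInt η a s + jInt η a (-s) + 2 * Real.pi‖ ≤ (4 * η * (Real.exp (L * η) + 1) + 4 * η) / a := by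
  have hf : Differentiable ℂ (dslope (fun z => Complex.exp (Complex.I * s * z)) 0) := by
    have h : DifferentiableOn ℂ (fun z => Complex.exp (Complex.I * s * z)) univ :=
      Differentiable.differentiableOn (by fun_prop)
    rw [← Complex.differentiableOn_dslope (c := (0 : ℂ)) univ_mem, differentiableOn_univ] at h
    exact h
  set f := dslope (fun z => Complex.exp (Complex.I * s * z)) 0 with hfd
  have hfz : ∀ z : ℂ, z ≠ 0 → f z = (Complex.exp (Complex.I * s * z) - 1) / z := fun z hz => by
    rw [hfd, dslope_of_ne _ hz, slope_def_field]; simp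
  have hrect := Complex.integral_boundary_rect_eq_zero_of_differentiableOn f
      (⟨-a, -η⟩ : ℂ) ⟨a, η⟩ hf.differentiableOn
  simp only at hrect
  have hside : ∀ c : ℝ, |c| = a → ‖∫ y in (-η)..η, f (c + y * Complex.I)‖ ≤
      (Real.exp (L * η) + 1) / a * (2 * η) := by
    intro c hc
    refine (intervalIntegral.norm_integral_le_of_norm_le_const
      (C := (Real.exp (L * η) + 1) / a) fun y hy => ?_).trans (le_of_eq ?_)
    · have hn := Complex.abs_re_le_norm ((c : ℂ) + y * Complex.I)
      have e : ((c : ℂ) + y * Complex.I).re = c := by simp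
      rw [e, hc] at hn
      rw [hfz _ (norm_pos_iff.1 (ha.trans_le hn)), norm_div]
      refine div_le_div₀ (by positivity) ?_ ha hn
      refine (norm_sub_le _ _).trans ?_
      rw [norm_one, Complex.norm_exp]
      refine add_le_add_left (Real.exp_le_exp.2 ?_) 1
      have e2 : (Complex.I * s * ((c : ℂ) + y * Complex.I)).re = -(s * y) := by simp
      rw [e2]
      rw [uIoc_of_le (by linarith)] at hy
      have hyη : |y| ≤ η := abs_le.2 ⟨hy.1.le, hy.2⟩
      calc -(s * y) ≤ |s * y| := neg_le_abs _
        _ = |s| * |y| := abs_mul _ _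
        _ ≤ L * η := mul_le_mul hs hyη (abs_nonneg _) ((abs_nonneg s).trans hs)
    · rw [abs_of_pos (by linarith)]; ring
  have hc : ∀ s : ℝ, IntervalIntegrable (fun ξ : ℝ => Complex.exp (Complex.I * s *
      (ξ + Complex.I * η)) / (Complex.I * (ξ + Complex.I * η))) volume (-a) a := fun s =>
    (Continuous.div (by fun_prop) (by fun_prop) fun ξ =>
      mul_ne_zero Complex.I_ne_zero (line_ne_zero hη ξ)).intervalIntegrable _ _
  have hup : ∫ x in (-a)..a, f (x + η * Complex.I) = Complex.I * (jInt η a s - jInt η a 0) := by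
    rw [jInt, jInt, ← intervalIntegral.integral_sub (hc s) (hc 0),
      ← intervalIntegral.integral_const_mul]
    refine intervalIntegral.integral_congr fun ξ _ => ?_
    have hz := line_ne_zero hη ξ
    rw [mul_comm (η : ℂ), hfz _ hz]
    simp only [Complex.ofReal_zero, mul_zero, zero_mul, Complex.exp_zero]
    field_simp
  have hlow : ∫ x in (-a)..a, f (x + ((-η : ℝ) : ℂ) * Complex.I) =
      -(Complex.I * (jInt η a (-s) - jInt η a 0)) := by
    rw [jInt, jInt, ← intervalIntegral.integral_sub (hc (-s)) (hc 0),
      ← intervalIntegral.integral_const_mul, ← intervalIntegral.integral_neg]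
    have hrefl := intervalIntegral.integral_comp_neg (a := -a) (b := a)
      (fun x : ℝ => f (x + ((-η : ℝ) : ℂ) * Complex.I))
    rw [neg_neg] at hrefl
    rw [← hrefl]
    refine intervalIntegral.integral_congr fun ξ _ => ?_
    have hz := line_ne_zero hη ξ
    have e : ((-ξ : ℝ) : ℂ) + ((-η : ℝ) : ℂ) * Complex.I = -(ξ + Complex.I * η) := by
      push_cast; ring
    rw [e, hfz _ (neg_ne_zero.2 hz)]
    simp only [Complex.ofReal_zero, mul_zero, zero_mul, Complex.exp_zero, Complex.ofReal_neg,
      mul_neg, neg_mul]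
    field_simp
  rw [hup, hlow] at hrect
  have h1 := hside a (abs_of_pos ha)
  have h2 := hside (-a) (by rw [abs_neg, abs_of_pos ha])
  have h3 := norm_jInt_zero_add_le hη ha
  have e : jInt η a s + jInt η a (-s) + 2 * Real.pi = (2 * jInt η a 0 + 2 * Real.pi) +
      ((∫ y in (-η)..η, f (a + y * Complex.I)) -
        ∫ y in (-η)..η, f (((-a : ℝ) : ℂ) + y * Complex.I)) := by
    rw [smul_eq_mul, smul_eq_mul] at hrect
    have h4 : Complex.I * (jInt η a s + jInt η a (-s) - 2 * jInt η a 0) =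
      Complex.I * ((∫ y in (-η)..η, f (a + y * Complex.I)) -
        ∫ y in (-η)..η, f (((-a : ℝ) : ℂ) + y * Complex.I)) := by
      linear_combination -hrect
    have h5 := mul_left_cancel₀ Complex.I_ne_zero h4
    linear_combination h5
  rw [e]
  refine (norm_add_le _ _).trans ?_
  have h6 := norm_sub_le (∫ y in (-η)..η, f (a + y * Complex.I))
    (∫ y in (-η)..η, f (((-a : ℝ) : ℂ) + y * Complex.I))
  have e3 : (4 * η * (Real.exp (L * η) + 1) + 4 * η) / a = 4 * η / a +
    ((Real.exp (L * η) + 1) / a * (2 * η) + (Real.exp (L * η) + 1) / a * (2 * η)) := by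
    field_simp; ring
  linarith

/-- `∫ e^{isz} / (iz) dξ` converges to `-2π` or `0` according to the sign of `s`. -/
lemma exists_norm_jInt_le {η L : ℝ} (hη : 0 < η) : ∃ C, 0 ≤ C ∧ ∀ a s : ℝ, 1 ≤ a →
    s ≠ 0 → |s| ≤ L →
    ‖jInt η a s + (if s < 0 then 2 * (Real.pi : ℂ) else 0)‖ ≤ C / (√a * √|s|) := by
  set C₁ := 2 + (2 * Real.exp (1 + L * η) + Real.pi) with hC₁
  set C₂ := 4 * η * (Real.exp (L * η) + 1) + 4 * η with hC₂
  have hC₁0 : 0 ≤ C₁ := by have := Real.pi_pos; positivity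
  have hC₂0 : 0 ≤ C₂ := by positivity
  have hpos : ∀ a s : ℝ, 1 ≤ a → 0 < s → s ≤ L → ‖jInt η a s‖ ≤ C₁ / (√a * √s) := by
    intro a s ha hs hsL
    have ha0 : 0 < a := by linarith
    have hpi := Real.pi_pos
    have hE := Real.exp_pos (1 + L * η)
    rw [← Real.sqrt_mul ha0.le, le_div_iff₀ (Real.sqrt_pos.2 (by positivity))]
    rcases le_total (a * s) 1 with h | h
    · have h1 := norm_jInt_le_of_small hη ha0 (s := s) (L := L) (by rwa [abs_of_pos hs])
        (by rwa [abs_of_pos hs])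
      have h2 : √(a * s) ≤ 1 := Real.sqrt_le_one.2 h
      nlinarith [Real.sqrt_nonneg (a * s), norm_nonneg (jInt η a s)]
    · have h1 := norm_jInt_le_of_pos hη ha0 hs
      have h2 : √(a * s) ≤ a * s := by
        rw [Real.sqrt_le_left (by positivity)]; nlinarith
      rw [le_div_iff₀ (by positivity)] at h1
      nlinarith [norm_nonneg (jInt η a s)]
  refine ⟨C₁ + C₂ * √L, by positivity, fun a s ha hs hsL => ?_⟩
  have ha0 : 0 < a := by linarith
  rcases lt_or_gt_of_ne hs with h | h
  · rw [if_pos h, abs_of_neg h]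
    rw [abs_of_neg h] at hsL
    have h1 := hpos a (-s) ha (neg_pos.2 h) hsL
    have h2 := norm_jInt_add_jInt_neg_le (s := s) (L := L) hη ha0 (by rwa [abs_of_neg h])
    have e : jInt η a s + 2 * Real.pi = (jInt η a s + jInt η a (-s) + 2 * Real.pi) -
      jInt η a (-s) := by ring
    rw [e]
    refine (norm_sub_le _ _).trans ?_
    rw [add_div, add_comm]
    refine add_le_add h1 (h2.trans ?_)
    rw [div_le_div_iff₀ ha0 (mul_pos (Real.sqrt_pos.2 ha0) (Real.sqrt_pos.2 (neg_pos.2 h)))]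
    suffices h0 : √a * √(-s) ≤ √L * a by
      have := mul_le_mul_of_nonneg_left h0 hC₂0
      rw [← hC₂]; linarith
    have h3 : √(-s) ≤ √L := Real.sqrt_le_sqrt hsL
    have h4 : √a ≤ a := by rw [Real.sqrt_le_left ha0.le]; nlinarith
    have := mul_le_mul h4 h3 (Real.sqrt_nonneg _) ha0.le
    linarith
  · rw [if_neg (not_lt.2 h.le), add_zero, abs_of_pos h]
    rw [abs_of_pos h] at hsL
    refine (hpos a s ha h hsL).trans ?_
    refine div_le_div_of_nonneg_right ?_ (by positivity)
    nlinarith [Real.sqrt_nonneg L, mul_nonneg hC₂0 (Real.sqrt_nonneg L)]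

end Contour

/-! ### Recovery of `Φ₁` from the Weyl function -/

section InverseFourier

lemma integral_inv_sqrt {L : ℝ} (hL : 0 ≤ L) :
    IntervalIntegrable (fun s : ℝ => 1 / √|s|) volume (-L) L ∧
      ∫ s in (-L)..L, 1 / √|s| = 4 * √L := by
  have e : ∀ s : ℝ, 0 ≤ s → 1 / √|s| = s ^ (-(1 / 2) : ℝ) := fun s hs => by
    rw [abs_of_nonneg hs, Real.sqrt_eq_rpow, Real.rpow_neg hs, one_div]
  have h1 : IntervalIntegrable (fun s : ℝ => 1 / √|s|) volume 0 L := by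
    refine (intervalIntegral.intervalIntegrable_rpow' (a := 0) (b := L)
      (show (-1 : ℝ) < -(1 / 2) by norm_num)).congr fun s hs => ?_
    rw [uIoc_of_le hL] at hs
    exact (e s hs.1.le).symm
  have h2 : IntervalIntegrable (fun s : ℝ => 1 / √|s|) volume (-L) 0 := by
    have := (IntervalIntegrable.iff_comp_neg (by simp)).1 h1
    simpa using this.symm
  have h3 : ∫ s in (0 : ℝ)..L, 1 / √|s| = 2 * √L := by
    rw [intervalIntegral.integral_congr (g := fun s => s ^ (-(1 / 2) : ℝ)) fun s hs => by
      rw [uIcc_of_le hL] at hs; exact e s hs.1, integral_rpow (Or.inl (by norm_num))]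
    rw [Real.zero_rpow (by norm_num), Real.sqrt_eq_rpow]
    norm_num
    ring
  refine ⟨h2.trans h1, ?_⟩
  have h4 := intervalIntegral.integral_comp_neg (a := 0) (b := L) (fun s : ℝ => 1 / √|s|)
  simp only [abs_neg, neg_zero] at h4
  rw [← intervalIntegral.integral_add_adjacent_intervals h2 h1, ← h4, h3]
  ring

/-- The trivial bound for the integral of a function of order `1 / |z|` along a line. -/
lemma norm_lineIntegral_le_sqrt {f : ℂ → ℂ} {η D a : ℝ} (hη : 0 < η) (hD : 0 ≤ D) (ha : 0 < a)
    (hb : ∀ z : ℂ, z.im = η → ‖f z‖ ≤ D / ‖z‖) :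
    ‖∫ ξ in (-a)..a, f (ξ + Complex.I * η)‖ ≤ D / √η * (4 * √a) := by
  obtain ⟨h1, h2⟩ := integral_inv_sqrt ha.le
  rw [← h2, ← intervalIntegral.integral_const_mul]
  have hne : ∀ᵐ ξ : ℝ, ξ ≠ 0 := by simp [ae_iff]
  refine intervalIntegral.norm_integral_le_of_norm_le (by linarith) (hne.mono fun ξ hξ0 _ => ?_)
    (h1.const_mul _)
  have e : ((ξ : ℂ) + Complex.I * η).im = η := by simp
  refine (hb _ e).trans ?_
  have hp : 0 < √η * √|ξ| := mul_pos (Real.sqrt_pos.2 hη) (Real.sqrt_pos.2 (abs_pos.2 hξ0))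
  rw [div_mul_div_comm, mul_one]
  refine div_le_div_of_nonneg_left hD hp ?_
  rw [← Real.sqrt_mul hη.le, Complex.norm_def]
  refine Real.sqrt_le_sqrt ?_
  rw [Complex.normSq_apply, e]
  have e2 : ((ξ : ℂ) + Complex.I * η).re = ξ := by simp
  rw [e2, ← abs_mul_abs_self ξ]
  nlinarith [sq_nonneg (|ξ| - η), abs_nonneg ξ]

/-- The finite Laplace transform of an integrable function is entire. -/
lemma differentiable_integral_exp {V : Type*} [NormedAddCommGroup V] [NormedSpace ℂ V]
    [CompleteSpace V] {g : ℝ → V} {s t : ℝ} (hg : IntervalIntegrable g volume s t)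
    (c : ℂ) : Differentiable ℂ fun z : ℂ => ∫ x in s..t, Complex.exp (c * z * x) • g x := by
  intro z
  have hcont : ∀ z : ℂ, Continuous fun x : ℝ => Complex.exp (c * z * x) := fun z => by fun_prop
  have hint : ∀ z : ℂ, IntervalIntegrable (fun x : ℝ => Complex.exp (c * z * x) • g x) volume s t :=
    fun z => hg.continuousOn_smul (hcont z).continuousOn
  set B := |s| + |t| with hB
  have hxB : ∀ x ∈ uIoc s t, |x| ≤ B := by
    intro x hx
    rcases le_total s t with h | h
    · rw [uIoc_of_le h] at hx
      exact abs_le.2 ⟨by linarith [neg_abs_le s, abs_nonneg t, hx.1], by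
        linarith [le_abs_self t, abs_nonneg s, hx.2]⟩
    · rw [uIoc_of_ge h] at hx
      exact abs_le.2 ⟨by linarith [neg_abs_le t, abs_nonneg s, hx.1], by
        linarith [le_abs_self s, abs_nonneg t, hx.2]⟩
  have hB0 : 0 ≤ B := by positivity
  set W := Real.exp (‖c‖ * (‖z‖ + 1) * B) * (‖c‖ * B) with hW
  refine (intervalIntegral.hasDerivAt_integral_of_dominated_loc_of_deriv_le
    (F := fun z x => Complex.exp (c * z * x) • g x)
    (F' := fun z x => (Complex.exp (c * z * x) * (c * x)) • g x)
    (bound := fun x => W * ‖g x‖) (Metric.ball_mem_nhds z one_pos)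
    (Eventually.of_forall fun z => ?_) (hint z) ?_ ?_ (hg.norm.const_mul W)
    ?_).2.differentiableAt
  · have h := hint z
    rw [intervalIntegrable_iff] at h
    exact h.aestronglyMeasurable
  · have h : IntervalIntegrable (fun x : ℝ => (Complex.exp (c * z * x) * (c * x)) • g x) volume s t :=
      hg.continuousOn_smul (Continuous.continuousOn (by fun_prop))
    rw [intervalIntegrable_iff] at h
    exact h.aestronglyMeasurable
  · refine Eventually.of_forall fun x hx w hw => ?_
    have hwn : ‖w‖ ≤ ‖z‖ + 1 := by
      rw [mem_ball_iff_norm] at hw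
      have := norm_sub_norm_le w z
      linarith
    have hx' := hxB x hx
    rw [norm_smul, norm_mul]
    refine mul_le_mul_of_nonneg_right ?_ (norm_nonneg _)
    refine mul_le_mul ?_ ?_ (norm_nonneg _) (Real.exp_pos _).le
    · rw [Complex.norm_exp]
      refine Real.exp_le_exp.2 ((Complex.re_le_norm _).trans ?_)
      rw [norm_mul, norm_mul, Complex.norm_real, Real.norm_eq_abs]
      exact mul_le_mul (mul_le_mul_of_nonneg_left hwn (norm_nonneg _)) hx' (abs_nonneg _)
        (by positivity)
    · rw [norm_mul, Complex.norm_real, Real.norm_eq_abs]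
      exact mul_le_mul_of_nonneg_left hx' (norm_nonneg _)
  · refine Eventually.of_forall fun x _ w _ => ?_
    have h1 : HasDerivAt (fun w : ℂ => c * w * x) (c * x) w := by
      have := ((hasDerivAt_id' w).const_mul c).mul_const (x : ℂ)
      simpa using this
    exact h1.cexp.smul_const (g x)

variable {l M η K D : ℝ} {κ : ℝ → ℂ} {φ : ℂ → ℂ}

/-- Interpolation between the two bounds for the remainder. The weights `3/5` and `2/5` leave a
factor `a ^ (-1/10)` that tends to zero, and a majorant `δ ^ (-2/5)` that is square integrable at
`δ = 0`, since `2 · 2/5 < 1`. -/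
lemma le_rpow_of_le {B P Q a δ : ℝ} (hB : 0 ≤ B) (hP : 0 ≤ P) (hQ : 0 ≤ Q) (ha : 0 < a) (hδ : 0 < δ)
    (h1 : B ≤ P * √a) (h2 : B ≤ Q / (a * δ)) :
    B ≤ (P + Q) * a ^ (-(1 / 10) : ℝ) * δ ^ (-(2 / 5) : ℝ) := by
  have e : B = B ^ (3 / 5 : ℝ) * B ^ (2 / 5 : ℝ) := by
    rw [← Real.rpow_add' hB (by norm_num)]; norm_num
  have b1 : B ^ (3 / 5 : ℝ) ≤ ((P + Q) * a ^ (1 / 2 : ℝ)) ^ (3 / 5 : ℝ) := by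
    refine Real.rpow_le_rpow hB (h1.trans ?_) (by norm_num)
    rw [Real.sqrt_eq_rpow]
    exact mul_le_mul_of_nonneg_right (by linarith) (by positivity)
  have b2 : B ^ (2 / 5 : ℝ) ≤ ((P + Q) * (a ^ (-1 : ℝ) * δ ^ (-1 : ℝ))) ^ (2 / 5 : ℝ) := by
    refine Real.rpow_le_rpow hB (h2.trans ?_) (by norm_num)
    rw [Real.rpow_neg_one, Real.rpow_neg_one, ← mul_inv, ← div_eq_mul_inv]
    exact div_le_div_of_nonneg_right (by linarith) (by positivity)
  rw [e]
  refine (mul_le_mul b1 b2 (by positivity) (by positivity)).trans (le_of_eq ?_)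
  have hPQ : 0 ≤ P + Q := by positivity
  rw [Real.mul_rpow hPQ (by positivity), Real.mul_rpow hPQ (by positivity),
    Real.mul_rpow (by positivity) (by positivity), ← Real.rpow_mul ha.le, ← Real.rpow_mul ha.le,
    ← Real.rpow_mul hδ.le]
  have e1 : (P + Q) ^ (3 / 5 : ℝ) * (P + Q) ^ (2 / 5 : ℝ) = P + Q := by
    rw [← Real.rpow_add' hPQ (by norm_num)]; norm_num
  have e2 : a ^ (1 / 2 * (3 / 5) : ℝ) * a ^ (-1 * (2 / 5) : ℝ) = a ^ (-(1 / 10) : ℝ) := by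
    rw [← Real.rpow_add ha]; norm_num
  have e3 : δ ^ (-1 * (2 / 5) : ℝ) = δ ^ (-(2 / 5) : ℝ) := by norm_num
  rw [← e2, e3]
  linear_combination a ^ (1 / 2 * (3 / 5) : ℝ) * a ^ (-1 * (2 / 5) : ℝ) * δ ^ (-(2 / 5) : ℝ) * e1

lemma exp_line (x η ξ : ℝ) : Complex.exp (-(Complex.I * x * (ξ + Complex.I * η))) =
    ((Real.exp (x * η) : ℝ) : ℂ) * Complex.exp (-(Complex.I * x * ξ)) := by
  rw [Complex.ofReal_exp, ← Complex.exp_add]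
  congr 1
  push_cast
  linear_combination (-(x : ℂ) * η) * Complex.I_sq

/-- The contribution of the remainder of the Weyl function. -/
lemma exists_norm_remainder_le (hη : 0 < η) (hMη : M < η) (hD : 0 ≤ D)
    {R : ℂ → ℂ} (hR : DifferentiableOn ℂ R (halfPlane M))
    (hRD : ∀ z ∈ halfPlane M, ‖R z‖ ≤ D * Real.exp (-(2 * z.im * l))) :
    ∃ C, 0 ≤ C ∧ ∀ a x : ℝ, 0 < a → x ∈ Ioo 0 (2 * l) →
      ‖∫ ξ in (-a)..a, Complex.exp (-(Complex.I * x * (ξ + Complex.I * η))) *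
        (R (ξ + Complex.I * η) / (2 * Complex.I * (ξ + Complex.I * η)))‖ ≤
        C * a ^ (-(1 / 10) : ℝ) * (2 * l - x) ^ (-(2 / 5) : ℝ) := by
  refine ⟨D / √η * 4 + 2 * D, by positivity, fun a x ha hx => ?_⟩
  have hδ : 0 < 2 * l - x := by linarith [hx.2]
  set f : ℂ → ℂ := fun z => Complex.exp (-(Complex.I * x * z)) * (R z / (2 * Complex.I * z)) with hf
  have hb : ∀ z : ℂ, η ≤ z.im → ‖f z‖ ≤ D * Real.exp (-(2 * l - x) * z.im) / ‖z‖ := by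
    intro z hz
    have h1 := hRD z (hMη.trans_le hz)
    rw [hf, norm_mul, norm_div, norm_mul, norm_mul, Complex.norm_exp, Complex.norm_I,
      Complex.norm_ofNat, mul_one]
    have e : (-(Complex.I * x * z)).re = x * z.im := by simp
    have hz0 : 0 < ‖z‖ := hη.trans_le (hz.trans (Complex.im_le_norm z))
    rw [e, ← mul_div_assoc]
    have e2 : Real.exp (-(2 * l - x) * z.im) =
        Real.exp (x * z.im) * Real.exp (-(2 * z.im * l)) := by
      rw [← Real.exp_add]; ring_nf
    rw [e2]
    refine div_le_div₀ (by positivity) ?_ hz0 (by linarith)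
    have := mul_le_mul_of_nonneg_left h1 (Real.exp_pos (x * z.im)).le
    linarith
  -- for negative `M` the half-plane `ℂ_M` contains the pole `z = 0`
  have hdiff : DifferentiableOn ℂ f (halfPlane (max M 0)) := by
    intro z hz
    have hzM : z ∈ halfPlane M := (le_max_left M 0).trans_lt hz
    have hz0 : z ≠ 0 := by
      rintro rfl
      have : (0 : ℝ) < (0 : ℂ).im := (le_max_right M 0).trans_lt hz
      simp at this
    have hop : IsOpen (halfPlane M) := isOpen_lt continuous_const Complex.continuous_im
    have hRz : DifferentiableAt ℂ R z := (hR z hzM).differentiableAt (hop.mem_nhds hzM)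
    refine DifferentiableAt.differentiableWithinAt (DifferentiableAt.mul (by fun_prop) ?_)
    exact hRz.div (by fun_prop) (by simp [hz0])
  have h2 := norm_lineIntegral_le hdiff hη (max_lt hMη hη) hδ hD ha hb
  have h1 := norm_lineIntegral_le_sqrt hη hD ha (f := f) fun z hz => (hb z hz.ge).trans <| by
    refine div_le_div_of_nonneg_right (mul_le_of_le_one_right hD (Real.exp_le_one_iff.2 ?_))
      (norm_nonneg _)
    rw [hz]; nlinarith
  exact le_rpow_of_le (norm_nonneg _) (by positivity) (by positivity) ha hδ
    (h1.trans (le_of_eq (by ring))) h2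

/-- The contribution of the Laplace transform of a bounded function. -/
lemma exists_norm_transform_le (hl : 0 < l) (hη : 0 < η) (hκ : StronglyMeasurable κ)
    (hK : ∀ t, ‖κ t‖ ≤ K) :
    ∃ C, 0 ≤ C ∧ ∀ a x : ℝ, 1 ≤ a → x ∈ Ioo 0 (2 * l) →
      ‖(∫ t in (0 : ℝ)..x / 2, κ t) + 1 / Real.pi *
        ∫ ξ in (-a)..a, Complex.exp (-(Complex.I * x * (ξ + Complex.I * η))) *
          ((∫ t in (0 : ℝ)..l, Complex.exp (2 * Complex.I * (ξ + Complex.I * η) * t) * κ t) /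
            (2 * Complex.I * (ξ + Complex.I * η)))‖ ≤ C / √a := by
  obtain ⟨C, hC0, hC⟩ := exists_norm_jInt_le hη (L := 2 * l)
  have hK0 : 0 ≤ K := (norm_nonneg _).trans (hK 0)
  have hpi := Real.pi_pos
  refine ⟨1 / (2 * Real.pi) * (K * C * (2 * √(2 * l))), by positivity, fun a x ha hx => ?_⟩
  have ha0 : 0 < a := by linarith
  have hpiC : (Real.pi : ℂ) ≠ 0 := by exact_mod_cast hpi.ne'
  have hκi : ∀ s t, IntervalIntegrable κ volume s t := fun s t =>
    intervalIntegrable_of_bdd (C := K) hκ.aestronglyMeasurable fun x _ => hK x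
  have hx2 : x / 2 ∈ Icc 0 l := ⟨by linarith [hx.1], by linarith [hx.2]⟩
  let Z : ℝ → ℂ := fun ξ => ξ + Complex.I * η
  have hZ0 : ∀ ξ, Z ξ ≠ 0 := fun ξ => line_ne_zero hη ξ
  -- interchange of the order of integration
  have hswap : ∫ ξ in (-a)..a, Complex.exp (-(Complex.I * x * (ξ + Complex.I * η))) *
          ((∫ t in (0 : ℝ)..l, Complex.exp (2 * Complex.I * (ξ + Complex.I * η) * t) * κ t) /
            (2 * Complex.I * (ξ + Complex.I * η))) =
      1 / 2 * ∫ t in (0 : ℝ)..l, κ t * jInt η a (2 * t - x) := by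
    let q : ℝ → ℝ → ℂ := fun ξ t => κ t * (1 / 2 * (Complex.exp (Complex.I * ((2 * t - x : ℝ) : ℂ) *
      (ξ + Complex.I * η)) / (Complex.I * (ξ + Complex.I * η))))
    have hL : ∀ ξ : ℝ, Complex.exp (-(Complex.I * x * (ξ + Complex.I * η))) *
          ((∫ t in (0 : ℝ)..l, Complex.exp (2 * Complex.I * (ξ + Complex.I * η) * t) * κ t) /
            (2 * Complex.I * (ξ + Complex.I * η))) = ∫ t in (0 : ℝ)..l, q ξ t := by
      intro ξ
      rw [← intervalIntegral.integral_div, ← intervalIntegral.integral_const_mul]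
      refine intervalIntegral.integral_congr fun t _ => ?_
      have hz := hZ0 ξ
      have e : Complex.exp (Complex.I * ((2 * t - x : ℝ) : ℂ) * (ξ + Complex.I * η)) =
          Complex.exp (-(Complex.I * x * (ξ + Complex.I * η))) *
          Complex.exp (2 * Complex.I * (ξ + Complex.I * η) * t) := by
        rw [← Complex.exp_add]; congr 1; push_cast; ring
      simp only [q, e]
      rw [mul_assoc 2 Complex.I, div_mul_eq_div_div]
      ring
    simp only [hL]
    have hqm : StronglyMeasurable (Function.uncurry q) := by
      refine (hκ.comp_measurable measurable_snd).mul ?_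
      have : Continuous fun p : ℝ × ℝ => (1 / 2 * (Complex.exp (Complex.I *
          ((2 * p.2 - x : ℝ) : ℂ) * (p.1 + Complex.I * η)) /
            (Complex.I * (p.1 + Complex.I * η))) : ℂ) :=
        continuous_const.mul (Continuous.div (by fun_prop) (by fun_prop) fun p =>
          mul_ne_zero Complex.I_ne_zero (hZ0 p.1))
      exact this.stronglyMeasurable
    have hqb : ∀ ξ ∈ Ioc (-a) a, ∀ t ∈ Ioc 0 l, ‖q ξ t‖ ≤ K * (Real.exp (2 * l * η) / η) := by
      intro ξ _ t ht
      refine _root_.norm_mul_le_of_le (hK t) ?_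
      rw [norm_mul, norm_div (Complex.exp _), norm_mul Complex.I, Complex.norm_I, one_mul,
        Complex.norm_exp]
      have e : (Complex.I * ((2 * t - x : ℝ) : ℂ) * ((ξ : ℂ) + Complex.I * η)).re =
          -((2 * t - x) * η) := by simp
      rw [e]
      have h1 : Real.exp (-((2 * t - x) * η)) ≤ Real.exp (2 * l * η) :=
        Real.exp_le_exp.2 (by nlinarith [ht.1, hx.2])
      have h2 := div_le_div₀ (Real.exp_pos _).le h1 hη (norm_line_ge η ξ)
      have h3 : ‖(1 / 2 : ℂ)‖ ≤ 1 := by norm_num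
      exact (mul_le_of_le_one_left (by positivity) h3).trans h2
    have hqi : IntegrableOn (Function.uncurry q) (uIoc (-a) a ×ˢ uIoc 0 l) := by
      rw [uIoc_of_le (by linarith), uIoc_of_le hl.le]
      refine Measure.integrableOn_of_bounded (M := K * (Real.exp (2 * l * η) / η)) ?_
        hqm.aestronglyMeasurable ?_
      · rw [Measure.volume_eq_prod, Measure.prod_prod]
        exact ENNReal.mul_ne_top measure_Ioc_lt_top.ne measure_Ioc_lt_top.ne
      · exact ae_restrict_of_forall_mem (measurableSet_Ioc.prod measurableSet_Ioc)
          fun p hp => hqb _ hp.1 _ hp.2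
    rw [intervalIntegral_intervalIntegral_swap hqi,
      ← intervalIntegral.integral_const_mul]
    refine intervalIntegral.integral_congr fun t _ => ?_
    simp only [q]
    rw [intervalIntegral.integral_const_mul, intervalIntegral.integral_const_mul, jInt]
    ring
  have i1 : IntervalIntegrable (fun t => κ t * (if 2 * t - x < 0 then 2 * (Real.pi : ℂ) else 0))
      volume 0 l := by
    refine intervalIntegrable_of_bdd (C := K * (2 * Real.pi)) ?_ fun t _ => ?_
    · refine (hκ.mul (StronglyMeasurable.ite ?_ stronglyMeasurable_const
        stronglyMeasurable_const)).aestronglyMeasurable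
      exact measurableSet_lt (by fun_prop) measurable_const
    · refine _root_.norm_mul_le_of_le (hK t) ?_
      split_ifs
      · simp [abs_of_pos hpi]
      · simp [hpi.le]
  have hind : ∫ t in (0 : ℝ)..x / 2, κ t =
      1 / (2 * Real.pi) * ∫ t in (0 : ℝ)..l, κ t * (if 2 * t - x < 0 then 2 * (Real.pi : ℂ) else 0) := by
    have e1 : ∫ t in (0 : ℝ)..l, κ t * (if 2 * t - x < 0 then 2 * (Real.pi : ℂ) else 0) =
        ∫ t in (0 : ℝ)..x / 2, κ t * (2 * Real.pi) := by
      rw [← intervalIntegral.integral_add_adjacent_intervals (intervalIntegrable_of_mem i1 hx2)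
        ((intervalIntegrable_of_mem i1 hx2).symm.trans i1)]
      have z1 : ∫ t in (x / 2)..l, κ t * (if 2 * t - x < 0 then 2 * (Real.pi : ℂ) else 0) = 0 := by
        refine (intervalIntegral.integral_congr (g := fun _ => 0) fun t ht => ?_).trans
          intervalIntegral.integral_zero
        rw [uIcc_of_le hx2.2] at ht
        rw [if_neg (by linarith [ht.1]), mul_zero]
      rw [z1, add_zero]
      refine intervalIntegral.integral_congr_ae ?_
      have hne : ∀ᵐ t : ℝ, t ≠ x / 2 := by simp [ae_iff]
      filter_upwards [hne] with t hne ht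
      rw [uIoc_of_le hx2.1] at ht
      rw [if_pos]
      have := lt_of_le_of_ne ht.2 hne
      linarith
    rw [e1, intervalIntegral.integral_mul_const]
    field_simp
  have hJc : Continuous fun t => jInt η a (2 * t - x) := by
    have hc : Continuous (fun s => jInt η a s) := by
      unfold jInt
      refine intervalIntegral.continuous_parametric_intervalIntegral_of_continuous' ?_ _ _
      refine Continuous.div (by fun_prop) (by fun_prop) fun p => ?_
      exact mul_ne_zero Complex.I_ne_zero (hZ0 p.2)
    exact hc.comp (by fun_prop)
  have i2 : IntervalIntegrable (fun t => κ t * jInt η a (2 * t - x)) volume 0 l :=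
    (hκi 0 l).mul_continuousOn hJc.continuousOn
  have e : (∫ t in (0 : ℝ)..x / 2, κ t) + 1 / Real.pi *
      (1 / 2 * ∫ t in (0 : ℝ)..l, κ t * jInt η a (2 * t - x)) =
      1 / (2 * Real.pi) * ∫ t in (0 : ℝ)..l, κ t * (jInt η a (2 * t - x) +
        if 2 * t - x < 0 then 2 * (Real.pi : ℂ) else 0) := by
    simp only [mul_add]
    rw [intervalIntegral.integral_add i2 i1, mul_add, ← hind]
    field_simp
    ring
  obtain ⟨s1, s2⟩ := integral_inv_sqrt (L := 2 * l) (by linarith)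
  have s3 : IntervalIntegrable (fun t => 1 / √|2 * t - x|) volume 0 l := by
    have h := (s1.mono_set (c := -x) (d := 2 * l - x) (by
      rw [uIcc_of_le (by linarith), uIcc_of_le (by linarith)]
      exact Icc_subset_Icc (by linarith [hx.2]) (by linarith [hx.1])))
    have := (h.comp_sub_right x).comp_mul_left (c := 2)
    simpa using this
  have s4 : ∫ t in (0 : ℝ)..l, 1 / √|2 * t - x| ≤ 2 * √(2 * l) := by
    rw [intervalIntegral.integral_comp_mul_sub (fun s => 1 / √|s|) two_ne_zero, smul_eq_mul]
    have := intervalIntegral.integral_mono_interval (f := fun s : ℝ => 1 / √|s|) (μ := volume)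
      (a := 2 * 0 - x) (b := 2 * l - x) (c := -(2 * l)) (d := 2 * l) (by linarith [hx.2])
      (by linarith) (by linarith [hx.1]) (Eventually.of_forall fun s => by positivity) s1
    rw [s2] at this
    linarith
  rw [hswap, e, norm_mul]
  have n1 : ‖(1 / (2 * Real.pi) : ℂ)‖ = 1 / (2 * Real.pi) := by
    simp [abs_of_pos hpi]
  rw [n1, mul_div_assoc]
  refine mul_le_mul_of_nonneg_left ?_ (by positivity)
  have hne : ∀ᵐ t : ℝ, t ≠ x / 2 := by simp [ae_iff]
  refine (intervalIntegral.norm_integral_le_of_norm_le hl.le (g := fun t => K * C / √a *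
    (1 / √|2 * t - x|)) (hne.mono fun t hne ht => ?_) (s3.const_mul _)).trans ?_
  · refine (_root_.norm_mul_le_of_le (hK t) (hC a _ ha (fun h => hne (by linarith)) ?_)).trans
      (le_of_eq ?_)
    · exact abs_le.2 ⟨by linarith [ht.1, hx.2], by linarith [ht.2, hx.1]⟩
    · field_simp
  · rw [intervalIntegral.integral_const_mul]
    refine (mul_le_mul_of_nonneg_left s4 (by positivity)).trans (le_of_eq ?_)
    ring

lemma memLp_sub_rpow (hl : 0 < l) :
    MemLp (fun x : ℝ => 1 + (2 * l - x) ^ (-(2 / 5) : ℝ)) 2 (vol (2 * l)) := by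
  have h0 : MemLp (fun _ : ℝ => (1 : ℝ)) 2 (vol (2 * l)) := memLp_const 1
  refine h0.add ?_
  have hm : AEStronglyMeasurable (fun x : ℝ => (2 * l - x) ^ (-(2 / 5) : ℝ)) (vol (2 * l)) := by
    have h : Measurable fun x : ℝ => 2 * l - x := by fun_prop
    exact (h.pow_const _).aestronglyMeasurable
  rw [memLp_two_iff_integrable_sq hm]
  have h1 := (intervalIntegral.intervalIntegrable_rpow' (a := 0) (b := 2 * l)
    (show (-1 : ℝ) < -(4 / 5) by norm_num)).comp_sub_left (2 * l)
  rw [sub_zero, sub_self] at h1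
  have h2 := (intervalIntegrable_iff_integrableOn_Ioo_of_le (by linarith)).1 h1.symm
  refine IntegrableOn.congr_fun h2 (fun x hx => ?_) measurableSet_Ioo
  have hδ : 0 ≤ 2 * l - x := by linarith [hx.2]
  rw [← Real.rpow_natCast, ← Real.rpow_mul hδ]
  norm_num

/-- Recovery of a bounded function from its Laplace transform along a line in the half-plane, when
the transform is known up to an error `O(e^{-2 l Im z})`. -/
lemma tendsto_eLpNorm_inverseFourier (hl : 0 < l) (hη : 0 < η) (hMη : M < η) (hD : 0 ≤ D)
    (hκ : StronglyMeasurable κ) (hK : ∀ t, ‖κ t‖ ≤ K) (hφ : DifferentiableOn ℂ φ (halfPlane M))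
    (hφκ : ∀ z ∈ halfPlane M, ‖φ z + ∫ t in (0 : ℝ)..l, Complex.exp (2 * Complex.I * z * t) * κ t‖ ≤
      D * Real.exp (-(2 * z.im * l))) :
    Tendsto (fun a : ℝ => eLpNorm (fun x : ℝ => (∫ t in (0 : ℝ)..x / 2, κ t) -
      ((1 / Real.pi * Real.exp (x * η) : ℝ) : ℂ) *
        ∫ ξ in (-a)..a, Complex.exp (-(Complex.I * x * ξ)) *
          (φ (ξ + Complex.I * η) / (2 * Complex.I * (ξ + Complex.I * η))))
      2 (vol (2 * l))) atTop (𝓝 0) := by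
  set G : ℂ → ℂ := fun z => ∫ t in (0 : ℝ)..l, Complex.exp (2 * Complex.I * z * t) * κ t with hG
  have hκi : ∀ s t, IntervalIntegrable κ volume s t := fun s t =>
    intervalIntegrable_of_bdd (C := K) hκ.aestronglyMeasurable fun x _ => hK x
  have hGd : Differentiable ℂ G := differentiable_integral_exp (hκi 0 l) _
  obtain ⟨C₁, hC₁0, hC₁⟩ := exists_norm_remainder_le (l := l) hη hMη hD
    (R := fun z => φ z + G z) (hφ.add hGd.differentiableOn) hφκ
  obtain ⟨C₂, hC₂0, hC₂⟩ := exists_norm_transform_le hl hη hκ hK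
  have hpi := Real.pi_pos
  have hcl : Continuous fun ξ : ℝ => (ξ : ℂ) + Complex.I * η := by fun_prop
  have hφc : Continuous fun ξ : ℝ => φ (ξ + Complex.I * η) :=
    hφ.continuousOn.comp_continuous hcl fun ξ => by simpa [halfPlane] using hMη
  have hGc : Continuous fun ξ : ℝ => G (ξ + Complex.I * η) := hGd.continuous.comp hcl
  have hd : ∀ ξ : ℝ, 2 * Complex.I * ((ξ : ℂ) + Complex.I * η) ≠ 0 := fun ξ =>
    mul_ne_zero (by simp) (line_ne_zero hη ξ)
  -- pointwise estimate
  have hpt : ∀ a x : ℝ, 1 ≤ a → x ∈ Ioo 0 (2 * l) → ‖(∫ t in (0 : ℝ)..x / 2, κ t) -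
      ((1 / Real.pi * Real.exp (x * η) : ℝ) : ℂ) *
        ∫ ξ in (-a)..a, Complex.exp (-(Complex.I * x * ξ)) *
          (φ (ξ + Complex.I * η) / (2 * Complex.I * (ξ + Complex.I * η)))‖ ≤
      (C₁ + C₂) * a ^ (-(1 / 10) : ℝ) * ‖1 + (2 * l - x) ^ (-(2 / 5) : ℝ)‖ := by
    intro a x ha hx
    have ha0 : 0 < a := by linarith
    have hδ : 0 < 2 * l - x := by linarith [hx.2]
    have h1 := hC₁ a x ha0 hx
    have h2 := hC₂ a x ha hx
    have hce : Continuous fun ξ : ℝ => Complex.exp (-(Complex.I * x * (ξ + Complex.I * η))) := by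
      fun_prop
    have j1 : IntervalIntegrable (fun ξ : ℝ => Complex.exp (-(Complex.I * x * (ξ + Complex.I * η))) *
        ((φ (ξ + Complex.I * η) + G (ξ + Complex.I * η)) / (2 * Complex.I * (ξ + Complex.I * η))))
        volume (-a) a :=
      (hce.mul ((hφc.add hGc).div (by fun_prop) hd)).intervalIntegrable _ _
    have j2 : IntervalIntegrable (fun ξ : ℝ => Complex.exp (-(Complex.I * x * (ξ + Complex.I * η))) *
        (G (ξ + Complex.I * η) / (2 * Complex.I * (ξ + Complex.I * η)))) volume (-a) a :=
      (hce.mul (hGc.div (by fun_prop) hd)).intervalIntegrable _ _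
    have e1 : ((1 / Real.pi * Real.exp (x * η) : ℝ) : ℂ) *
        ∫ ξ in (-a)..a, Complex.exp (-(Complex.I * x * ξ)) *
          (φ (ξ + Complex.I * η) / (2 * Complex.I * (ξ + Complex.I * η))) =
        1 / Real.pi * ((∫ ξ in (-a)..a, Complex.exp (-(Complex.I * x * (ξ + Complex.I * η))) *
        ((φ (ξ + Complex.I * η) + G (ξ + Complex.I * η)) /
          (2 * Complex.I * (ξ + Complex.I * η)))) -
        ∫ ξ in (-a)..a, Complex.exp (-(Complex.I * x * (ξ + Complex.I * η))) *
        (G (ξ + Complex.I * η) / (2 * Complex.I * (ξ + Complex.I * η)))) := by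
      rw [← intervalIntegral.integral_sub j1 j2, Complex.ofReal_mul, mul_assoc,
        ← intervalIntegral.integral_const_mul]
      push_cast
      congr 1
      refine intervalIntegral.integral_congr fun ξ _ => ?_
      have := exp_line x η ξ
      push_cast at this
      simp only [this]
      ring
    rw [e1]
    have e2 : ∀ A B C p : ℂ, A - p * (B - C) = (A + p * C) - p * B := fun A B C p => by ring
    rw [e2]
    refine (norm_sub_le _ _).trans ((add_le_add h2
      (d := C₁ * a ^ (-(1 / 10) : ℝ) * (2 * l - x) ^ (-(2 / 5) : ℝ)) ?_).trans ?_)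
    · rw [norm_mul]
      refine (mul_le_of_le_one_left (norm_nonneg _) ?_).trans h1
      have : ‖(1 / Real.pi : ℂ)‖ = 1 / Real.pi := by simp [abs_of_pos hpi]
      rw [this, div_le_one hpi]
      linarith [Real.pi_gt_three]
    · have h3 : C₂ / √a ≤ C₂ * a ^ (-(1 / 10) : ℝ) := by
        rw [div_eq_mul_inv, Real.sqrt_eq_rpow, ← Real.rpow_neg ha0.le]
        exact mul_le_mul_of_nonneg_left (Real.rpow_le_rpow_of_exponent_le ha (by norm_num)) hC₂0
      rw [Real.norm_of_nonneg (by positivity)]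
      have p1 : 0 ≤ a ^ (-(1 / 10) : ℝ) := by positivity
      have p2 : 0 ≤ (2 * l - x) ^ (-(2 / 5) : ℝ) := by positivity
      nlinarith [mul_nonneg hC₁0 p1, mul_nonneg (mul_nonneg hC₂0 p1) p2]
  -- the majorant is square integrable
  have hg := memLp_sub_rpow hl
  have hlim : Tendsto (fun a : ℝ => ENNReal.ofReal ((C₁ + C₂) * a ^ (-(1 / 10) : ℝ)) *
      eLpNorm (fun x : ℝ => 1 + (2 * l - x) ^ (-(2 / 5) : ℝ)) 2 (vol (2 * l))) atTop (𝓝 0) := by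
    have h1 : Tendsto (fun a : ℝ => (C₁ + C₂) * a ^ (-(1 / 10) : ℝ)) atTop (𝓝 ((C₁ + C₂) * 0)) :=
      (tendsto_rpow_neg_atTop (by norm_num)).const_mul _
    have h2 := ENNReal.Tendsto.mul_const (b := eLpNorm (fun x : ℝ => 1 + (2 * l - x) ^
      (-(2 / 5) : ℝ)) 2 (vol (2 * l))) (ENNReal.tendsto_ofReal h1) (Or.inr hg.eLpNorm_ne_top)
    simpa using h2
  refine tendsto_of_tendsto_of_tendsto_of_le_of_le' tendsto_const_nhds hlim
    (Eventually.of_forall fun _ => zero_le) ?_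
  filter_upwards [eventually_ge_atTop 1] with a ha
  refine eLpNorm_le_mul_eLpNorm_of_ae_le_mul ?_ 2
  exact ae_restrict_of_forall_mem measurableSet_Ioo fun x hx => hpt a x ha hx

end InverseFourier

section Recovery

variable {m₁ m₂ : ℕ} {l M η : ℝ} {v : ℝ → Matrix (Fin m₁) (Fin m₂) ℂ}
  {u : ℝ → ℂ → Matrix (Fin m₁ ⊕ Fin m₂) (Fin m₁ ⊕ Fin m₂) ℂ}
  {E : ℝ → ℝ → Matrix (Fin m₂) (Fin m₂) ℂ} {N : ℝ → ℝ → Matrix (Fin m₁) (Fin m₂) ℂ}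
  {k : ℝ → Matrix (Fin m₂) (Fin m₁) ℂ} {φ : ℂ → Matrix (Fin m₂) (Fin m₁) ℂ}

/-- A matrix entry as a bounded linear functional. -/
noncomputable def entryL {a b : Type*} [Fintype a] [Fintype b] [DecidableEq b] (i : a) (j : b) :
    Matrix a b ℂ →L[ℂ] ℂ :=
  LinearMap.toContinuousLinearMap
    { toFun := fun A => A i j
      map_add' := fun _ _ => rfl
      map_smul' := fun _ _ => rfl }

lemma integral_entry {a b : Type*} [Fintype a] [Fintype b] [DecidableEq a] [DecidableEq b]
    {s t : ℝ} {f : ℝ → Matrix a b ℂ} (hf : IntervalIntegrable f volume s t) (i : a) (j : b) :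
    (∫ x in s..t, f x) i j = ∫ x in s..t, f x i j :=
  ((entryL i j).intervalIntegral_comp_comm hf).symm

/-- The inversion formula for `Φ₁`. -/
lemma isInverseFourier_nodePrim (hk : IsNodeDensity l v E k) (hl : 0 < l) (hM : 0 ≤ M)
    {D : ℝ} (hD : 0 ≤ D) (hφ : DifferentiableOn ℂ φ (halfPlane M))
    (hφk : ∀ z ∈ halfPlane M, ‖φ z + lap k z l‖ ≤ D * Real.exp (-(2 * z.im * l)))
    (hMη : M < η) : IsInverseFourier l η φ (nodePrim k) := by
  intro i j
  obtain ⟨K, hK0, hK⟩ := hk.bound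
  obtain ⟨e, he, hE⟩ : ∃ e : ℝ, 0 ≤ e ∧ ∀ A : Matrix (Fin m₂) (Fin m₁) ℂ, ‖A i j‖ ≤ e * ‖A‖ :=
    ⟨_, ContinuousLinearMap.opNorm_nonneg _, fun A => (entryL i j).le_opNorm A⟩
  have hlap : ∀ z, (lap k z l) i j =
      ∫ t in (0 : ℝ)..l, Complex.exp (2 * Complex.I * z * t) * k t i j := by
    intro z
    rw [lap, integral_entry (hk.isPrim_lap hl.le z).integrable]
    simp only [Matrix.smul_apply, smul_eq_mul, mul_assoc]
  have h := tendsto_eLpNorm_inverseFourier (l := l) (M := M) (η := η)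
    (κ := fun t => k t i j) (φ := fun z => φ z i j)
    (K := e * K)
    (D := e * D) hl (hM.trans_lt hMη) hMη (by positivity)
    ((entryL i j).continuous.comp_stronglyMeasurable hk.measurable)
    (fun t => (hE _).trans (mul_le_mul_of_nonneg_left (hK t) he))
    (fun z hz => ((entryL i j).differentiableAt.comp_differentiableWithinAt z (hφ z hz) :))
    (fun z hz => ?_)
  · refine h.congr fun a => ?_
    congr 1
    ext x
    rw [nodePrim, integral_entry (hk.intervalIntegrable _ _)]
  · rw [← hlap, ← Matrix.add_apply, mul_assoc]
    exact (hE _).trans (mul_le_mul_of_nonneg_left (hφk z hz) he)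

/-- The inversion formula determines a continuous function. -/
lemma IsInverseFourier.eqOn (hl : 0 < l) (hη : 0 < η) (hMη : M < η)
    (hφ : DifferentiableOn ℂ φ (halfPlane M)) {Φ Ψ : ℝ → Matrix (Fin m₂) (Fin m₁) ℂ}
    (hΦ : IsInverseFourier l η φ Φ) (hΨ : IsInverseFourier l η φ Ψ)
    (hΦc : ContinuousOn Φ (Icc 0 l)) (hΨc : ContinuousOn Ψ (Icc 0 l)) :
    ∀ x ∈ Icc 0 l, Ψ x = Φ x := by
  intro y hy
  ext i j
  have hmaps : MapsTo (fun x : ℝ => x / 2) (Icc 0 (2 * l)) (Icc 0 l) := fun x hx =>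
    ⟨by linarith [hx.1], by linarith [hx.2]⟩
  have hc : ∀ {Θ : ℝ → Matrix (Fin m₂) (Fin m₁) ℂ}, ContinuousOn Θ (Icc 0 l) →
      ContinuousOn (fun x : ℝ => Θ (x / 2) i j) (Icc 0 (2 * l)) := fun {Θ} hΘ =>
    (entryL i j).continuous.comp_continuousOn
      (hΘ.comp (Continuous.continuousOn (by fun_prop)) hmaps)
  have hm : ∀ {Θ : ℝ → Matrix (Fin m₂) (Fin m₁) ℂ}, ContinuousOn Θ (Icc 0 l) →
      AEStronglyMeasurable (fun x : ℝ => Θ (x / 2) i j) (vol (2 * l)) := fun hΘ =>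
    ((hc hΘ).mono Ioo_subset_Icc_self).aestronglyMeasurable measurableSet_Ioo
  let T : ℝ → ℝ → ℂ := fun a x => ((1 / Real.pi * Real.exp (x * η) : ℝ) : ℂ) *
        ∫ ξ in (-a)..a, Complex.exp (-(Complex.I * x * ξ)) *
          (φ (ξ + Complex.I * η) i j / (2 * Complex.I * (ξ + Complex.I * η)))
  have hcl : Continuous fun ξ : ℝ => (ξ : ℂ) + Complex.I * η := by fun_prop
  have hφc : Continuous fun ξ : ℝ => φ (ξ + Complex.I * η) i j :=
    (entryL i j).continuous.comp
      (hφ.continuousOn.comp_continuous hcl fun ξ => by simpa [halfPlane] using hMη)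
  have hTm : ∀ a, AEStronglyMeasurable (T a) (vol (2 * l)) := by
    intro a
    have h1 : Continuous (T a) := by
      refine Continuous.mul (by fun_prop) ?_
      refine intervalIntegral.continuous_parametric_intervalIntegral_of_continuous' ?_ _ _
      refine Continuous.mul (by fun_prop) (Continuous.div ?_ (by fun_prop) fun p => ?_)
      · exact hφc.comp continuous_snd
      · exact mul_ne_zero (by simp) (line_ne_zero hη p.2)
    exact h1.aestronglyMeasurable
  have hle : ∀ a, eLpNorm (fun x : ℝ => Ψ (x / 2) i j - Φ (x / 2) i j) 2 (vol (2 * l)) ≤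
      eLpNorm (fun x : ℝ => Ψ (x / 2) i j - T a x) 2 (vol (2 * l)) +
      eLpNorm (fun x : ℝ => Φ (x / 2) i j - T a x) 2 (vol (2 * l)) := by
    intro a
    have h1 := eLpNorm_sub_le (p := 2) ((hm hΨc).sub (hTm a)) ((hm hΦc).sub (hTm a)) one_le_two
    refine le_trans (le_of_eq ?_) h1
    congr 1
    ext x
    simp
  have h0 : eLpNorm (fun x : ℝ => Ψ (x / 2) i j - Φ (x / 2) i j) 2 (vol (2 * l)) = 0 := by
    refine le_antisymm ?_ zero_le
    have h1 := (hΨ i j).add (hΦ i j)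
    rw [add_zero] at h1
    exact ge_of_tendsto' h1 hle
  replace h0 := (eLpNorm_eq_zero_iff ((hm hΨc).sub (hm hΦc)) two_ne_zero).1 h0
  have h1 : (fun x : ℝ => Ψ (x / 2) i j) =ᵐ[volume.restrict (Icc 0 (2 * l))]
      fun x => Φ (x / 2) i j := by
    rw [← restrict_Ioo_eq_restrict_Icc]
    exact h0.mono fun x hx => sub_eq_zero.1 hx
  have h2 := Measure.eqOn_Icc_of_ae_eq volume (by linarith : (0 : ℝ) ≠ 2 * l) h1 (hc hΨc) (hc hΦc)
    (show 2 * y ∈ Icc 0 (2 * l) from ⟨by linarith [hy.1], by linarith [hy.2]⟩)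
  simpa using h2

end Recovery

/-! ### A uniqueness theorem for finite Laplace transforms -/

section Liouville

variable {a b : Type*} [Fintype a] [Fintype b] [DecidableEq a] [DecidableEq b]

/-- An integrable function on `(0, r)` is determined by its Laplace transform. -/
lemma ae_eq_zero_of_laplace_eq_zero {r : ℝ} (hr : 0 < r) {P : ℝ → Matrix a b ℂ}
    (hP : IntervalIntegrable P volume 0 r)
    (h : ∀ ω : ℂ, ∫ t in (0 : ℝ)..r, Complex.exp (ω * t) • P t = 0) :
    ∀ᵐ t ∂(vol r), P t = 0 := by
  have hQ : IsPrim r (fun x => ∫ t in (0 : ℝ)..x, P t) P := by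
    simpa using isPrim_integral hr.le hP 0
  set Q : ℝ → Matrix a b ℂ := fun x => ∫ t in (0 : ℝ)..x, P t with hQd
  have hrr : r ∈ Icc 0 r := ⟨hr.le, le_rfl⟩
  have hQ0 : Q 0 = 0 := by simp [hQd]
  have hQr : Q r = 0 := by simpa using h 0
  have hQi : IntervalIntegrable Q volume 0 r := by
    apply ContinuousOn.intervalIntegrable; rw [uIcc_of_le hr.le]; exact hQ.continuousOn
  have hexp : ∀ ω : ℂ, Continuous fun t : ℝ => Complex.exp (ω * t) := fun ω => by fun_prop
  -- integration by parts
  have hQz : ∀ ω : ℂ, ω ≠ 0 → ∫ t in (0 : ℝ)..r, Complex.exp (ω * t) • Q t = 0 := by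
    intro ω hω
    have h1 := (hQ.exp_smul ω).eq r hrr
    simp only [hQ0, hQr, smul_zero, zero_add, smul_add, smul_smul] at h1
    have i1 : IntervalIntegrable (fun t : ℝ => (Complex.exp (ω * t) * ω) • Q t) volume 0 r :=
      hQi.continuousOn_smul ((hexp ω).mul continuous_const).continuousOn
    have i2 : IntervalIntegrable (fun t : ℝ => Complex.exp (ω * t) • P t) volume 0 r :=
      hP.continuousOn_smul (hexp ω).continuousOn
    rw [intervalIntegral.integral_add i1 i2, h ω, add_zero] at h1
    have h2 : ∫ t in (0 : ℝ)..r, (Complex.exp (ω * t) * ω) • Q t =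
        ω • ∫ t in (0 : ℝ)..r, Complex.exp (ω * t) • Q t := by
      rw [← intervalIntegral.integral_smul]
      exact intervalIntegral.integral_congr fun t _ => by rw [smul_smul, mul_comm]
    rw [h2] at h1
    exact (smul_eq_zero.1 h1.symm).resolve_left hω
  let f : ℝ → Matrix a b ℂ := (Ioc 0 r).indicator Q
  have hfi : Integrable f :=
    (integrable_indicator_iff measurableSet_Ioc).2
      ((intervalIntegrable_iff_integrableOn_Ioc_of_le hr.le).1 hQi)
  have hF : ∀ ξ : ℝ, ξ ≠ 0 → FourierTransform.fourier f ξ = 0 := by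
    intro ξ hξ
    rw [Real.fourier_real_eq_integral_exp_smul]
    have e : (fun t : ℝ => Complex.exp (((-2 * Real.pi * t * ξ : ℝ) : ℂ) * Complex.I) • f t) =
        (Ioc 0 r).indicator fun t : ℝ => Complex.exp (-(2 * Real.pi * ξ * Complex.I) * t) • Q t := by
      ext1 t
      by_cases ht : t ∈ Ioc 0 r
      · rw [indicator_of_mem ht, show f t = Q t from indicator_of_mem ht _]
        congr 2
        push_cast
        ring
      · rw [indicator_of_notMem ht, show f t = 0 from indicator_of_notMem ht _, smul_zero]
    rw [e, integral_indicator measurableSet_Ioc, ← intervalIntegral.integral_of_le hr.le]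
    refine hQz _ (neg_ne_zero.2 ?_)
    have : (ξ : ℂ) ≠ 0 := by exact_mod_cast hξ
    simp [this, Real.pi_ne_zero]
  have hFae : FourierTransform.fourier f =ᵐ[volume] fun _ => 0 := by
    have hne : ∀ᵐ ξ : ℝ, ξ ≠ 0 := by simp [ae_iff]
    exact hne.mono fun ξ hξ => hF ξ hξ
  have hQv : ∀ t ∈ Ioo 0 r, Q t = 0 := by
    intro t ht
    have hnh : Ioo 0 r ∈ 𝓝 t := isOpen_Ioo.mem_nhds ht
    have hft : f =ᶠ[𝓝 t] Q := by
      filter_upwards [hnh] with s hs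
      exact indicator_of_mem (Ioo_subset_Ioc_self hs) _
    have hc : ContinuousAt f t := by
      refine ContinuousAt.congr ?_ hft.symm
      exact (hQ.continuousOn.mono Ioo_subset_Icc_self).continuousAt hnh
    have h1 := hfi.fourierInv_fourier_eq ((integrable_zero _ _ _).congr hFae.symm) hc
    rw [← hft.eq_of_nhds, ← h1, Real.fourierInv_eq]
    refine (integral_congr_ae (g := fun _ => 0) (hFae.mono fun ξ hξ => ?_)).trans
      (integral_zero _ _)
    simp only at hξ
    rw [hξ, smul_zero]
  filter_upwards [hQ.ae_hasDerivAt, ae_restrict_mem measurableSet_Ioo] with t ht htm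
  have h0 : HasDerivAt Q 0 t := (hasDerivAt_const t (0 : Matrix a b ℂ)).congr_of_eventuallyEq <| by
    filter_upwards [isOpen_Ioo.mem_nhds htm] with s hs using hQv s hs
  exact ht.unique h0

/-- If the Laplace transform of a function on `(0, r)` is as small in a lower half-plane as that of
a function supported at `r`, the function vanishes: after division by the exponential the transform
is a bounded entire function which tends to zero along the imaginary axis. -/
lemma ae_eq_zero_of_laplace_le {r M C : ℝ} (hr : 0 < r) (hM : 0 ≤ M) {P : ℝ → Matrix a b ℂ}
    (hP : IntervalIntegrable P volume 0 r)
    (hb : ∀ ω : ℂ, ω.im < -M → ‖∫ t in (0 : ℝ)..r, Complex.exp (-(2 * (Complex.I * ω)) * t) • P t‖ ≤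
      C * Real.exp (2 * ω.im * r)) : ∀ᵐ t ∂(vol r), P t = 0 := by
  let L : ℂ → Matrix a b ℂ := fun ω => ∫ t in (0 : ℝ)..r, Complex.exp (-(2 * Complex.I) * ω * t) • P t
  have hLd : Differentiable ℂ L := differentiable_integral_exp hP _
  have hL : ∀ ω : ℂ, ∫ t in (0 : ℝ)..r, Complex.exp (-(2 * (Complex.I * ω)) * t) • P t = L ω :=
    fun ω => intervalIntegral.integral_congr fun t _ => by
      simp only [neg_mul, mul_assoc]
  let W : ℂ → Matrix a b ℂ := fun ω => Complex.exp (2 * Complex.I * ω * r) • L ω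
  have hWd : Differentiable ℂ W :=
    (Complex.differentiable_exp.comp
      (by fun_prop : Differentiable ℂ fun ω : ℂ => 2 * Complex.I * ω * r)).smul hLd
  have hW : ∀ ω : ℂ, W ω =
      ∫ t in (0 : ℝ)..r, Complex.exp (2 * Complex.I * ω * (r - t)) • P t := by
    intro ω
    simp only [W, L]
    rw [← intervalIntegral.integral_smul]
    refine intervalIntegral.integral_congr fun t _ => ?_
    rw [smul_smul, ← Complex.exp_add]
    congr 2
    ring
  have hnorm : ∀ (ω : ℂ) (t : ℝ), ‖Complex.exp (2 * Complex.I * ω * (r - t)) • P t‖ =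
      Real.exp (-(2 * ω.im * (r - t))) * ‖P t‖ := by
    intro ω t
    rw [norm_smul, Complex.norm_exp]
    congr 2
    have : 2 * Complex.I * ω * (r - t) = ((r - t : ℝ) : ℂ) * (2 * (Complex.I * ω)) := by
      push_cast; ring
    rw [this, Complex.re_ofReal_mul]
    simp
    ring
  have hPn := hP.norm
  set J := ∫ t in (0 : ℝ)..r, ‖P t‖ with hJ
  have hJ0 : 0 ≤ J := intervalIntegral.integral_nonneg hr.le fun _ _ => norm_nonneg _
  have hbdd : ∀ ω, ‖W ω‖ ≤ max C (Real.exp (2 * M * r) * J) := by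
    intro ω
    rcases lt_or_ge ω.im (-M) with h | h
    · refine le_trans ?_ (le_max_left _ _)
      have h1 := hb ω h
      rw [hL] at h1
      have e : (2 * Complex.I * ω * r).re = -(2 * ω.im * r) := by simp
      simp only [W]
      rw [norm_smul, Complex.norm_exp, e, Real.exp_neg, ← div_eq_inv_mul,
        div_le_iff₀ (Real.exp_pos _)]
      exact h1
    · refine le_trans ?_ (le_max_right _ _)
      rw [hW, hJ, ← intervalIntegral.integral_const_mul]
      refine intervalIntegral.norm_integral_le_of_norm_le hr.le (Eventually.of_forall fun t ht => ?_)
        (hPn.const_mul _)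
      rw [hnorm]
      refine mul_le_mul_of_nonneg_right (Real.exp_le_exp.2 ?_) (norm_nonneg _)
      nlinarith [ht.1, ht.2, mul_nonneg hM ht.1.le,
        mul_nonneg (sub_nonneg.2 ht.2) (by linarith : 0 ≤ ω.im + M)]
  have hconst : ∀ ω, W ω = W 0 := fun ω => hWd.apply_eq_apply_of_bounded
    (isBounded_iff_forall_norm_le.2 ⟨_, by rintro _ ⟨ω, rfl⟩; exact hbdd ω⟩) ω 0
  -- the value of the constant
  have hW0 : W 0 = 0 := by
    have hlim : Tendsto (fun n : ℕ => W (Complex.I * n)) atTop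
        (𝓝 (∫ _ in (0 : ℝ)..r, (0 : Matrix a b ℂ))) := by
      simp only [hW]
      refine intervalIntegral.tendsto_integral_filter_of_dominated_convergence (fun t => ‖P t‖)
        (Eventually.of_forall fun n => ?_) (Eventually.of_forall fun n => ?_) hPn ?_
      · have : IntervalIntegrable (fun t : ℝ => Complex.exp (2 * Complex.I * (Complex.I * n) *
          (r - t)) • P t) volume 0 r := hP.continuousOn_smul (Continuous.continuousOn (by fun_prop))
        rw [intervalIntegrable_iff] at this
        exact this.aestronglyMeasurable
      · refine Eventually.of_forall fun t ht => ?_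
        rw [uIoc_of_le hr.le] at ht
        rw [hnorm]
        refine mul_le_of_le_one_left (norm_nonneg _) (Real.exp_le_one_iff.2 ?_)
        have e : (Complex.I * (n : ℂ)).im = n := by simp
        rw [e]
        have : 0 ≤ (n : ℝ) * (r - t) := mul_nonneg (Nat.cast_nonneg _) (sub_nonneg.2 ht.2)
        linarith
      · have hne : ∀ᵐ t : ℝ, t ≠ r := by simp [ae_iff]
        filter_upwards [hne] with t hne ht
        rw [uIoc_of_le hr.le] at ht
        have hlt : 0 < r - t := sub_pos.2 (lt_of_le_of_ne ht.2 hne)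
        rw [tendsto_zero_iff_norm_tendsto_zero]
        simp only [hnorm]
        rw [← zero_mul ‖P t‖]
        refine Tendsto.mul_const _ ?_
        have h1 : Tendsto (fun n : ℕ => (2 * (r - t)) * (n : ℝ)) atTop atTop :=
          tendsto_natCast_atTop_atTop.const_mul_atTop (by linarith)
        refine (Real.tendsto_exp_neg_atTop_nhds_zero.comp h1).congr fun n => ?_
        have e : (Complex.I * (n : ℂ)).im = n := by simp
        simp only [Function.comp, e]
        congr 1
        ring
    simp only [hconst, intervalIntegral.integral_zero] at hlim
    exact tendsto_nhds_unique tendsto_const_nhds hlim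
  refine ae_eq_zero_of_laplace_eq_zero hr hP fun ω => ?_
  have h1 := hconst (ω * (Complex.I / 2))
  rw [hW0] at h1
  have h2 := (smul_eq_zero.1 h1).resolve_left (Complex.exp_ne_zero _)
  rw [← h2]
  refine intervalIntegral.integral_congr fun t _ => ?_
  congr 2
  linear_combination (ω * t) * Complex.I_sq

end Liouville

/-! ### The factorization identity for the kernel of `S` -/

section Convolution

variable {a b c : Type*} [Fintype a] [Fintype b] [Fintype c] [DecidableEq a] [DecidableEq b]
  [DecidableEq c]

lemma intervalIntegral_swap_of_bdd {V : Type*} [NormedAddCommGroup V] [NormedSpace ℝ V]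
    {F : ℝ → ℝ → V} {r C : ℝ} (hr : 0 ≤ r) (hF : StronglyMeasurable (Function.uncurry F))
    (hC : ∀ x ∈ Ioc 0 r, ∀ y ∈ Ioc 0 r, ‖F x y‖ ≤ C) :
    ∫ x in (0 : ℝ)..r, ∫ y in (0 : ℝ)..r, F x y = ∫ y in (0 : ℝ)..r, ∫ x in (0 : ℝ)..r, F x y := by
  refine intervalIntegral_intervalIntegral_swap ?_
  rw [uIoc_of_le hr]
  refine Measure.integrableOn_of_bounded (M := C) ?_ hF.aestronglyMeasurable ?_
  · rw [Measure.volume_eq_prod, Measure.prod_prod]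
    exact ENNReal.mul_ne_top measure_Ioc_lt_top.ne measure_Ioc_lt_top.ne
  · exact ae_restrict_of_forall_mem (measurableSet_Ioc.prod measurableSet_Ioc)
      fun p hp => hC _ hp.1 _ hp.2

lemma integral_eq_zero_of_Ioo {V : Type*} [NormedAddCommGroup V] [NormedSpace ℝ V] {f : ℝ → V}
    {s t : ℝ} (hst : s ≤ t) (h : ∀ x ∈ Ioo s t, f x = 0) : ∫ x in s..t, f x = 0 := by
  rw [intervalIntegral.integral_of_le hst, integral_Ioc_eq_integral_Ioo]
  exact setIntegral_eq_zero_of_forall_eq_zero h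

/-- The exponential `e^{-2iωt}`. -/
noncomputable def expKer (ω : ℂ) (t : ℝ) : ℂ := Complex.exp (-(2 * (Complex.I * ω)) * t)

lemma continuous_expKer (ω : ℂ) : Continuous (expKer ω) := by unfold expKer; fun_prop

lemma norm_expKer (ω : ℂ) (t : ℝ) : ‖expKer ω t‖ = Real.exp (2 * ω.im * t) := by
  rw [expKer, Complex.norm_exp, Complex.re_mul_ofReal]
  simp

lemma expKer_add (ω : ℂ) (s t : ℝ) : expKer ω (s + t) = expKer ω s * expKer ω t := by
  rw [expKer, expKer, expKer, ← Complex.exp_add]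
  congr 1
  push_cast
  ring

lemma norm_expKer_le (ω : ℂ) {t r : ℝ} (ht : 0 ≤ t) (htr : t ≤ r) :
    ‖expKer ω t‖ ≤ Real.exp (2 * |ω.im| * r) := by
  rw [norm_expKer]
  refine Real.exp_le_exp.2 ?_
  have h1 := le_abs_self ω.im
  have h2 := abs_nonneg ω.im
  nlinarith [mul_le_mul_of_nonneg_right h1 ht, mul_le_mul_of_nonneg_left htr h2]

variable {ν : ℝ → Matrix a b ℂ} {k : ℝ → Matrix b c ℂ} {r C K : ℝ}

/-- The correlation `∫₀ʳ ν(x) k(x - s) dx`. -/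
noncomputable def corr (r : ℝ) (ν : ℝ → Matrix a b ℂ) (k : ℝ → Matrix b c ℂ) (s : ℝ) :
    Matrix a c ℂ := ∫ x in (0 : ℝ)..r, ν x * k (x - s)

/-- The convolution `∫₀ʳ ν(s) k(t - s) ds`. -/
noncomputable def conv (r : ℝ) (ν : ℝ → Matrix a b ℂ) (k : ℝ → Matrix b c ℂ) (t : ℝ) :
    Matrix a c ℂ := ∫ s in (0 : ℝ)..r, ν s * k (t - s)

lemma stronglyMeasurable_corr (hν : StronglyMeasurable ν) (hk : StronglyMeasurable k) :
    StronglyMeasurable (corr r ν k) :=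
  stronglyMeasurable_intervalIntegral (h := fun s x => ν x * k (x - s)) (e := fun _ => r)
    (stronglyMeasurable_mul (hν.comp_measurable measurable_snd)
      (hk.comp_measurable (by fun_prop))) measurable_const

lemma stronglyMeasurable_conv (hν : StronglyMeasurable ν) (hk : StronglyMeasurable k) :
    StronglyMeasurable (conv r ν k) :=
  stronglyMeasurable_intervalIntegral (h := fun t s => ν s * k (t - s)) (e := fun _ => r)
    (stronglyMeasurable_mul (hν.comp_measurable measurable_snd)
      (hk.comp_measurable (by fun_prop))) measurable_const

lemma norm_corr_le (hr : 0 ≤ r) (hC : ∀ x, ‖ν x‖ ≤ C) (hK : ∀ x, ‖k x‖ ≤ K) (s : ℝ) :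
    ‖corr r ν k s‖ ≤ C * K * r := by
  have := intervalIntegral.norm_integral_le_of_norm_le_const (a := 0) (b := r)
    (f := fun x => ν x * k (x - s)) (C := C * K) fun x _ => norm_mul_le_of_le (hC x) (hK _)
  rwa [sub_zero, abs_of_nonneg hr] at this

lemma norm_conv_le (hr : 0 ≤ r) (hC : ∀ x, ‖ν x‖ ≤ C) (hK : ∀ x, ‖k x‖ ≤ K) (s : ℝ) :
    ‖conv r ν k s‖ ≤ C * K * r := by
  have := intervalIntegral.norm_integral_le_of_norm_le_const (a := 0) (b := r)
    (f := fun x => ν x * k (s - x)) (C := C * K) fun x _ => norm_mul_le_of_le (hC x) (hK _)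
  rwa [sub_zero, abs_of_nonneg hr] at this

lemma intervalIntegrable_of_measurable_bdd {V : Type*} [NormedAddCommGroup V] [NormedSpace ℝ V]
    {f : ℝ → V} (hf : StronglyMeasurable f) (hC : ∀ x, ‖f x‖ ≤ C) (s t : ℝ) :
    IntervalIntegrable f volume s t :=
  intervalIntegrable_of_bdd (C := C) hf.aestronglyMeasurable fun x _ => hC x

lemma intervalIntegrable_expKer_smul {f : ℝ → Matrix a b ℂ} {s t : ℝ}
    (hf : IntervalIntegrable f volume s t) (ω : ℂ) :
    IntervalIntegrable (fun x => expKer ω x • f x) volume s t :=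
  hf.continuousOn_smul (continuous_expKer ω).continuousOn

/-- Integration of `ν` against a causal convolution is the Laplace transform of a correlation. -/
lemma integral_mul_causal (hr : 0 ≤ r) (hν : StronglyMeasurable ν) (hC : ∀ x, ‖ν x‖ ≤ C)
    (hk : StronglyMeasurable k) (hK : ∀ x, ‖k x‖ ≤ K) (hk0 : ∀ x < 0, k x = 0) (ω : ℂ) :
    ∫ x in (0 : ℝ)..r, ν x * (∫ t in (0 : ℝ)..x, expKer ω (x - t) • k t) =
      ∫ s in (0 : ℝ)..r, expKer ω s • corr r ν k s := by
  have hki : ∀ x s t, IntervalIntegrable (fun s => k (x - s)) volume s t := fun x s t =>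
    intervalIntegrable_of_measurable_bdd (hk.comp_measurable (by fun_prop)) (fun s => hK _) s t
  have h1 : ∀ x ∈ uIcc 0 r, ν x * (∫ t in (0 : ℝ)..x, expKer ω (x - t) • k t) =
      ∫ s in (0 : ℝ)..r, expKer ω s • (ν x * k (x - s)) := by
    intro x hx
    rw [uIcc_of_le hr] at hx
    have e1 : ∫ t in (0 : ℝ)..x, expKer ω (x - t) • k t =
        ∫ s in (0 : ℝ)..x, expKer ω s • k (x - s) := by
      have := intervalIntegral.integral_comp_sub_left (a := 0) (b := x)
        (fun s => expKer ω s • k (x - s)) x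
      simpa using this
    have e2 : ∫ s in (0 : ℝ)..x, expKer ω s • k (x - s) =
        ∫ s in (0 : ℝ)..r, expKer ω s • k (x - s) := by
      rw [← intervalIntegral.integral_add_adjacent_intervals
        (intervalIntegrable_expKer_smul (hki x 0 x) ω) (intervalIntegrable_expKer_smul (hki x x r) ω),
        integral_eq_zero_of_Ioo hx.2 fun s hs => ?_, add_zero]
      rw [hk0 _ (by linarith [hs.1]), smul_zero]
    rw [e1, e2, ← integral_const_matrix_mul _ (intervalIntegrable_expKer_smul (hki x 0 r) ω)]
    exact intervalIntegral.integral_congr fun s _ => Matrix.mul_smul _ _ _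
  rw [intervalIntegral.integral_congr h1, intervalIntegral_swap_of_bdd
    (C := Real.exp (2 * |ω.im| * r) * (C * K)) hr]
  · refine intervalIntegral.integral_congr fun s _ => ?_
    rw [intervalIntegral.integral_smul]; rfl
  · exact ((continuous_expKer ω).stronglyMeasurable.comp_measurable measurable_snd).smul
      (stronglyMeasurable_mul (hν.comp_measurable measurable_fst) (hk.comp_measurable (by fun_prop)))
  · intro x _ s hs
    rw [norm_smul]
    exact mul_le_mul (norm_expKer_le ω hs.1.le hs.2) (norm_mul_le_of_le (hC x) (hK _))
      (norm_nonneg _) (Real.exp_pos _).le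

/-- The Laplace transform, cut off at `r`, of a convolution. -/
lemma integral_mul_causal_tail (hr : 0 ≤ r) (hν : StronglyMeasurable ν) (hC : ∀ x, ‖ν x‖ ≤ C)
    (hk : StronglyMeasurable k) (hK : ∀ x, ‖k x‖ ≤ K) (hk0 : ∀ x < 0, k x = 0) (ω : ℂ) :
    ∫ s in (0 : ℝ)..r, expKer ω s • (ν s * ∫ τ in (0 : ℝ)..(r - s), expKer ω τ • k τ) =
      ∫ t in (0 : ℝ)..r, expKer ω t • conv r ν k t := by
  have hki : ∀ x s t, IntervalIntegrable (fun t => k (t - x)) volume s t := fun x s t =>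
    intervalIntegrable_of_measurable_bdd (hk.comp_measurable (by fun_prop)) (fun s => hK _) s t
  have h1 : ∀ s ∈ uIcc 0 r, expKer ω s • (ν s * ∫ τ in (0 : ℝ)..(r - s), expKer ω τ • k τ) =
      ∫ t in (0 : ℝ)..r, expKer ω t • (ν s * k (t - s)) := by
    intro s hs
    rw [uIcc_of_le hr] at hs
    have e1 : expKer ω s • ∫ τ in (0 : ℝ)..(r - s), expKer ω τ • k τ =
        ∫ t in s..r, expKer ω t • k (t - s) := by
      rw [← intervalIntegral.integral_smul]
      have := intervalIntegral.integral_comp_sub_right (a := s) (b := r)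
        (fun τ => expKer ω s • expKer ω τ • k τ) s
      rw [sub_self] at this
      rw [← this]
      refine intervalIntegral.integral_congr fun t _ => ?_
      simp only [smul_smul, ← expKer_add, add_sub_cancel]
    have e2 : ∫ t in s..r, expKer ω t • k (t - s) = ∫ t in (0 : ℝ)..r, expKer ω t • k (t - s) := by
      rw [← intervalIntegral.integral_add_adjacent_intervals
        (intervalIntegrable_expKer_smul (hki s 0 s) ω) (intervalIntegrable_expKer_smul (hki s s r) ω),
        integral_eq_zero_of_Ioo hs.1 fun t ht => ?_, zero_add]
      rw [hk0 _ (by linarith [ht.2]), smul_zero]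
    rw [← Matrix.mul_smul, e1, e2,
      ← integral_const_matrix_mul _ (intervalIntegrable_expKer_smul (hki s 0 r) ω)]
    exact intervalIntegral.integral_congr fun t _ => Matrix.mul_smul _ _ _
  rw [intervalIntegral.integral_congr h1, intervalIntegral_swap_of_bdd
    (C := Real.exp (2 * |ω.im| * r) * (C * K)) hr]
  · refine intervalIntegral.integral_congr fun s _ => ?_
    rw [intervalIntegral.integral_smul]; rfl
  · exact ((continuous_expKer ω).stronglyMeasurable.comp_measurable measurable_snd).smul
      (stronglyMeasurable_mul (hν.comp_measurable measurable_fst) (hk.comp_measurable (by fun_prop)))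
  · intro x _ s hs
    rw [norm_smul]
    exact mul_le_mul (norm_expKer_le ω hs.1.le hs.2) (norm_mul_le_of_le (hC x) (hK _))
      (norm_nonneg _) (Real.exp_pos _).le

end Convolution

section Factorization

variable {m₁ m₂ p q : ℕ} {l M : ℝ} {v : ℝ → Matrix (Fin m₁) (Fin m₂) ℂ}
  {u : ℝ → ℂ → Matrix (Fin m₁ ⊕ Fin m₂) (Fin m₁ ⊕ Fin m₂) ℂ}
  {E : ℝ → ℝ → Matrix (Fin m₂) (Fin m₂) ℂ} {N : ℝ → ℝ → Matrix (Fin m₁) (Fin m₂) ℂ}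
  {k : ℝ → Matrix (Fin m₂) (Fin m₁) ℂ} {φ : ℂ → Matrix (Fin m₂) (Fin m₁) ℂ}

/-- The row `N(r, ·)`, cut off outside `[0, r]`. -/
noncomputable def rowN (N : ℝ → ℝ → Matrix (Fin m₁) (Fin m₂) ℂ) (r : ℝ) :
    ℝ → Matrix (Fin m₁) (Fin m₂) ℂ := (Icc 0 r).indicator (N r)

lemma IsTransmutation.rowN_measurable (h : IsTransmutation l v E N) (r : ℝ) :
    StronglyMeasurable (rowN N r) :=
  (h.measN.comp_measurable measurable_prodMk_left).indicator measurableSet_Icc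

lemma IsTransmutation.exists_norm_rowN_le (h : IsTransmutation l v E N) :
    ∃ C, 0 ≤ C ∧ ∀ r ∈ Icc 0 l, ∀ x, ‖rowN N r x‖ ≤ C := by
  obtain ⟨C, hC0, hC⟩ := h.bound
  refine ⟨C, hC0, fun r hr x => ?_⟩
  by_cases hx : x ∈ Icc 0 r
  · rw [rowN, indicator_of_mem hx]
    exact (hC r hr x ⟨hx.1, hx.2.trans hr.2⟩).2
  · rw [rowN, indicator_of_notMem hx, norm_zero]; exact hC0

lemma opN_eq_rowN {r : ℝ} (hr : 0 ≤ r) (f : ℝ → Matrix (Fin m₂) (Fin p) ℂ) :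
    opN N f r = ∫ x in (0 : ℝ)..r, rowN N r x * f x :=
  intervalIntegral.integral_congr fun x hx => by
    rw [uIcc_of_le hr] at hx
    rw [rowN, indicator_of_mem hx]

/-- The residual of the equation for the row `N(r, ·)`: it vanishes if and only if `-N(r, ·)*`
solves `S_r h = k`. -/
noncomputable def residual (N : ℝ → ℝ → Matrix (Fin m₁) (Fin m₂) ℂ)
    (k : ℝ → Matrix (Fin m₂) (Fin m₁) ℂ) (r t : ℝ) : Matrix (Fin m₁) (Fin m₂) ℂ :=
  rowN N r t + (k t)ᴴ + conv r (corr r (rowN N r) k) (fun s => (k s)ᴴ) t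

/-- The solution of `F' = -2iωF + kA` with `F(0) = I`. -/
noncomputable def dualSol (k : ℝ → Matrix (Fin m₂) (Fin m₁) ℂ) (ω : ℂ)
    (A : Matrix (Fin m₁) (Fin m₂) ℂ) (x : ℝ) : Matrix (Fin m₂) (Fin m₂) ℂ :=
  Complex.exp (-(2 * (Complex.I * ω)) * x) • (1 + lap k ω x * A)

lemma IsNodeDensity.isPrim_dualSol (hk : IsNodeDensity l v E k) (hl : 0 ≤ l) (ω : ℂ)
    (A : Matrix (Fin m₁) (Fin m₂) ℂ) :
    IsPrim l (dualSol k ω A) (fun x => (-(2 * (Complex.I * ω))) • dualSol k ω A x + k x * A) := by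
  have h := ((IsPrim.const hl (1 : Matrix (Fin m₂) (Fin m₂) ℂ)).add
    ((hk.isPrim_lap hl ω).mul_const A)).exp_smul (-(2 * (Complex.I * ω)))
  refine h.congr_ae (Eventually.of_forall fun x => ?_)
  rw [smul_add, zero_add, Matrix.smul_mul, smul_smul (Complex.exp _) (Complex.exp _),
    ← Complex.exp_add, neg_mul, neg_add_cancel, Complex.exp_zero, one_smul, dualSol, neg_mul,
    smul_comm]

lemma integral_expKer_sub_smul (k : ℝ → Matrix (Fin m₂) (Fin m₁) ℂ) (ω : ℂ) (x : ℝ) :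
    ∫ t in (0 : ℝ)..x, expKer ω (x - t) • k t = expKer ω x • lap k ω x := by
  rw [lap, ← intervalIntegral.integral_smul]
  refine intervalIntegral.integral_congr fun t _ => ?_
  rw [smul_smul, expKer, expKer, ← Complex.exp_add]
  congr 2
  push_cast
  ring

lemma dualSol_eq (k : ℝ → Matrix (Fin m₂) (Fin m₁) ℂ) (ω : ℂ)
    (A : Matrix (Fin m₁) (Fin m₂) ℂ) (x : ℝ) :
    dualSol k ω A x = expKer ω x • (1 : Matrix (Fin m₂) (Fin m₂) ℂ) +
      (∫ t in (0 : ℝ)..x, expKer ω (x - t) • k t) * A := by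
  rw [integral_expKer_sub_smul, dualSol, smul_add, Matrix.smul_mul]
  rfl

/-- The upper block of the solution orthogonal to the Weyl solution is exponentially small. -/
lemma IsTransmutation.norm_add_opN_dualSol_le (h : IsTransmutation l v E N)
    (hu : IsFundamentalSolution l v u) (hv : StronglyMeasurable v)
    (hvM : ∀ x, ‖v x‖ ≤ M) (hk : IsNodeDensity l v E k) (hl : 0 ≤ l) {z : ℂ} (hz : M < z.im)
    {w : Matrix (Fin m₂) (Fin m₁) ℂ} (hw : w ∈ weylBall M u l z) {r : ℝ} (hr : r ∈ Icc 0 l) :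
    ‖-wᴴ + opN N (dualSol k (starRingEnd ℂ z) (-wᴴ)) r‖ ≤
      Real.exp (M * l) * Real.exp (-(2 * z.im * r)) := by
  have hM : 0 ≤ M := (norm_nonneg _).trans (hvM 0)
  have hend := hu.vnorm_dual_le hv hvM hl (hu.vnorm_le_of_mem_weylBall hv hvM hl hz hw)
  have hs := hu.isDiracSol_mul hv hvM hl (starRingEnd ℂ z) (dualCol w)
  have hz' : (starRingEnd ℂ z).im ≤ -M := by rw [Complex.conj_im]; linarith
  have h1 := hs.norm_lower_le_exp hvM hz' hend hr
  have h2 := norm_le_of_vnorm_le fun c => hs.vnorm_upper_le hvM hz' hend hr c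
  have h0 : lowerRow m₁ m₂ * (u 0 (starRingEnd ℂ z) * dualCol w) = 1 := by
    rw [(hu _).1, Matrix.one_mul, dualCol, lowerRow_mul_fromRows]
  have hd0 : dualSol k (starRingEnd ℂ z) (-wᴴ) 0 = 1 := by simp [dualSol, lap]
  have h3 := h.fundamental_mul hu hv hvM hk (hk.isPrim_dualSol hl (starRingEnd ℂ z) (-wᴴ)) hr
  rw [hd0] at h3
  rw [h0] at h1
  have h4 := h2.trans h1
  rw [dualCol, ← h3, upperRow_mul_fromRows, norm_cexp_smul_ofReal, Complex.conj_im] at h4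
  have h5 := mul_le_mul_of_nonneg_right (norm_one_matrix_le (p := Fin m₂))
      (Real.exp_pos ((-z.im + M) * r)).le
  have e1 : (Complex.I * starRingEnd ℂ z).re * r = z.im * r := by simp
  rw [e1] at h4
  have h6 : Real.exp (z.im * r) * ‖-wᴴ + opN N (dualSol k (starRingEnd ℂ z) (-wᴴ)) r‖ ≤
      Real.exp (z.im * r) * (Real.exp (M * r) * Real.exp (-(2 * z.im * r))) := by
    refine (h4.trans h5).trans (le_of_eq ?_)
    rw [one_mul, ← Real.exp_add, ← Real.exp_add]
    ring_nf
  refine (le_of_mul_le_mul_left h6 (Real.exp_pos _)).trans ?_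
  exact mul_le_mul_of_nonneg_right (Real.exp_le_exp.2 (mul_le_mul_of_nonneg_left hr.2 hM))
    (Real.exp_pos _).le

lemma IsNodeDensity.integral_expKer_adj (hk : IsNodeDensity l v E k) (z : ℂ) (y : ℝ) :
    ∫ t in (0 : ℝ)..y, expKer (starRingEnd ℂ z) t • (k t)ᴴ = (lap k z y)ᴴ := by
  have hi : IntervalIntegrable (fun t : ℝ => Complex.exp (2 * (Complex.I * z) * t) • k t)
      volume 0 y := (hk.intervalIntegrable 0 y).continuousOn_smul
        (Continuous.continuousOn (by fun_prop))
  rw [lap, ← integral_adj hi]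
  refine intervalIntegral.integral_congr fun t _ => ?_
  rw [conjTranspose_smul, RCLike.star_def, ← Complex.exp_conj, expKer]
  congr 2
  simp only [map_mul, Complex.conj_I, Complex.conj_ofReal, map_ofNat]
  ring

/-- The Laplace transform of the residual is exponentially small: up to such an error `-φ(ω̄)*` is
the transform of `k*`, so that the transform of the residual agrees with the upper block of the
solution with initial value `[-φ(ω̄)*; I]`, stripped of its exponential factor. -/
lemma IsTransmutation.norm_laplace_residual_le (h : IsTransmutation l v E N)
    (hu : IsFundamentalSolution l v u) (hv : StronglyMeasurable v)
    (hvM : ∀ x, ‖v x‖ ≤ M) (hk : IsNodeDensity l v E k)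
    (hφ : ∀ z ∈ halfPlane M, φ z ∈ weylBall M u l z) {r : ℝ} (hr : r ∈ Ioc 0 l) :
    ∃ C, ∀ ω : ℂ, ω.im < -M → ‖∫ t in (0 : ℝ)..r, expKer ω t • residual N k r t‖ ≤
      C * Real.exp (2 * ω.im * r) := by
  have hl : 0 ≤ l := hr.1.le.trans hr.2
  have hr' : r ∈ Icc 0 l := Ioc_subset_Icc_self hr
  obtain ⟨D, hD0, hD⟩ := h.norm_add_lap_le hu hv hvM hk hl
  obtain ⟨B, hB0, hB⟩ := h.exists_norm_rowN_le
  obtain ⟨K, hK0, hK⟩ := hk.bound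
  have hk0 : ∀ x < 0, k x = 0 := fun x hx => hk.zero x fun hx' => not_le.2 hx hx'.1
  set ν := rowN N r with hν
  set H := corr r ν k with hH
  have hνm := h.rowN_measurable r
  have hνB := hB r hr'
  have hHm : StronglyMeasurable H := stronglyMeasurable_corr hνm hk.measurable
  have hHB : ∀ s, ‖H s‖ ≤ B * K * r := norm_corr_le hr.1.le hνB hK
  have hkm : StronglyMeasurable fun s => (k s)ᴴ := stronglyMeasurable_adj hk.measurable
  have hkB : ∀ s, ‖(k s)ᴴ‖ ≤ K := fun s => (Matrix.l2_opNorm_conjTranspose _).le.trans (hK s)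
  have hk0' : ∀ x < 0, (k x)ᴴ = 0 := fun x hx => by rw [hk0 x hx, conjTranspose_zero]
  refine ⟨Real.exp (M * l) + D + B * K * r * D * r, fun ω hω => ?_⟩
  set z := starRingEnd ℂ ω with hzd
  have hωz : ω = starRingEnd ℂ z := by rw [hzd, Complex.conj_conj]
  have him : ω.im = -z.im := by rw [hωz, Complex.conj_im]
  have hz : M < z.im := by linarith
  set A : Matrix (Fin m₁) (Fin m₂) ℂ := -(φ z)ᴴ with hA
  let Kf : ℝ → Matrix (Fin m₁) (Fin m₂) ℂ := fun y => ∫ t in (0 : ℝ)..y, expKer ω t • (k t)ᴴ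
  have hKf : ∀ y, Kf y = (lap k z y)ᴴ := fun y => by
    simp only [Kf, hωz]; exact hk.integral_expKer_adj z y
  have hAK : ∀ y ∈ Icc 0 l, ‖A - Kf y‖ ≤ D * Real.exp (-(2 * z.im * y)) := by
    intro y hy
    have : A - Kf y = -(φ z + lap k z y)ᴴ := by
      rw [hKf, hA, conjTranspose_add]; abel
    rw [this, norm_neg, Matrix.l2_opNorm_conjTranspose]
    exact hD z hz _ (hφ z hz) y hy
  have h1 := h.norm_add_opN_dualSol_le hu hv hvM hk hl hz (hφ z hz) hr'
  rw [← hωz, ← hA] at h1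
  have iν : IntervalIntegrable ν volume 0 r := intervalIntegrable_of_measurable_bdd hνm hνB 0 r
  have iH : IntervalIntegrable H volume 0 r := intervalIntegrable_of_measurable_bdd hHm hHB 0 r
  have ik : IntervalIntegrable (fun s => (k s)ᴴ) volume 0 r :=
    intervalIntegrable_of_measurable_bdd hkm hkB 0 r
  -- the representation of `N F`
  have hNF : opN N (dualSol k ω A) r = (∫ x in (0 : ℝ)..r, expKer ω x • ν x) +
      (∫ s in (0 : ℝ)..r, expKer ω s • H s) * A := by
    have hlapc : ContinuousOn (fun x => expKer ω x • lap k ω x) (uIcc 0 r) := by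
      rw [uIcc_of_le hr.1.le]
      exact (continuous_expKer ω).continuousOn.smul
        ((hk.isPrim_lap hl ω).continuousOn.mono (Icc_subset_Icc_right hr.2))
    have i1 : IntervalIntegrable
        (fun x => ν x * ∫ t in (0 : ℝ)..x, expKer ω (x - t) • k t) volume 0 r := by
      simp only [integral_expKer_sub_smul]
      exact intervalIntegrable_bdd_mul hνm.aestronglyMeasurable (ae_of_all _ hνB)
        hlapc.intervalIntegrable
    rw [opN_eq_rowN hr.1.le, hH, ← integral_mul_causal hr.1.le hνm hνB hk.measurable hK hk0,
      ← integral_matrix_mul_const A i1, ← intervalIntegral.integral_add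
        (intervalIntegrable_expKer_smul iν ω) (intervalIntegrable_mul_const i1 A)]
    refine intervalIntegral.integral_congr fun x _ => ?_
    rw [dualSol_eq, Matrix.mul_add, Matrix.mul_smul, Matrix.mul_one, Matrix.mul_assoc]
  have hKc : ContinuousOn (fun s => Kf (r - s)) (uIcc 0 r) := by
    have h2 : ContinuousOn (fun y => Kf y) (Icc 0 l) := by
      simp only [hKf]
      exact (adjL (Fin m₂) (Fin m₁)).continuous.comp_continuousOn (hk.isPrim_lap hl z).continuousOn
    rw [uIcc_of_le hr.1.le]
    refine h2.comp (Continuous.continuousOn (by fun_prop)) fun s hs => ?_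
    exact ⟨sub_nonneg.2 hs.2, by linarith [hs.1, hr.2]⟩
  have iHK : IntervalIntegrable (fun s => H s * Kf (r - s)) volume 0 r :=
    intervalIntegrable_bdd_mul hHm.aestronglyMeasurable (ae_of_all _ hHB) hKc.intervalIntegrable
  have hres : ∫ t in (0 : ℝ)..r, expKer ω t • residual N k r t =
      (A + opN N (dualSol k ω A) r) - (A - Kf r) -
        ∫ s in (0 : ℝ)..r, expKer ω s • (H s * (A - Kf (r - s))) := by
    have ic : IntervalIntegrable (conv r H fun s => (k s)ᴴ) volume 0 r :=
      intervalIntegrable_of_measurable_bdd (stronglyMeasurable_conv hHm hkm)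
        (norm_conv_le hr.1.le hHB hkB) 0 r
    have e1 : ∫ t in (0 : ℝ)..r, expKer ω t • residual N k r t =
        (∫ t in (0 : ℝ)..r, expKer ω t • ν t) + Kf r +
          ∫ t in (0 : ℝ)..r, expKer ω t • conv r H (fun s => (k s)ᴴ) t := by
      have j1 := intervalIntegrable_expKer_smul iν ω
      have j2 := intervalIntegrable_expKer_smul ik ω
      rw [show Kf r = ∫ t in (0 : ℝ)..r, expKer ω t • (k t)ᴴ from rfl,
        ← intervalIntegral.integral_add j1 j2,
        ← intervalIntegral.integral_add (j1.add j2) (intervalIntegrable_expKer_smul ic ω)]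
      refine intervalIntegral.integral_congr fun t _ => ?_
      simp only [residual, smul_add]
      rfl
    have e2 : ∫ s in (0 : ℝ)..r, expKer ω s • (H s * (A - Kf (r - s))) =
        (∫ s in (0 : ℝ)..r, expKer ω s • H s) * A -
          ∫ s in (0 : ℝ)..r, expKer ω s • (H s * Kf (r - s)) := by
      rw [← integral_matrix_mul_const A (intervalIntegrable_expKer_smul iH ω),
        ← intervalIntegral.integral_sub
          (intervalIntegrable_mul_const (intervalIntegrable_expKer_smul iH ω) A)
          (intervalIntegrable_expKer_smul iHK ω)]
      refine intervalIntegral.integral_congr fun s _ => ?_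
      rw [Matrix.mul_sub, smul_sub, Matrix.smul_mul]
    rw [e1, e2, hNF, ← integral_mul_causal_tail hr.1.le hHm hHB hkm hkB hk0' ω]
    abel
  have hbound : ‖∫ s in (0 : ℝ)..r, expKer ω s • (H s * (A - Kf (r - s)))‖ ≤
      B * K * r * D * Real.exp (2 * ω.im * r) * r := by
    have := intervalIntegral.norm_integral_le_of_norm_le_const (a := 0) (b := r)
      (f := fun s => expKer ω s • (H s * (A - Kf (r - s))))
      (C := B * K * r * D * Real.exp (2 * ω.im * r)) fun s hs => ?_
    · rwa [sub_zero, abs_of_pos hr.1] at this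
    · rw [uIoc_of_le hr.1.le] at hs
      rw [norm_smul, norm_expKer]
      have h2 := norm_mul_le_of_le (hHB s)
        (hAK (r - s) ⟨sub_nonneg.2 hs.2, by linarith [hs.1, hr.2]⟩)
      refine (mul_le_mul_of_nonneg_left h2 (Real.exp_pos _).le).trans (le_of_eq ?_)
      have e3 : Real.exp (2 * ω.im * r) =
          Real.exp (2 * ω.im * s) * Real.exp (-(2 * z.im * (r - s))) := by
        rw [← Real.exp_add, him]; ring_nf
      rw [e3]; ring
  have e4 : -(2 * z.im * r) = 2 * ω.im * r := by rw [him]; ring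
  have h2 := hAK r hr'
  rw [e4] at h1 h2
  rw [hres]
  refine (norm_sub_le _ _).trans ((add_le_add ((norm_sub_le _ _).trans (add_le_add h1 h2))
    hbound).trans (le_of_eq ?_))
  ring

end Factorization

/-! ### Invertibility of the operators `S_r` -/

section Gram

variable {m₁ m₂ p q : ℕ} {k : ℝ → Matrix (Fin m₂) (Fin m₁) ℂ} {r l K : ℝ}
  {f : ℝ → Matrix (Fin m₂) (Fin p) ℂ} {g : ℝ → Matrix (Fin m₂) (Fin q) ℂ}

lemma intervalIntegral_swap_of_le {V : Type*} [NormedAddCommGroup V] [NormedSpace ℝ V]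
    {F : ℝ → ℝ → V} {g : ℝ → ℝ} (hr : 0 ≤ r) (hF : StronglyMeasurable (Function.uncurry F))
    (hg : IntervalIntegrable g volume 0 r) (hle : ∀ x y, ‖F x y‖ ≤ g x) :
    ∫ x in (0 : ℝ)..r, ∫ y in (0 : ℝ)..r, F x y = ∫ y in (0 : ℝ)..r, ∫ x in (0 : ℝ)..r, F x y := by
  refine intervalIntegral_intervalIntegral_swap ?_
  rw [intervalIntegrable_iff] at hg
  rw [IntegrableOn, Measure.volume_eq_prod, ← Measure.prod_restrict]
  rw [uIoc_of_le hr] at hg ⊢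
  exact Integrable.mono' (Integrable.comp_fst hg _) hF.aestronglyMeasurable
    (ae_of_all _ fun p => hle _ _)

/-- The kernel `∫₀ʳ k(x - ζ) k(t - ζ)* dζ`. -/
noncomputable def gram (r : ℝ) (k : ℝ → Matrix (Fin m₂) (Fin m₁) ℂ) (x t : ℝ) :
    Matrix (Fin m₂) (Fin m₂) ℂ := ∫ ζ in (0 : ℝ)..r, k (x - ζ) * (k (t - ζ))ᴴ

/-- The function `∫₀ʳ k(t - ζ)* f(t) dt` of `ζ`, the adjoint of convolution with `k`. -/
noncomputable def adjConv (r : ℝ) (k : ℝ → Matrix (Fin m₂) (Fin m₁) ℂ)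
    (f : ℝ → Matrix (Fin m₂) (Fin p) ℂ) (ζ : ℝ) : Matrix (Fin m₁) (Fin p) ℂ :=
  ∫ t in (0 : ℝ)..r, (k (t - ζ))ᴴ * f t

/-- The integral operator with kernel `gram`. -/
noncomputable def gramOp (r : ℝ) (k : ℝ → Matrix (Fin m₂) (Fin m₁) ℂ)
    (f : ℝ → Matrix (Fin m₂) (Fin p) ℂ) (x : ℝ) : Matrix (Fin m₂) (Fin p) ℂ :=
  ∫ t in (0 : ℝ)..r, gram r k x t * f t

lemma norm_adj_le (hK : ∀ x, ‖k x‖ ≤ K) (x : ℝ) : ‖(k x)ᴴ‖ ≤ K :=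
  (Matrix.l2_opNorm_conjTranspose _).le.trans (hK x)

lemma stronglyMeasurable_gram (hk : StronglyMeasurable k) :
    StronglyMeasurable (Function.uncurry (gram r k)) :=
  stronglyMeasurable_intervalIntegral (α := ℝ × ℝ)
    (h := fun q ζ => k (q.1 - ζ) * (k (q.2 - ζ))ᴴ) (e := fun _ => r)
    (stronglyMeasurable_mul (hk.comp_measurable (by fun_prop))
      (stronglyMeasurable_adj (hk.comp_measurable (by fun_prop)))) measurable_const

lemma norm_gram_le (hr : 0 ≤ r) (hK : ∀ x, ‖k x‖ ≤ K) (x t : ℝ) : ‖gram r k x t‖ ≤ K * K * r := by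
  have := intervalIntegral.norm_integral_le_of_norm_le_const (a := 0) (b := r)
    (f := fun ζ => k (x - ζ) * (k (t - ζ))ᴴ) (C := K * K)
    fun ζ _ => norm_mul_le_of_le (hK _) (norm_adj_le hK _)
  rwa [sub_zero, abs_of_nonneg hr] at this

lemma stronglyMeasurable_adjConv (hk : StronglyMeasurable k) (hf : StronglyMeasurable f) :
    StronglyMeasurable (adjConv r k f) :=
  stronglyMeasurable_intervalIntegral (h := fun ζ t => (k (t - ζ))ᴴ * f t) (e := fun _ => r)
    (stronglyMeasurable_mul (stronglyMeasurable_adj (hk.comp_measurable (by fun_prop)))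
      (hf.comp_measurable measurable_snd)) measurable_const

lemma norm_integral_mul_le {a b c : ℕ} {G : ℝ → Matrix (Fin a) (Fin b) ℂ}
    {f : ℝ → Matrix (Fin b) (Fin c) ℂ} {C : ℝ} (hr : 0 ≤ r) (hG : ∀ x, ‖G x‖ ≤ C)
    (hf : IntervalIntegrable f volume 0 r) :
    ‖∫ t in (0 : ℝ)..r, G t * f t‖ ≤ C * ∫ t in (0 : ℝ)..r, ‖f t‖ := by
  rw [← intervalIntegral.integral_const_mul]
  exact intervalIntegral.norm_integral_le_of_norm_le hr
    (ae_of_all _ fun t _ => norm_mul_le_of_le (hG t) le_rfl) (hf.norm.const_mul C)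

lemma norm_gramOp_le (hr : 0 ≤ r) (hK : ∀ x, ‖k x‖ ≤ K) (hf : IntervalIntegrable f volume 0 r)
    (x : ℝ) : ‖gramOp r k f x‖ ≤ K * K * r * ∫ t in (0 : ℝ)..r, ‖f t‖ :=
  norm_integral_mul_le hr (norm_gram_le hr hK x) hf

lemma norm_adjConv_le (hr : 0 ≤ r) (hK : ∀ x, ‖k x‖ ≤ K) (hf : IntervalIntegrable f volume 0 r)
    (x : ℝ) : ‖adjConv r k f x‖ ≤ K * ∫ t in (0 : ℝ)..r, ‖f t‖ :=
  norm_integral_mul_le hr (fun t => norm_adj_le hK (t - x)) hf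

lemma stronglyMeasurable_gramOp (hk : StronglyMeasurable k) (hf : StronglyMeasurable f) :
    StronglyMeasurable (gramOp r k f) :=
  stronglyMeasurable_intervalIntegral (h := fun x t => gram r k x t * f t) (e := fun _ => r)
    (stronglyMeasurable_mul (stronglyMeasurable_gram hk)
      (hf.comp_measurable measurable_snd)) measurable_const

/-- The operator with kernel `gram` is convolution with `k` composed with its adjoint. -/
lemma gramOp_eq (hr : 0 ≤ r) (hk : StronglyMeasurable k) (hK : ∀ x, ‖k x‖ ≤ K)
    (hf : StronglyMeasurable f) (hfi : IntervalIntegrable f volume 0 r) (x : ℝ) :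
    gramOp r k f x = ∫ ζ in (0 : ℝ)..r, k (x - ζ) * adjConv r k f ζ := by
  have hK0 : 0 ≤ K := (norm_nonneg _).trans (hK 0)
  have hkx : StronglyMeasurable fun ζ => k (x - ζ) := hk.comp_measurable (by fun_prop)
  have e1 : ∀ t ∈ uIcc 0 r, gram r k x t * f t =
      ∫ ζ in (0 : ℝ)..r, k (x - ζ) * (k (t - ζ))ᴴ * f t := by
    intro t _
    refine (integral_matrix_mul_const _ ?_).symm
    exact intervalIntegrable_of_measurable_bdd (C := K * K) (stronglyMeasurable_mul hkx
      (stronglyMeasurable_adj (hk.comp_measurable (by fun_prop))))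
      (fun ζ => norm_mul_le_of_le (hK _) (norm_adj_le hK _)) 0 r
  rw [gramOp, intervalIntegral.integral_congr e1,
    intervalIntegral_swap_of_le (g := fun t => K * K * ‖f t‖) hr]
  · refine intervalIntegral.integral_congr fun ζ _ => ?_
    rw [adjConv, ← integral_const_matrix_mul]
    · exact intervalIntegral.integral_congr fun t _ => Matrix.mul_assoc _ _ _
    · exact intervalIntegrable_bdd_mul (C := K) (stronglyMeasurable_adj
        (hk.comp_measurable (by fun_prop))).aestronglyMeasurable
        (ae_of_all _ fun t => norm_adj_le hK _) hfi
  · exact stronglyMeasurable_mul (stronglyMeasurable_mul (hk.comp_measurable (by fun_prop))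
      (stronglyMeasurable_adj (hk.comp_measurable (by fun_prop))))
      (hf.comp_measurable measurable_fst)
  · exact hfi.norm.const_mul _
  · exact fun t ζ => norm_mul_le_of_le (norm_mul_le_of_le (hK _) (norm_adj_le hK _)) le_rfl

/-- The sesquilinear form of the operator with kernel `gram`. -/
lemma integral_adj_mul_gramOp (hr : 0 ≤ r) (hk : StronglyMeasurable k) (hK : ∀ x, ‖k x‖ ≤ K)
    (hf : StronglyMeasurable f) (hfi : IntervalIntegrable f volume 0 r)
    (hg : StronglyMeasurable g) (hgi : IntervalIntegrable g volume 0 r) :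
    ∫ x in (0 : ℝ)..r, (g x)ᴴ * gramOp r k f x =
      ∫ ζ in (0 : ℝ)..r, (adjConv r k g ζ)ᴴ * adjConv r k f ζ := by
  have hK0 : 0 ≤ K := (norm_nonneg _).trans (hK 0)
  have hbm : StronglyMeasurable (adjConv r k f) := stronglyMeasurable_adjConv hk hf
  have hbB := norm_adjConv_le hr hK hfi
  set B := K * ∫ t in (0 : ℝ)..r, ‖f t‖
  have hB0 : 0 ≤ B := (norm_nonneg _).trans (hbB 0)
  have e1 : ∀ x ∈ uIcc 0 r, (g x)ᴴ * gramOp r k f x =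
      ∫ ζ in (0 : ℝ)..r, (g x)ᴴ * (k (x - ζ) * adjConv r k f ζ) := by
    intro x _
    rw [gramOp_eq hr hk hK hf hfi, integral_const_matrix_mul]
    exact intervalIntegrable_of_measurable_bdd (C := K * B) (stronglyMeasurable_mul
      (hk.comp_measurable (by fun_prop)) hbm) (fun ζ => norm_mul_le_of_le (hK _) (hbB _)) 0 r
  rw [intervalIntegral.integral_congr e1,
    intervalIntegral_swap_of_le (g := fun x => ‖g x‖ * (K * B)) hr]
  · refine intervalIntegral.integral_congr fun ζ _ => ?_
    have hi : IntervalIntegrable (fun x => (k (x - ζ))ᴴ * g x) volume 0 r :=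
      intervalIntegrable_bdd_mul (C := K) (stronglyMeasurable_adj
        (hk.comp_measurable (by fun_prop))).aestronglyMeasurable
        (ae_of_all _ fun t => norm_adj_le hK _) hgi
    rw [show adjConv r k g ζ = ∫ t in (0 : ℝ)..r, (k (t - ζ))ᴴ * g t from rfl, ← integral_adj hi,
      ← integral_matrix_mul_const _ (intervalIntegrable_adj hi)]
    refine intervalIntegral.integral_congr fun x _ => ?_
    rw [Matrix.conjTranspose_mul, conjTranspose_conjTranspose, Matrix.mul_assoc]
  · exact stronglyMeasurable_mul (stronglyMeasurable_adj (hg.comp_measurable measurable_fst))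
      (stronglyMeasurable_mul (hk.comp_measurable (by fun_prop))
        (hbm.comp_measurable measurable_snd))
  · exact hgi.norm.mul_const _
  · exact fun x ζ => norm_mul_le_of_le (Matrix.l2_opNorm_conjTranspose _).le
      (norm_mul_le_of_le (hK _) (hbB _))

/-- Matrices with the operator norm, as a topological vector space, are the Euclidean space of
their entries, which carries the Hilbert–Schmidt inner product. -/
noncomputable def matEquiv (m₂ p : ℕ) :
    EuclideanSpace ℂ (Fin m₂ × Fin p) ≃L[ℂ] Matrix (Fin m₂) (Fin p) ℂ :=
  LinearEquiv.toContinuousLinearEquiv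
    ((WithLp.linearEquiv 2 ℂ (Fin m₂ × Fin p → ℂ)).trans
      (LinearEquiv.curry ℂ ℂ (Fin m₂) (Fin p)))

lemma matEquiv_apply (x : EuclideanSpace ℂ (Fin m₂ × Fin p)) (i : Fin m₂) (j : Fin p) :
    matEquiv m₂ p x i j = x (i, j) := rfl

lemma inner_eq_trace (x y : EuclideanSpace ℂ (Fin m₂ × Fin p)) :
    inner ℂ x y = ((matEquiv m₂ p x)ᴴ * matEquiv m₂ p y).trace := by
  rw [PiLp.inner_apply, Fintype.sum_prod_type, Finset.sum_comm, Matrix.trace]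
  refine Finset.sum_congr rfl fun j _ => ?_
  rw [Matrix.diag_apply, Matrix.mul_apply]
  refine Finset.sum_congr rfl fun i _ => ?_
  rw [RCLike.inner_apply, conjTranspose_apply, matEquiv_apply, matEquiv_apply, mul_comm]
  rfl

lemma integral_trace {F : ℝ → Matrix (Fin p) (Fin p) ℂ} (hF : IntervalIntegrable F volume 0 r) :
    ∫ x in (0 : ℝ)..r, (F x).trace = (∫ x in (0 : ℝ)..r, F x).trace :=
  (LinearMap.toContinuousLinearMap (Matrix.traceLinearMap (Fin p) ℂ ℂ)).intervalIntegral_comp_comm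
    hF

lemma integral_vol {V : Type*} [NormedAddCommGroup V] [NormedSpace ℝ V] (hr : 0 ≤ r) (f : ℝ → V) :
    ∫ x, f x ∂(vol r) = ∫ x in (0 : ℝ)..r, f x := by
  rw [intervalIntegral.integral_of_le hr, integral_Ioc_eq_integral_Ioo]

lemma intervalIntegrable_of_memLp {V : Type*} [NormedAddCommGroup V] {f : ℝ → V} (hr : 0 ≤ r)
    (hf : MemLp f 2 (vol r)) : IntervalIntegrable f volume 0 r := by
  rw [intervalIntegrable_iff_integrableOn_Ioo_of_le hr]
  have : IsFiniteMeasure (vol r) := ⟨by simp [vol]⟩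
  exact hf.integrable (by norm_num)

end Gram

section Invertible

variable {m₁ m₂ p q : ℕ} {k : ℝ → Matrix (Fin m₂) (Fin m₁) ℂ} {r l K : ℝ}
  {Φ₁ : ℝ → Matrix (Fin m₂) (Fin m₁) ℂ}

/-- The Hilbert space of square-integrable `m₂ × p` matrix functions on `(0, r)`. -/
noncomputable abbrev MatLp (m₂ p : ℕ) (r : ℝ) := Lp (EuclideanSpace ℂ (Fin m₂ × Fin p)) 2 (vol r)

/-- The matrix function given by an element of the Hilbert space. -/
noncomputable def matFun (f : MatLp m₂ p r) (x : ℝ) : Matrix (Fin m₂) (Fin p) ℂ :=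
  matEquiv m₂ p (f x)

lemma stronglyMeasurable_matFun (f : MatLp m₂ p r) : StronglyMeasurable (matFun f) :=
  (matEquiv m₂ p).continuous.comp_stronglyMeasurable (Lp.stronglyMeasurable f)

lemma memLp_matFun (f : MatLp m₂ p r) : MemLp (matFun f) 2 (vol r) :=
  (matEquiv m₂ p).toContinuousLinearMap.comp_memLp' (Lp.memLp f)

lemma intervalIntegrable_matFun (hr : 0 ≤ r) (f : MatLp m₂ p r) :
    IntervalIntegrable (matFun f) volume 0 r := intervalIntegrable_of_memLp hr (memLp_matFun f)

lemma memLp_gramOp (hr : 0 ≤ r) (hk : StronglyMeasurable k) (hK : ∀ x, ‖k x‖ ≤ K)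
    (f : MatLp m₂ p r) :
    MemLp (fun x => (matEquiv m₂ p).symm (gramOp r k (matFun f) x)) 2 (vol r) := by
  have : IsFiniteMeasure (vol r) := ⟨by simp [vol]⟩
  have h : MemLp (gramOp r k (matFun f)) 2 (vol r) :=
    MemLp.of_bound (stronglyMeasurable_gramOp hk (stronglyMeasurable_matFun f)).aestronglyMeasurable
      _ (ae_of_all _ (norm_gramOp_le hr hK (intervalIntegrable_matFun hr f)))
  exact (matEquiv m₂ p).symm.toContinuousLinearMap.comp_memLp' h

lemma gramOp_congr {f g : ℝ → Matrix (Fin m₂) (Fin p) ℂ} (hr : 0 ≤ r) (h : f =ᵐ[vol r] g) (x : ℝ) :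
    gramOp r k f x = gramOp r k g x := by
  rw [gramOp, gramOp, ← integral_vol hr, ← integral_vol hr]
  exact integral_congr_ae (h.mono fun t ht => by simp only [ht])

lemma intervalIntegrable_gram_mul {f : ℝ → Matrix (Fin m₂) (Fin p) ℂ} (hr : 0 ≤ r)
    (hk : StronglyMeasurable k) (hK : ∀ x, ‖k x‖ ≤ K)
    (hf : IntervalIntegrable f volume 0 r) (x : ℝ) :
    IntervalIntegrable (fun t => gram r k x t * f t) volume 0 r :=
  intervalIntegrable_bdd_mul
    ((stronglyMeasurable_gram hk).comp_measurable measurable_prodMk_left).aestronglyMeasurable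
    (ae_of_all _ fun t => norm_gram_le hr hK x t) hf

lemma gramOp_add {f g : ℝ → Matrix (Fin m₂) (Fin p) ℂ} (hr : 0 ≤ r)
    (hk : StronglyMeasurable k) (hK : ∀ x, ‖k x‖ ≤ K)
    (hf : IntervalIntegrable f volume 0 r) (hg : IntervalIntegrable g volume 0 r) (x : ℝ) :
    gramOp r k (f + g) x = gramOp r k f x + gramOp r k g x := by
  rw [gramOp, gramOp, gramOp, ← intervalIntegral.integral_add
    (intervalIntegrable_gram_mul hr hk hK hf x) (intervalIntegrable_gram_mul hr hk hK hg x)]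
  exact intervalIntegral.integral_congr fun t _ => Matrix.mul_add _ _ _

lemma gramOp_smul (c : ℂ) (f : ℝ → Matrix (Fin m₂) (Fin p) ℂ) (x : ℝ) :
    gramOp r k (c • f) x = c • gramOp r k f x := by
  rw [gramOp, gramOp, ← intervalIntegral.integral_smul]
  refine intervalIntegral.integral_congr fun t _ => ?_
  rw [Pi.smul_apply, Matrix.mul_smul]

/-- The operator with kernel `gram` on the Hilbert space. -/
noncomputable def gramLin (p : ℕ) (hr : 0 ≤ r) (hk : StronglyMeasurable k) (hK : ∀ x, ‖k x‖ ≤ K) :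
    MatLp m₂ p r →ₗ[ℂ] MatLp m₂ p r where
  toFun f := (memLp_gramOp hr hk hK f).toLp _
  map_add' f g := by
    rw [← MemLp.toLp_add]
    refine MemLp.toLp_congr _ _ (ae_of_all _ fun x => ?_)
    have h : matFun (f + g) =ᵐ[vol r] matFun f + matFun g :=
      (Lp.coeFn_add f g).mono fun t ht => by
        rw [matFun, ht, Pi.add_apply, map_add]; rfl
    simp only [Pi.add_apply]
    rw [gramOp_congr hr h, gramOp_add hr hk hK (intervalIntegrable_matFun hr f)
      (intervalIntegrable_matFun hr g), map_add]
  map_smul' c f := by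
    rw [RingHom.id_apply, ← MemLp.toLp_const_smul]
    refine MemLp.toLp_congr _ _ (ae_of_all _ fun x => ?_)
    have h : matFun (c • f) =ᵐ[vol r] c • matFun f :=
      (Lp.coeFn_smul c f).mono fun t ht => by
        rw [matFun, ht, Pi.smul_apply, map_smul]; rfl
    simp only [Pi.smul_apply]
    rw [gramOp_congr hr h, gramOp_smul, map_smul]

lemma matFun_gramLin (hr : 0 ≤ r) (hk : StronglyMeasurable k) (hK : ∀ x, ‖k x‖ ≤ K)
    (f : MatLp m₂ p r) : matFun (gramLin p hr hk hK f) =ᵐ[vol r] gramOp r k (matFun f) := by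
  filter_upwards [(memLp_gramOp hr hk hK f).coeFn_toLp] with x hx
  rw [matFun, show gramLin p hr hk hK f = (memLp_gramOp hr hk hK f).toLp _ from rfl, hx,
    ContinuousLinearEquiv.apply_symm_apply]

lemma inner_matLp (hr : 0 ≤ r) (f g : MatLp m₂ p r) :
    inner ℂ f g = ∫ x in (0 : ℝ)..r, ((matFun f x)ᴴ * matFun g x).trace := by
  rw [L2.inner_def, ← integral_vol hr]
  exact integral_congr_ae (ae_of_all _ fun x => inner_eq_trace _ _)

lemma inner_gramLin (hr : 0 ≤ r) (hk : StronglyMeasurable k) (hK : ∀ x, ‖k x‖ ≤ K)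
    (f g : MatLp m₂ p r) : inner ℂ g (gramLin p hr hk hK f) =
      ∫ ζ in (0 : ℝ)..r, ((adjConv r k (matFun g) ζ)ᴴ * adjConv r k (matFun f) ζ).trace := by
  have hfi := intervalIntegrable_matFun hr f
  have hgi := intervalIntegrable_matFun hr g
  have hfm := stronglyMeasurable_matFun f
  have hgm := stronglyMeasurable_matFun g
  rw [inner_matLp hr, ← integral_vol hr, integral_congr_ae
    (g := fun x => ((matFun g x)ᴴ * gramOp r k (matFun f) x).trace)
    ((matFun_gramLin hr hk hK f).mono fun x hx => by simp only [hx]), integral_vol hr,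
    integral_trace, integral_trace, integral_adj_mul_gramOp hr hk hK hfm hfi hgm hgi]
  · exact intervalIntegrable_of_measurable_bdd (stronglyMeasurable_mul (stronglyMeasurable_adj
      (stronglyMeasurable_adjConv hk hgm)) (stronglyMeasurable_adjConv hk hfm))
      (fun ζ => norm_mul_le_of_le (norm_adj_le (norm_adjConv_le hr hK hgi) ζ)
        (norm_adjConv_le hr hK hfi ζ)) 0 r
  · refine (hgi.norm.mul_const (K * K * r * ∫ t in (0 : ℝ)..r, ‖matFun f t‖)).mono_fun'
      (stronglyMeasurable_mul (stronglyMeasurable_adj hgm)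
        (stronglyMeasurable_gramOp hk hfm)).aestronglyMeasurable (ae_of_all _ fun x => ?_)
    exact norm_mul_le_of_le (Matrix.l2_opNorm_conjTranspose _).le (norm_gramOp_le hr hK hfi x)

lemma isSymmetric_gramLin (hr : 0 ≤ r) (hk : StronglyMeasurable k) (hK : ∀ x, ‖k x‖ ≤ K) :
    (gramLin p hr hk hK).IsSymmetric := by
  intro f g
  rw [← inner_conj_symm, inner_gramLin, inner_gramLin, intervalIntegral.integral_of_le hr,
    intervalIntegral.integral_of_le hr, ← integral_conj]
  refine integral_congr_ae (ae_of_all _ fun ζ => ?_)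
  simp only
  rw [starRingEnd_apply, ← Matrix.trace_conjTranspose, Matrix.conjTranspose_mul,
    conjTranspose_conjTranspose]

lemma re_inner_gramLin_nonneg (hr : 0 ≤ r) (hk : StronglyMeasurable k) (hK : ∀ x, ‖k x‖ ≤ K)
    (f : MatLp m₂ p r) : 0 ≤ (inner ℂ f (gramLin p hr hk hK f)).re := by
  have h0 : ∀ ζ, 0 ≤ ((adjConv r k (matFun f) ζ)ᴴ * adjConv r k (matFun f) ζ).trace := fun ζ =>
    (posSemidef_conjTranspose_mul_self (adjConv r k (matFun f) ζ)).trace_nonneg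
  have h : ∀ ζ, ((adjConv r k (matFun f) ζ)ᴴ * adjConv r k (matFun f) ζ).trace =
      ((((adjConv r k (matFun f) ζ)ᴴ * adjConv r k (matFun f) ζ).trace.re : ℝ) : ℂ) := fun ζ =>
    Complex.ext rfl (Complex.nonneg_iff.1 (h0 ζ)).2.symm
  rw [inner_gramLin, intervalIntegral.integral_congr fun ζ _ => h ζ,
    intervalIntegral.integral_ofReal, Complex.ofReal_re]
  exact intervalIntegral.integral_nonneg hr fun ζ _ => (Complex.nonneg_iff.1 (h0 ζ)).1

/-- `I + (gram)` is a positive definite operator bounded below by `I`, hence bijective. -/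
lemma bijective_id_add_gramLin (p : ℕ) (hr : 0 ≤ r) (hk : StronglyMeasurable k)
    (hK : ∀ x, ‖k x‖ ≤ K) :
    Function.Bijective fun f : MatLp m₂ p r => f + gramLin p hr hk hK f := by
  -- a symmetric operator defined everywhere is bounded, by the Hellinger–Toeplitz theorem
  let G : MatLp m₂ p r →L[ℂ] MatLp m₂ p r :=
    ⟨gramLin p hr hk hK, (isSymmetric_gramLin hr hk hK).continuous⟩
  have hu : IsUnit (1 + G) := by
    refine ContinuousLinearMap.isUnit_of_forall_le_norm_inner_map _ (c := 1) one_pos fun f => ?_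
    have h1 : inner ℂ ((1 + G) f) f = inner ℂ f f + inner ℂ f (gramLin p hr hk hK f) := by
      rw [← isSymmetric_gramLin hr hk hK f f, ← inner_add_left]
      rfl
    have h2 : (inner ℂ f f : ℂ).re = ‖f‖ ^ 2 := inner_self_eq_norm_sq (𝕜 := ℂ) f
    refine le_trans ?_ (Complex.re_le_norm _)
    rw [h1, Complex.add_re, h2, NNReal.coe_one, mul_one]
    linarith [re_inner_gramLin_nonneg hr hk hK f]
  exact ContinuousLinearMap.isUnit_iff_bijective.1 hu

/-- The compressed operator `S_r` in terms of the derivative `k` of `Φ₁`. -/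
lemma opS_indicator (hΦ : ∀ᵐ x ∂(vol l), deriv Φ₁ x = k x) (hk0 : ∀ x < 0, k x = 0)
    (hrl : r ≤ l) (f : ℝ → Matrix (Fin m₂) (Fin p) ℂ) {x : ℝ} (hx : x ∈ Ioo 0 r) :
    opS l Φ₁ ((Ioo 0 r).indicator f) x = f x + gramOp r k f x := by
  have hr : 0 < r := hx.1.trans hx.2
  -- `ζ ↦ y - ζ` maps null sets to null sets, so that equality almost everywhere suffices under the
  -- integral, even though it is needed at every point `(x, t)`
  have hae : ∀ y ∈ Ioo 0 l, ∀ᵐ ζ : ℝ, ζ ∈ Ioo 0 y → deriv Φ₁ (y - ζ) = k (y - ζ) := by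
    intro y hy
    have h1 := (ae_restrict_iff' measurableSet_Ioo).1 hΦ
    filter_upwards [(quasiMeasurePreserving_sub_left volume y).ae h1] with ζ hζ hm
    exact hζ ⟨sub_pos.2 hm.2, by linarith [hm.1, hy.2]⟩
  have hs : ∀ t ∈ Ioo 0 r, sKernel Φ₁ x t = gram r k x t := by
    intro t ht
    have hm0 : 0 < min x t := lt_min hx.1 ht.1
    have hmr : min x t ≤ r := (min_le_left _ _).trans hx.2.le
    have e1 : sKernel Φ₁ x t = ∫ ζ in (0 : ℝ)..(min x t), k (x - ζ) * (k (t - ζ))ᴴ := by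
      rw [sKernel, intervalIntegral.integral_of_le hm0.le, intervalIntegral.integral_of_le hm0.le,
        integral_Ioc_eq_integral_Ioo, integral_Ioc_eq_integral_Ioo]
      refine setIntegral_congr_ae measurableSet_Ioo ?_
      filter_upwards [hae x ⟨hx.1, hx.2.trans_le hrl⟩, hae t ⟨ht.1, ht.2.trans_le hrl⟩]
        with ζ h1 h2 hζ
      rw [h1 ⟨hζ.1, hζ.2.trans_le (min_le_left _ _)⟩, h2 ⟨hζ.1, hζ.2.trans_le (min_le_right _ _)⟩]
    rw [e1, gram, intervalIntegral.integral_of_le hm0.le, intervalIntegral.integral_of_le hr.le]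
    refine (setIntegral_eq_of_subset_of_forall_sdiff_eq_zero measurableSet_Ioc
      (Ioc_subset_Ioc_right hmr) fun ζ hζ => ?_).symm
    have hlt : min x t < ζ := by
      by_contra hc
      exact hζ.2 ⟨hζ.1.1, not_lt.1 hc⟩
    rcases min_lt_iff.1 hlt with h | h
    · rw [hk0 _ (sub_neg.2 h), Matrix.zero_mul]
    · rw [hk0 (t - ζ) (sub_neg.2 h), conjTranspose_zero, Matrix.mul_zero]
  rw [opS, indicator_of_mem hx, gramOp, intervalIntegral.integral_of_le (hr.le.trans hrl),
    intervalIntegral.integral_of_le hr.le, integral_Ioc_eq_integral_Ioo,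
    integral_Ioc_eq_integral_Ioo]
  congr 1
  refine (setIntegral_eq_of_subset_of_forall_sdiff_eq_zero measurableSet_Ioo
    (Ioo_subset_Ioo_right hrl) fun t ht => ?_).trans
      (setIntegral_congr_fun measurableSet_Ioo fun t ht => ?_)
  · rw [indicator_of_notMem ht.2, Matrix.mul_zero]
  · simp only [indicator_of_mem ht, hs t ht]

lemma compressedEq_iff (hΦ : ∀ᵐ x ∂(vol l), deriv Φ₁ x = k x) (hk0 : ∀ x < 0, k x = 0)
    (hrl : r ≤ l) {f g : ℝ → Matrix (Fin m₂) (Fin p) ℂ} :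
    CompressedEq l r Φ₁ f g ↔
      MemLp f 2 (vol r) ∧ ∀ᵐ x ∂(vol r), f x + gramOp r k f x = g x := by
  refine and_congr_right fun _ => ?_
  have h : ∀ᵐ x ∂(vol r), opS l Φ₁ ((Ioo 0 r).indicator f) x = f x + gramOp r k f x :=
    ae_restrict_of_forall_mem measurableSet_Ioo fun x hx => opS_indicator hΦ hk0 hrl f hx
  exact ⟨fun h' => by filter_upwards [h, h'] with x h1 h2; rw [← h1, h2],
    fun h' => by filter_upwards [h, h'] with x h1 h2; rw [h1, h2]⟩

/-- `S_r = I + B B*`, with `B` the convolution with `Φ₁'`, is invertible on matrix functions with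
any number of columns. -/
lemma compressedInvertible (hΦ : ∀ᵐ x ∂(vol l), deriv Φ₁ x = k x) (hk : StronglyMeasurable k)
    (hK : ∀ x, ‖k x‖ ≤ K) (hk0 : ∀ x < 0, k x = 0) (hr : 0 ≤ r) (hrl : r ≤ l) :
    CompressedInvertible l r Φ₁ := by
  intro p g hg
  have hb := bijective_id_add_gramLin p hr hk hK
  have toL : ∀ f : ℝ → Matrix (Fin m₂) (Fin p) ℂ, MemLp f 2 (vol r) →
      ∃ F : MatLp m₂ p r, matFun F =ᵐ[vol r] f := by
    intro f hf
    have h := (matEquiv m₂ p).symm.toContinuousLinearMap.comp_memLp' hf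
    refine ⟨h.toLp _, h.coeFn_toLp.mono fun x hx => ?_⟩
    rw [matFun, hx]
    exact (matEquiv m₂ p).apply_symm_apply _
  have hadd : ∀ F : MatLp m₂ p r, matFun (F + gramLin p hr hk hK F) =ᵐ[vol r]
      fun x => matFun F x + gramOp r k (matFun F) x := by
    intro F
    filter_upwards [Lp.coeFn_add F (gramLin p hr hk hK F), matFun_gramLin hr hk hK F] with x h1 h2
    rw [matFun, h1, Pi.add_apply, map_add, ← h2]
    rfl
  have hinj : ∀ F G : MatLp m₂ p r, matFun F =ᵐ[vol r] matFun G → F = G := fun F G h =>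
    Lp.ext (h.mono fun x hx => (matEquiv m₂ p).injective hx)
  simp only [compressedEq_iff hΦ hk0 hrl]
  obtain ⟨G, hG⟩ := toL g hg
  constructor
  · obtain ⟨F, hF⟩ := hb.2 G
    refine ⟨matFun F, memLp_matFun F, ?_⟩
    filter_upwards [hadd F, hG] with x h1 h2
    rw [← h1, ← h2]
    exact congrArg (fun H => matFun H x) hF
  · rintro f f' ⟨hf, hfe⟩ ⟨hf', hfe'⟩
    obtain ⟨F, hF⟩ := toL f hf
    obtain ⟨F', hF'⟩ := toL f' hf'
    have key : ∀ (F : MatLp m₂ p r) (f : ℝ → Matrix (Fin m₂) (Fin p) ℂ), matFun F =ᵐ[vol r] f →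
        (∀ᵐ x ∂(vol r), f x + gramOp r k f x = g x) →
        matFun (F + gramLin p hr hk hK F) =ᵐ[vol r] g := by
      intro F f h1 h2
      filter_upwards [hadd F, h1, h2] with x a1 a2 a3
      rw [a1, a2, gramOp_congr hr h1, a3]
    have : F = F' := hb.1 (hinj _ _ ((key F f hF hfe).trans (key F' f' hF' hfe').symm))
    subst this
    exact hF.symm.trans hF'

end Invertible

/-! ### Recovery of `β` -/

section Beta

variable {m₁ m₂ p q : ℕ} {l M : ℝ} {v : ℝ → Matrix (Fin m₁) (Fin m₂) ℂ}
  {u : ℝ → ℂ → Matrix (Fin m₁ ⊕ Fin m₂) (Fin m₁ ⊕ Fin m₂) ℂ}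
  {E : ℝ → ℝ → Matrix (Fin m₂) (Fin m₂) ℂ} {N : ℝ → ℝ → Matrix (Fin m₁) (Fin m₂) ℂ}
  {k : ℝ → Matrix (Fin m₂) (Fin m₁) ℂ} {φ : ℂ → Matrix (Fin m₂) (Fin m₁) ℂ} {r : ℝ}

lemma IsNodeDensity.eq_zero_of_neg (hk : IsNodeDensity l v E k) {x : ℝ} (hx : x < 0) : k x = 0 :=
  hk.zero x fun hx' => not_le.2 hx hx'.1

lemma IsNodeDensity.deriv_nodePrim (hk : IsNodeDensity l v E k) (hl : 0 ≤ l) :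
    ∀ᵐ x ∂(vol l), deriv (nodePrim k) x = k x :=
  (hk.isPrim hl).ae_hasDerivAt.mono fun _ hx => hx.deriv

lemma IsNodeDensity.bddDiff (hk : IsNodeDensity l v E k) (hl : 0 ≤ l) : BddDiff l (nodePrim k) := by
  obtain ⟨K, _, hK⟩ := hk.bound
  exact ⟨(hk.isPrim hl).absolutelyContinuous (ae_of_all _ hK), K,
    (hk.deriv_nodePrim hl).mono fun x hx => hx ▸ hK x⟩

/-- The Laplace transform of the residual is as small in a lower half-plane as that of a function
concentrated at the endpoint `r`; hence the residual vanishes. -/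
lemma IsTransmutation.residual_ae_eq_zero (h : IsTransmutation l v E N)
    (hu : IsFundamentalSolution l v u) (hv : StronglyMeasurable v)
    (hvM : ∀ x, ‖v x‖ ≤ M) (hk : IsNodeDensity l v E k)
    (hφ : ∀ z ∈ halfPlane M, φ z ∈ weylBall M u l z) (hr : r ∈ Ioc 0 l) :
    ∀ᵐ t ∂(vol r), residual N k r t = 0 := by
  obtain ⟨C, hC⟩ := h.norm_laplace_residual_le hu hv hvM hk hφ hr
  obtain ⟨B, hB0, hB⟩ := h.exists_norm_rowN_le
  obtain ⟨K, hK0, hK⟩ := hk.bound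
  have hνm := h.rowN_measurable r
  have hνB := hB r (Ioc_subset_Icc_self hr)
  have hHm : StronglyMeasurable (corr r (rowN N r) k) := stronglyMeasurable_corr hνm hk.measurable
  have hkm : StronglyMeasurable fun s => (k s)ᴴ := stronglyMeasurable_adj hk.measurable
  refine ae_eq_zero_of_laplace_le (C := C) hr.1 ((norm_nonneg _).trans (hvM 0)) ?_ hC
  have i1 := intervalIntegrable_of_measurable_bdd hνm hνB 0 r
  have i2 := intervalIntegrable_of_measurable_bdd hkm (norm_adj_le hK) 0 r
  have i3 := intervalIntegrable_of_measurable_bdd (stronglyMeasurable_conv (r := r) hHm hkm)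
    (norm_conv_le hr.1.le (norm_corr_le hr.1.le hνB hK) (norm_adj_le hK)) 0 r
  exact (i1.add i2).add i3

/-- The adjoint of the row `-N(r, ·)` is `S_r⁻¹ Φ₁'`. -/
lemma IsTransmutation.compressedEq_rowN (h : IsTransmutation l v E N)
    (hu : IsFundamentalSolution l v u) (hv : StronglyMeasurable v)
    (hvM : ∀ x, ‖v x‖ ≤ M) (hk : IsNodeDensity l v E k)
    (hφ : ∀ z ∈ halfPlane M, φ z ∈ weylBall M u l z) (hr : r ∈ Ioc 0 l) :
    CompressedEq l r (nodePrim k) (fun t => -(rowN N r t)ᴴ) (deriv (nodePrim k)) := by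
  have hl : 0 ≤ l := hr.1.le.trans hr.2
  obtain ⟨B, hB0, hB⟩ := h.exists_norm_rowN_le
  obtain ⟨K, hK0, hK⟩ := hk.bound
  have hfm : StronglyMeasurable fun t => -(rowN N r t)ᴴ :=
    (stronglyMeasurable_adj (h.rowN_measurable r)).neg
  have hfB : ∀ t, ‖-(rowN N r t)ᴴ‖ ≤ B := fun t => by
    rw [norm_neg, Matrix.l2_opNorm_conjTranspose]; exact hB r (Ioc_subset_Icc_self hr) t
  have : IsFiniteMeasure (vol r) := ⟨by simp [vol]⟩
  rw [compressedEq_iff (hk.deriv_nodePrim hl) (fun x => hk.eq_zero_of_neg) hr.2]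
  refine ⟨MemLp.of_bound hfm.aestronglyMeasurable B (ae_of_all _ hfB), ?_⟩
  have hd : ∀ᵐ t ∂(vol r), deriv (nodePrim k) t = k t :=
    ae_mono (Measure.restrict_mono (Ioo_subset_Ioo_right hr.2) le_rfl) (hk.deriv_nodePrim hl)
  filter_upwards [h.residual_ae_eq_zero hu hv hvM hk hφ hr, hd] with t ht hdt
  have e1 : ∀ ζ, adjConv r k (fun t => -(rowN N r t)ᴴ) ζ = -(corr r (rowN N r) k ζ)ᴴ := by
    intro ζ
    rw [corr, ← integral_adj, adjConv, ← intervalIntegral.integral_neg]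
    · refine intervalIntegral.integral_congr fun x _ => ?_
      rw [Matrix.conjTranspose_mul, Matrix.mul_neg]
    · exact intervalIntegrable_of_measurable_bdd (stronglyMeasurable_mul (h.rowN_measurable r)
        (hk.measurable.comp_measurable (by fun_prop)))
        (fun x => norm_mul_le_of_le (hB r (Ioc_subset_Icc_self hr) x) (hK _)) 0 r
  have e2 : gramOp r k (fun t => -(rowN N r t)ᴴ) t =
      -(conv r (corr r (rowN N r) k) (fun s => (k s)ᴴ) t)ᴴ := by
    rw [gramOp_eq hr.1.le hk.measurable hK hfm (intervalIntegrable_of_measurable_bdd hfm hfB 0 r),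
      conv, ← integral_adj, ← intervalIntegral.integral_neg]
    · refine intervalIntegral.integral_congr fun x _ => ?_
      rw [e1, Matrix.conjTranspose_mul, conjTranspose_conjTranspose, Matrix.mul_neg]
    · exact intervalIntegrable_of_measurable_bdd (stronglyMeasurable_mul
        (stronglyMeasurable_corr (h.rowN_measurable r) hk.measurable)
        (stronglyMeasurable_adj (hk.measurable.comp_measurable (by fun_prop))))
        (fun x => norm_mul_le_of_le (norm_corr_le hr.1.le (hB r (Ioc_subset_Icc_self hr)) hK x)
          (norm_adj_le hK _)) 0 r
  have e3 := congrArg conjTranspose ht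
  rw [residual, conjTranspose_add, conjTranspose_add, conjTranspose_conjTranspose,
    conjTranspose_zero] at e3
  rw [e2, hdt, ← sub_eq_zero, ← neg_eq_zero, ← e3]
  abel

lemma upperRow_conjTranspose : (upperRow m₁ m₂)ᴴ = fromRows 1 0 := by
  ext (i | i) j <;> simp [upperRow, Matrix.one_apply, eq_comm, apply_ite]

lemma lowerRow_conjTranspose : (lowerRow m₁ m₂)ᴴ = fromRows 0 1 := by
  ext (i | i) j <;> simp [lowerRow, Matrix.one_apply, eq_comm, apply_ite]

lemma eq_fromCols (B : Matrix (Fin p) (Fin m₁ ⊕ Fin m₂) ℂ) :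
    B = fromCols (B * (upperRow m₁ m₂)ᴴ) (B * (lowerRow m₁ m₂)ᴴ) := by
  ext i (j | j) <;> simp [Matrix.mul_apply, upperRow, lowerRow, Matrix.one_apply, apply_ite]

lemma fromCols_mul_upperRow (A : Matrix (Fin p) (Fin m₁) ℂ) (B : Matrix (Fin p) (Fin m₂) ℂ) :
    fromCols A B * (upperRow m₁ m₂)ᴴ = A := by
  rw [upperRow_conjTranspose, fromCols_mul_fromRows]; simp

lemma fromCols_mul_lowerRow (A : Matrix (Fin p) (Fin m₁) ℂ) (B : Matrix (Fin p) (Fin m₂) ℂ) :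
    fromCols A B * (lowerRow m₁ m₂)ᴴ = B := by
  rw [lowerRow_conjTranspose, fromCols_mul_fromRows]; simp

/-- `β = [I + N Φ₁, N I]`. -/
lemma IsTransmutation.betaFun_eq_opN (h : IsTransmutation l v E N)
    (hu : IsFundamentalSolution l v u) (hv : StronglyMeasurable v)
    (hvM : ∀ x, ‖v x‖ ≤ M) (hk : IsNodeDensity l v E k) (hr : r ∈ Icc 0 l) :
    betaFun u r = fromCols (1 + opN N (nodePrim k) r) (opN N (fun _ => 1) r) := by
  have hl : 0 ≤ l := hr.1.trans hr.2
  have hF : IsPrim l (nodePrim k)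
      (fun x => (-(2 * (Complex.I * (0 : ℂ)))) • nodePrim k x +
        k x * (1 : Matrix (Fin m₁) (Fin m₁) ℂ)) :=
    (hk.isPrim hl).congr_ae (ae_of_all _ fun x => by simp)
  have hG : IsPrim l (fun _ => (1 : Matrix (Fin m₂) (Fin m₂) ℂ))
      (fun x => (-(2 * (Complex.I * (0 : ℂ)))) • (1 : Matrix (Fin m₂) (Fin m₂) ℂ) +
        k x * (0 : Matrix (Fin m₁) (Fin m₂) ℂ)) :=
    (IsPrim.const hl _).congr_ae (ae_of_all _ fun x => by simp)
  have h1 := congrArg (upperRow m₁ m₂ * ·) (h.fundamental_mul hu hv hvM hk hF hr)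
  have h2 := congrArg (upperRow m₁ m₂ * ·) (h.fundamental_mul hu hv hvM hk hG hr)
  have h0 : nodePrim k 0 = 0 := by simp [nodePrim]
  simp only [upperRow_mul_fromRows, ← Matrix.mul_assoc, h0] at h1 h2
  rw [eq_fromCols (betaFun u r), betaFun, upperRow_conjTranspose, lowerRow_conjTranspose,
    ← h1, ← h2]
  simp

/-- Recovery of `β` from `Φ₁`: `β = [I + N Φ₁, N I]`, and the row of `N` is `-(S_r⁻¹ Φ₁')*`. -/
lemma IsTransmutation.betaFun_eq (h : IsTransmutation l v E N)
    (hu : IsFundamentalSolution l v u) (hv : StronglyMeasurable v)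
    (hvM : ∀ x, ‖v x‖ ≤ M) (hk : IsNodeDensity l v E k)
    (hφ : ∀ z ∈ halfPlane M, φ z ∈ weylBall M u l z) (hr : r ∈ Ioc 0 l)
    (hinv : CompressedInvertible l r (nodePrim k))
    {f : ℝ → Matrix (Fin m₂) (Fin m₁) ℂ}
    (hf : CompressedEq l r (nodePrim k) f (deriv (nodePrim k))) :
    betaFun u r = upperRow m₁ m₂ - ∫ t in (0 : ℝ)..r, (f t)ᴴ * fromCols (nodePrim k t) 1 := by
  have hl : 0 ≤ l := hr.1.le.trans hr.2
  have hr' := Ioc_subset_Icc_self hr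
  have hf0 := h.compressedEq_rowN hu hv hvM hk hφ hr
  have : IsFiniteMeasure (vol r) := ⟨by simp [vol]⟩
  have hd : MemLp (deriv (nodePrim k)) 2 (vol r) := by
    obtain ⟨K, hK0, hK⟩ := hk.bound
    have hd : ∀ᵐ t ∂(vol r), deriv (nodePrim k) t = k t :=
      ae_mono (Measure.restrict_mono (Ioo_subset_Ioo_right hr.2) le_rfl) (hk.deriv_nodePrim hl)
    have hd : k =ᵐ[vol r] deriv (nodePrim k) := by filter_upwards [hd] with t ht using ht.symm
    exact (MemLp.of_bound hk.measurable.aestronglyMeasurable K (ae_of_all _ hK)).ae_eq hd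
  have heq := (hinv m₁ _ hd).2 f _ hf hf0
  obtain ⟨B, hB0, hB⟩ := h.exists_norm_rowN_le
  have hcols : IntervalIntegrable (fun t => fromCols (nodePrim k t)
      (1 : Matrix (Fin m₂) (Fin m₂) ℂ)) volume 0 r := by
    have hc : ∀ A : Matrix (Fin m₂) (Fin m₁) ℂ, fromCols A (1 : Matrix (Fin m₂) (Fin m₂) ℂ) =
        A * upperRow m₁ m₂ + lowerRow m₁ m₂ := fun A => by
      ext i (j | j) <;> simp [upperRow, lowerRow, Matrix.mul_fromCols]
    simp only [hc]
    apply ContinuousOn.intervalIntegrable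
    rw [uIcc_of_le hr.1.le]
    exact ((((hk.isPrim hl).mul_const (upperRow m₁ m₂)).add
      (IsPrim.const hl (lowerRow m₁ m₂))).continuousOn.mono (Icc_subset_Icc_right hr.2))
  have e1 : ∫ t in (0 : ℝ)..r, (f t)ᴴ *
      fromCols (nodePrim k t) (1 : Matrix (Fin m₂) (Fin m₂) ℂ) =
      -∫ t in (0 : ℝ)..r, rowN N r t *
        fromCols (nodePrim k t) (1 : Matrix (Fin m₂) (Fin m₂) ℂ) := by
    rw [← intervalIntegral.integral_neg, ← integral_vol hr.1.le, ← integral_vol hr.1.le]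
    refine integral_congr_ae (heq.mono fun t ht => ?_)
    simp only [ht, conjTranspose_neg, conjTranspose_conjTranspose, Matrix.neg_mul]
  have hi3 : IntervalIntegrable (fun t => rowN N r t * fromCols (nodePrim k t)
      (1 : Matrix (Fin m₂) (Fin m₂) ℂ)) volume 0 r :=
    intervalIntegrable_bdd_mul (h.rowN_measurable r).aestronglyMeasurable
      (ae_of_all _ (hB r hr')) hcols
  have e2 : ∫ t in (0 : ℝ)..r, rowN N r t *
      fromCols (nodePrim k t) (1 : Matrix (Fin m₂) (Fin m₂) ℂ) =
      fromCols (opN N (nodePrim k) r) (opN N (fun _ => 1) r) := by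
    rw [eq_fromCols (∫ t in (0 : ℝ)..r, rowN N r t *
        fromCols (nodePrim k t) (1 : Matrix (Fin m₂) (Fin m₂) ℂ)),
      ← integral_matrix_mul_const _ hi3, ← integral_matrix_mul_const _ hi3,
      opN_eq_rowN hr.1.le, opN_eq_rowN hr.1.le]
    simp only [Matrix.mul_assoc, fromCols_mul_upperRow, fromCols_mul_lowerRow]
  rw [e1, e2, sub_neg_eq_add, h.betaFun_eq_opN hu hv hvM hk hr', upperRow]
  ext i (j | j) <;> simp

end Beta

/-! ### Recovery of `γ` and of the potential -/

section Gamma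

variable {m₁ m₂ : ℕ} {l M : ℝ} {v : ℝ → Matrix (Fin m₁) (Fin m₂) ℂ}
  {u : ℝ → ℂ → Matrix (Fin m₁ ⊕ Fin m₂) (Fin m₁ ⊕ Fin m₂) ℂ}

lemma BddDiff.isPrim {a b : Type*} [Fintype a] [Fintype b] [DecidableEq b]
    {f : ℝ → Matrix a b ℂ} (hl : 0 ≤ l) (hf : BddDiff l f) : IsPrim l f (deriv f) := by
  obtain ⟨hac, C, hC⟩ := hf
  have hd : ∀ᵐ x ∂(vol l), HasDerivAt f (deriv f x) x :=
    vol_of_ae_Icc (hac.boundedVariationOn.ae_differentiableAt_of_mem_uIcc.mono fun x hx hx' =>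
      (hx (by rwa [uIcc_of_le hl])).hasDerivAt)
  refine IsPrim.of_absolutelyContinuous hl hac hd ?_ hC
  rw [intervalIntegrable_iff_integrableOn_Ioo_of_le hl]
  exact Measure.integrableOn_of_bounded (M := C) (by simp) (aestronglyMeasurable_deriv f _) hC

lemma hasDerivAt_matrix_inv {a a' : ℝ → Matrix (Fin m₂) (Fin m₂) ℂ} {x : ℝ} (hu : IsUnit (a x))
    (ha : HasDerivAt a (a' x) x) :
    HasDerivAt (fun y => (a y)⁻¹) (-((a x)⁻¹ * a' x * (a x)⁻¹)) x := by
  obtain ⟨w, hw⟩ := hu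
  have h1 := hasFDerivAt_ringInverse (𝕜 := ℝ) w
  rw [hw] at h1
  have h2 := h1.comp_hasDerivAt x ha
  have e : (a x)⁻¹ = ((w⁻¹ : (Matrix (Fin m₂) (Fin m₂) ℂ)ˣ) : Matrix (Fin m₂) (Fin m₂) ℂ) := by
    rw [← hw, Matrix.coe_units_inv]
  rw [e]
  simp only [nonsing_inv_eq_ringInverse]
  exact h2

lemma exists_bound_inv {a : ℝ → Matrix (Fin m₂) (Fin m₂) ℂ} (ha : ContinuousOn a (Icc 0 l))
    (hu : ∀ x ∈ Icc 0 l, IsUnit (a x)) : ∃ C, ∀ x ∈ Icc 0 l, ‖(a x)⁻¹‖ ≤ C := by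
  refine isCompact_Icc.exists_bound_of_continuousOn fun x hx => ?_
  obtain ⟨w, hw⟩ := hu x hx
  have h1 := NormedRing.inverse_continuousAt w
  rw [hw] at h1
  simp only [nonsing_inv_eq_ringInverse]
  exact h1.comp_continuousWithinAt (ha x hx)

/-- The inverse of an invertible boundedly differentiable matrix function is absolutely
continuous. -/
lemma IsPrim.absolutelyContinuous_inv {a a' : ℝ → Matrix (Fin m₂) (Fin m₂) ℂ} {C : ℝ}
    (ha : IsPrim l a a') (hC : ∀ᵐ x ∂(vol l), ‖a' x‖ ≤ C)
    (hu : ∀ x ∈ Icc 0 l, IsUnit (a x)) :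
    AbsolutelyContinuousOnInterval (fun x => (a x)⁻¹) 0 l := by
  obtain ⟨B, hB⟩ := exists_bound_inv ha.continuousOn hu
  have hB0 : 0 ≤ B := (norm_nonneg _).trans (hB 0 ⟨le_rfl, ha.nonneg⟩)
  have hd : ∀ᵐ x ∂(vol l), HasDerivAt a (a' x) x := ha.ae_hasDerivAt
  have hdet : ∀ x ∈ Icc 0 l, IsUnit (a x).det := fun x hx =>
    (Matrix.isUnit_iff_isUnit_det _).1 (hu x hx)
  have hlip : LipschitzOnWith (B * |C| * B).toNNReal (fun x => (a x)⁻¹) (uIcc 0 l) := by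
    rw [uIcc_of_le ha.nonneg]
    refine LipschitzOnWith.of_dist_le_mul fun x hx y hy => ?_
    have e : (a x)⁻¹ - (a y)⁻¹ = (a x)⁻¹ * (a y - a x) * (a y)⁻¹ := by
      rw [Matrix.mul_sub, Matrix.sub_mul, Matrix.nonsing_inv_mul _ (hdet x hx), Matrix.one_mul,
        Matrix.mul_assoc, Matrix.mul_nonsing_inv _ (hdet y hy), Matrix.mul_one]
    have hyx : ‖a y - a x‖ ≤ |C| * ‖x - y‖ := by
      rw [ha.eq x hx, ha.eq y hy, add_sub_add_left_eq_sub,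
        intervalIntegral.integral_interval_sub_left (ha.integrable_of_mem hy)
          (ha.integrable_of_mem hx), norm_sub_rev x y, Real.norm_eq_abs]
      refine intervalIntegral.norm_integral_le_of_norm_le_const_ae ?_
      filter_upwards [ae_Ioc_of_vol hC] with t ht htm
      exact (ht ⟨(le_min hx.1 hy.1).trans_lt htm.1, htm.2.trans (max_le hx.2 hy.2)⟩).trans
        (le_abs_self C)
    rw [dist_eq_norm, dist_eq_norm, e, Real.coe_toNNReal _ (by positivity)]
    refine (norm_mul_le_of_le (norm_mul_le_of_le (hB x hx) hyx) (hB y hy)).trans (le_of_eq ?_)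
    ring
  exact hlip.absolutelyContinuousOnInterval

variable (hu : IsFundamentalSolution l v u) (hv : StronglyMeasurable v)
  (hvM : ∀ x, ‖v x‖ ≤ M) (hl : 0 ≤ l)
include hu hv hvM hl

lemma norm_betaFun_le {x : ℝ} (hx : x ∈ Icc 0 l) : ‖betaFun u x‖ ≤ 1 := by
  have h := Matrix.l2_opNorm_conjTranspose_mul_self (betaFun u x)ᴴ
  rw [conjTranspose_conjTranspose, betaFun_mul_conjTranspose hu hv hvM hl hx,
    Matrix.l2_opNorm_conjTranspose] at h
  nlinarith [norm_one_matrix_le (p := Fin m₁), norm_nonneg (betaFun u x)]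

lemma gammaFun_bddDiff : BddDiff l (gammaFun u) := by
  have hM : 0 ≤ M := (norm_nonneg _).trans (hvM 0)
  have hp := gammaFun_isPrim hu hv hvM hl
  have hC : ∀ᵐ x ∂(vol l), ‖-((v x)ᴴ * betaFun u x)‖ ≤ M * 1 :=
    ae_restrict_of_forall_mem measurableSet_Ioo fun x hx => by
      rw [norm_neg]
      exact norm_mul_le_of_le ((Matrix.l2_opNorm_conjTranspose _).le.trans (hvM x))
        (norm_betaFun_le hu hv hvM hl (Ioo_subset_Icc_self hx))
  refine ⟨hp.absolutelyContinuous hC, M * 1, ?_⟩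
  filter_upwards [hp.ae_hasDerivAt, hC] with x h1 h2
  rwa [h1.deriv]

lemma gammaFun_zero : gammaFun u 0 = lowerRow m₁ m₂ := by
  rw [gammaFun, (hu 0).1, Matrix.mul_one]

lemma isComplement_gammaFun : IsComplement l (betaFun u) (gammaFun u) := by
  refine ⟨gammaFun_bddDiff hu hv hvM hl, fun x hx => ⟨betaFun_mul_gammaFun hu hv hvM hl hx, ?_⟩,
    gammaFun_zero hu hv hvM hl⟩
  rw [gammaFun_mul_conjTranspose hu hv hvM hl hx]
  exact PosDef.one

/-- The potential is recovered from `β` and `γ`. -/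
lemma ae_eq_deriv_betaFun_mul :
    ∀ᵐ x ∂(vol l), v x = deriv (betaFun u) x * (gammaFun u x)ᴴ := by
  have h := ae_restrict_of_forall_mem (μ := volume) measurableSet_Ioo fun x hx =>
    gammaFun_mul_conjTranspose hu hv hvM hl (x := x) (Ioo_subset_Icc_self hx)
  filter_upwards [(betaFun_isPrim hu hv hvM hl).ae_hasDerivAt, h] with x h1 h2
  rw [h1.deriv, Matrix.mul_assoc, h2, Matrix.mul_one]

variable {γt : ℝ → Matrix (Fin m₂) (Fin m₁ ⊕ Fin m₂) ℂ}

lemma IsComplement.mul_betaFun (h : IsComplement l (betaFun u) γt) {x : ℝ} (hx : x ∈ Icc 0 l) :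
    γt x * (betaFun u x)ᴴ = 0 := by
  have := congrArg conjTranspose (h.2.1 x hx).1
  rwa [Matrix.conjTranspose_mul, conjTranspose_conjTranspose, conjTranspose_zero] at this

/-- A complement of `β` is a multiple of `γ`. -/
lemma IsComplement.eq_mul_gammaFun (h : IsComplement l (betaFun u) γt) {x : ℝ}
    (hx : x ∈ Icc 0 l) : γt x = γt x * (gammaFun u x)ᴴ * gammaFun u x := by
  have h1 := congrArg (γt x * ·) (conjTranspose_mul_betaFun_add hu hv hvM hl hx)
  simp only [Matrix.mul_add, ← Matrix.mul_assoc, h.mul_betaFun hu hv hvM hl hx, Matrix.zero_mul,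
    zero_add, Matrix.mul_one] at h1
  exact h1.symm

lemma IsComplement.conjTranspose_eq (h : IsComplement l (betaFun u) γt) {x : ℝ}
    (hx : x ∈ Icc 0 l) : (γt x)ᴴ = (gammaFun u x)ᴴ * (γt x * (gammaFun u x)ᴴ)ᴴ := by
  rw [← Matrix.conjTranspose_mul, ← h.eq_mul_gammaFun hu hv hvM hl hx]

lemma IsComplement.mul_conjTranspose (h : IsComplement l (betaFun u) γt) {x : ℝ}
    (hx : x ∈ Icc 0 l) : γt x * (γt x)ᴴ =
      γt x * (gammaFun u x)ᴴ * (γt x * (gammaFun u x)ᴴ)ᴴ := by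
  rw [Matrix.mul_assoc, ← h.conjTranspose_eq hu hv hvM hl hx]

lemma IsComplement.isUnit (h : IsComplement l (betaFun u) γt) {x : ℝ} (hx : x ∈ Icc 0 l) :
    IsUnit (γt x * (gammaFun u x)ᴴ) := by
  have h1 := (h.2.1 x hx).2.isUnit
  rw [h.mul_conjTranspose hu hv hvM hl hx, Matrix.isUnit_iff_isUnit_det, Matrix.det_mul] at h1
  rw [Matrix.isUnit_iff_isUnit_det]
  exact isUnit_of_mul_isUnit_left h1

lemma IsComplement.isPrim_mul (h : IsComplement l (betaFun u) γt) :
    IsPrim l (fun x => γt x * (gammaFun u x)ᴴ) (fun x => deriv γt x * (gammaFun u x)ᴴ) := by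
  refine ((h.1.isPrim hl).mul (gammaFun_isPrim hu hv hvM hl).adj).congr_ae
    (ae_restrict_of_forall_mem measurableSet_Ioo fun x hx => ?_)
  rw [conjTranspose_neg, Matrix.conjTranspose_mul, conjTranspose_conjTranspose, Matrix.mul_neg,
    ← Matrix.mul_assoc, h.mul_betaFun hu hv hvM hl (Ioo_subset_Icc_self hx), Matrix.zero_mul,
    neg_zero, add_zero]

lemma norm_gammaFun_le {x : ℝ} (hx : x ∈ Icc 0 l) : ‖gammaFun u x‖ ≤ 1 := by
  have h := Matrix.l2_opNorm_conjTranspose_mul_self (gammaFun u x)ᴴ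
  rw [conjTranspose_conjTranspose, gammaFun_mul_conjTranspose hu hv hvM hl hx,
    Matrix.l2_opNorm_conjTranspose] at h
  nlinarith [norm_one_matrix_le (p := Fin m₂), norm_nonneg (gammaFun u x)]

lemma IsComplement.exists_bound_deriv (h : IsComplement l (betaFun u) γt) :
    ∃ C, 0 ≤ C ∧ ∀ᵐ x ∂(vol l), ‖deriv γt x * (gammaFun u x)ᴴ‖ ≤ C := by
  obtain ⟨C, hC⟩ := h.1.2
  refine ⟨|C| * 1, by positivity, ?_⟩
  filter_upwards [hC, ae_restrict_mem measurableSet_Ioo] with x h1 h2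
  exact norm_mul_le_of_le (h1.trans (le_abs_self C)) ((Matrix.l2_opNorm_conjTranspose _).le.trans
    (norm_gammaFun_le hu hv hvM hl (Ioo_subset_Icc_self h2)))

/-- The coefficient of the equation for `κ`, in terms of `a = γ̃ γ*`: it equals `a' a⁻¹`. -/
lemma IsComplement.coeff_eq (h : IsComplement l (betaFun u) γt) {x : ℝ} (hx : x ∈ Icc 0 l)
    (κ : Matrix (Fin m₂) (Fin m₂) ℂ) :
    κ * deriv γt x * (γt x)ᴴ * (γt x * (γt x)ᴴ)⁻¹ =
      κ * (deriv γt x * (gammaFun u x)ᴴ) * (γt x * (gammaFun u x)ᴴ)⁻¹ := by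
  have hdet : IsUnit (γt x * (gammaFun u x)ᴴ)ᴴ.det := by
    rw [Matrix.det_conjTranspose]
    exact ((Matrix.isUnit_iff_isUnit_det _).1 (h.isUnit hu hv hvM hl hx)).star
  rw [h.mul_conjTranspose hu hv hvM hl hx, Matrix.mul_inv_rev,
    h.conjTranspose_eq hu hv hvM hl hx]
  set a := γt x * (gammaFun u x)ᴴ
  rw [Matrix.mul_assoc (κ * deriv γt x), ← Matrix.mul_assoc _ (aᴴ)⁻¹, Matrix.mul_assoc _ aᴴ,
    Matrix.mul_nonsing_inv _ hdet, Matrix.mul_one]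
  simp only [Matrix.mul_assoc]

lemma IsComplement.solvesKappa_inv (h : IsComplement l (betaFun u) γt) :
    SolvesKappa l γt (fun x => (γt x * (gammaFun u x)ᴴ)⁻¹) := by
  obtain ⟨C, -, hC⟩ := h.exists_bound_deriv hu hv hvM hl
  have hp := h.isPrim_mul hu hv hvM hl
  refine ⟨hp.absolutelyContinuous_inv hC fun x hx => h.isUnit hu hv hvM hl hx, ?_, ?_⟩
  · simp only [h.2.2, gammaFun_zero hu hv hvM hl, lowerRow_mul_conjTranspose, inv_one]
  · filter_upwards [hp.ae_hasDerivAt, ae_restrict_mem measurableSet_Ioo] with x h1 hx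
    have hx' := Ioo_subset_Icc_self hx
    rw [h.coeff_eq hu hv hvM hl hx']
    exact hasDerivAt_matrix_inv (a' := fun x => deriv γt x * (gammaFun u x)ᴴ)
      (h.isUnit hu hv hvM hl hx') h1

/-- Every solution `κ` satisfies `κ γ̃ γ* = I`. -/
lemma IsComplement.gammaFun_eq (h : IsComplement l (betaFun u) γt)
    {κ : ℝ → Matrix (Fin m₂) (Fin m₂) ℂ} (hκ : SolvesKappa l γt κ) {x : ℝ} (hx : x ∈ Icc 0 l) :
    gammaFun u x = κ x * γt x := by
  obtain ⟨C, hC0, hC⟩ := h.exists_bound_deriv hu hv hvM hl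
  have hp := h.isPrim_mul hu hv hvM hl
  have hau : ∀ x ∈ Icc 0 l, IsUnit (γt x * (gammaFun u x)ᴴ) := fun x hx => h.isUnit hu hv hvM hl hx
  obtain ⟨B, hB⟩ := exists_bound_inv hp.continuousOn hau
  have hκc : ContinuousOn κ (Icc 0 l) := by
    have := hκ.1.continuousOn
    rwa [uIcc_of_le hl] at this
  obtain ⟨D, hD⟩ := isCompact_Icc.exists_bound_of_continuousOn hκc
  have hd : ∀ᵐ x ∂(vol l), HasDerivAt κ
      (-(κ x * (deriv γt x * (gammaFun u x)ᴴ) * (γt x * (gammaFun u x)ᴴ)⁻¹)) x := by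
    filter_upwards [hκ.2.2, ae_restrict_mem measurableSet_Ioo] with x h1 hx
    rwa [h.coeff_eq hu hv hvM hl (Ioo_subset_Icc_self hx)] at h1
  have hb : ∀ᵐ x ∂(vol l),
      ‖-(κ x * (deriv γt x * (gammaFun u x)ᴴ) * (γt x * (gammaFun u x)ᴴ)⁻¹)‖ ≤ D * C * B := by
    filter_upwards [hC, ae_restrict_mem measurableSet_Ioo] with x h1 hx
    rw [norm_neg]
    exact norm_mul_le_of_le (norm_mul_le_of_le (hD x (Ioo_subset_Icc_self hx)) h1)
      (hB x (Ioo_subset_Icc_self hx))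
  have hκd : BddDiff l κ := ⟨hκ.1, D * C * B, by
    filter_upwards [hd, hb] with x h1 h2
    rwa [h1.deriv]⟩
  have hκp := (hκd.isPrim hl).congr_ae (hd.mono fun x hx => hx.deriv)
  have hz := (hκp.mul hp).congr_ae (f' := fun _ => 0) (ae_restrict_of_forall_mem measurableSet_Ioo
    fun x hx => by
      rw [Matrix.neg_mul, Matrix.mul_assoc (κ x * _), Matrix.nonsing_inv_mul _
        ((Matrix.isUnit_iff_isUnit_det _).1 (hau x (Ioo_subset_Icc_self hx))), Matrix.mul_one,
        neg_add_cancel])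
  have h1 := hz.eq_of_zero hx
  simp only [hκ.2.1, h.2.2, gammaFun_zero hu hv hvM hl, lowerRow_mul_conjTranspose,
    Matrix.one_mul] at h1
  rw [h.eq_mul_gammaFun hu hv hvM hl hx, ← Matrix.mul_assoc, h1, Matrix.one_mul]

end Gamma

/-! ### The procedure and the uniqueness of the potential -/

section Procedure

variable {m₁ m₂ p : ℕ} {l M r : ℝ} {v : ℝ → Matrix (Fin m₁) (Fin m₂) ℂ}
  {u : ℝ → ℂ → Matrix (Fin m₁ ⊕ Fin m₂) (Fin m₁ ⊕ Fin m₂) ℂ}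
  {E : ℝ → ℝ → Matrix (Fin m₂) (Fin m₂) ℂ} {k : ℝ → Matrix (Fin m₂) (Fin m₁) ℂ}
  {φ : ℂ → Matrix (Fin m₂) (Fin m₁) ℂ}

/-- The node function of the system, with the properties used to recover `β` from `φ`. -/
lemma exists_nodeFunction (hl : 0 < l) (hM : 0 ≤ M) (hv : StronglyMeasurable v)
    (hvM : ∀ x, ‖v x‖ ≤ M) (hu : IsFundamentalSolution l v u) (hφ : IsWeylFunction l M u φ) :
    ∃ (E : ℝ → ℝ → Matrix (Fin m₂) (Fin m₂) ℂ) (k : ℝ → Matrix (Fin m₂) (Fin m₁) ℂ),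
      IsNodeDensity l v E k ∧ IsNodeFunction l (gammaFun u) (nodePrim k) ∧
      (∀ η, M < η → IsInverseFourier l η φ (nodePrim k)) ∧
      ∀ r ∈ Ioc 0 l, CompressedInvertible l r (nodePrim k) ∧
        ∀ h : ℝ → Matrix (Fin m₂) (Fin m₁) ℂ,
          CompressedEq l r (nodePrim k) h (deriv (nodePrim k)) →
          betaFun u r = upperRow m₁ m₂ -
            ∫ t in (0 : ℝ)..r, (h t)ᴴ * fromCols (nodePrim k t) 1 := by
  obtain ⟨E, N, h⟩ := exists_transmutation hv hM hvM hl.le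
  obtain ⟨k, hk⟩ := h.exists_density hv hvM
  refine ⟨E, k, hk, ⟨E, h.isSimilarityKernel hu hv hvM hl.le hk,
    ae_restrict_of_forall_mem measurableSet_Ioo fun x hx =>
      h.opE_nodePrim hu hv hvM hk (Ioo_subset_Icc_self hx)⟩, fun η hη => ?_, fun r hr => ?_⟩
  · obtain ⟨D, hD0, hD⟩ := h.norm_add_lap_le hu hv hvM hk hl.le
    exact isInverseFourier_nodePrim hk hl hM hD0 hφ.1
      (fun z hz => hD z hz _ (hφ.2 z hz) l ⟨hl.le, le_rfl⟩) hη
  · obtain ⟨K, -, hK⟩ := hk.bound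
    have hinv : CompressedInvertible l r (nodePrim k) :=
      compressedInvertible (hk.deriv_nodePrim hl.le) hk.measurable hK
        (fun x hx => hk.eq_zero_of_neg hx) hr.1.le hr.2
    exact ⟨hinv, fun f hf => h.betaFun_eq hu hv hvM hk hφ.2 hr hinv hf⟩

lemma deriv_eq_of_eqOn {a b : Type*} [Fintype a] [Fintype b] [DecidableEq b]
    {F G : ℝ → Matrix a b ℂ} (h : ∀ x ∈ Icc 0 l, F x = G x) {x : ℝ} (hx : x ∈ Ioo 0 l) :
    deriv F x = deriv G x :=
  Filter.EventuallyEq.deriv_eq (by filter_upwards [Icc_mem_nhds hx.1 hx.2] with y hy using h y hy)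

/-- `β` depends only on the Weyl function. -/
lemma betaFun_eq_of_isWeylFunction {M' : ℝ} {v' : ℝ → Matrix (Fin m₁) (Fin m₂) ℂ}
    {u' : ℝ → ℂ → Matrix (Fin m₁ ⊕ Fin m₂) (Fin m₁ ⊕ Fin m₂) ℂ}
    (hl : 0 < l) (hM : 0 ≤ M) (hv : StronglyMeasurable v)
    (hvM : ∀ x, ‖v x‖ ≤ M) (hu : IsFundamentalSolution l v u) (hφ : IsWeylFunction l M u φ)
    (hM' : 0 ≤ M') (hv' : StronglyMeasurable v')
    (hvM' : ∀ x, ‖v' x‖ ≤ M') (hu' : IsFundamentalSolution l v' u')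
    (hφ' : IsWeylFunction l M' u' φ) :
    ∀ x ∈ Icc 0 l, betaFun u' x = betaFun u x := by
  obtain ⟨E, k, hk, -, hF, hβ⟩ := exists_nodeFunction hl hM hv hvM hu hφ
  obtain ⟨E', k', hk', -, hF', hβ'⟩ := exists_nodeFunction hl hM' hv' hvM' hu' hφ'
  have hM1 : M < max M M' + 1 := (le_max_left _ _).trans_lt (lt_add_one _)
  have hM2 : M' < max M M' + 1 := (le_max_right _ _).trans_lt (lt_add_one _)
  have heq : ∀ x ∈ Icc 0 l, nodePrim k' x = nodePrim k x :=
    (hF _ hM1).eqOn hl (hM.trans_lt hM1) hM1 hφ.1 (hF' _ hM2) (hk.isPrim hl.le).continuousOn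
      (hk'.isPrim hl.le).continuousOn
  intro x hx
  rcases hx.1.eq_or_lt with rfl | hx0
  · rw [betaFun, betaFun, (hu 0).1, (hu' 0).1]
  have hx' : x ∈ Ioc 0 l := ⟨hx0, hx.2⟩
  have hd : ∀ᵐ t ∂(vol l), deriv (nodePrim k') t = deriv (nodePrim k) t :=
    ae_restrict_of_forall_mem measurableSet_Ioo fun t ht => deriv_eq_of_eqOn heq ht
  have hd1 := hk.deriv_nodePrim hl.le
  have hd2 : ∀ᵐ t ∂(vol l), deriv (nodePrim k') t = k t := by
    filter_upwards [hd, hd1] with t h1 h2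
    rw [h1, h2]
  have hsub : vol x ≤ vol l := Measure.restrict_mono (Ioo_subset_Ioo_right hx.2) le_rfl
  have : IsFiniteMeasure (vol x) := ⟨by simp [vol]⟩
  obtain ⟨K, -, hK⟩ := hk.bound
  have hkp : MemLp k 2 (vol x) :=
    MemLp.of_bound hk.measurable.aestronglyMeasurable K (ae_of_all _ hK)
  obtain ⟨f, hf⟩ := ((hβ x hx').1 m₁ k hkp).1
  have hneg : ∀ y < 0, k y = 0 := fun y => hk.eq_zero_of_neg
  rw [compressedEq_iff hd1 hneg hx.2] at hf
  have hf1 : CompressedEq l x (nodePrim k) f (deriv (nodePrim k)) := by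
    rw [compressedEq_iff hd1 hneg hx.2]
    refine ⟨hf.1, ?_⟩
    filter_upwards [hf.2, ae_mono hsub hd1] with t h1 h2
    rw [h1, h2]
  have hf2 : CompressedEq l x (nodePrim k') f (deriv (nodePrim k')) := by
    rw [compressedEq_iff hd2 hneg hx.2]
    refine ⟨hf.1, ?_⟩
    filter_upwards [hf.2, ae_mono hsub hd2] with t h1 h2
    rw [h1, h2]
  rw [(hβ x hx').2 f hf1, (hβ' x hx').2 f hf2]
  congr 1
  refine intervalIntegral.integral_congr fun t ht => ?_
  rw [uIcc_of_le hx.1] at ht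
  simp only [heq t ⟨ht.1, ht.2.trans hx.2⟩]

/-- A bounded potential is determined by its Weyl function. -/
lemma ae_eq_of_isWeylFunction {M' : ℝ} {v' : ℝ → Matrix (Fin m₁) (Fin m₂) ℂ}
    {u' : ℝ → ℂ → Matrix (Fin m₁ ⊕ Fin m₂) (Fin m₁ ⊕ Fin m₂) ℂ}
    (hl : 0 < l) (hM : 0 ≤ M) (hv : StronglyMeasurable v)
    (hvM : ∀ x, ‖v x‖ ≤ M) (hu : IsFundamentalSolution l v u) (hφ : IsWeylFunction l M u φ)
    (hM' : 0 ≤ M') (hv' : StronglyMeasurable v')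
    (hvM' : ∀ x, ‖v' x‖ ≤ M') (hu' : IsFundamentalSolution l v' u')
    (hφ' : IsWeylFunction l M' u' φ) : v' =ᵐ[vol l] v := by
  have hβ := betaFun_eq_of_isWeylFunction hl hM hv hvM hu hφ hM' hv' hvM' hu' hφ'
  have hc' := isComplement_gammaFun hu' hv' hvM' hl.le
  have hc : IsComplement l (betaFun u) (gammaFun u') :=
    ⟨hc'.1, fun x hx => hβ x hx ▸ hc'.2.1 x hx, hc'.2.2⟩
  have hκ := hc.solvesKappa_inv hu hv hvM hl.le
  have hγ : ∀ x ∈ Icc 0 l, gammaFun u' x = gammaFun u x := fun x hx =>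
    (hc'.gammaFun_eq hu' hv' hvM' hl.le hκ hx).trans (hc.gammaFun_eq hu hv hvM hl.le hκ hx).symm
  filter_upwards [ae_eq_deriv_betaFun_mul hu hv hvM hl.le,
    ae_eq_deriv_betaFun_mul hu' hv' hvM' hl.le, ae_restrict_mem measurableSet_Ioo] with x h1 h2 hx
  rw [h1, h2, deriv_eq_of_eqOn hβ hx, hγ x (Ioo_subset_Icc_self hx)]

end Procedure

end SkewDirac

theorem mainTheorem1 (m₁ m₂ : ℕ) (l M : ℝ) (hl : 0 < l) (hM : 0 < M)
    (v : ℝ → Matrix (Fin m₁) (Fin m₂) ℂ) (hv : SkewDirac.IsBddPotential l M v)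
    (u : ℝ → ℂ → Matrix (Fin m₁ ⊕ Fin m₂) (Fin m₁ ⊕ Fin m₂) ℂ)
    (hu : SkewDirac.IsFundamentalSolution l v u)
    (φ : ℂ → Matrix (Fin m₂) (Fin m₁) ℂ) (hφ : SkewDirac.IsWeylFunction l M u φ) :
    -- the procedure
    (∃ Φ₁ : ℝ → Matrix (Fin m₂) (Fin m₁) ℂ,
      SkewDirac.BddDiff l Φ₁ ∧ Φ₁ 0 = 0 ∧
      SkewDirac.IsNodeFunction l (SkewDirac.gammaFun u) Φ₁ ∧
      -- recovery of `Φ₁` from `φ`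
      (∀ η : ℝ, M < η → SkewDirac.IsInverseFourier l η φ Φ₁) ∧
      (∀ η : ℝ, M < η → ∀ Ψ : ℝ → Matrix (Fin m₂) (Fin m₁) ℂ, ContinuousOn Ψ (Set.Icc 0 l) →
        SkewDirac.IsInverseFourier l η φ Ψ → ∀ x ∈ Set.Icc 0 l, Ψ x = Φ₁ x) ∧
      -- recovery of `β` from `Φ₁`
      (∀ r ∈ Set.Ioc 0 l, SkewDirac.CompressedInvertible l r Φ₁ ∧
        ∀ h : ℝ → Matrix (Fin m₂) (Fin m₁) ℂ, SkewDirac.CompressedEq l r Φ₁ h (deriv Φ₁) →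
          SkewDirac.betaFun u r = SkewDirac.upperRow m₁ m₂ -
            ∫ t in (0 : ℝ)..r, (h t)ᴴ * Matrix.fromCols (Φ₁ t) 1)) ∧
    -- recovery of `γ` from `β`
    (∃ γt : ℝ → Matrix (Fin m₂) (Fin m₁ ⊕ Fin m₂) ℂ,
      SkewDirac.IsComplement l (SkewDirac.betaFun u) γt) ∧
    (∀ γt : ℝ → Matrix (Fin m₂) (Fin m₁ ⊕ Fin m₂) ℂ,
      SkewDirac.IsComplement l (SkewDirac.betaFun u) γt →
      (∃ κ : ℝ → Matrix (Fin m₂) (Fin m₂) ℂ, SkewDirac.SolvesKappa l γt κ) ∧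
      ∀ κ : ℝ → Matrix (Fin m₂) (Fin m₂) ℂ, SkewDirac.SolvesKappa l γt κ →
        ∀ x ∈ Set.Icc 0 l, SkewDirac.gammaFun u x = κ x * γt x) ∧
    -- recovery of `v` from `β` and `γ`
    (∀ᵐ x ∂(SkewDirac.vol l),
      v x = deriv (SkewDirac.betaFun u) x * (SkewDirac.gammaFun u x)ᴴ) ∧
    -- uniqueness: any bounded potential with the same Weyl function coincides with `v`
    (∀ (M' : ℝ) (v' : ℝ → Matrix (Fin m₁) (Fin m₂) ℂ)
      (u' : ℝ → ℂ → Matrix (Fin m₁ ⊕ Fin m₂) (Fin m₁ ⊕ Fin m₂) ℂ),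
      0 < M' → SkewDirac.IsBddPotential l M' v' → SkewDirac.IsFundamentalSolution l v' u' →
      SkewDirac.IsWeylFunction l M' u' φ → v' =ᵐ[SkewDirac.vol l] v) := by
  obtain ⟨w, hw, hwM, hvw⟩ := hv.exists_measurable hM.le
  have huw := hu.congr hvw
  obtain ⟨E, k, hk, hnode, hF, hβ⟩ := SkewDirac.exists_nodeFunction hl hM.le hw hwM huw hφ
  have hΦ := hk.isPrim hl.le
  refine ⟨⟨SkewDirac.nodePrim k, hk.bddDiff hl.le, by simp [SkewDirac.nodePrim], hnode, hF,
      fun η hη Ψ hΨ hFΨ => (hF η hη).eqOn hl (hM.trans hη) hη hφ.1 hFΨ hΦ.continuousOn hΨ, hβ⟩,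
    ⟨_, SkewDirac.isComplement_gammaFun huw hw hwM hl.le⟩,
    fun γt hγt => ⟨⟨_, hγt.solvesKappa_inv huw hw hwM hl.le⟩,
      fun κ hκ x hx => hγt.gammaFun_eq huw hw hwM hl.le hκ hx⟩, ?_, ?_⟩
  · filter_upwards [SkewDirac.ae_eq_deriv_betaFun_mul huw hw hwM hl.le, hvw] with x h1 h2
    rw [h2, h1]
  · intro M' v' u' hM' hv' hu' hφ'
    obtain ⟨w', hw', hwM', hvw'⟩ := hv'.exists_measurable hM'.le
    exact hvw'.trans ((SkewDirac.ae_eq_of_isWeylFunction hl hM.le hw hwM huw hφ hM'.le hw' hwM'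
      (hu'.congr hvw') hφ').trans hvw.symm)
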